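/- **Setting.** Let $\mathbb F$ be a finite field, $\sigma$ an automorphism of $\mathbb F$ of order $\mu$, $K=\mathbb F^\sigma$, $R=\mathbb F[X;\sigma]$ (so $Xa=\sigma(a)X$), $z=X^\mu$; the center of $R$ is $K[z]$. Fix a basis $b_0,\dots,b_{\mu-1}$ of $\mathbb F$ over $K$ and finitely many generators $a_1,\dots,a_{s}$ of $\mathbb F$ as a $K$-algebra. Running time means the number of basic operations in $K$: each arithmetic operation in $K$ counts $1$; each addition or subtraction, multiplication, inversion, and application of a power of $\sigma$ in $\mathbb F$ counts as $S$, $M$, $I$, $A$ basic operations, where $S,M,I,A$ are fixed natural numbers. Polynomials and skew polynomials are handled coefficient by coefficient with the standard (schoolbook) multiplication, division with remainder and Euclidean algorithms, linear systems by Gaussian elimination, and elements of an extension $K[z]/(\pi)$ by reduced representatives. Drawing a random element of $\mathbb F$ counts $\mu$. For nonzero $f,g,h\in R$: left division gives $f=cg+r$ with $\deg r<\deg g$, $c$ is the left quotient; $(f,g)_r$ is the right greatest common divisor; $Rf_h=\{g: gh\in Rf\}$; the left least common multiple $[f,h]_\ell$ is $f_hh$; the bound $f^*$ of $f$ is a generator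 of the largest two-sided ideal contained in $Rf$. **Algorithm Factorize.** Input $f\in R$, $\deg f=n\ge 1$. 1. *Bound.* Put $p:=f$. While some $d\in\{a_1,\dots,a_s,X\}$ has $pd\notin Rp$, replace $p$ by $[p_d,p]_\ell$, where $d$ is the first such generator. At the end $p=f^*$. Write $f^*=d\,\hat f X^m$ with $d\in\mathbb F^\times$ and $\hat f\in K[z]$ monic, $\hat f(0)\neq 0$. 2. Factor $\hat f=\pi_1\cdots\pi_q$ into monic irreducible polynomials of $K[z]$ by separating multiple factors and Berlekamp's algorithm. 3. Let $f_1$ be the left quotient of $f$ by $X^m$. For $1\le i<q$ put $f_{i+1}:=(f_i,\pi_{i+1}\cdots\pi_q)_r$ and let $g_i$ be the left quotient of $f_i$ by $f_{i+1}$; put $g_q:=f_q$. 4. Return the concatenation of the lists $\mathrm{FactorizeIrred}(g_1,\pi_1),\dots,\mathrm{FactorizeIrred}(g_q,\pi_q)$, followed by $m$ copies of $X$. (If $q=0$, then $f=f_1X^m$ with $f_1$ constant, and the list is $f_1X,X,\dots,X$.) **FactorizeIrred**$(f,\pi)$, where $\pi$ is irreducible in $K[z]$. If $f=1$, return the empty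 list. If $\deg_X\pi=\mu\deg f$, return $[f]$. Otherwise let $A=R/R\pi$, an algebra of dimension $\mu^2$ with basis $b_iX^j$ $(0\le i,j<\mu)$ over $K_\pi=K[z]/(\pi)$. Solve the linear system $f=fyf$ over $K_\pi$ for $y\in A$, put $e:=yf$, let $\zeta$ be a zero divisor of $(1-e)A(1-e)$ found by FindZeroDivisor, $g:=(\zeta,f)_r$, and let $h$ be the left quotient of $f$ by $g$; return $\mathrm{FactorizeIrred}(h,\pi)$ followed by $\mathrm{FactorizeIrred}(g,\pi)$. **FindZeroDivisor** (Las Vegas). Draw $x\in A$ uniformly at random, put $a:=(1-e)x(1-e)$, compute the minimal polynomial of $a$ over $K_\pi$ in the algebra $(1-e)A(1-e)$, and factor it into irreducible polynomials over $K_\pi$ by the same method as in step 2 (with the subalgebra of the elements satisfying $b^{\#K}=b$). If it has at least two irreducible factors, counted with multiplicity, and $g_1$ is the first, the result is $\zeta=g_1(a)$; otherwise the attempt fails. After a failure the attempt is repeated with new independent random choices. In the version of Factorize *with at most $k$ attempts*, each call of FindZeroDivisor gives up after $k$ failed attempts, and then Factorize reports failure. **Corollary.** Algorithm Factorize runs in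 time $\mathcal O(n^3)$. Precisely: there is a constant $C$, depending only on $\mathbb F$, $\sigma$, the chosen basis and generators, and $S,M,I,A$, such that for every $n\ge1$ and every $f\in R$ of degree $n$: 1. for every $k\ge1$ and all random choices, the algorithm with at most $k$ attempts uses at most $Ckn^3$ basic operations (so at most $Cn^3$ if each zero divisor search is run once), and unless it reports failure it returns a list of irreducible elements of $R$ whose product, in the order of the list, is $f$; 2. for every $k$, the expected number of basic operations of the algorithm with at most $k$ attempts is at most $Cn^3$, with the same $C$ for all $k$ (hence also with unlimited attempts); 3. the probability that the algorithm with at most $k$ attempts reports failure tends to $0$ as $k\to\infty$. -/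

import Mathlib

universe u

namespace SkewFact

noncomputable section

/-! ### Computations with an operation count -/

/-- A deterministic computation: its result together with the number of basic operations used. -/
@[ext]
structure Cost (α : Type u) : Type u where
  val : α
  ops : ℕ

instance : Monad Cost where
  pure a := ⟨a, 0⟩
  bind x g := ⟨(g x.val).val, x.ops + (g x.val).ops⟩

/-- Run a computation on every entry of a list, from left to right. -/
def mapC {α β : Type u} (f : α → Cost β) : List α → Cost (List β)
  | [] => pure []
  | a :: l => do
    let b ← f a
    let bs ← mapC f l
    pure (b :: bs)

open Classical in
/-- The loop `while p s do s ← body s`. The number of rounds is capped by the second to last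
argument, which at every use is at least the number of rounds that the uncapped loop makes. -/
def whileC {S : Type u} (p : S → Prop) (body : S → Cost S) : ℕ → S → Cost S
  | 0, s => pure s
  | n + 1, s => if p s then (do let t ← body s; whileC p body n t) else pure s

/-- Square-and-multiply exponentiation `a ^ n` for a costed multiplication. -/
def powC {M : Type u} (mul : M → M → Cost M) (one a : M) (n : ℕ) : Cost M :=
  n.bits.reverse.foldlM (fun acc bit => do
    let s ← mul acc acc
    if bit then mul s a else pure s) one

/-! ### Costed arithmetic in a commutative ring and its (commutative) polynomials -/

/-- Costed arithmetic of a coefficient ring. -/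
structure Arith (L : Type u) : Type u where
  add : L → L → Cost L
  neg : L → Cost L
  mul : L → L → Cost L
  inv : L → Cost L

section CommPoly

variable {L : Type u} [CommRing L] (o : Arith L)

/-- `r + a x ^ k g`, computed coefficient by coefficient. -/
def addMonoP (a : L) (k : ℕ) (g r : Polynomial L) : Cost (Polynomial L) :=
  (List.range (g.natDegree + 1)).foldlM (fun r i => do
    let t ← o.mul a (g.coeff i)
    let t ← o.add (r.coeff (i + k)) t
    pure (r.update (i + k) t)) r

/-- `f + g`. -/
def addP (f g : Polynomial L) : Cost (Polynomial L) :=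
  (List.range (g.natDegree + 1)).foldlM (fun r i => do
    let t ← o.add (r.coeff i) (g.coeff i)
    pure (r.update i t)) f

/-- `-f`. -/
def negP (f : Polynomial L) : Cost (Polynomial L) :=
  (List.range (f.natDegree + 1)).foldlM (fun r i => do
    let t ← o.neg (f.coeff i)
    pure (r.update i t)) 0

/-- `a f` for a scalar `a`. -/
def scaleP (a : L) (f : Polynomial L) : Cost (Polynomial L) :=
  (List.range (f.natDegree + 1)).foldlM (fun r i => do
    let t ← o.mul a (f.coeff i)
    pure (r.update i t)) 0

/-- `r + f g` (schoolbook multiplication). -/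
def addMulP (f g r : Polynomial L) : Cost (Polynomial L) :=
  (List.range (f.natDegree + 1)).foldlM (fun r i => addMonoP o (f.coeff i) i g r) r

/-- `f g`. -/
def mulP (f g : Polynomial L) : Cost (Polynomial L) := addMulP o f g 0

/-- Euclidean division: quotient and remainder of `f` by `g ≠ 0`. -/
def divP (f g : Polynomial L) : Cost (Polynomial L × Polynomial L) := do
  let b ← o.inv g.leadingCoeff
  whileC (fun s : Polynomial L × Polynomial L => s.2 ≠ 0 ∧ g.natDegree ≤ s.2.natDegree)
    (fun s => do
      let k := s.2.natDegree - g.natDegree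
      let a ← o.mul s.2.leadingCoeff b
      let t ← o.add (s.1.coeff k) a
      let a' ← o.neg a
      let r ← addMonoP o a' k g s.2
      pure (s.1.update k t, r))
    (f.natDegree + 1) (0, f)

/-- Monic greatest common divisor, by the Euclidean algorithm. -/
def gcdP (f g : Polynomial L) : Cost (Polynomial L) := do
  let s ← whileC (fun s : Polynomial L × Polynomial L => s.2 ≠ 0)
    (fun s => do
      let d ← divP o s.1 s.2
      pure (s.2, d.2))
    (g.natDegree + 1) (f, g)
  let u ← o.inv s.1.leadingCoeff
  scaleP o u s.1

/-- The derivative of `f`. -/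
def derivP (f : Polynomial L) : Cost (Polynomial L) :=
  (List.range f.natDegree).foldlM (fun r i => do
    let t ← o.mul ((i + 1 : ℕ) : L) (f.coeff (i + 1))
    pure (r.update i t)) 0

/-- `f g` modulo `m`. -/
def mulModP (m f g : Polynomial L) : Cost (Polynomial L) := do
  let p ← mulP o f g
  let d ← divP o p m
  pure d.2

/-- Product of a list of polynomials. -/
def prodP : List (Polynomial L) → Cost (Polynomial L)
  | [] => pure 1
  | p :: ps => do
    let q ← prodP ps
    mulP o p q

/-- One reduction of Gaussian elimination. A vector with coordinates `v_0, v_1, …` is stored as the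
polynomial `∑ v_i x ^ i`. The pairs `(v, c)` consist of a vector and of the coefficients `c` of its
expression in the input vectors. The pair `x` is reduced by the pairs of the echelon system `st`,
whose vectors are monic; the pivot of a vector is its leading coefficient. -/
def reduceVec (st : List (Polynomial L × Polynomial L)) (x : Polynomial L × Polynomial L) :
    Cost (Polynomial L × Polynomial L) :=
  st.foldlM (fun x b => do
    let a ← o.neg (x.1.coeff b.1.natDegree)
    let v ← addMonoP o a 0 b.1 x.1
    let c ← addMonoP o a 0 b.2 x.2
    pure (v, c)) x

open Classical in
/-- Gaussian elimination over a field: a basis `c^(1), c^(2), …` of the space of linear relations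
`∑_j c_j v_j = 0` between the vectors of the list `v_0, v_1, …`. For every `v_j` that depends on
`v_0, …, v_{j-1}` there is one relation in the basis, with `c_j = 1` and `c_i = 0` for `i > j`;
they are listed by increasing `j`. -/
def relations (vs : List (Polynomial L)) : Cost (List (Polynomial L)) := do
  let s ← vs.zipIdx.foldlM
    (fun (s : List (Polynomial L × Polynomial L) × List (Polynomial L)) p => do
      let x ← reduceVec o s.1 (p.1, Polynomial.X ^ p.2)
      if x.1 = 0 then pure (s.1, s.2 ++ [x.2])
      else do
        let a ← o.inv x.1.leadingCoeff
        let v ← scaleP o a x.1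
        let c ← scaleP o a x.2
        pure (s.1 ++ [(v, c)], s.2)) ([], [])
  pure s.2

end CommPoly

/-! ### Factorization of commutative polynomials: Berlekamp's algorithm -/

/-- Costed arithmetic of a finite-dimensional commutative algebra `L` over the finite field `K`,
whose elements are stored by their coordinates in a `K`-basis: `coord a i` is the `i`-th coordinate
of `a`, and `ofCoord c` is the element with coordinates `c 0, …, c (dim - 1)`. -/
structure FieldData (K L : Type u) : Type u extends Arith L where
  dim : ℕ
  coord : L → ℕ → K
  ofCoord : (ℕ → K) → L

section Berlekamp

variable {K L : Type u} [Field K] [Finite K] [CommRing L] [Algebra K L]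
  (kA : Arith K) (D : FieldData K L)

/-- The `K`-coordinates of a polynomial `∑_{j < m} y_j x ^ j` over `L`, stored as a vector. -/
def vecOf (m : ℕ) (y : Polynomial L) : Polynomial K :=
  ∑ j ∈ Finset.range m, ∑ i ∈ Finset.range D.dim,
    Polynomial.monomial (j * D.dim + i) (D.coord (y.coeff j) i)

/-- The polynomial of degree `< m` over `L` with given `K`-coordinates. -/
def ofVec (m : ℕ) (c : Polynomial K) : Polynomial L :=
  ∑ j ∈ Finset.range m,
    Polynomial.monomial j (D.ofCoord fun i => c.coeff (j * D.dim + i))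

/-- A `K`-basis of the Berlekamp subalgebra `{b | b ^ #K = b}` of `L[x] / (g)`, by linear algebra
over `K`. -/
def berlekampBasis (g : Polynomial L) : Cost (List (Polynomial L)) := do
  let m := g.natDegree
  let vs ← mapC (fun β => do
      let y ← powC (mulModP D.toArith g) 1 β (Nat.card K)
      let β' ← negP D.toArith β
      let z ← addP D.toArith y β'
      pure (vecOf D m z))
    ((List.range (m * D.dim)).map fun s => ofVec D m (Polynomial.X ^ s))
  let rels ← relations kA vs
  pure (rels.map (ofVec D m))

/-- The elements of the finite field `K`. -/
def elems (K : Type u) [Finite K] : List K := (Set.toFinite (Set.univ : Set K)).toFinset.toList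

/-- The nonconstant ones among the `gcd (h, b - c)`, for `c` in `K`. -/
def splitOne (b h : Polynomial L) : Cost (List (Polynomial L)) := do
  let l ← mapC (fun c => do
      let a ← D.neg (algebraMap K L c)
      let t ← D.add (b.coeff 0) a
      gcdP D.toArith h (b.update 0 t)) (elems K)
  pure (l.filter fun p => 0 < p.natDegree)

/-- Berlekamp's algorithm for a squarefree monic nonconstant polynomial. -/
def berlekamp (g : Polynomial L) : Cost (List (Polynomial L)) := do
  let bs ← berlekampBasis kA D g
  bs.foldlM (fun hs b => do
    let ls ← mapC (splitOne D b) hs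
    pure ls.flatten) [g]

/-- The `p`-th root of a polynomial with zero derivative over a field with `#K ^ dim` elements and
of characteristic `p`. -/
def rootP (g : Polynomial L) : Cost (Polynomial L) :=
  (List.range (g.natDegree / ringChar K + 1)).foldlM (fun r i => do
    let t ← powC D.mul 1 (g.coeff (ringChar K * i)) (Nat.card K ^ D.dim / ringChar K)
    pure (r.update i t)) 0

open Classical in
/-- The monic irreducible factors, with multiplicities, of a monic polynomial: separation of
multiple factors, then Berlekamp's algorithm. The first argument caps the depth of the recursion,
in each step of which the degree decreases. -/
def factorAux : ℕ → Polynomial L → Cost (List (Polynomial L))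
  | 0, _ => pure []
  | n + 1, g =>
    if g.natDegree = 0 then pure []
    else do
      let g' ← derivP D.toArith g
      if g' = 0 then do
        let h ← rootP (K := K) D g
        let l ← factorAux n h
        pure (List.replicate (ringChar K) l).flatten
      else do
        let c ← gcdP D.toArith g g'
        let q ← divP D.toArith g c
        let l₁ ← berlekamp kA D q.1
        let l₂ ← factorAux n c
        pure (l₁ ++ l₂)

/-- Factorization of a monic polynomial over `L` into monic irreducible polynomials. -/
def factorPoly (g : Polynomial L) : Cost (List (Polynomial L)) :=
  factorAux kA D (g.natDegree + 1) g

end Berlekamp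

/-! ### The base field `K` and its extensions `K[z] / (π)` -/

/-- Arithmetic of the base field: every operation counts as one basic operation. -/
def baseArith (K : Type u) [Field K] : Arith K where
  add a b := ⟨a + b, 1⟩
  neg a := ⟨-a, 1⟩
  mul a b := ⟨a * b, 1⟩
  inv a := ⟨a⁻¹, 1⟩

/-- `K` as an algebra of dimension `1` over itself. -/
def baseData (K : Type u) [Field K] : FieldData K K where
  toArith := baseArith K
  dim := 1
  coord a _ := a
  ofCoord c := c 0

section Extension

variable {K : Type u} [Field K] (π : Polynomial K)

/-- The representative of degree `< deg π` of a class modulo the monic polynomial `π`. -/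
def rep (a : AdjoinRoot π) : Polynomial K :=
  (Function.surjInv (AdjoinRoot.mk_surjective (g := π)) a) %ₘ π

/-- The inverse of a class modulo `π`, by the extended Euclidean algorithm. -/
def invMod (a : AdjoinRoot π) : Cost (AdjoinRoot π) := do
  let o := baseArith K
  let s ← whileC
    (fun s : (Polynomial K × Polynomial K) × (Polynomial K × Polynomial K) => s.1.2 ≠ 0)
    (fun s => do
      let d ← divP o s.1.1 s.1.2
      let c ← negP o d.1
      let v ← addMulP o c s.2.2 s.2.1
      pure ((s.1.2, d.2), (s.2.2, v)))
    (π.natDegree + 1) ((π, rep π a), (0, 1))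
  let u ← o.inv s.1.1.leadingCoeff
  let v ← scaleP o u s.2.1
  pure (AdjoinRoot.mk π v)

/-- Arithmetic of `K[z] / (π)`, in terms of operations in `K` on reduced representatives. -/
def extData : FieldData K (AdjoinRoot π) where
  add a b := do
    let p ← addP (baseArith K) (rep π a) (rep π b)
    pure (AdjoinRoot.mk π p)
  neg a := do
    let p ← negP (baseArith K) (rep π a)
    pure (AdjoinRoot.mk π p)
  mul a b := do
    let p ← mulModP (baseArith K) π (rep π a) (rep π b)
    pure (AdjoinRoot.mk π p)
  inv a := invMod π a
  dim := π.natDegree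
  coord a i := (rep π a).coeff i
  ofCoord c := AdjoinRoot.mk π (∑ i ∈ Finset.range π.natDegree, Polynomial.monomial i (c i))

end Extension

/-! ### Skew polynomials -/

/-- The action of `ℕ` on `F` by the powers of `σ`. With it, `SkewPolynomial F` is the skew
polynomial ring `F[X; σ]`, in which `X a = σ(a) X`. -/
abbrev sigmaAction {F : Type u} [Field F] (σ : F ≃+* F) :
    MulSemiringAction (Multiplicative ℕ) F :=
  MulSemiringAction.compHom F (powersHom (RingAut F) σ)

/-- Numbers of basic operations in `K` spent on an addition (or subtraction), a multiplication, an
inversion, and an application of a power of `σ`, in the field `F`. -/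
structure OpCost where
  add : ℕ
  mul : ℕ
  inv : ℕ
  aut : ℕ

section Skew

variable (F : Type u) [Field F] [MulSemiringAction (Multiplicative ℕ) F]

/-- The invariant subfield `K = F^σ`. -/
abbrev fixedField : Subfield F :=
  RingHom.eqLocusField (SkewPolynomial.φ : F →+* F) (RingHom.id F)

/-- The order `μ` of `σ`. -/
def autOrder : ℕ := orderOf (SkewPolynomial.φ : F →+* F)

variable {F}

/-- The degree of a nonzero skew polynomial (and `0` for the zero polynomial). -/
def deg (p : SkewPolynomial F) : ℕ := p.support.sup id

/-- The leading coefficient. -/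
def lc (p : SkewPolynomial F) : F := p.coeff (deg p)

/-- The least exponent that occurs in a nonzero skew polynomial. -/
def lowDeg (p : SkewPolynomial F) : ℕ := sInf {i | p.coeff i ≠ 0}

/-- The embedding `K[z] → F[X; σ]` with `z ↦ X ^ μ`, whose image is the center. -/
def emb (p : Polynomial (fixedField F)) : SkewPolynomial F :=
  p.sum fun i c => SkewPolynomial.monomial (autOrder F * i) (c : F)

open Classical in
/-- An element of `F` that lies in `K`, as an element of `K` (and `0` for the others). -/
def toFixed (a : F) : fixedField F := if h : a ∈ fixedField F then ⟨a, h⟩ else 0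

variable (w : OpCost)

def fAdd (a b : F) : Cost F := ⟨a + b, w.add⟩

def fNeg (a : F) : Cost F := ⟨-a, w.add⟩

def fMul (a b : F) : Cost F := ⟨a * b, w.mul⟩

def fInv (a : F) : Cost F := ⟨a⁻¹, w.inv⟩

/-- `σ ^ k` applied to `a`. -/
def fAut (k : ℕ) (a : F) : Cost F := ⟨(SkewPolynomial.φ : F →+* F)^[k] a, w.aut⟩

/-- `r + a X ^ k g`, computed coefficient by coefficient. -/
def addMonoR (a : F) (k : ℕ) (g r : SkewPolynomial F) : Cost (SkewPolynomial F) :=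
  (List.range (deg g + 1)).foldlM (fun r i => do
    let t ← fAut w k (g.coeff i)
    let t ← fMul w a t
    let t ← fAdd w (r.coeff (i + k)) t
    pure (r.update (i + k) t)) r

/-- `-f`. -/
def negR (f : SkewPolynomial F) : Cost (SkewPolynomial F) :=
  (List.range (deg f + 1)).foldlM (fun r i => do
    let t ← fNeg w (f.coeff i)
    pure (r.update i t)) 0

/-- `a f` for a scalar `a`. -/
def scaleR (a : F) (f : SkewPolynomial F) : Cost (SkewPolynomial F) :=
  (List.range (deg f + 1)).foldlM (fun r i => do
    let t ← fMul w a (f.coeff i)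
    pure (r.update i t)) 0

/-- `r + f g` (standard multiplication). -/
def addMulR (f g r : SkewPolynomial F) : Cost (SkewPolynomial F) :=
  (List.range (deg f + 1)).foldlM (fun r i => addMonoR w (f.coeff i) i g r) r

/-- `f g`. -/
def mulR (f g : SkewPolynomial F) : Cost (SkewPolynomial F) := addMulR w f g 0

/-- Left Euclidean division of `f` by `g ≠ 0`: the pair `(c, r)` with `f = c g + r` and
`deg r < deg g`. -/
def divR (f g : SkewPolynomial F) : Cost (SkewPolynomial F × SkewPolynomial F) := do
  let b ← fInv w (lc g)
  whileC (fun s : SkewPolynomial F × SkewPolynomial F => s.2 ≠ 0 ∧ deg g ≤ deg s.2)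
    (fun s => do
      let k := deg s.2 - deg g
      let b' ← fAut w k b
      let a ← fMul w (lc s.2) b'
      let t ← fAdd w (s.1.coeff k) a
      let a' ← fNeg w a
      let r ← addMonoR w a' k g s.2
      pure (s.1.update k t, r))
    (deg f + 1) (0, f)

/-- Right greatest common divisor, by the left Euclidean algorithm. -/
def rgcdR (f g : SkewPolynomial F) : Cost (SkewPolynomial F) := do
  let s ← whileC (fun s : SkewPolynomial F × SkewPolynomial F => s.2 ≠ 0)
    (fun s => do
      let d ← divR w s.1 s.2
      pure (s.2, d.2))
    (deg g + 1) (f, g)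
  pure s.1

/-- A generator `f_h` of the annihilator `{g | g h ∈ R f}` of `h + R f` in the ring
`R = F[X; σ]`, by the extended left Euclidean algorithm. -/
def annR (f h : SkewPolynomial F) : Cost (SkewPolynomial F) := do
  let s ← whileC
    (fun s : (SkewPolynomial F × SkewPolynomial F) × (SkewPolynomial F × SkewPolynomial F) =>
      s.1.2 ≠ 0)
    (fun s => do
      let d ← divR w s.1.1 s.1.2
      let c ← negR w d.1
      let v ← addMulR w c s.2.2 s.2.1
      pure ((s.1.2, d.2), (s.2.2, v)))
    (deg h + 1) ((f, h), (0, 1))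
  pure s.2.2

/-- Left least common multiple `f_h h` of `f` and `h`. -/
def lcmR (f h : SkewPolynomial F) : Cost (SkewPolynomial F) := do
  let v ← annR w f h
  mulR w v h

open Classical in
/-- The first `d` in the list for which the remainder of `p d` on left division by `p` is nonzero,
if there is any. -/
def firstBad (p : SkewPolynomial F) :
    List (SkewPolynomial F) → Cost (Option (SkewPolynomial F))
  | [] => pure none
  | d :: ds => do
    let t ← mulR w p d
    let q ← divR w t p
    if q.2 = 0 then firstBad p ds else pure (some d)

/-- The bound of a nonzero skew polynomial. As long as some algebra generator `d` in the list `ds`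
has `p d ∉ R p`, the current polynomial `p` is replaced by the left least common multiple of `p_d`
and `p`, where `R p_d` is the annihilator of `d + R p`, and the search starts again from the first
generator. The first argument caps the number of replacements, each of which increases the
degree. -/
def boundAux (ds : List (SkewPolynomial F)) : ℕ → SkewPolynomial F → Cost (SkewPolynomial F)
  | 0, p => pure p
  | n + 1, p => do
    let bad ← firstBad w p ds
    match bad with
    | none => pure p
    | some d => do
      let pd ← annR w p d
      let p' ← lcmR w pd p
      boundAux ds n p'

/-- The bound `f*` of a nonzero skew polynomial `f`, from the generators `gens` of `F` over `K`
and `X`, which generate `F[X; σ]` as an algebra over its center. -/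
def boundR (gens : List F) (f : SkewPolynomial F) : Cost (SkewPolynomial F) :=
  boundAux w (gens.map SkewPolynomial.C ++ [SkewPolynomial.X]) (autOrder F * deg f + 1) f

/-! ### The algebra `A = R / R π` for `π` irreducible in `K[z]`

Elements of `A` are stored as their representatives of degree `< μ deg π` in `R = F[X; σ]`.
Over the field `K_π = K[z] / (π)` the algebra has the basis `b_i X ^ j`, `0 ≤ i, j < μ`, where
`b` is a basis of `F` over `K`. The coordinate that belongs to `b_i X ^ j` has index
`i μ + j`. Elements of `F` are stored by their `K`-coordinates in `b`, so that passing between the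
coordinates of an element of `A` and the skew polynomial is no arithmetic, and is not charged. -/

variable (b : Module.Basis (Fin (autOrder F)) (fixedField F) F)
  (π : Polynomial (fixedField F))

/-- Remainder modulo the central polynomial `π`. -/
def modA (f : SkewPolynomial F) : Cost (SkewPolynomial F) := do
  let d ← divR w f (emb π)
  pure d.2

/-- Multiplication in `A`. -/
def mulA (f g : SkewPolynomial F) : Cost (SkewPolynomial F) := do
  let t ← mulR w f g
  modA w π t

/-- The `K_π`-coordinates of an element of `A`, stored as a vector. -/
def vecA (r : SkewPolynomial F) : Polynomial (AdjoinRoot π) :=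
  ∑ i : Fin (autOrder F), ∑ j : Fin (autOrder F),
    Polynomial.monomial ((i : ℕ) * autOrder F + j)
      (AdjoinRoot.mk π (∑ k ∈ Finset.range π.natDegree,
        Polynomial.monomial k (b.repr (r.coeff (autOrder F * k + j)) i)))

/-- The element of `A` with given `K_π`-coordinates. -/
def ofVecA (c : Polynomial (AdjoinRoot π)) : SkewPolynomial F :=
  ∑ i : Fin (autOrder F), ∑ j : Fin (autOrder F),
    emb (rep π (c.coeff ((i : ℕ) * autOrder F + j))) * SkewPolynomial.monomial (j : ℕ) (b i)

/-- The basis `b_i X ^ j` of `A` over `K_π`. -/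
def basisA : List (SkewPolynomial F) :=
  (List.finRange (autOrder F)).flatMap fun i =>
    (List.finRange (autOrder F)).map fun j => SkewPolynomial.monomial (j : ℕ) (b i)

/-- A solution `y` of `f = f y f` in `A`, by solving a linear system over `K_π`. -/
def solveVN (f : SkewPolynomial F) : Cost (SkewPolynomial F) := do
  let vs ← mapC (fun v => do
      let t ← mulA w π f v
      let t ← mulA w π t f
      pure (vecA b π t)) (basisA b)
  let rels ← relations (extData π).toArith (vs ++ [vecA b π f])
  negR w (ofVecA b π (rels.getLastD 0))

/-- The element `1 - e` of `A`, where `e = y f` is an idempotent with `A e = A f`. -/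
def coIdempotent (f : SkewPolynomial F) : Cost (SkewPolynomial F) := do
  let f₀ ← modA w π f
  let y ← solveVN w b π f₀
  let e ← mulA w π y f₀
  let e' ← negR w e
  addMulR w 1 1 e'

/-- The powers `p, p a, …, p a ^ n` in `A`. -/
def powersA (a : SkewPolynomial F) : ℕ → SkewPolynomial F → Cost (List (SkewPolynomial F))
  | 0, p => pure [p]
  | n + 1, p => do
    let q ← mulA w π p a
    let l ← powersA a n q
    pure (p :: l)

/-- The value `g(a)` of a polynomial `g` over `K_π`, from the list of the powers of `a`. -/
def evalA (g : Polynomial (AdjoinRoot π)) (pows : List (SkewPolynomial F)) :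
    Cost (SkewPolynomial F) :=
  pows.zipIdx.foldlM (fun s p => do
    let t ← mulA w π (emb (rep π (g.coeff p.2))) p.1
    addMulR w 1 t s) 0

/-- The deterministic part of the search for a zero divisor in the corner algebra `B = e' A e'`
over `K_π` (with identity element `e'`): from an element `x` of `A` form `a = e' x e'`, compute the
minimal polynomial `g` of `a` in `B` over `K_π` and factor it; if `g = g₁ g₂ ⋯` is reducible, then
`g₁(a)` is a zero divisor of `B`, otherwise report a failure. -/
def zeroDivisorFrom [Finite F] (e' x : SkewPolynomial F) :
    Cost (Option (SkewPolynomial F)) := do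
  let t ← mulA w π e' x
  let a ← mulA w π t e'
  let pows ← powersA w π a (autOrder F ^ 2) e'
  let rels ← relations (extData π).toArith (pows.map (vecA b π))
  let fs ← factorPoly (baseArith (fixedField F)) (extData π) (rels.headD 0)
  match fs with
  | g₁ :: _ :: _ => do
    let ζ ← evalA w π g₁ pows
    pure (some ζ)
  | _ => pure none

end Skew

/-! ### Randomized computations -/

/-- A randomized computation: the joint distribution of its result, or `none` for a failure, and
of the number of basic operations used. -/
def Rand (α : Type u) : Type u := PMF (Option α × ℕ)

namespace Rand

variable {α β : Type u}

/-- The distribution of outcomes. -/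
def dist (p : Rand α) : PMF (Option α × ℕ) := p

/-- Charge `c` further operations. -/
def charge (c : ℕ) (p : Rand α) : Rand α := PMF.map (fun x => (x.1, c + x.2)) p

def fail : Rand α := PMF.pure (none, 0)

instance : Monad Rand where
  pure a := PMF.pure (some a, 0)
  bind p g := PMF.bind p fun x =>
    match x.1 with
    | none => PMF.pure (none, x.2)
    | some a => charge x.2 (g a)

/-- A deterministic computation. -/
def lift (x : Cost α) : Rand α := PMF.pure (some x.val, x.ops)

/-- A deterministic computation that may fail. -/
def liftOption (x : Cost (Option α)) : Rand α := PMF.pure (x.val, x.ops)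

/-- Repeat independent runs of `p` until the first success, but at most `k` times. -/
def retry (p : Rand α) : ℕ → Rand α
  | 0 => fail
  | k + 1 => PMF.bind p fun x =>
    match x.1 with
    | none => charge x.2 (retry p k)
    | some a => PMF.pure (some a, x.2)

/-- The expected number of operations. -/
def expectedOps (p : Rand α) : ENNReal := ∑' x : Option α × ℕ, p.dist x * (x.2 : ENNReal)

/-- The probability of a failure. -/
def failProb (p : Rand α) : ENNReal := ∑' c : ℕ, p.dist (none, c)

/-- A uniformly random list of `n` elements of `F`, at a cost of `n c` operations. -/
def coins (F : Type u) [Fintype F] [Nonempty F] (n c : ℕ) : Rand (Fin n → F) :=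
  PMF.map (fun x => (some x, n * c)) (PMF.uniformOfFintype (Fin n → F))

end Rand

/-! ### The factorization algorithm -/

section Factor

variable {F : Type u} [Field F] [Fintype F] [MulSemiringAction (Multiplicative ℕ) F]
  (w : OpCost) (b : Module.Basis (Fin (autOrder F)) (fixedField F) F) (k : ℕ)

/-- One attempt to find a zero divisor of `e' A e'`, where `A = R / R π`: the search is made with a
uniformly random element `x` of `A`. Drawing an element of `F` counts as `μ` operations. -/
def findZeroDivisor (π : Polynomial (fixedField F)) (e' : SkewPolynomial F) :
    Rand (SkewPolynomial F) := do
  let c ← Rand.coins F (autOrder F * π.natDegree) (autOrder F)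
  Rand.liftOption (zeroDivisorFrom w b π e'
    (∑ i : Fin (autOrder F * π.natDegree), SkewPolynomial.monomial (i : ℕ) (c i)))

open Classical in
/-- Factorization of `f` with irreducible bound `π ∈ K[z]`. The first argument caps the depth of
the recursion, in which the degree of `f` decreases. -/
def factorizeIrred (π : Polynomial (fixedField F)) :
    ℕ → SkewPolynomial F → Rand (List (SkewPolynomial F))
  | 0, _ => Rand.fail
  | n + 1, f =>
    if f = 1 then pure []
    else if deg (emb π) = autOrder F * deg f then pure [f]
    else do
      let e' ← Rand.lift (coIdempotent w b π f)
      let ζ ← Rand.retry (findZeroDivisor w b π e') k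
      let g ← Rand.lift (rgcdR w ζ f)
      let h ← Rand.lift (divR w f g)
      let l₁ ← factorizeIrred π n h.1
      let l₂ ← factorizeIrred π n g
      pure (l₁ ++ l₂)

/-- From `f_1` and `π_1, …, π_s`, the list of the pairs `(g_i, π_i)`, where `f_{i+1}` is the right
greatest common divisor of `f_i` and `π_{i+1} ⋯ π_s`, where `f_i = g_i f_{i+1}` for `i < s`, and
where `g_s = f_s`. -/
def splitByFactors : SkewPolynomial F → List (Polynomial (fixedField F)) →
    Cost (List (SkewPolynomial F × Polynomial (fixedField F)))
  | _, [] => pure []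
  | f, [π] => pure [(f, π)]
  | f, π :: π' :: πs => do
    let P ← prodP (baseArith (fixedField F)) (π' :: πs)
    let f' ← rgcdR w f (emb P)
    let q ← divR w f f'
    let l ← splitByFactors f' (π' :: πs)
    pure ((q.1, π) :: l)

/-- A bound has the form `p = d f̂ X ^ m` with `d ∈ F` and `f̂ ∈ K[z]` monic, `f̂(0) ≠ 0`.
This is the list of the monic irreducible factors of `f̂` in `K[z]`, with multiplicities. -/
def factorBound (p : SkewPolynomial F) : Cost (List (Polynomial (fixedField F))) := do
  let u ← fInv w (lc p)
  let p' ← scaleR w u p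
  factorPoly (baseArith (fixedField F)) (baseData (fixedField F))
    (∑ i ∈ Finset.range (deg p + 1), Polynomial.monomial i
      (toFixed (p'.coeff (lowDeg p + autOrder F * i))))

/-- Concatenation of the factorizations of the `g_i`. -/
def factorizeAll : List (SkewPolynomial F × Polynomial (fixedField F)) →
    Rand (List (SkewPolynomial F))
  | [] => pure []
  | x :: l => do
    let l₁ ← factorizeIrred w b k x.2 (deg x.1 + 1) x.1
    let l₂ ← factorizeAll l
    pure (l₁ ++ l₂)

/-- The algorithm for the factorization of `f` into irreducible factors. Every call of the search
for a zero divisor is attempted at most `k` times, after which the algorithm gives up with a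
failure. -/
def factorize (gens : List F) (f : SkewPolynomial F) : Rand (List (SkewPolynomial F)) := do
  let p ← Rand.lift (boundR w gens f)
  let m := lowDeg p
  let πs ← Rand.lift (factorBound w p)
  let q ← Rand.lift (divR w f (SkewPolynomial.X ^ m))
  let gs ← Rand.lift (splitByFactors w q.1 πs)
  let out ← factorizeAll w b k gs
  if πs = [] then
    -- here `f = q X ^ m` with a constant `q`, which is put into the first factor
    pure (SkewPolynomial.monomial 1 (q.1.coeff 0) :: List.replicate (m - 1) SkewPolynomial.X)
  else pure (out ++ List.replicate m SkewPolynomial.X)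

end Factor

end

end SkewFact

/-!
Why the algorithm is correct and cubic.

**Bound.** Write `μ` for the order of `σ` and `z = X ^ μ`. Multiplication by `z` on `R / R f` is an
`F`-linear endomorphism of a space of dimension at most `deg f`, so its characteristic polynomial
in `z` annihilates `R / R f` (`exists_annihilator`): the bound has degree at
most `μ * deg f`. Every replacement in the loop raises the degree of a left multiple of `f` that
divides the bound, and the loop stops at an element that is invariant under algebra generators of
`R` over its center, hence at the bound (`boundR_spec`). Invariant elements have the form
`d f̂ X ^ m` with `f̂` in `K[z]` (`IsInv.eq_emb_mul`), and `f̂` is the minimal central multiple of the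
cofactor of `X ^ m` in `f` (`IsBound.split`). Its irreducible factors are separated one after the
other by greatest common divisors (`IsMinimalCentral.split_rgcdR`).

**Commutative factorization.** The cost of Gaussian elimination and of Berlekamp's algorithm is
bounded for arbitrary faithful arithmetic of a finite extension of `K`, so that the same theorem
`factorPoly_spec` serves for `K[z]` and for polynomials over `K_π = K[z] / (π)`.

**Irreducible bound.** Let `π ≠ z` be irreducible in `K[z]`, of degree `δ`. The algebra
`A = R / R π` is finite and simple with center `K_π`, and has dimension `μ ^ 2` over `K_π`; by
Wedderburn's theorems it is the endomorphism algebra of a space of dimension `μ`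
(`exists_algEquiv_end`). Hence `f = f y f` is solvable, and the nonconstant right factors of `π`
have degree at least `δ`, those of degree `δ` being irreducible. If `f` is one of larger degree,
then the idempotent `1 - y f` has an image `U` of dimension at least two
(`two_le_finrank_range`, by counting), and the compression of a random element to `U` is a
uniformly random endomorphism of `U`. By the second moment method at least half of the
endomorphisms have an eigenvector (`card_le_two_mul_card_eigenvector`), and at most one eighth are
scalar; whenever an endomorphism with an eigenvector is not scalar, its minimal polynomial is
reducible. So one attempt fails with probability at most `5 / 8`, whatever `π` and `f` are
(`findZeroDivisor_spec`), and a zero divisor splits `f` properly (`deg_rgcdR_lt`).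

**Cost.** Linear algebra in `A` takes place in dimension `μ ^ 2`, which is a constant, so that every
attempt and every splitting costs `O(δ ^ 3)`. There are at most `deg g / δ - 1` splittings for a
factor `g` with bound `π`, which makes `O((deg g) ^ 3)`, and the sum of these cubes over all factors
is at most `(deg f) ^ 3`. The expected number of attempts per splitting is bounded by a geometric
series (`Rand.Spec.retry`), and the probability of a failure is at most `deg f * (5 / 8) ^ k`. The
bookkeeping for randomized computations is the predicate `Rand.Spec` with its rule for sequential
composition `Rand.Spec.bind`; `factorize_spec` collects everything.
-/

set_option linter.unusedSectionVars false

namespace SkewFact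

/-! ### Reasoning about costed computations -/

section CostRules

variable {α β S : Type u}

@[simp] theorem Cost.val_pure (a : α) : (pure a : Cost α).val = a := rfl

@[simp] theorem Cost.ops_pure (a : α) : (pure a : Cost α).ops = 0 := rfl

@[simp] theorem Cost.val_bind (x : Cost α) (g : α → Cost β) :
    (x >>= g).val = (g x.val).val := rfl

@[simp] theorem Cost.ops_bind (x : Cost α) (g : α → Cost β) :
    (x >>= g).ops = x.ops + (g x.val).ops := rfl

theorem foldlM_val {α : Type*} (f : S → α → Cost S) (l : List α) (s : S) :
    (l.foldlM f s).val = l.foldl (fun s a => (f s a).val) s := by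
  induction l generalizing s with
  | nil => rfl
  | cons a l ih => simp [List.foldlM_cons, ih]

/-- A left fold preserves an invariant `I`; its cost is the sum of the costs of its steps. -/
theorem foldlM_spec {α : Type*} (f : S → α → Cost S) (I : S → Prop) (c : α → ℕ) :
    ∀ (l : List α) (s : S), I s →
      (∀ s a, a ∈ l → I s → I (f s a).val ∧ (f s a).ops ≤ c a) →
      I (l.foldlM f s).val ∧ (l.foldlM f s).ops ≤ (l.map c).sum := by
  intro l
  induction l with
  | nil => intro s hs _; exact ⟨hs, le_rfl⟩
  | cons a l ih =>
    intro s hs h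
    obtain ⟨h1, h2⟩ := h s a (by simp) hs
    obtain ⟨h3, h4⟩ := ih _ h1 fun s b hb => h s b (by simp [hb])
    simp only [List.foldlM_cons, Cost.val_bind, Cost.ops_bind, List.map_cons, List.sum_cons]
    exact ⟨h3, by omega⟩

theorem foldlM_ops_le {α : Type*} (f : S → α → Cost S) (c : ℕ) (l : List α) (s : S)
    (h : ∀ s a, a ∈ l → (f s a).ops ≤ c) : (l.foldlM f s).ops ≤ l.length * c := by
  simpa using (foldlM_spec f (fun _ => True) (fun _ => c) l s trivial
    fun s a ha _ => ⟨trivial, h s a ha⟩).2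

theorem foldlM_concat {α : Type*} (f : S → α → Cost S) (l : List α) (s : S) (a : α) :
    ((l ++ [a]).foldlM f s).val = (f (l.foldlM f s).val a).val ∧
    ((l ++ [a]).foldlM f s).ops = (l.foldlM f s).ops + (f (l.foldlM f s).val a).ops := by
  induction l generalizing s with
  | nil => simp [List.foldlM_cons]
  | cons d l ih => simp [List.foldlM_cons, ih]; omega

/-- A version of `foldlM_spec` with an invariant that depends on the number of steps made. -/
theorem foldlM_range_spec (f : S → ℕ → Cost S) (I : ℕ → S → Prop) (c : ℕ → ℕ) (s : S)
    (n : ℕ) (h0 : I 0 s)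
    (h : ∀ i s, i < n → I i s → I (i + 1) (f s i).val ∧ (f s i).ops ≤ c i) :
    I n ((List.range n).foldlM f s).val ∧
      ((List.range n).foldlM f s).ops ≤ ∑ i ∈ Finset.range n, c i := by
  induction n with
  | zero => exact ⟨h0, by simp⟩
  | succ n ih =>
    obtain ⟨h1, h2⟩ := ih fun i s hi => h i s (by omega)
    obtain ⟨h3, h4⟩ := h n _ (by omega) h1
    rw [List.range_succ, (foldlM_concat _ _ _ _).1, (foldlM_concat _ _ _ _).2,
      Finset.sum_range_succ]
    exact ⟨h3, by omega⟩

theorem mapC_val (f : α → Cost β) (l : List α) : (mapC f l).val = l.map fun a => (f a).val := by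
  induction l with
  | nil => rfl
  | cons a l ih => simp [mapC, ih]

theorem mapC_ops (f : α → Cost β) (l : List α) : (mapC f l).ops = (l.map fun a => (f a).ops).sum := by
  induction l with
  | nil => rfl
  | cons a l ih => simp [mapC, ih]

theorem mapC_ops_le (f : α → Cost β) (l : List α) (c : ℕ) (h : ∀ a ∈ l, (f a).ops ≤ c) :
    (mapC f l).ops ≤ l.length * c := by
  rw [mapC_ops]
  simpa using List.sum_le_card_nsmul (l.map fun a => (f a).ops) c (by simpa using h)

/-- The loop rule: `I` is an invariant, `Φ` pays for the rounds, and `rank` bounds their number. -/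
theorem whileC_spec (p : S → Prop) (body : S → Cost S) (I : S → Prop) (Φ rank : S → ℕ)
    (h : ∀ s, I s → p s → I (body s).val ∧ (body s).ops + Φ (body s).val ≤ Φ s ∧
      rank (body s).val < rank s) :
    ∀ (n : ℕ) (s : S), I s → rank s ≤ n →
      I (whileC p body n s).val ∧ ¬ p (whileC p body n s).val ∧
      (whileC p body n s).ops + Φ (whileC p body n s).val ≤ Φ s := by
  intro n
  induction n with
  | zero =>
    intro s hs hr
    refine ⟨hs, fun hp => ?_, by simp [whileC]⟩
    have := (h s hs hp).2.2
    omega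
  | succ n ih =>
    intro s hs hr
    by_cases hp : p s
    · obtain ⟨h1, h2, h3⟩ := h s hs hp
      obtain ⟨h4, h5, h6⟩ := ih _ h1 (by omega)
      simp only [whileC, hp, if_true, Cost.val_bind, Cost.ops_bind]
      exact ⟨h4, h5, by omega⟩
    · simp only [whileC, hp, if_false, Cost.val_pure, Cost.ops_pure]
      exact ⟨hs, not_false, by omega⟩

/-- Value of square-and-multiply: any relation `T n x` ("`x` represents the `n`-th power") that is
respected by the multiplication holds for the result. The result is moreover `Q` as soon as products
are. -/
theorem powC_spec {M : Type u} (mul : M → M → Cost M) (one a : M) (T : ℕ → M → Prop) (c : ℕ)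
    (h0 : T 0 one) (hsq : ∀ n x, T n x → T (n + n) (mul x x).val)
    (hmul : ∀ n x, T n x → T (n + 1) (mul x a).val)
    (hc : ∀ n x, T n x → (mul x x).ops ≤ c ∧ (mul x a).ops ≤ c) (n : ℕ) :
    T n (powC mul one a n).val ∧ (powC mul one a n).ops ≤ 2 * n.size * c := by
  have key : ∀ (l : List Bool),
      T (l.foldr (fun b n => Nat.bit b n) 0)
        ((l.reverse.foldlM (fun acc bit => do
          let s ← mul acc acc
          if bit then mul s a else pure s) one : Cost M).val) ∧
      ((l.reverse.foldlM (fun acc bit => do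
          let s ← mul acc acc
          if bit then mul s a else pure s) one : Cost M).ops) ≤ 2 * l.length * c := by
    intro l
    induction l with
    | nil => exact ⟨h0, by simp⟩
    | cons b l ih =>
      obtain ⟨ih1, ih2⟩ := ih
      rw [List.reverse_cons]
      rw [(foldlM_concat _ _ _ _).1, (foldlM_concat _ _ _ _).2]
      set y := (l.reverse.foldlM (fun acc bit => do
          let s ← mul acc acc
          if bit then mul s a else pure s) one : Cost M).val with hy
      have hs := hsq _ _ ih1
      have c1 := (hc _ _ ih1).1
      have c2 := (hc _ _ hs).2
      simp only [List.length_cons, List.foldr_cons]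
      have e : 2 * (l.length + 1) * c = 2 * l.length * c + c + c := by ring
      cases b
      · refine ⟨?_, ?_⟩
        · simpa [Nat.bit, two_mul] using hs
        · simp only [Cost.ops_bind, Bool.false_eq_true, if_false, Cost.ops_pure]
          omega
      · refine ⟨?_, ?_⟩
        · simpa [Nat.bit, two_mul] using hmul _ _ hs
        · simp only [Cost.ops_bind, if_true]
          omega
  have hb : ∀ n : ℕ, n.bits.foldr (fun b n => Nat.bit b n) 0 = n := by
    intro n
    induction n using Nat.binaryRec' with
    | zero => simp
    | bit b n hn ih => rw [Nat.bits_append_bit _ _ hn]; simp [ih]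
  have := key n.bits
  rwa [hb, Nat.size_eq_bits_len] at this

end CostRules

/-! ### The Euclidean algorithm in a ring with a degree function -/

section Euclid

variable {S : Type u} [Ring S]

/-- A degree function on a ring, with value `0` at `0`. -/
structure IsDegree (d : S → ℕ) : Prop where
  map_zero : d 0 = 0
  map_one : d 1 = 0
  map_mul : ∀ {a b : S}, a ≠ 0 → b ≠ 0 → d (a * b) = d a + d b
  map_neg : ∀ a : S, d (-a) = d a
  map_add_le : ∀ a b : S, d (a + b) ≤ max (d a) (d b)

/-- A costed left division with remainder, of cost quadratic in the sense of the schoolbook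
method: (number of coefficients of the quotient) times (number of coefficients of the divisor). -/
def DivSpec (d : S → ℕ) (κ : ℕ) (div : S → S → Cost (S × S)) : Prop :=
  ∀ f g, g ≠ 0 → f = (div f g).val.1 * g + (div f g).val.2 ∧
    ((div f g).val.2 = 0 ∨ d (div f g).val.2 < d g) ∧
    (div f g).ops ≤ κ * ((d f + 1 - d g) * (d g + 1) + 1)

variable {d : S → ℕ}

theorem IsDegree.sub_le (hd : IsDegree d) (a b : S) : d (a - b) ≤ max (d a) (d b) := by
  rw [sub_eq_add_neg, ← hd.map_neg b]
  exact hd.map_add_le _ _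

theorem IsDegree.mul_le (hd : IsDegree d) (a b : S) : d (a * b) ≤ d a + d b := by
  by_cases ha : a = 0
  · simp [ha, hd.map_zero]
  by_cases hb : b = 0
  · simp [hb, hd.map_zero]
  exact (hd.map_mul ha hb).le

/-- The degree of a quotient. -/
theorem IsDegree.quotient (hd : IsDegree d) {f g q r : S} (hg : g ≠ 0) (h : f = q * g + r)
    (hr : r = 0 ∨ d r < d g) : q = 0 ∨ d q + d g = d f := by
  by_cases hq : q = 0
  · exact Or.inl hq
  right
  have h1 := hd.map_mul hq hg
  rcases hr with hr | hr
  · rw [h, hr, add_zero, h1]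
  · have h2 := hd.map_add_le (q * g) r
    rw [← h] at h2
    have h3 := hd.sub_le f r
    rw [show f - r = q * g by rw [h]; simp] at h3
    omega

/-- Uniqueness of division with remainder. -/
theorem IsDegree.unique [NoZeroDivisors S] (hd : IsDegree d) {g q r q' r' : S} (hg : g ≠ 0)
    (h : q * g + r = q' * g + r')
    (hr : r = 0 ∨ d r < d g) (hr' : r' = 0 ∨ d r' < d g) : q = q' ∧ r = r' := by
  have h1 : r' - r = (q - q') * g := by
    rw [sub_mul, sub_eq_sub_iff_add_eq_add, add_comm, ← h, add_comm]
  by_cases hq : q - q' = 0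
  · have := sub_eq_zero.1 hq
    subst this
    exact ⟨rfl, by simpa using h⟩
  · exfalso
    have h2 := hd.map_mul hq hg
    rw [← h1] at h2
    have h3 := hd.sub_le r' r
    have h4 : r' - r ≠ 0 := by rw [h1]; exact mul_ne_zero hq hg
    have h0 := hd.map_zero
    rcases hr with hr | hr <;> rcases hr' with hr' | hr'
    · simp [hr, hr'] at h4
    · rw [hr, sub_zero] at h2; omega
    · rw [hr', zero_sub, hd.map_neg] at h2; omega
    · omega

open Classical in
/-- The potential that pays for the rounds of the Euclidean algorithm. -/
noncomputable def euclidPot (d : S → ℕ) (s : S × S) : ℕ := if s.2 = 0 then 0 else d s.1 + 2 * d s.2 + 2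

theorem euclidPot_le (d : S → ℕ) (s : S × S) : euclidPot d s ≤ d s.1 + 2 * d s.2 + 2 := by
  unfold euclidPot; split_ifs <;> omega

/-- The decrease of the potential in one round is at least the number of coefficients of the
quotient, and one more in a round with a nonzero quotient. -/
theorem euclidPot_step (hd : IsDegree d) {f g q r : S} (hg : g ≠ 0)
    (h : f = q * g + r) (hr : r = 0 ∨ d r < d g) :
    (d f + 1 - d g) + 1 + euclidPot d (g, r) ≤ euclidPot d (f, g) ∧
    d q + 1 + euclidPot d (g, r) ≤ euclidPot d (f, g) := by
  have hq := hd.quotient hg h hr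
  have h0 := hd.map_zero
  unfold euclidPot
  by_cases hr0 : r = 0
  · rcases hq with hq | hq
    · simp only [hr0, hg, hq, if_true, if_false, h0]; omega
    · simp only [hr0, hg, if_true, if_false]; omega
  · have hlt := hr.resolve_left hr0
    rcases hq with hq | hq
    · have : f = r := by rw [h, hq]; simp
      simp only [hr0, hg, hq, if_false, h0, this]; omega
    · simp only [hr0, hg, if_false]; omega

open Classical in
/-- The Euclidean algorithm computes a right greatest common divisor. -/
theorem gcd_loop_spec (hd : IsDegree d) {κ : ℕ} {div : S → S → Cost (S × S)}
    (hdiv : DivSpec d κ div) (f g : S) :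
    let x := whileC (fun s : S × S => s.2 ≠ 0)
      (fun s => do
        let e ← div s.1 s.2
        pure (s.2, e.2)) (d g + 1) (f, g)
    (∀ t, (∃ a b, t = a * f + b * g) ↔ ∃ a, t = a * x.val.1) ∧
    (g ≠ 0 ∨ f ≠ 0 → x.val.1 ≠ 0) ∧
    x.ops ≤ κ * (min (d f) (d g) + 1) * (d f + 2 * d g + 2) := by
  intro x
  set B := min (d f) (d g) with hB
  obtain ⟨⟨h1, h2, -⟩, h3, h4⟩ := whileC_spec (fun s : S × S => s.2 ≠ 0)
      (fun s => do
        let e ← div s.1 s.2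
        pure (s.2, e.2))
      (fun s => (∀ t, (∃ a b, t = a * f + b * g) ↔ ∃ a b, t = a * s.1 + b * s.2) ∧
        (g ≠ 0 ∨ f ≠ 0 → s.1 ≠ 0 ∨ s.2 ≠ 0) ∧
        (d s.1 < d s.2 ∧ d s.1 ≤ B ∨ d s.2 ≤ B))
      (fun s => κ * (B + 1) * euclidPot d s)
      (fun s => if s.2 = 0 then 0 else d s.2 + 1)
      (by
        rintro ⟨r0, r1⟩ ⟨i1, i2, i3⟩ (hr1 : r1 ≠ 0)
        obtain ⟨e1, e2, e3⟩ := hdiv r0 r1 hr1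
        simp only [Cost.val_bind, Cost.ops_bind, Cost.val_pure, Cost.ops_pure, add_zero]
        generalize (div r0 r1).val = y at *
        obtain ⟨q, r⟩ := y
        simp only at *
        obtain ⟨p1, -⟩ := euclidPot_step hd hr1 e1 e2
        refine ⟨⟨fun t => (i1 t).trans ⟨?_, ?_⟩, fun _ => Or.inl hr1, ?_⟩, ?_, ?_⟩
        · rintro ⟨a, b, rfl⟩
          exact ⟨a * q + b, a, by rw [e1]; noncomm_ring⟩
        · rintro ⟨a, b, rfl⟩
          exact ⟨b, a - b * q, by rw [e1]; noncomm_ring⟩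
        · by_cases hr : r = 0
          · right; rw [hr, hd.map_zero]; exact Nat.zero_le _
          have := e2.resolve_left hr
          rcases i3 with h | h
          · rcases hd.quotient hr1 e1 e2 with hq | hq
            · rw [hq, zero_mul, zero_add] at e1
              rw [← e1]; omega
            · omega
          · omega
        · calc (div r0 r1).ops + κ * (B + 1) * euclidPot d (r1, r)
              ≤ κ * ((B + 1) * ((d r0 + 1 - d r1) + 1)) + κ * (B + 1) * euclidPot d (r1, r) := by
                gcongr
                refine e3.trans ?_
                gcongr
                rcases i3 with h | h
                · rw [show d r0 + 1 - d r1 = 0 by omega]; omega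
                · nlinarith [Nat.zero_le (d r0 + 1 - d r1)]
            _ = κ * (B + 1) * ((d r0 + 1 - d r1) + 1 + euclidPot d (r1, r)) := by ring
            _ ≤ _ := by gcongr
        · simp only [hr1, if_false]
          split_ifs with hr
          · omega
          · have := e2.resolve_left hr; omega)
      (d g + 1) (f, g)
      ⟨fun t => Iff.rfl, fun h => h.symm, by simp only; omega⟩
      (by dsimp only; split_ifs <;> omega)
  have h3' : x.val.2 = 0 := not_not.1 h3
  refine ⟨fun t => (h1 t).trans ?_, fun h => ?_, ?_⟩
  · change (∃ a b, t = a * x.val.1 + b * x.val.2) ↔ _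
    simp [h3']
  · exact (h2 h).resolve_right (not_not.2 h3')
  · have h5 := euclidPot_le d (f, g)
    have h6 : κ * (B + 1) * euclidPot d (f, g) ≤ κ * (B + 1) * (d f + 2 * d g + 2) := by gcongr
    change x.ops + _ ≤ _ at h4
    omega

open Classical in
/-- The extended Euclidean algorithm: in the final state `((r₀, 0), (v₀, v₁))`, the element `v₁`
generates the annihilator of `h` modulo `S f`, and `v₀ h ≡ r₀`, a greatest common divisor. -/
theorem ext_loop_spec [NoZeroDivisors S] (hd : IsDegree d) {κ : ℕ} {div : S → S → Cost (S × S)}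
    {neg : S → Cost S} {addMul : S → S → S → Cost S}
    (hdiv : DivSpec d κ div) (hneg : ∀ a, (neg a).val = -a ∧ (neg a).ops ≤ κ * (d a + 1))
    (haddMul : ∀ a b r, (addMul a b r).val = r + a * b ∧
      (addMul a b r).ops ≤ κ * ((d a + 1) * (d b + 1)))
    (f h : S) (hf : f ≠ 0) (n : ℕ) (hn : d h + 1 ≤ n) :
    let x := whileC (fun s : (S × S) × (S × S) => s.1.2 ≠ 0)
      (fun s => do
        let e ← div s.1.1 s.1.2
        let c ← neg e.1
        let v ← addMul c s.2.2 s.2.1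
        pure ((s.1.2, e.2), (s.2.2, v))) n ((f, h), (0, 1))
    (∀ g, (∃ q, g * h = q * f) ↔ ∃ y, g = y * x.val.2.2) ∧
    (∃ u, x.val.1.1 = u * f + x.val.2.1 * h) ∧
    (∀ t, (∃ a b, t = a * f + b * h) ↔ ∃ a, t = a * x.val.1.1) ∧
    x.val.1.1 ≠ 0 ∧
    d x.val.2.1 ≤ max (d f) (d h) ∧ d x.val.2.2 ≤ max (d f) (d h) ∧
    x.ops ≤ 9 * κ * (max (d f) (d h) + 1) ^ 2 := by
  intro x
  set N := max (d f) (d h) with hN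
  obtain ⟨⟨h1, h2, h7, h3, h4, h5⟩, h6, h8⟩ := whileC_spec
      (fun s : (S × S) × (S × S) => s.1.2 ≠ 0)
      (fun s => do
        let e ← div s.1.1 s.1.2
        let c ← neg e.1
        let v ← addMul c s.2.2 s.2.1
        pure ((s.1.2, e.2), (s.2.2, v)))
      (fun s => (∀ g, (∃ q, g * h = q * f) ↔
          ∃ a b, a * s.1.1 + b * s.1.2 = 0 ∧ g = a * s.2.1 + b * s.2.2) ∧
        ((∃ u, s.1.1 = u * f + s.2.1 * h) ∧ ∃ u, s.1.2 = u * f + s.2.2 * h) ∧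
        (∀ t, (∃ a b, t = a * f + b * h) ↔ ∃ a b, t = a * s.1.1 + b * s.1.2) ∧
        s.1.1 ≠ 0 ∧
        d s.2.1 + max (d s.1.1) (d s.1.2) ≤ N ∧ d s.2.2 + max (d s.1.1) (d s.1.2) ≤ N)
      (fun s => 3 * κ * (N + 1) * euclidPot d s.1)
      (fun s => if s.1.2 = 0 then 0 else d s.1.2 + 1)
      (by
        rintro ⟨⟨r0, r1⟩, v0, v1⟩ ⟨i1, ⟨⟨u0, i2⟩, u1, i3⟩, i7, i4, i5, i6⟩ (hr1 : r1 ≠ 0)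
        obtain ⟨e1, e2, e3⟩ := hdiv r0 r1 hr1
        simp only [Cost.val_bind, Cost.ops_bind, Cost.val_pure, Cost.ops_pure, add_zero]
        generalize (div r0 r1).val = y at *
        obtain ⟨q, r⟩ := y
        simp only at *
        obtain ⟨n1, n2⟩ := hneg q
        obtain ⟨a1, a2⟩ := haddMul (-q) v1 v0
        obtain ⟨p1, p2⟩ := euclidPot_step hd hr1 e1 e2
        have hq := hd.quotient hr1 e1 e2
        rw [n1, a1]
        rw [hd.map_neg] at a2
        have hrle : d r ≤ d r1 := by
          rcases e2 with h | h
          · rw [h, hd.map_zero]; exact Nat.zero_le _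
          · exact h.le
        refine ⟨⟨fun g => (i1 g).trans ⟨?_, ?_⟩, ⟨⟨u1, i3⟩, u0 - q * u1, ?_⟩,
          fun t => (i7 t).trans ⟨?_, ?_⟩, hr1, ?_, ?_⟩, ?_, ?_⟩
        · rintro ⟨a, b, h, rfl⟩
          refine ⟨a * q + b, a, ?_, by noncomm_ring⟩
          rw [← h, e1]; noncomm_ring
        · rintro ⟨a, b, h, rfl⟩
          refine ⟨b, a - b * q, ?_, by noncomm_ring⟩
          rw [← h]; rw [e1]; noncomm_ring
        · have : r = r0 - q * r1 := by rw [e1]; simp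
          rw [this]; nth_rw 1 [i2, i3]; noncomm_ring
        · rintro ⟨a, b, rfl⟩
          exact ⟨a * q + b, a, by rw [e1]; noncomm_ring⟩
        · rintro ⟨a, b, rfl⟩
          exact ⟨b, a - b * q, by rw [e1]; noncomm_ring⟩
        · omega
        · have k1 := hd.map_add_le v0 (-q * v1)
          have k2 := hd.mul_le (-q) v1
          rw [hd.map_neg] at k2
          rcases hq with hq | hq
          · simp only [hq, neg_zero, zero_mul, add_zero]; omega
          · omega
        · have hT : (div r0 r1).ops ≤ κ * ((N + 1) * ((d r0 + 1 - d r1) + 1)) := by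
            refine e3.trans ?_
            gcongr
            have : d r1 + 1 ≤ N + 1 := by omega
            nlinarith [Nat.zero_le (d r0 + 1 - d r1)]
          have hv : d v1 + 1 ≤ N + 1 := by omega
          have hA : (addMul (-q) v1 v0).ops ≤ κ * ((d q + 1) * (N + 1)) :=
            a2.trans (by gcongr)
          have hB : (neg q).ops ≤ κ * ((d q + 1) * (N + 1)) := by
            refine n2.trans ?_
            gcongr
            exact Nat.le_mul_of_pos_right _ (by omega)
          calc _ ≤ κ * ((N + 1) * ((d r0 + 1 - d r1) + 1)) + (κ * ((d q + 1) * (N + 1)) +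
                κ * ((d q + 1) * (N + 1))) + 3 * κ * (N + 1) * euclidPot d (r1, r) := by gcongr
            _ = κ * (N + 1) * ((d r0 + 1 - d r1) + 1 + euclidPot d (r1, r)) +
                2 * (κ * (N + 1) * (d q + 1 + euclidPot d (r1, r))) := by ring
            _ ≤ κ * (N + 1) * euclidPot d (r0, r1) + 2 * (κ * (N + 1) * euclidPot d (r0, r1)) := by
                gcongr
            _ = _ := by ring
        · simp only [hr1, if_false]
          split_ifs with hr
          · omega
          · have := e2.resolve_left hr; omega)
      n ((f, h), (0, 1))
      ⟨fun g => ⟨fun ⟨q, hq⟩ => ⟨-q, g, by simp [hq], by simp⟩,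
          fun ⟨a, b, hab, hg⟩ => ⟨-a, by
            simp only [mul_zero, mul_one, zero_add] at hg
            rw [hg, neg_mul, eq_neg_iff_add_eq_zero, add_comm, hab]⟩⟩,
        ⟨⟨1, by simp⟩, 0, by simp⟩, fun t => Iff.rfl, hf, by simp [hd.map_zero, hN],
        by simp [hd.map_one, hN]⟩
      (by dsimp only; split_ifs <;> omega)
  have h6' : x.val.1.2 = 0 := not_not.1 h6
  refine ⟨fun g => (h1 g).trans ?_, h2.1, fun t => (h7 t).trans ?_, h3, ?_, ?_, ?_⟩
  · change (∃ a b, a * x.val.1.1 + b * x.val.1.2 = 0 ∧ g = a * x.val.2.1 + b * x.val.2.2) ↔ _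
    have h3' : x.val.1.1 ≠ 0 := h3
    simp [h6', h3']
  · change (∃ a b, t = a * x.val.1.1 + b * x.val.1.2) ↔ _
    simp [h6']
  · exact le_trans (Nat.le_add_right _ _) h4
  · exact le_trans (Nat.le_add_right _ _) h5
  · have h9 := euclidPot_le d (f, h)
    change x.ops + _ ≤ _ at h8
    have h10 : euclidPot d (f, h) ≤ 3 * (N + 1) := by
      have : d f ≤ N := le_max_left _ _
      have : d h ≤ N := le_max_right _ _
      simp only at h9
      omega
    calc x.ops ≤ 3 * κ * (N + 1) * euclidPot d (f, h) := le_trans (Nat.le_add_right _ _) h8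
      _ ≤ 3 * κ * (N + 1) * (3 * (N + 1)) := by gcongr
      _ = _ := by ring

/-- The division loop: every round lowers the degree of the remainder. -/
theorem div_loop_spec (hd : IsDegree d) (f g : S) {c : ℕ} (body : S × S → Cost (S × S))
    (h : ∀ s : S × S, s.2 ≠ 0 → d g ≤ d s.2 → d s.2 ≤ d f →
      (body s).val.1 * g + (body s).val.2 = s.1 * g + s.2 ∧
      ((body s).val.2 = 0 ∨ d (body s).val.2 < d s.2) ∧ (body s).ops ≤ c) :
    let x := whileC (fun s : S × S => s.2 ≠ 0 ∧ d g ≤ d s.2) body (d f + 1) (0, f)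
    f = x.val.1 * g + x.val.2 ∧ (x.val.2 = 0 ∨ d x.val.2 < d g) ∧
    x.ops ≤ c * (d f + 1 - d g) := by
  classical
  intro x
  obtain ⟨⟨h1, -⟩, h2, h3⟩ := whileC_spec (fun s : S × S => s.2 ≠ 0 ∧ d g ≤ d s.2) body
    (fun s => f = s.1 * g + s.2 ∧ d s.2 ≤ d f)
    (fun s => if s.2 = 0 then 0 else c * (d s.2 + 1 - d g))
    (fun s => if s.2 = 0 then 0 else d s.2 + 1)
    (by
      rintro s ⟨i1, i2⟩ ⟨hs, hg⟩
      obtain ⟨b1, b2, b3⟩ := h s hs hg i2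
      refine ⟨⟨by rw [b1]; exact i1, ?_⟩, ?_, ?_⟩
      · rcases b2 with b2 | b2
        · rw [b2, hd.map_zero]; exact Nat.zero_le _
        · omega
      · simp only [hs, if_false]
        split_ifs with h0
        · calc _ ≤ c * 1 := by omega
            _ ≤ _ := by gcongr; omega
        · have := b2.resolve_left h0
          calc _ ≤ c * 1 + c * (d (body s).val.2 + 1 - d g) := by omega
            _ = c * (1 + (d (body s).val.2 + 1 - d g)) := by ring
            _ ≤ _ := by gcongr; omega
      · simp only [hs, if_false]
        split_ifs with h0
        · omega
        · have := b2.resolve_left h0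
          omega)
    (d f + 1) (0, f) ⟨by simp, le_rfl⟩ (by dsimp only; split_ifs <;> omega)
  refine ⟨h1, ?_, ?_⟩
  · by_contra hcon
    rw [not_or, not_lt] at hcon
    exact h2 hcon
  · change x.ops + _ ≤ _ at h3
    refine (le_trans (Nat.le_add_right _ _) h3).trans ?_
    dsimp only
    split_ifs
    · exact Nat.zero_le _
    · exact le_rfl

end Euclid

end SkewFact

namespace SkewFact

open Polynomial

/-! ### Arithmetic of commutative polynomials -/

/-- A loop that rewrites the coefficients `k, k + 1, …, k + n - 1` one after the other. Here `co`
is the coefficient function of whatever kind of polynomial `P` stands for. -/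
theorem foldl_range_coeff {P A : Type*} (co : P → ℕ → A) (step : P → ℕ → P) (φ : ℕ → A → A)
    (k : ℕ) (h : ∀ r i, co (step r i) = Function.update (co r) (i + k) (φ i (co r (i + k))))
    (n : ℕ) (r : P) (j : ℕ) :
    co ((List.range n).foldl step r) j =
      if k ≤ j ∧ j < n + k then φ (j - k) (co r j) else co r j := by
  induction n with
  | zero => rw [if_neg (by omega)]; rfl
  | succ n ih =>
    rw [List.range_succ, List.foldl_append, List.foldl_cons, List.foldl_nil, h,
      Function.update_apply]
    by_cases hj : j = n + k
    · subst hj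
      rw [if_pos rfl, ih, if_neg (by omega), if_pos (by omega), Nat.add_sub_cancel]
    · rw [if_neg hj, ih]
      by_cases h1 : k ≤ j ∧ j < n + k
      · rw [if_pos h1, if_pos (by omega)]
      · rw [if_neg h1, if_neg (by omega)]

section CommPoly

variable {L : Type u} [Field L]

/-- The costed arithmetic `o` computes the field operations, each at a cost of at most `M`. -/
structure Arith.Exact (o : Arith L) (M : ℕ) : Prop where
  pos : 1 ≤ M
  add : ∀ a b, (o.add a b).val = a + b
  neg : ∀ a, (o.neg a).val = -a
  mul : ∀ a b, (o.mul a b).val = a * b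
  inv : ∀ a, (o.inv a).val = a⁻¹
  add_ops : ∀ a b, (o.add a b).ops ≤ M
  neg_ops : ∀ a, (o.neg a).ops ≤ M
  mul_ops : ∀ a b, (o.mul a b).ops ≤ M
  inv_ops : ∀ a, (o.inv a).ops ≤ M

theorem isDegree_natDegree : IsDegree (natDegree : L[X] → ℕ) where
  map_zero := natDegree_zero
  map_one := natDegree_one
  map_mul := natDegree_mul
  map_neg := natDegree_neg
  map_add_le := natDegree_add_le

variable {o : Arith L} {M : ℕ} (ho : o.Exact M)
include ho

theorem addMonoP_val (a : L) (k : ℕ) (g r : L[X]) :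
    (addMonoP o a k g r).val = r + C a * X ^ k * g := by
  ext j
  rw [addMonoP, foldlM_val, foldl_range_coeff (fun p : L[X] => p.coeff) _
    (fun i t => t + a * g.coeff i) k
    (fun r i => by simp [ho.add, ho.mul, coeff_update])]
  rw [coeff_add, mul_assoc, coeff_C_mul, X_pow_mul, coeff_mul_X_pow']
  by_cases h1 : k ≤ j
  · by_cases h2 : j < g.natDegree + 1 + k
    · rw [if_pos ⟨h1, h2⟩, if_pos h1]
    · rw [if_neg (by omega), if_pos h1, coeff_eq_zero_of_natDegree_lt (p := g) (by omega), mul_zero,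
        add_zero]
  · rw [if_neg (by omega), if_neg h1, mul_zero, add_zero]

theorem addMonoP_ops (a : L) (k : ℕ) (g r : L[X]) :
    (addMonoP o a k g r).ops ≤ 2 * M * (g.natDegree + 1) := by
  refine (foldlM_ops_le _ (2 * M) _ _ fun r i _ => ?_).trans (by rw [List.length_range, mul_comm])
  have := ho.mul_ops a (g.coeff i)
  have := ho.add_ops (r.coeff (i + k)) (o.mul a (g.coeff i)).val
  simp only [Cost.ops_bind, Cost.ops_pure]
  omega

theorem addP_val (f g : L[X]) : (addP o f g).val = f + g := by
  ext j
  rw [addP, foldlM_val, foldl_range_coeff (fun p : L[X] => p.coeff) _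
    (fun i t => t + g.coeff i) 0 (fun r i => by simp [ho.add, coeff_update])]
  rw [coeff_add]
  split_ifs with h
  · simp
  · rw [coeff_eq_zero_of_natDegree_lt (p := g) (by omega), add_zero]

theorem addP_ops (f g : L[X]) : (addP o f g).ops ≤ M * (g.natDegree + 1) := by
  refine (foldlM_ops_le _ M _ _ fun r i _ => ?_).trans (by rw [List.length_range, mul_comm])
  simpa using ho.add_ops _ _

theorem negP_val (f : L[X]) : (negP o f).val = -f := by
  ext j
  rw [negP, foldlM_val, foldl_range_coeff (fun p : L[X] => p.coeff) _
    (fun i t => -f.coeff i) 0 (fun r i => by simp [ho.neg, coeff_update])]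
  rw [coeff_neg]
  split_ifs with h
  · simp
  · rw [coeff_eq_zero_of_natDegree_lt (p := f) (by omega)]; simp

theorem negP_ops (f : L[X]) : (negP o f).ops ≤ M * (f.natDegree + 1) := by
  refine (foldlM_ops_le _ M _ _ fun r i _ => ?_).trans (by rw [List.length_range, mul_comm])
  simpa using ho.neg_ops _

theorem scaleP_val (a : L) (f : L[X]) : (scaleP o a f).val = C a * f := by
  ext j
  rw [scaleP, foldlM_val, foldl_range_coeff (fun p : L[X] => p.coeff) _
    (fun i t => a * f.coeff i) 0 (fun r i => by simp [ho.mul, coeff_update])]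
  rw [coeff_C_mul]
  split_ifs with h
  · simp
  · rw [coeff_eq_zero_of_natDegree_lt (p := f) (by omega)]; simp

theorem scaleP_ops (a : L) (f : L[X]) : (scaleP o a f).ops ≤ M * (f.natDegree + 1) := by
  refine (foldlM_ops_le _ M _ _ fun r i _ => ?_).trans (by rw [List.length_range, mul_comm])
  simpa using ho.mul_ops _ _

theorem addMulP_val (f g r : L[X]) : (addMulP o f g r).val = r + f * g := by
  have key : ∀ n, ((List.range n).foldl (fun r i => (addMonoP o (f.coeff i) i g r).val) r) =
      r + (∑ i ∈ Finset.range n, C (f.coeff i) * X ^ i) * g := by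
    intro n
    induction n with
    | zero => simp
    | succ n ih =>
      rw [List.range_succ, List.foldl_append, ih, List.foldl_cons, List.foldl_nil,
        addMonoP_val ho, Finset.sum_range_succ]
      ring
  rw [addMulP, foldlM_val, key, ← as_sum_range_C_mul_X_pow]

theorem addMulP_ops (f g r : L[X]) :
    (addMulP o f g r).ops ≤ 2 * M * ((f.natDegree + 1) * (g.natDegree + 1)) := by
  refine (foldlM_ops_le _ (2 * M * (g.natDegree + 1)) _ _ fun r i _ =>
    addMonoP_ops ho _ _ _ _).trans (by rw [List.length_range]; apply le_of_eq; ring)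

theorem mulP_val (f g : L[X]) : (mulP o f g).val = f * g := by
  rw [mulP, addMulP_val ho, zero_add]

theorem mulP_ops (f g : L[X]) :
    (mulP o f g).ops ≤ 2 * M * ((f.natDegree + 1) * (g.natDegree + 1)) :=
  addMulP_ops ho _ _ _

theorem divP_spec : DivSpec (natDegree : L[X] → ℕ) (5 * M) (divP o) := by
  intro f g hg
  have hpos := ho.pos
  obtain ⟨h1, h2, h3⟩ := div_loop_spec isDegree_natDegree f g (c := 5 * M * (g.natDegree + 1))
    (fun s => do
      let k := s.2.natDegree - g.natDegree
      let a ← o.mul s.2.leadingCoeff (o.inv g.leadingCoeff).val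
      let t ← o.add (s.1.coeff k) a
      let a' ← o.neg a
      let r ← addMonoP o a' k g s.2
      pure (s.1.update k t, r))
    (by
      rintro ⟨q, r⟩ hr hle -
      simp only at hr hle
      simp only [Cost.val_bind, Cost.ops_bind, Cost.val_pure, Cost.ops_pure, ho.mul, ho.add,
        ho.neg, ho.inv, addMonoP_val ho]
      set k := r.natDegree - g.natDegree with hk
      set a := r.leadingCoeff * g.leadingCoeff⁻¹ with ha
      have hup : q.update k (q.coeff k + a) = q + C a * X ^ k := by
        ext j
        rw [coeff_update, coeff_add, coeff_C_mul_X_pow, Function.update_apply]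
        split_ifs with h
        · rw [h]
        · rw [add_zero]
      have ha0 : a ≠ 0 := mul_ne_zero (leadingCoeff_ne_zero.2 hr)
        (inv_ne_zero (leadingCoeff_ne_zero.2 hg))
      refine ⟨?_, ?_, ?_⟩
      · rw [hup, C_neg]; ring
      · by_cases h0 : r + C (-a) * X ^ k * g = 0
        · exact Or.inl h0
        right
        have hdeg : (C a * X ^ k * g).degree = r.degree := by
          rw [degree_mul, degree_C_mul_X_pow k ha0, degree_eq_natDegree hg,
            degree_eq_natDegree hr]
          norm_cast
          omega
        have hlt := degree_sub_lt_left hdeg.symm hr (by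
          rw [leadingCoeff_mul, leadingCoeff_mul_X_pow, leadingCoeff_C, ha, mul_assoc,
            inv_mul_cancel₀ (leadingCoeff_ne_zero.2 hg), mul_one])
        have he : r + C (-a) * X ^ k * g = r - C a * X ^ k * g := by rw [C_neg]; ring
        rw [he] at h0 ⊢
        exact (natDegree_lt_natDegree_iff h0).2 hlt
      · have := ho.mul_ops r.leadingCoeff g.leadingCoeff⁻¹
        have := ho.add_ops (q.coeff k) a
        have := ho.neg_ops a
        have := addMonoP_ops ho (-a) k g r
        nlinarith [Nat.zero_le (M * g.natDegree)])
  refine ⟨h1, h2, ?_⟩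
  rw [divP, Cost.ops_bind]
  have := ho.inv_ops g.leadingCoeff
  refine (Nat.add_le_add this h3).trans ?_
  nlinarith

theorem gcdP_spec (f g : L[X]) (hfg : f ≠ 0 ∨ g ≠ 0) :
    (gcdP o f g).val.Monic ∧ (gcdP o f g).val ∣ f ∧ (gcdP o f g).val ∣ g ∧
    (∃ u v, (gcdP o f g).val = u * f + v * g) := by
  obtain ⟨h1, h2, -⟩ := gcd_loop_spec isDegree_natDegree (divP_spec ho) f g
  simp only [gcdP, Cost.val_bind, scaleP_val ho, ho.inv]
  generalize (whileC (fun s : L[X] × L[X] => s.2 ≠ 0) _ _ _).val.1 = x at h1 h2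
  have hx := h2 hfg.symm
  have hx' := leadingCoeff_ne_zero.2 hx
  have hdvd : ∀ y, x ∣ y → C x.leadingCoeff⁻¹ * x ∣ y := fun y hy =>
    (IsUnit.mul_left_dvd (isUnit_C.2 (isUnit_iff_ne_zero.2 (inv_ne_zero hx')))).2 hy
  refine ⟨?_, hdvd _ ?_, hdvd _ ?_, ?_⟩
  · rw [mul_comm]; exact monic_mul_leadingCoeff_inv hx
  · obtain ⟨a, ha⟩ := (h1 f).1 ⟨1, 0, by simp⟩
    exact ⟨a, by rw [mul_comm]; exact ha⟩
  · obtain ⟨a, ha⟩ := (h1 g).1 ⟨0, 1, by simp⟩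
    exact ⟨a, by rw [mul_comm]; exact ha⟩
  · obtain ⟨a, b, hab⟩ := (h1 x).2 ⟨1, by simp⟩
    refine ⟨C x.leadingCoeff⁻¹ * a, C x.leadingCoeff⁻¹ * b, ?_⟩
    nth_rw 2 [hab]; ring

theorem gcdP_ops (f g : L[X]) : (gcdP o f g).ops ≤
    12 * M * ((min f.natDegree g.natDegree + 1) * (f.natDegree + g.natDegree + 1)) := by
  obtain ⟨h1, h2, h3⟩ := gcd_loop_spec isDegree_natDegree (divP_spec ho) f g
  have hpos := ho.pos
  simp only [gcdP, Cost.ops_bind]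
  generalize whileC (fun s : L[X] × L[X] => s.2 ≠ 0) _ _ _ = x at h1 h2 h3
  have hx : x.val.1.natDegree ≤ f.natDegree + g.natDegree := by
    by_cases h : g ≠ 0 ∨ f ≠ 0
    · rcases h with h | h
      · obtain ⟨a, ha⟩ := (h1 g).1 ⟨0, 1, by simp⟩
        have := natDegree_le_of_dvd ⟨a, by rw [mul_comm]; exact ha⟩ h
        omega
      · obtain ⟨a, ha⟩ := (h1 f).1 ⟨1, 0, by simp⟩
        have := natDegree_le_of_dvd ⟨a, by rw [mul_comm]; exact ha⟩ h
        omega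
    · push Not at h
      obtain ⟨a, b, hab⟩ := (h1 x.val.1).2 ⟨1, by simp⟩
      rw [hab]; simp [h]
  have e1 := ho.inv_ops x.val.1.leadingCoeff
  have e2 := scaleP_ops ho (o.inv x.val.1.leadingCoeff).val x.val.1
  set s := f.natDegree + g.natDegree
  set m := min f.natDegree g.natDegree
  have e3 : x.ops ≤ 5 * M * (m + 1) * (2 * (s + 1)) := h3.trans (by gcongr; omega)
  have e4 : M * (x.val.1.natDegree + 1) ≤ M * (s + 1) := by gcongr
  have e5 : M ≤ M * (s + 1) := Nat.le_mul_of_pos_right _ (by omega)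
  have e6 : M * (s + 1) ≤ M * (s + 1) * (m + 1) := Nat.le_mul_of_pos_right _ (by omega)
  nlinarith

theorem derivP_val (f : L[X]) : (derivP o f).val = derivative f := by
  ext j
  rw [derivP, foldlM_val, foldl_range_coeff (fun p : L[X] => p.coeff) _
    (fun i t => ((i + 1 : ℕ) : L) * f.coeff (i + 1)) 0
    (fun r i => by simp [ho.mul, coeff_update])]
  rw [coeff_derivative]
  split_ifs with h
  · simp [mul_comm]
  · rw [coeff_eq_zero_of_natDegree_lt (p := f) (by omega)]; simp

theorem derivP_ops (f : L[X]) : (derivP o f).ops ≤ M * f.natDegree := by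
  refine (foldlM_ops_le _ M _ _ fun r i _ => ?_).trans (by rw [List.length_range, mul_comm])
  simpa using ho.mul_ops _ _

theorem divP_val_snd {f m : L[X]} (hm : m.Monic) : (divP o f m).val.2 = f %ₘ m := by
  obtain ⟨h1, h2, -⟩ := divP_spec ho f m hm.ne_zero
  refine ((div_modByMonic_unique (divP o f m).val.1 (divP o f m).val.2 hm ⟨?_, ?_⟩).2).symm
  · rw [add_comm, mul_comm]; exact h1.symm
  · rcases h2 with h | h
    · rw [h, degree_zero]; exact bot_lt_iff_ne_bot.2 (degree_ne_bot.2 hm.ne_zero)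
    · exact degree_lt_degree h

theorem mulModP_val {m : L[X]} (hm : m.Monic) (f g : L[X]) :
    (mulModP o m f g).val = (f * g) %ₘ m := by
  simp only [mulModP, Cost.val_bind, Cost.val_pure, mulP_val ho, divP_val_snd ho hm]

theorem mulModP_ops {m : L[X]} (hm : m.Monic) (f g : L[X]) (hf : f.natDegree < m.natDegree)
    (hg : g.natDegree < m.natDegree) :
    (mulModP o m f g).ops ≤ 17 * M * m.natDegree ^ 2 := by
  simp only [mulModP, Cost.ops_bind, Cost.ops_pure, mulP_val ho, add_zero]
  have h1 := mulP_ops ho f g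
  have h2 := (divP_spec ho (f * g) m hm.ne_zero).2.2
  have h3 : (f * g).natDegree ≤ f.natDegree + g.natDegree := natDegree_mul_le
  set n := m.natDegree
  have h4 : (f.natDegree + 1) * (g.natDegree + 1) ≤ n * n := by gcongr <;> omega
  have h5 : ((f * g).natDegree + 1 - n) * (n + 1) ≤ n * (n + 1) := by gcongr; omega
  have h6 : 1 ≤ n := by omega
  have h7 : n ≤ n * n := Nat.le_mul_of_pos_right _ (by omega)
  calc _ ≤ 2 * M * (n * n) + 5 * M * (n * (n + 1) + 1) := by
        refine Nat.add_le_add (h1.trans (by gcongr)) (h2.trans (by gcongr))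
    _ = M * (7 * (n * n) + 5 * n + 5) := by ring
    _ ≤ M * (17 * (n * n)) := by gcongr; omega
    _ = _ := by ring

theorem prodP_val (l : List L[X]) : (prodP o l).val = l.prod := by
  induction l with
  | nil => rfl
  | cons p l ih => simp [prodP, mulP_val ho, ih]

theorem prodP_ops (l : List L[X]) (h : ∀ p ∈ l, p ≠ 0) :
    (prodP o l).ops ≤ 2 * M * ((l.prod.natDegree + l.length) * (l.prod.natDegree + 1)) := by
  induction l with
  | nil => simp [prodP]
  | cons p l ih =>
    have ih' := ih fun q hq => h q (by simp [hq])
    have hl : l.prod ≠ 0 := List.prod_ne_zero fun h0 => h 0 (by simp [h0]) rfl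
    have h1 := mulP_ops ho p l.prod
    simp only [prodP, Cost.ops_bind, prodP_val ho, List.prod_cons, List.length_cons]
    rw [natDegree_mul (h p (by simp)) hl]
    set a := p.natDegree
    set b := l.prod.natDegree
    calc _ ≤ 2 * M * ((b + l.length) * (b + 1)) + 2 * M * ((a + 1) * (b + 1)) := by gcongr
      _ = 2 * M * ((a + b + (l.length + 1)) * (b + 1)) := by ring
      _ ≤ _ := by gcongr; omega

end CommPoly

end SkewFact

namespace SkewFact

open Polynomial

/-! ### Gaussian elimination -/

section Relations

variable {L : Type u} [Field L]

/-- The linear map that sends the coefficient vector `c` to the combination `∑ c_i v_i`. -/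
noncomputable def relMap {E : Type*} [AddCommGroup E] [Module L E] (v : ℕ → E) : L[X] →ₗ[L] E :=
  Polynomial.lsum fun i => LinearMap.toSpanSingleton L E (v i)

theorem relMap_monomial {E : Type*} [AddCommGroup E] [Module L E] (v : ℕ → E) (i : ℕ) (a : L) :
    relMap v (monomial i a) = a • v i := by
  simp [relMap, Polynomial.lsum_apply]

theorem relMap_X_pow {E : Type*} [AddCommGroup E] [Module L E] (v : ℕ → E) (i : ℕ) :
    relMap v (X ^ i : L[X]) = v i := by
  rw [X_pow_eq_monomial, relMap_monomial, one_smul]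

theorem relMap_eq_sum {E : Type*} [AddCommGroup E] [Module L E] (v : ℕ → E) (c : L[X]) {n : ℕ}
    (hn : c.natDegree < n) : relMap v c = ∑ i ∈ Finset.range n, c.coeff i • v i := by
  conv_lhs => rw [as_sum_range' c n hn]
  simp [relMap_monomial]

theorem relMap_congr {E : Type*} [AddCommGroup E] [Module L E] {v v' : ℕ → E} {c : L[X]} {n : ℕ}
    (hn : c.natDegree < n) (h : ∀ i < n, v i = v' i) : relMap v c = relMap v' c := by
  rw [relMap_eq_sum v c hn, relMap_eq_sum v' c hn]
  exact Finset.sum_congr rfl fun i hi => by rw [h i (Finset.mem_range.1 hi)]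

theorem map_relMap {E E' : Type*} [AddCommGroup E] [Module L E] [AddCommGroup E'] [Module L E']
    (T : E →ₗ[L] E') (v : ℕ → E) (c : L[X]) : T (relMap v c) = relMap (fun i => T (v i)) c := by
  rw [relMap_eq_sum v c (Nat.lt_succ_self _), relMap_eq_sum _ c (Nat.lt_succ_self _)]
  simp

/-- The span of the vectors of an echelon system. -/
noncomputable def echSpan (st : List (L[X] × L[X])) : Submodule L L[X] :=
  Submodule.span L {y | y ∈ st.map Prod.fst}

/-- The pivot position of a vector is a zero of all later vectors. -/
def IsEchelon (st : List (L[X] × L[X])) : Prop :=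
  (∀ b ∈ st, b.1.Monic) ∧ st.Pairwise fun b b' => b'.1.coeff b.1.natDegree = 0

theorem coeff_eq_zero_of_mem_echSpan {st : List (L[X] × L[X])} {j : ℕ}
    (h : ∀ b ∈ st, b.1.coeff j = 0) {x : L[X]} (hx : x ∈ echSpan st) : x.coeff j = 0 := by
  have : echSpan st ≤ LinearMap.ker (lcoeff L j) := Submodule.span_le.2 <| by
    rintro y hy
    obtain ⟨b, hb, rfl⟩ := List.mem_map.1 hy
    exact h b hb
  exact this hx

/-- A vector in the span of an echelon system that vanishes at all pivots is zero. -/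
theorem IsEchelon.eq_zero {st : List (L[X] × L[X])} (hst : IsEchelon st) {x : L[X]}
    (hx : x ∈ echSpan st) (h : ∀ b ∈ st, x.coeff b.1.natDegree = 0) : x = 0 := by
  induction st generalizing x with
  | nil => simpa [echSpan] using hx
  | cons b st ih =>
    obtain ⟨h1, h2⟩ := hst
    rw [List.pairwise_cons] at h2
    have hset : {y | y ∈ (b :: st).map Prod.fst} = insert b.1 {y | y ∈ st.map Prod.fst} := by
      ext y; simp
    rw [echSpan, hset] at hx
    obtain ⟨a, y, hy, rfl⟩ := Submodule.mem_span_insert.1 hx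
    have hb := h b (by simp)
    have ha : a = 0 := by
      have hy0 : y.coeff b.1.natDegree = 0 := coeff_eq_zero_of_mem_echSpan h2.1 hy
      simpa [hy0, (h1 b (by simp)).coeff_natDegree] using hb
    subst ha
    rw [zero_smul, zero_add]
    exact ih ⟨fun b hb => h1 b (by simp [hb]), h2.2⟩ hy fun b hb => by
      simpa using h b (by simp [hb])

/-- A list of monic vectors in which every degree of a nonzero element of `V` occurs spans `V`. -/
theorem mem_span_of_natDegree_mem (V : Submodule L L[X]) (l : List L[X]) (n : ℕ)
    (hl : ∀ c ∈ l, c ∈ V ∧ c.Monic)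
    (h : ∀ c ∈ V, c ≠ 0 → c.natDegree < n → ∃ c' ∈ l, c'.natDegree = c.natDegree) :
    ∀ c ∈ V, c.degree < n → c ∈ Submodule.span L {y | y ∈ l} := by
  induction n with
  | zero =>
    intro c _ hc
    have : c = 0 := by
      ext i
      simpa using (degree_lt_iff_coeff_zero c 0).1 (by exact_mod_cast hc) i (Nat.zero_le i)
    rw [this]; exact Submodule.zero_mem _
  | succ n ih =>
    intro c hcV hc
    have ih' := ih fun c hc hc0 hn => h c hc hc0 (by omega)
    by_cases hc0 : c = 0
    · rw [hc0]; exact Submodule.zero_mem _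
    have hcn := (natDegree_lt_iff_degree_lt hc0).2 hc
    rcases Nat.lt_succ_iff_lt_or_eq.1 hcn with hlt | heq
    · exact ih' c hcV ((natDegree_lt_iff_degree_lt hc0).1 hlt)
    obtain ⟨c', hc', hdeg⟩ := h c hcV hc0 hcn
    obtain ⟨hV', hmon⟩ := hl c' hc'
    have hlc := leadingCoeff_ne_zero.2 hc0
    have h1 : (c - c.leadingCoeff • c').degree < (n : WithBot ℕ) := by
      have := degree_sub_lt_left (p := c) (q := C c.leadingCoeff * c')
        (by rw [degree_C_mul hlc, degree_eq_natDegree hc0, degree_eq_natDegree hmon.ne_zero, hdeg])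
        hc0 (by rw [leadingCoeff_mul, leadingCoeff_C, hmon, mul_one])
      rw [smul_eq_C_mul]
      rwa [degree_eq_natDegree hc0, heq] at this
    have h2 := ih' _ (V.sub_mem hcV (V.smul_mem _ hV')) h1
    have h3 := Submodule.add_mem _ h2 (Submodule.smul_mem _ c.leadingCoeff
      (Submodule.subset_span hc' : c' ∈ Submodule.span L {y | y ∈ l}))
    simpa using h3

theorem length_le_of_pairwise_lt {α : Type*} (f : α → ℕ) (l : List α) (n : ℕ)
    (h : l.Pairwise fun a b => f a < f b) (hn : ∀ a ∈ l, f a < n) : l.length ≤ n := by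
  have h1 : (l.map f).Nodup := (List.pairwise_map.2 h).imp fun h => h.ne
  have h2 : (l.map f).toFinset ⊆ Finset.range n := fun i hi => by
    obtain ⟨a, ha, rfl⟩ := List.mem_map.1 (List.mem_toFinset.1 hi)
    exact Finset.mem_range.2 (hn a ha)
  have h3 := Finset.card_le_card h2
  rwa [List.toFinset_card_of_nodup h1, List.length_map, Finset.card_range] at h3

variable {o : Arith L} {M : ℕ} (ho : o.Exact M)
include ho

/-- Reduction by an echelon system: the coefficients of the relation are tracked, the vector changes
by an element of the span, and vanishes at all pivots afterwards. -/
theorem reduceVec_spec (v : ℕ → L[X]) (D n : ℕ) (st : List (L[X] × L[X])) (hst : IsEchelon st)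
    (hv : ∀ b ∈ st, b.1 = relMap v b.2 ∧ b.1.natDegree ≤ D ∧ b.2.degree < n)
    (x : L[X] × L[X]) (hx : x.1 = relMap v x.2) (hD : x.1.natDegree ≤ D) :
    let y := reduceVec o st x
    y.val.1 = relMap v y.val.2 ∧ y.val.1.natDegree ≤ D ∧ (y.val.2 - x.2).degree < n ∧
    y.val.1 - x.1 ∈ echSpan st ∧ (∀ b ∈ st, y.val.1.coeff b.1.natDegree = 0) ∧
    (∀ j, (∀ b ∈ st, b.1.coeff j = 0) → y.val.1.coeff j = x.1.coeff j) ∧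
    y.ops ≤ st.length * (M * (2 * D + 2 * n + 5)) := by
  induction st generalizing x with
  | nil =>
    simp only [reduceVec, List.foldlM_nil, Cost.val_pure, Cost.ops_pure]
    exact ⟨hx, hD, by simp, by simp, by simp, by simp, by simp⟩
  | cons b st ih =>
    obtain ⟨h1, h2⟩ := hst
    rw [List.pairwise_cons] at h2
    obtain ⟨b1, b2, b3⟩ := hv b (by simp)
    set a := x.1.coeff b.1.natDegree with ha
    have hx'1 : x.1 + C (-a) * X ^ 0 * b.1 = x.1 - a • b.1 := by
      rw [smul_eq_C_mul, C_neg]; ring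
    have hx'2 : x.2 + C (-a) * X ^ 0 * b.2 = x.2 - a • b.2 := by
      rw [smul_eq_C_mul, C_neg]; ring
    have ih' := ih ⟨fun b hb => h1 b (by simp [hb]), h2.2⟩ (fun b hb => hv b (by simp [hb]))
      (x.1 - a • b.1, x.2 - a • b.2)
      (by simp only [map_sub, map_smul, ← hx, ← b1])
      ((natDegree_sub_le _ _).trans (max_le hD ((natDegree_smul_le _ _).trans b2)))
    have hy : (reduceVec o (b :: st) x).val =
        (reduceVec o st (x.1 - a • b.1, x.2 - a • b.2)).val := by
      rw [reduceVec, List.foldlM_cons]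
      simp only [Cost.val_bind, Cost.val_pure, ho.neg, addMonoP_val ho, hx'1, hx'2, ← ha]
      rfl
    have hops : (reduceVec o (b :: st) x).ops ≤ M * (2 * D + 2 * n + 5) +
        (reduceVec o st (x.1 - a • b.1, x.2 - a • b.2)).ops := by
      rw [reduceVec, List.foldlM_cons]
      simp only [Cost.ops_bind, Cost.val_bind, Cost.ops_pure, Cost.val_pure, ho.neg,
        addMonoP_val ho, hx'1, hx'2, ← ha]
      have e1 := ho.neg_ops a
      have e2 := addMonoP_ops ho (-a) 0 b.1 x.1
      have e3 := addMonoP_ops ho (-a) 0 b.2 x.2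
      have e4 : 2 * M * (b.1.natDegree + 1) ≤ 2 * M * (D + 1) := by gcongr
      have e5 : 2 * M * (b.2.natDegree + 1) ≤ 2 * M * (n + 1) := by
        gcongr
        exact natDegree_le_of_degree_le b3.le
      have e6 : M * (2 * D + 2 * n + 5) = M + 2 * M * (D + 1) + 2 * M * (n + 1) := by ring
      change _ ≤ _ + (reduceVec o st _).ops
      rw [e6]
      have e7 := Nat.add_le_add (Nat.add_le_add e1 (e2.trans e4)) (e3.trans e5)
      rw [add_zero, ← add_assoc]
      exact Nat.add_le_add e7 le_rfl
    obtain ⟨i1, i2, i3, i4, i5, i6, i7⟩ := ih'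
    intro y
    rw [show y.val = _ from hy]
    generalize (reduceVec o st (x.1 - a • b.1, x.2 - a • b.2)) = z at *
    have hle : echSpan st ≤ echSpan (b :: st) := Submodule.span_mono fun y hy => by
      simp only [Set.mem_ofPred_eq, List.map_cons, List.mem_cons] at hy ⊢; exact Or.inr hy
    have hb : b.1 ∈ echSpan (b :: st) := Submodule.subset_span (by simp)
    refine ⟨i1, i2, ?_, ?_, ?_, ?_, ?_⟩
    · have : z.val.2 - x.2 = (z.val.2 - (x.2 - a • b.2)) - a • b.2 := by ring
      rw [this]
      exact (degree_sub_le _ _).trans_lt (max_lt i3 ((degree_smul_le _ _).trans_lt b3))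
    · have : z.val.1 - x.1 = (z.val.1 - (x.1 - a • b.1)) - a • b.1 := by ring
      rw [this]
      exact Submodule.sub_mem _ (hle i4) (Submodule.smul_mem _ _ hb)
    · intro b' hb'
      rcases List.mem_cons.1 hb' with rfl | hb'
      · rw [i6 _ h2.1]
        simp [(h1 b' (by simp)).coeff_natDegree, ha]
      · exact i5 b' hb'
    · intro j hj
      rw [i6 j fun b hb => hj b (by simp [hb])]
      simp [hj b (by simp)]
    · refine hops.trans ?_
      rw [List.length_cons, add_mul, one_mul]
      omega

/-- Gaussian elimination finds monic relations whose degrees are exactly the degrees of all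
nonzero relations. -/
theorem relations_spec (vs : List L[X]) (D : ℕ) (hD : ∀ y ∈ vs, y.natDegree ≤ D) :
    let v : ℕ → L[X] := fun i => vs.getD i 0
    let rels := relations o vs
    (∀ c ∈ rels.val, relMap v c = 0 ∧ c.Monic ∧ c.natDegree < vs.length) ∧
    rels.val.Pairwise (fun c c' => c.natDegree < c'.natDegree) ∧
    (∀ c : L[X], c ≠ 0 → c.natDegree < vs.length → relMap v c = 0 →
      ∃ c' ∈ rels.val, c'.natDegree = c.natDegree) ∧
    rels.ops ≤ M * (vs.length * ((vs.length + 1) * (2 * D + 2 * vs.length + 5))) := by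
  classical
  intro v rels
  set n := vs.length with hn
  have hvD : ∀ i, (v i).natDegree ≤ D := by
    intro i
    by_cases hi : i < vs.length
    · have : v i = vs[i] := by simp [v, hi]
      rw [this]; exact hD _ (List.getElem_mem _)
    · have : v i = 0 := by
        simp only [v]; exact List.getD_eq_default _ _ (by omega)
      rw [this, natDegree_zero]; exact Nat.zero_le _
  have hzip : vs.zipIdx = (List.range n).map fun i => (v i, i) := by
    apply List.ext_getElem (by simp [hn])
    intro i h1 h2
    simp only [List.length_zipIdx] at h1
    simp [v, h1]
  have key := foldlM_range_spec
    (fun (s : List (L[X] × L[X]) × List L[X]) i => do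
      let x ← reduceVec o s.1 (v i, X ^ i)
      if x.1 = 0 then pure (s.1, s.2 ++ [x.2])
      else do
        let a ← o.inv x.1.leadingCoeff
        let y ← scaleP o a x.1
        let c ← scaleP o a x.2
        pure (s.1 ++ [(y, c)], s.2))
    (fun j s => IsEchelon s.1 ∧
      (∀ b ∈ s.1, b.1 = relMap v b.2 ∧ b.1.natDegree ≤ D ∧ b.2.degree < j) ∧
      (∀ i < j, v i ∈ echSpan s.1) ∧ s.1.length ≤ j ∧
      (∀ c ∈ s.2, relMap v c = 0 ∧ c.Monic ∧ c.natDegree < j) ∧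
      s.2.Pairwise (fun c c' => c.natDegree < c'.natDegree) ∧
      (∀ c : L[X], c ≠ 0 → c.natDegree < j → relMap v c = 0 →
        ∃ c' ∈ s.2, c'.natDegree = c.natDegree))
    (fun _ => M * ((n + 1) * (2 * D + 2 * n + 5))) ([], []) n
    ⟨⟨by simp, by simp⟩, by simp, by simp, by simp, by simp, by simp, by simp⟩
    (by
      rintro j ⟨st, out⟩ hj ⟨i1, i2, i3, i4, i5, i6, i7⟩
      obtain ⟨r1, r2, r3, r4, r5, -, r7⟩ := reduceVec_spec ho v D j st i1 i2 (v j, X ^ j)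
        (relMap_X_pow v j).symm (hvD j)
      simp only [Cost.val_bind, Cost.ops_bind]
      generalize reduceVec o st (v j, X ^ j) = x at *
      simp only at r1 r2 r3 r4 r5 r7 i4 i5 i6 i7
      have hsplit : x.val.2 = X ^ j + (x.val.2 - X ^ j) := by ring
      have hmon : x.val.2.Monic := by
        rw [hsplit]; exact monic_X_pow_add r3
      have hdeg : x.val.2.natDegree = j := by
        rw [hsplit, add_comm, natDegree_add_eq_right_of_degree_lt (by rwa [degree_X_pow]),
          natDegree_X_pow]
      have hx7 : x.ops ≤ M * (n * (2 * D + 2 * n + 5)) := by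
        refine r7.trans ?_
        calc _ = M * (st.length * (2 * D + 2 * j + 5)) := by ring
          _ ≤ _ := by gcongr; omega
      have hlow : ∀ c : L[X], c.degree < j → relMap v c ∈ echSpan st := by
        intro c hc
        by_cases hc0 : c = 0
        · rw [hc0, map_zero]; exact Submodule.zero_mem _
        rw [relMap_eq_sum v c ((natDegree_lt_iff_degree_lt hc0).2 hc)]
        exact Submodule.sum_mem _ fun i hi => Submodule.smul_mem _ _ (i3 i (Finset.mem_range.1 hi))
      by_cases hx0 : x.val.1 = 0
      · simp only [hx0, if_true, Cost.val_pure, Cost.ops_pure]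
        rw [hx0] at r1 r4
        refine ⟨⟨i1, fun b hb => ⟨(i2 b hb).1, (i2 b hb).2.1, (i2 b hb).2.2.trans
          (by exact_mod_cast Nat.lt_succ_self j)⟩, ?_, by omega, ?_, ?_, ?_⟩, ?_⟩
        · intro i hi
          rcases Nat.lt_succ_iff_lt_or_eq.1 hi with h | rfl
          · exact i3 i h
          · simpa using Submodule.neg_mem _ r4
        · intro c hc
          rcases List.mem_append.1 hc with h | h
          · exact ⟨(i5 c h).1, (i5 c h).2.1, (i5 c h).2.2.trans (Nat.lt_succ_self j)⟩
          · rw [List.mem_singleton.1 h]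
            exact ⟨r1.symm, hmon, by omega⟩
        · rw [List.pairwise_append]
          refine ⟨i6, by simp, fun c hc c' hc' => ?_⟩
          rw [List.mem_singleton.1 hc', hdeg]
          exact (i5 c hc).2.2
        · intro c hc0 hc hrel
          rcases Nat.lt_succ_iff_lt_or_eq.1 hc with h | h
          · obtain ⟨c', h1, h2⟩ := i7 c hc0 h hrel
            exact ⟨c', by simp [h1], h2⟩
          · exact ⟨x.val.2, by simp, by rw [hdeg, h]⟩
        · refine le_trans hx7 ?_
          gcongr
          omega
      · simp only [hx0, if_false, Cost.val_bind, Cost.ops_bind, Cost.val_pure, Cost.ops_pure,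
          scaleP_val ho, ho.inv]
        set a := x.val.1.leadingCoeff⁻¹ with ha
        have hlc := leadingCoeff_ne_zero.2 hx0
        have ha0 : a ≠ 0 := inv_ne_zero hlc
        have hmono : (C a * x.val.1).Monic := by
          rw [mul_comm]; exact monic_mul_leadingCoeff_inv hx0
        have hle : echSpan st ≤ echSpan (st ++ [(C a * x.val.1, C a * x.val.2)]) :=
          Submodule.span_mono fun y hy => by
            simp only [Set.mem_ofPred_eq, List.map_append, List.mem_append] at hy ⊢
            exact Or.inl hy
        have hnew : x.val.1 ∈ echSpan (st ++ [(C a * x.val.1, C a * x.val.2)]) := by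
          have h1 : C a * x.val.1 ∈ echSpan (st ++ [(C a * x.val.1, C a * x.val.2)]) :=
            Submodule.subset_span (by simp)
          have h2 := Submodule.smul_mem _ a⁻¹ h1
          have h3 : a⁻¹ • (C a * x.val.1) = x.val.1 := by
            rw [← smul_eq_C_mul, inv_smul_smul₀ ha0]
          rwa [h3] at h2
        refine ⟨⟨⟨?_, ?_⟩, ?_, ?_, by simpa using i4, ?_, i6, ?_⟩, ?_⟩
        · intro b hb
          rcases List.mem_append.1 hb with h | h
          · exact i1.1 b h
          · rw [List.mem_singleton.1 h]; exact hmono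
        · rw [List.pairwise_append]
          refine ⟨i1.2, by simp, fun b hb b' hb' => ?_⟩
          rw [List.mem_singleton.1 hb', coeff_C_mul, r5 b hb, mul_zero]
        · intro b hb
          rcases List.mem_append.1 hb with h | h
          · exact ⟨(i2 b h).1, (i2 b h).2.1, (i2 b h).2.2.trans
              (by exact_mod_cast Nat.lt_succ_self j)⟩
          · rw [List.mem_singleton.1 h]
            refine ⟨?_, (natDegree_C_mul_le _ _).trans r2, ?_⟩
            · simp only
              rw [← smul_eq_C_mul, ← smul_eq_C_mul, map_smul, ← r1]
            · rw [degree_C_mul ha0, degree_eq_natDegree hmon.ne_zero, hdeg]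
              exact_mod_cast Nat.lt_succ_self j
        · intro i hi
          rcases Nat.lt_succ_iff_lt_or_eq.1 hi with h | rfl
          · exact hle (i3 i h)
          · have := Submodule.sub_mem _ hnew (hle r4)
            simpa using this
        · intro c hc
          exact ⟨(i5 c hc).1, (i5 c hc).2.1, (i5 c hc).2.2.trans (Nat.lt_succ_self j)⟩
        · intro c hc0 hc hrel
          rcases Nat.lt_succ_iff_lt_or_eq.1 hc with h | h
          · exact i7 c hc0 h hrel
          · exfalso
            -- such a relation would put `v j` into the span of the earlier vectors
            have hclc := leadingCoeff_ne_zero.2 hc0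
            have h1 : (c - C c.leadingCoeff * X ^ j).degree < (j : WithBot ℕ) := by
              have := degree_sub_lt_left (p := c) (q := C c.leadingCoeff * X ^ j)
                (by rw [degree_C_mul_X_pow _ hclc, degree_eq_natDegree hc0, h]) hc0
                (by rw [leadingCoeff_mul_X_pow, leadingCoeff_C])
              rwa [degree_eq_natDegree hc0, h] at this
            have h2 := hlow _ h1
            rw [map_sub, hrel, zero_sub, C_mul_X_pow_eq_monomial, relMap_monomial] at h2
            have h3 : v j ∈ echSpan st := by
              have := Submodule.smul_mem _ (-c.leadingCoeff⁻¹) h2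
              rwa [neg_smul, smul_neg, neg_neg, inv_smul_smul₀ hclc] at this
            have h4 : x.val.1 ∈ echSpan st := by
              simpa using Submodule.add_mem _ r4 h3
            exact hx0 (i1.eq_zero h4 r5)
        · have e1 := ho.inv_ops x.val.1.leadingCoeff
          have e2 := scaleP_ops ho a x.val.1
          have e3 := scaleP_ops ho a x.val.2
          have e4 : M * (x.val.1.natDegree + 1) ≤ M * (D + 1) := by gcongr
          have e5 : M * (x.val.2.natDegree + 1) ≤ M * (n + 1) := by gcongr; omega
          calc _ ≤ M * (n * (2 * D + 2 * n + 5)) + (M + (M * (D + 1) + M * (n + 1))) := by omega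
            _ = M * (n * (2 * D + 2 * n + 5) + (D + n + 3)) := by ring
            _ ≤ _ := by gcongr; nlinarith)
  obtain ⟨⟨-, -, -, -, k5, k6, k7⟩, k8⟩ := key
  generalize hT : (List.foldlM _ _ (List.range n) : Cost (List (L[X] × L[X]) × List L[X])) = T
    at k5 k6 k7 k8
  have hrels : rels.val = T.val.2 ∧ rels.ops = T.ops := by
    simp only [rels, relations, hzip, List.foldlM_map, Cost.val_bind, Cost.ops_bind,
      Cost.val_pure, Cost.ops_pure, add_zero]
    rw [← hT]
    constructor <;> congr!
  rw [hrels.1, hrels.2]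
  refine ⟨k5, k6, k7, k8.trans ?_⟩
  rw [Finset.sum_const, Finset.card_range, smul_eq_mul]
  apply le_of_eq; ring

end Relations

end SkewFact

namespace SkewFact

open Polynomial

/-! ### Berlekamp's algorithm -/

section Berlekamp

variable {K L : Type u} [Field K] [Field L] [Algebra K L]

/-- The data `D` compute the operations of the field `L` at a cost of at most `M` each, and the
coordinates are the coordinates in a `K`-basis of `L`. -/
structure FieldData.Faithful (D : FieldData K L) (M : ℕ) : Prop where
  exact : D.toArith.Exact M
  dim_pos : 0 < D.dim
  coord_add : ∀ a b i, D.coord (a + b) i = D.coord a i + D.coord b i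
  coord_smul : ∀ (c : K) a i, D.coord (c • a) i = c * D.coord a i
  coord_ofCoord : ∀ c i, i < D.dim → D.coord (D.ofCoord c) i = c i
  ext : ∀ a b, (∀ i < D.dim, D.coord a i = D.coord b i) → a = b

section Coordinates

variable {D : FieldData K L} {M : ℕ} (hD : D.Faithful M)
include hD

omit hD in
theorem coeff_vecOf (m : ℕ) (y : L[X]) {j i : ℕ} (hj : j < m) (hi : i < D.dim) :
    (vecOf D m y).coeff (j * D.dim + i) = D.coord (y.coeff j) i := by
  have key : ∀ j' i', i' < D.dim → (j' * D.dim + i' = j * D.dim + i ↔ j' = j ∧ i' = i) := by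
    intro j' i' hi'
    constructor
    · intro h
      have h1 : j' = j := by
        have := congrArg (· / D.dim) h
        simpa [Nat.mul_add_div (by omega : 0 < D.dim), mul_comm _ D.dim, Nat.div_eq_of_lt hi,
          Nat.div_eq_of_lt hi'] using this
      subst h1
      exact ⟨rfl, by omega⟩
    · rintro ⟨rfl, rfl⟩; rfl
  simp only [vecOf, finsetSum_coeff, coeff_monomial]
  rw [Finset.sum_eq_single_of_mem j (Finset.mem_range.2 hj),
    Finset.sum_eq_single_of_mem i (Finset.mem_range.2 hi), if_pos rfl]
  · intro i' hi' hne
    rw [if_neg]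
    rw [key _ _ (Finset.mem_range.1 hi')]
    exact fun h => hne h.2
  · intro j' _ hne
    refine Finset.sum_eq_zero fun i' hi' => ?_
    rw [if_neg]
    rw [key _ _ (Finset.mem_range.1 hi')]
    exact fun h => hne h.1

omit hD in
theorem degree_vecOf_lt (m : ℕ) (y : L[X]) : (vecOf D m y).degree < (m * D.dim : ℕ) := by
  refine (degree_sum_le _ _).trans_lt ((Finset.sup_lt_iff (WithBot.bot_lt_coe _)).2 fun j hj => ?_)
  refine (degree_sum_le _ _).trans_lt ((Finset.sup_lt_iff (WithBot.bot_lt_coe _)).2 fun i hi => ?_)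
  refine (degree_monomial_le _ _).trans_lt ?_
  have hj := Finset.mem_range.1 hj
  have hi := Finset.mem_range.1 hi
  have : j * D.dim + i < m * D.dim := by
    calc j * D.dim + i < (j + 1) * D.dim := by rw [add_mul]; omega
      _ ≤ _ := Nat.mul_le_mul_right _ hj
  exact_mod_cast this

/-- `vecOf` as a linear map. -/
noncomputable def vecOfHom (hD : D.Faithful M) (m : ℕ) : L[X] →ₗ[K] K[X] where
  toFun := vecOf D m
  map_add' x y := by simp [vecOf, hD.coord_add, Finset.sum_add_distrib]
  map_smul' c x := by simp [vecOf, hD.coord_smul, Finset.smul_sum, smul_monomial]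

theorem vecOf_inj {m : ℕ} {y y' : L[X]} (hy : y.degree < m) (hy' : y'.degree < m)
    (h : vecOf D m y = vecOf D m y') : y = y' := by
  ext j
  by_cases hj : j < m
  · refine hD.ext _ _ fun i hi => ?_
    rw [← coeff_vecOf m y hj hi, h, coeff_vecOf m y' hj hi]
  · rw [(degree_lt_iff_coeff_zero _ _).1 hy j (by omega),
      (degree_lt_iff_coeff_zero _ _).1 hy' j (by omega)]

omit hD in
theorem degree_ofVec_lt (m : ℕ) (c : K[X]) : (ofVec D m c).degree < (m : ℕ) := by
  refine (degree_sum_le _ _).trans_lt ((Finset.sup_lt_iff (WithBot.bot_lt_coe _)).2 fun j hj => ?_)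
  exact (degree_monomial_le _ _).trans_lt (by exact_mod_cast Finset.mem_range.1 hj)

omit hD in
theorem coeff_ofVec (m : ℕ) (c : K[X]) {j : ℕ} (hj : j < m) :
    (ofVec D m c).coeff j = D.ofCoord fun i => c.coeff (j * D.dim + i) := by
  simp only [ofVec, finsetSum_coeff, coeff_monomial]
  rw [Finset.sum_eq_single_of_mem j (Finset.mem_range.2 hj), if_pos rfl]
  exact fun j' _ hne => if_neg hne

theorem vecOf_ofVec {m : ℕ} {c : K[X]} (hc : c.degree < (m * D.dim : ℕ)) :
    vecOf D m (ofVec D m c) = c := by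
  ext s
  by_cases hs : s < m * D.dim
  · have hi : s % D.dim < D.dim := Nat.mod_lt _ hD.dim_pos
    have hj : s / D.dim < m := by rwa [Nat.div_lt_iff_lt_mul hD.dim_pos]
    have e : s / D.dim * D.dim + s % D.dim = s := Nat.div_add_mod' _ _
    rw [← e, coeff_vecOf m _ hj hi, coeff_ofVec m c hj, hD.coord_ofCoord _ _ hi]
  · rw [(degree_lt_iff_coeff_zero _ _).1 (degree_vecOf_lt m _) s (by omega),
      (degree_lt_iff_coeff_zero _ _).1 hc s (by omega)]

theorem ofVec_vecOf {m : ℕ} {y : L[X]} (hy : y.degree < m) : ofVec D m (vecOf D m y) = y :=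
  vecOf_inj hD (degree_ofVec_lt m _) hy (vecOf_ofVec hD (degree_vecOf_lt m y))

/-- `ofVec` as a linear map. -/
noncomputable def ofVecHom (hD : D.Faithful M) (m : ℕ) : K[X] →ₗ[K] L[X] where
  toFun := ofVec D m
  map_add' x y := by
    refine vecOf_inj (m := m) hD (degree_ofVec_lt m _) ((degree_add_le _ _).trans_lt
      (max_lt (degree_ofVec_lt m _) (degree_ofVec_lt m _))) ?_
    change _ = vecOfHom hD m (ofVec D m x + ofVec D m y)
    rw [map_add]
    change _ = vecOf D m (ofVec D m x) + vecOf D m (ofVec D m y)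
    ext s
    by_cases hs : s < m * D.dim
    · have hi : s % D.dim < D.dim := Nat.mod_lt _ hD.dim_pos
      have hj : s / D.dim < m := by rwa [Nat.div_lt_iff_lt_mul hD.dim_pos]
      have e : s / D.dim * D.dim + s % D.dim = s := Nat.div_add_mod' _ _
      rw [← e, coeff_add]
      simp only [coeff_vecOf m _ hj hi, coeff_ofVec m _ hj, hD.coord_ofCoord _ _ hi, coeff_add]
    · simp only [coeff_add, (degree_lt_iff_coeff_zero _ _).1 (degree_vecOf_lt m _) s
        (not_lt.1 hs), add_zero]
  map_smul' k x := by
    refine vecOf_inj (m := m) hD (degree_ofVec_lt m _) ((degree_smul_le _ _).trans_lt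
      (degree_ofVec_lt m _)) ?_
    change _ = vecOfHom hD m (k • ofVec D m x)
    rw [map_smul]
    change _ = k • vecOf D m (ofVec D m x)
    ext s
    by_cases hs : s < m * D.dim
    · have hi : s % D.dim < D.dim := Nat.mod_lt _ hD.dim_pos
      have hj : s / D.dim < m := by rwa [Nat.div_lt_iff_lt_mul hD.dim_pos]
      have e : s / D.dim * D.dim + s % D.dim = s := Nat.div_add_mod' _ _
      rw [← e, coeff_smul]
      simp only [coeff_vecOf m _ hj hi, coeff_ofVec m _ hj, hD.coord_ofCoord _ _ hi, coeff_smul]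
    · simp only [coeff_smul, (degree_lt_iff_coeff_zero _ _).1 (degree_vecOf_lt m _) s
        (not_lt.1 hs), smul_zero]

theorem natCard_eq_pow : Nat.card L = Nat.card K ^ D.dim := by
  let e : L ≃ (Fin D.dim → K) :=
    { toFun := fun a i => D.coord a i
      invFun := fun c => D.ofCoord fun i => if h : i < D.dim then c ⟨i, h⟩ else 0
      left_inv := fun a => hD.ext _ _ fun i hi => by
        rw [hD.coord_ofCoord _ _ hi]; simp [hi]
      right_inv := fun c => by
        ext i
        simp [hD.coord_ofCoord] }
  rw [Nat.card_congr e]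
  simp [Nat.card_fun]

end Coordinates

variable [Finite K]

/-- The map `y ↦ y ^ #K - y` of `L[x] / (g)`, on representatives. -/
noncomputable def frobSub (K : Type u) {L : Type u} [Field K] [Finite K] [Field L] [Algebra K L]
    (g : L[X]) : L[X] →ₗ[K] L[X] :=
  letI := Fintype.ofFinite K
  ((modByMonicHom g).restrictScalars K) ∘ₗ (FiniteField.frobeniusAlgHom K L[X]).toLinearMap -
    LinearMap.id

theorem frobSub_apply (g y : L[X]) : frobSub K g y = (y ^ Nat.card K) %ₘ g - y := by
  letI := Fintype.ofFinite K
  rw [Nat.card_eq_fintype_card]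
  rfl

theorem frobSub_eq_zero_iff {g y : L[X]} (hg : g.Monic) (hy : y.degree < g.degree) :
    frobSub K g y = 0 ↔ g ∣ y ^ Nat.card K - y := by
  rw [frobSub_apply, ← modByMonic_eq_zero_iff_dvd hg, sub_modByMonic,
    (modByMonic_eq_self_iff hg).2 hy]

variable {kA : Arith K} (hkA : kA.Exact 1) {D : FieldData K L} {M : ℕ} (hD : D.Faithful M)

include hD in
theorem powC_mulModP {g : L[X]} (hg : g.Monic) (hm : 0 < g.natDegree) {y : L[X]}
    (hy : y.natDegree < g.natDegree) (n : ℕ) :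
    (powC (mulModP D.toArith g) 1 y n).val = (y ^ n) %ₘ g ∧
    (powC (mulModP D.toArith g) 1 y n).ops ≤ 2 * n.size * (17 * M * g.natDegree ^ 2) := by
  have hg1 : g ≠ 1 := fun h => by simp [h] at hm
  obtain ⟨⟨h1, h2⟩, h3⟩ := powC_spec (mulModP D.toArith g) 1 y
    (fun n x => x.natDegree < g.natDegree ∧ x %ₘ g = (y ^ n) %ₘ g) (17 * M * g.natDegree ^ 2)
    ⟨by simpa using hm, by simp⟩
    (fun n x ⟨a, b⟩ => by
      rw [mulModP_val hD.exact hg]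
      refine ⟨natDegree_modByMonic_lt _ hg hg1, ?_⟩
      rw [(modByMonic_eq_self_iff hg).2 (degree_modByMonic_lt _ hg), mul_modByMonic, b,
        ← mul_modByMonic, pow_add])
    (fun n x ⟨a, b⟩ => by
      rw [mulModP_val hD.exact hg]
      refine ⟨natDegree_modByMonic_lt _ hg hg1, ?_⟩
      rw [(modByMonic_eq_self_iff hg).2 (degree_modByMonic_lt _ hg), mul_modByMonic, b,
        ← mul_modByMonic, pow_succ])
    (fun n x ⟨a, b⟩ => ⟨mulModP_ops hD.exact hg _ _ a a, mulModP_ops hD.exact hg _ _ a hy⟩) n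
  refine ⟨?_, h3⟩
  rw [← h2, (modByMonic_eq_self_iff hg).2 (degree_lt_degree h1)]

include hkA hD in
/-- The kernel of `y ↦ y ^ #K - y` is spanned by the elements that Gaussian elimination returns. -/
theorem berlekampBasis_spec {g : L[X]} (hg : g.Monic) (hm : 0 < g.natDegree) :
    (∀ b ∈ (berlekampBasis kA D g).val, g ∣ b ^ Nat.card K - b ∧ b.natDegree < g.natDegree) ∧
    (∀ y : L[X], y.natDegree < g.natDegree → g ∣ y ^ Nat.card K - y →
      y ∈ Submodule.span K {b | b ∈ (berlekampBasis kA D g).val}) ∧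
    (berlekampBasis kA D g).val.length ≤ g.natDegree * D.dim ∧
    (berlekampBasis kA D g).ops ≤ g.natDegree * D.dim *
      ((34 * (Nat.card K).size + 3) * M * g.natDegree ^ 2) +
      18 * (g.natDegree * D.dim) ^ 3 := by
  set m := g.natDegree with hmdef
  set q := Nat.card K
  have hdegm : g.degree = (m : WithBot ℕ) := degree_eq_natDegree hg.ne_zero
  have hβ : ∀ s, (ofVec D m (X ^ s)).natDegree < m := fun s => by
    by_cases h0 : ofVec D m (X ^ s) = 0
    · rw [h0, natDegree_zero]; exact hm
    · exact (natDegree_lt_iff_degree_lt h0).2 (degree_ofVec_lt m _)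
  set body : L[X] → Cost K[X] := fun β => do
      let y ← powC (mulModP D.toArith g) 1 β (Nat.card K)
      let β' ← negP D.toArith β
      let z ← addP D.toArith y β'
      pure (vecOf D m z) with hbody
  have hval : ∀ s, (body (ofVec D m (X ^ s))).val =
      vecOf D m (frobSub K g (ofVec D m (X ^ s))) := fun s => by
    simp only [hbody, Cost.val_bind, Cost.val_pure, (powC_mulModP hD hg hm (hβ s) q).1,
      negP_val hD.exact, addP_val hD.exact, frobSub_apply, sub_eq_add_neg, q]
  have hops : ∀ s, (body (ofVec D m (X ^ s))).ops ≤ (34 * q.size + 3) * M * m ^ 2 := fun s => by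
    simp only [hbody, Cost.ops_bind, Cost.ops_pure, negP_val hD.exact]
    have e1 := (powC_mulModP hD hg hm (hβ s) q).2
    have e2 := negP_ops hD.exact (ofVec D m (X ^ s))
    have e3 := addP_ops hD.exact (powC (mulModP D.toArith g) 1 (ofVec D m (X ^ s)) (Nat.card K)).val
      (-ofVec D m (X ^ s))
    rw [natDegree_neg] at e3
    have e4 : M * ((ofVec D m (X ^ s)).natDegree + 1) ≤ M * m ^ 2 := by
      gcongr
      have := hβ s
      nlinarith
    calc _ ≤ 2 * q.size * (17 * M * m ^ 2) + (M * m ^ 2 + (M * m ^ 2 + 0)) :=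
          Nat.add_le_add e1 (Nat.add_le_add (e2.trans e4) (Nat.add_le_add (e3.trans e4) le_rfl))
      _ ≤ _ := by nlinarith [Nat.zero_le (M * m ^ 2)]
  set N := m * D.dim with hN
  set vs := (List.range N).map fun s => vecOf D m (frobSub K g (ofVec D m (X ^ s))) with hvs
  have hvsl : vs.length = N := by simp [hvs]
  have hvsD : ∀ y ∈ vs, y.natDegree ≤ N := by
    intro y hy
    obtain ⟨s, -, rfl⟩ := List.mem_map.1 hy
    exact natDegree_le_of_degree_le (degree_vecOf_lt m _).le
  obtain ⟨r1, r2, r3, r4⟩ := relations_spec hkA vs N hvsD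
  rw [hvsl] at r1 r3 r4
  have hN0 : 0 < N := Nat.mul_pos hm hD.dim_pos
  have hrel : ∀ c : K[X], c.degree < (N : WithBot ℕ) → relMap (fun i => vs.getD i 0) c =
      vecOf D m (frobSub K g (ofVec D m c)) := by
    intro c hc
    have hcN : c.natDegree < N := by
      by_cases h0 : c = 0
      · rw [h0, natDegree_zero]; exact hN0
      · exact (natDegree_lt_iff_degree_lt h0).2 hc
    rw [relMap_congr (v' := fun i => (vecOfHom hD m ∘ₗ frobSub K g ∘ₗ ofVecHom hD m)
      (X ^ i : K[X])) hcN fun i hi => by simp [hvs, hi]; rfl]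
    rw [← map_relMap, show relMap (fun i => (X ^ i : K[X])) c = c by
      rw [relMap_eq_sum _ _ (Nat.lt_succ_self _)]
      conv_rhs => rw [as_sum_range_C_mul_X_pow c]
      simp [smul_eq_C_mul]]
    rfl
  have hmem : ∀ c : K[X], c.degree < (N : WithBot ℕ) →
      (relMap (fun i => vs.getD i 0) c = 0 ↔
        g ∣ ofVec D m c ^ Nat.card K - ofVec D m c) := by
    intro c hc
    have hlt : (ofVec D m c).degree < g.degree := by rw [hdegm]; exact degree_ofVec_lt m c
    rw [hrel c hc, ← frobSub_eq_zero_iff hg hlt]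
    constructor
    · intro h
      refine vecOf_inj (m := m) hD ?_ ?_ (h.trans (map_zero (vecOfHom hD m)).symm)
      · rw [frobSub_apply, ← hdegm]
        exact (degree_sub_le _ _).trans_lt (max_lt (degree_modByMonic_lt _ hg) hlt)
      · rw [degree_zero]; exact WithBot.bot_lt_coe m
    · intro h
      rw [h]; exact map_zero (vecOfHom hD m)
  have hB : (berlekampBasis kA D g).val = (relations kA vs).val.map (ofVec D m) ∧
      (berlekampBasis kA D g).ops ≤ N * ((34 * q.size + 3) * M * m ^ 2) +
        (relations kA vs).ops := by
    have e : (mapC body ((List.range N).map fun s => ofVec D m (X ^ s))).val = vs := by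
      rw [mapC_val, List.map_map]
      exact List.map_congr_left fun s _ => hval s
    have e' := mapC_ops_le body ((List.range N).map fun s => ofVec D m (X ^ s)) _
      (fun a ha => by obtain ⟨s, -, rfl⟩ := List.mem_map.1 ha; exact hops s)
    rw [List.length_map, List.length_range] at e'
    constructor
    · change (relations kA (mapC body _).val).val.map _ = _
      rw [e]
    · change (mapC body _).ops + ((relations kA (mapC body _).val).ops + 0) ≤ _
      rw [e]
      exact Nat.add_le_add e' le_rfl
  have hcdeg : ∀ c ∈ (relations kA vs).val, c.degree < (N : WithBot ℕ) := fun c hc =>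
    (natDegree_lt_iff_degree_lt (r1 c hc).2.1.ne_zero).1 (r1 c hc).2.2
  refine ⟨?_, ?_, ?_, ?_⟩
  · intro b hb
    rw [hB.1] at hb
    obtain ⟨c, hc, rfl⟩ := List.mem_map.1 hb
    refine ⟨(hmem c (hcdeg c hc)).1 (r1 c hc).1, ?_⟩
    by_cases h0 : ofVec D m c = 0
    · rw [h0, natDegree_zero]; exact hm
    · exact (natDegree_lt_iff_degree_lt h0).2 (degree_ofVec_lt m _)
  · intro y hy hdvd
    have hylt : y.degree < (m : WithBot ℕ) := by rw [← hdegm]; exact degree_lt_degree hy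
    have h1 := mem_span_of_natDegree_mem
      (LinearMap.ker (relMap fun i => vs.getD i 0)) (relations kA vs).val N
      (fun c hc => ⟨(r1 c hc).1, (r1 c hc).2.1⟩) (fun c hc h0 hn => r3 c h0 hn hc)
      (vecOf D m y)
      ((hmem _ (degree_vecOf_lt m y)).2 (by rwa [ofVec_vecOf hD hylt]))
      (degree_vecOf_lt m y)
    have h2 := Submodule.mem_map_of_mem (f := ofVecHom hD m) h1
    rw [Submodule.map_span] at h2
    change ofVec D m (vecOf D m y) ∈ _ at h2
    rw [ofVec_vecOf hD hylt] at h2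
    refine Submodule.span_mono ?_ h2
    rintro _ ⟨c, hc, rfl⟩
    change _ ∈ (berlekampBasis kA D g).val
    rw [hB.1]
    exact List.mem_map_of_mem hc
  · rw [hB.1, List.length_map]
    exact length_le_of_pairwise_lt natDegree _ _ r2 fun c hc => (r1 c hc).2.2
  · refine hB.2.trans (Nat.add_le_add le_rfl (r4.trans ?_))
    calc 1 * (N * ((N + 1) * (2 * N + 2 * N + 5))) ≤ N * ((N + N) * (2 * N + 2 * N + 5 * N)) := by
          rw [one_mul]; gcongr <;> omega
      _ = _ := by ring

end Berlekamp

end SkewFact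

set_option linter.style.haveILetI false

namespace SkewFact

open Polynomial

section Berlekamp

variable {K L : Type u} [Field K] [Field L] [Algebra K L] [Finite K]
  {kA : Arith K} (hkA : kA.Exact 1) {D : FieldData K L} {M : ℕ} (hD : D.Faithful M)

theorem monic_list_prod (l : List L[X]) (hl : ∀ p ∈ l, p.Monic) : l.prod.Monic := by
  induction l with
  | nil => exact monic_one
  | cons p l ih =>
    rw [List.prod_cons]
    exact (hl p (by simp)).mul (ih fun q hq => hl q (by simp [hq]))

theorem cube_add_sq_le {a m : ℕ} (h : a < m) : a ^ 3 + m ^ 2 ≤ m ^ 3 := by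
  calc a ^ 3 + m ^ 2 = a * a ^ 2 + m ^ 2 := by ring
    _ ≤ a * m ^ 2 + m ^ 2 := by gcongr
    _ = (a + 1) * m ^ 2 := by ring
    _ ≤ m * m ^ 2 := by gcongr; omega
    _ = m ^ 3 := by ring

theorem cube_add_cube_le (a b : ℕ) : a ^ 3 + b ^ 3 ≤ (a + b) ^ 3 := by
  have : (a + b) ^ 3 = a ^ 3 + b ^ 3 + 3 * (a * a * b + a * b * b) := by ring
  omega

theorem prod_elems (b : L[X]) :
    ((elems K).map fun c => b - C (algebraMap K L c)).prod = b ^ Nat.card K - b := by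
  classical
  letI := Fintype.ofFinite K
  have h1 : (Finset.univ.val.map fun a : K => (X - C a : K[X])).prod =
      X ^ Fintype.card K - X := by
    have hr := FiniteField.roots_X_pow_card_sub_X K
    have hd : (X ^ Fintype.card K - X : K[X]).natDegree = Fintype.card K :=
      FiniteField.X_pow_card_sub_X_natDegree_eq K Fintype.one_lt_card
    have := prod_multiset_X_sub_C_of_monic_of_roots_card_eq (p := (X ^ Fintype.card K - X : K[X]))
      (monic_X_pow_sub (by rw [degree_X]; exact_mod_cast Fintype.one_lt_card))
      (by rw [hr, hd]; rfl)
    rwa [hr] at this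
  have h2 := congrArg (aeval b) h1
  rw [map_multiset_prod, Multiset.map_map] at h2
  rw [Nat.card_eq_fintype_card, elems, Finset.prod_map_toList]
  simp only [map_sub, map_pow, aeval_X] at h2
  rw [← h2, ← Finset.prod_eq_multiset_prod]
  refine Finset.prod_congr (by ext; simp) fun c _ => ?_
  simp [IsScalarTower.algebraMap_apply K L L[X]]

theorem elems_length : (elems K).length = Nat.card K := by
  letI := Fintype.ofFinite K
  rw [elems, Finset.length_toList, Nat.card_eq_fintype_card, ← Finset.card_univ]
  congr 1
  ext; simp

/-- Dropping constants from a list of monic polynomials does not change the product. -/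
theorem prod_filter_natDegree (l : List L[X]) (hl : ∀ p ∈ l, p.Monic) :
    (l.filter fun p => decide (0 < p.natDegree)).prod = l.prod := by
  induction l with
  | nil => rfl
  | cons p l ih =>
    have ih' := ih fun q hq => hl q (by simp [hq])
    by_cases hp : 0 < p.natDegree
    · rw [List.filter_cons_of_pos (by simpa using hp), List.prod_cons, List.prod_cons, ih']
    · rw [List.filter_cons_of_neg (by simpa using hp), List.prod_cons, ih',
        (hl p (by simp)).natDegree_eq_zero.1 (by omega), one_mul]

include hD in
/-- Splitting by an element `b` with `h ∣ b ^ #K - b`: the factors `gcd (h, b - c)` are coprime, and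
their product is `h`. -/
theorem splitOne_spec {b h : L[X]} (hh : h.Monic) (hb : h ∣ b ^ Nat.card K - b) :
    (∀ p ∈ (splitOne D b h).val, p.Monic ∧ 0 < p.natDegree ∧
      ∃ c : K, p ∣ b - C (algebraMap K L c)) ∧
    (splitOne D b h).val.prod = h ∧
    (splitOne D b h).ops ≤ Nat.card K * (2 * M +
      12 * M * ((h.natDegree + 1) * (h.natDegree + b.natDegree + 1))) := by
  classical
  set a : K → L[X] := fun c => b - C (algebraMap K L c) with ha
  set d : K → L[X] := fun c => (gcdP D.toArith h (a c)).val with hd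
  have hup : ∀ c : K, b.update 0 (b.coeff 0 + -algebraMap K L c) = a c := fun c => by
    ext j
    rw [coeff_update, ha, coeff_sub, Function.update_apply, coeff_C]
    split_ifs with hj <;> simp [hj, sub_eq_add_neg]
  have hdspec : ∀ c, (d c).Monic ∧ d c ∣ h ∧ d c ∣ a c ∧ ∃ u v, d c = u * h + v * a c :=
    fun c => gcdP_spec hD.exact h (a c) (Or.inl hh.ne_zero)
  have hval : (splitOne D b h).val =
      ((elems K).map d).filter fun p => decide (0 < p.natDegree) := by
    simp only [splitOne, Cost.val_bind, Cost.val_pure, mapC_val, hD.exact.neg, hD.exact.add, hup]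
    rfl
  have hmon : ∀ p ∈ (elems K).map d, p.Monic := fun p hp => by
    obtain ⟨c, -, rfl⟩ := List.mem_map.1 hp
    exact (hdspec c).1
  refine ⟨?_, ?_, ?_⟩
  · intro p hp
    rw [hval, List.mem_filter] at hp
    obtain ⟨hp1, hp2⟩ := hp
    refine ⟨hmon p hp1, by simpa using hp2, ?_⟩
    obtain ⟨c, -, rfl⟩ := List.mem_map.1 hp1
    exact ⟨c, (hdspec c).2.2.1⟩
  · rw [hval, prod_filter_natDegree _ hmon]
    refine eq_of_monic_of_associated (monic_list_prod _ hmon) hh (associated_of_dvd_dvd ?_ ?_)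
    · rw [elems, Finset.prod_map_toList]
      refine Finset.prod_dvd_of_coprime (fun c _ c' _ hne => ?_) fun c _ => (hdspec c).2.1
      have h1 : IsCoprime (a c) (a c') := by
        have hu : algebraMap K L (c' - c) ≠ 0 := by
          rw [_root_.map_ne_zero]; exact sub_ne_zero.2 hne.symm
        refine ⟨C (algebraMap K L (c' - c))⁻¹, -C (algebraMap K L (c' - c))⁻¹, ?_⟩
        have : a c - a c' = C (algebraMap K L (c' - c)) := by
          simp only [ha, map_sub]; ring
        rw [neg_mul, ← sub_eq_add_neg, ← mul_sub, this, ← C_mul, inv_mul_cancel₀ hu, C_1]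
      exact (h1.of_isCoprime_of_dvd_left (hdspec c).2.2.1).of_isCoprime_of_dvd_right
        (hdspec c').2.2.1
    · have key : ∀ (l : List K) (x : L[X]), h ∣ x * (l.map a).prod → h ∣ x * (l.map d).prod := by
        intro l
        induction l with
        | nil => intro x hx; exact hx
        | cons c l ih =>
          intro x hx
          rw [List.map_cons, List.prod_cons] at hx ⊢
          rw [← mul_assoc]
          apply ih
          obtain ⟨-, -, -, u, v, huv⟩ := hdspec c
          rw [huv]
          have : x * (u * h + v * a c) * (l.map a).prod =
              h * (x * u * (l.map a).prod) + v * (x * (a c * (l.map a).prod)) := by ring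
          rw [this]
          exact dvd_add (dvd_mul_right _ _) (hx.mul_left _)
      have := key (elems K) 1 (by rw [one_mul, prod_elems]; exact hb)
      rwa [one_mul] at this
  · simp only [splitOne, Cost.ops_bind, Cost.ops_pure, add_zero]
    refine (mapC_ops_le _ _ (2 * M +
      12 * M * ((h.natDegree + 1) * (h.natDegree + b.natDegree + 1))) fun c _ => ?_).trans
      (by rw [elems_length])
    simp only [Cost.ops_bind, hD.exact.neg, hD.exact.add, hup]
    have e1 := hD.exact.neg_ops (algebraMap K L c)
    have e2 := hD.exact.add_ops (b.coeff 0) (-algebraMap K L c)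
    have e3 := gcdP_ops hD.exact h (a c)
    have e4 : (a c).natDegree ≤ b.natDegree := by
      refine (natDegree_sub_le _ _).trans ?_
      rw [natDegree_C]; simp
    have e5 : 12 * M * ((min h.natDegree (a c).natDegree + 1) *
        (h.natDegree + (a c).natDegree + 1)) ≤
        12 * M * ((h.natDegree + 1) * (h.natDegree + b.natDegree + 1)) := by
      gcongr
      exact min_le_left _ _
    omega

theorem natDegree_list_prod (l : List L[X]) (hl : ∀ p ∈ l, p.Monic) :
    l.prod.natDegree = (l.map natDegree).sum := by
  induction l with
  | nil => simp
  | cons p l ih =>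
    rw [List.prod_cons, (hl p (by simp)).natDegree_mul
      (monic_list_prod _ fun q hq => hl q (by simp [hq])), List.map_cons, List.sum_cons,
      ih fun q hq => hl q (by simp [hq])]

include hD in
/-- The refinement step of Berlekamp's algorithm for one element `b` of the subalgebra. -/
theorem mapC_splitOne_spec {b g : L[X]} (hb : g ∣ b ^ Nat.card K - b)
    (hbg : b.natDegree < g.natDegree) (hs : List L[X])
    (h1 : ∀ h ∈ hs, h.Monic ∧ 0 < h.natDegree) (h2 : hs.prod = g) :
    (∀ p ∈ (mapC (splitOne D b) hs).val.flatten, p.Monic ∧ 0 < p.natDegree ∧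
      (∃ c : K, p ∣ b - C (algebraMap K L c)) ∧ ∃ h ∈ hs, p ∣ h) ∧
    (mapC (splitOne D b) hs).val.flatten.prod = g ∧
    (mapC (splitOne D b) hs).ops ≤ 50 * Nat.card K * M * g.natDegree ^ 2 := by
  have hspec : ∀ h ∈ hs, _ := fun h hh => splitOne_spec hD (h1 h hh).1
    ((h2 ▸ List.dvd_prod hh : h ∣ g).trans hb)
  rw [mapC_val, mapC_ops]
  refine ⟨?_, ?_, ?_⟩
  · intro p hp
    obtain ⟨l, hl, hpl⟩ := List.mem_flatten.1 hp
    obtain ⟨h, hh, rfl⟩ := List.mem_map.1 hl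
    obtain ⟨s1, s2, -⟩ := hspec h hh
    obtain ⟨a1, a2, a3⟩ := s1 p hpl
    exact ⟨a1, a2, a3, h, hh, s2 ▸ List.dvd_prod hpl⟩
  · rw [List.prod_flatten, List.map_map, ← h2]
    conv_rhs => rw [← List.map_id hs]
    congr 1
    exact List.map_congr_left fun h hh => (hspec h hh).2.1
  · set m := g.natDegree with hm
    have hle : ∀ h ∈ hs, (splitOne D b h).ops ≤ 50 * Nat.card K * M * m * h.natDegree := by
      intro h hh
      refine (hspec h hh).2.2.trans ?_
      have hpos := (h1 h hh).2
      have hg0 : g ≠ 0 := fun h0 => by rw [hm, h0, natDegree_zero] at hbg; omega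
      have hhm : h.natDegree ≤ m := natDegree_le_of_dvd (h2 ▸ List.dvd_prod hh) hg0
      have e1 : (h.natDegree + 1) * (h.natDegree + b.natDegree + 1) ≤
          2 * h.natDegree * (2 * m) := by gcongr <;> omega
      have e2 : 1 ≤ m * h.natDegree := Nat.mul_pos (by omega) hpos
      calc _ ≤ Nat.card K * (2 * M * (m * h.natDegree) + 12 * M * (2 * h.natDegree * (2 * m))) := by
            exact Nat.mul_le_mul_left _ (Nat.add_le_add (Nat.le_mul_of_pos_right _ e2)
              (Nat.mul_le_mul_left _ e1))
        _ = _ := by ring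
    calc (hs.map fun h => (splitOne D b h).ops).sum
        ≤ (hs.map fun h => 50 * Nat.card K * M * m * h.natDegree).sum := List.sum_le_sum hle
      _ = 50 * Nat.card K * M * m * (hs.map natDegree).sum := by rw [List.sum_map_mul_left]
      _ = _ := by
        rw [← natDegree_list_prod hs fun h hh => (h1 h hh).1, h2]; ring

/-- A constant size of the factorization cost: `dM + d³` for a field of dimension `d` over `K`
whose operations cost `M`. -/
def FieldData.weight (D : FieldData K L) (M : ℕ) : ℕ := D.dim * M + D.dim ^ 3

theorem size_le (q : ℕ) : q.size ≤ q := Nat.size_le.2 Nat.lt_two_pow_self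

include hkA hD in
/-- Berlekamp's algorithm. A factor that is not split by any basis element of the Berlekamp subalgebra
is irreducible: the idempotents of `L[x] / (g)` lie in the subalgebra, and they are constant modulo
the factor. -/
theorem berlekamp_spec {g : L[X]} (hg : g.Monic) (hm : 0 < g.natDegree) (hsq : Squarefree g) :
    (∀ p ∈ (berlekamp kA D g).val, p.Monic ∧ Irreducible p) ∧
    (berlekamp kA D g).val.prod = g ∧
    (berlekamp kA D g).ops ≤ 110 * Nat.card K * D.weight M * g.natDegree ^ 3 := by
  obtain ⟨b1, b2, b3, b4⟩ := berlekampBasis_spec hkA hD hg hm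
  set bs := (berlekampBasis kA D g).val with hbs
  have key : ∀ (l : List L[X]) (hs : List L[X]),
      (∀ b ∈ l, g ∣ b ^ Nat.card K - b ∧ b.natDegree < g.natDegree) →
      (∀ h ∈ hs, h.Monic ∧ 0 < h.natDegree) → hs.prod = g →
      let r := l.foldlM (fun hs b => do
        let ls ← mapC (splitOne D b) hs
        (pure ls.flatten : Cost (List L[X]))) hs
      (∀ p ∈ r.val, p.Monic ∧ 0 < p.natDegree ∧
        (∀ b ∈ l, ∃ c : K, p ∣ b - C (algebraMap K L c)) ∧ ∃ h ∈ hs, p ∣ h) ∧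
      r.val.prod = g ∧ r.ops ≤ l.length * (50 * Nat.card K * M * g.natDegree ^ 2) := by
    intro l
    induction l with
    | nil =>
      intro hs _ h1 h2
      exact ⟨fun p hp => ⟨(h1 p hp).1, (h1 p hp).2, by simp, p, hp, dvd_rfl⟩, h2, Nat.zero_le _⟩
    | cons b l ih =>
      intro hs hl h1 h2
      obtain ⟨s1, s2, s3⟩ := mapC_splitOne_spec hD (hl b (by simp)).1 (hl b (by simp)).2 hs h1 h2
      obtain ⟨i1, i2, i3⟩ := ih (mapC (splitOne D b) hs).val.flatten
        (fun b hb => hl b (by simp [hb])) (fun p hp => ⟨(s1 p hp).1, (s1 p hp).2.1⟩) s2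
      simp only [List.foldlM_cons, Cost.val_bind, Cost.ops_bind, Cost.val_pure, Cost.ops_pure]
      refine ⟨fun p hp => ?_, i2, ?_⟩
      · obtain ⟨a1, a2, a3, h, hh, hph⟩ := i1 p hp
        obtain ⟨-, -, ⟨c, hc⟩, h', hh', hhh'⟩ := s1 h hh
        refine ⟨a1, a2, fun b' hb' => ?_, h', hh', hph.trans hhh'⟩
        rcases List.mem_cons.1 hb' with rfl | hb'
        · exact ⟨c, hph.trans hc⟩
        · exact a3 b' hb'
      · rw [List.length_cons, add_mul, one_mul]
        omega
  obtain ⟨k1, k2, k3⟩ := key bs [g] b1 (by simpa using ⟨hg, hm⟩) (by simp)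
  refine ⟨fun h hh => ?_, k2, ?_⟩
  · obtain ⟨hmon, hpos, hconst, -⟩ := k1 h hh
    refine ⟨hmon, ?_⟩
    have hhg : h ∣ g := k2 ▸ List.dvd_prod hh
    -- every element of the Berlekamp subalgebra is constant modulo `h`
    have hall : ∀ y ∈ Submodule.span K {b | b ∈ bs}, ∃ c : K, h ∣ y - C (algebraMap K L c) := by
      intro y hy
      induction hy using Submodule.span_induction with
      | mem b hb => exact hconst b hb
      | zero => exact ⟨0, by simp⟩
      | add x y _ _ hx hy =>
        obtain ⟨c, hc⟩ := hx
        obtain ⟨c', hc'⟩ := hy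
        refine ⟨c + c', ?_⟩
        have := dvd_add hc hc'
        rwa [show x - C (algebraMap K L c) + (y - C (algebraMap K L c')) =
          x + y - C (algebraMap K L (c + c')) by rw [map_add, C_add]; ring] at this
      | smul k x _ hx =>
        obtain ⟨c, hc⟩ := hx
        refine ⟨k * c, ?_⟩
        have := hc.mul_left (C (algebraMap K L k))
        rwa [show C (algebraMap K L k) * (x - C (algebraMap K L c)) =
          k • x - C (algebraMap K L (k * c)) by
            rw [map_mul, C_mul, mul_sub, ← algebraMap_smul L k x, smul_eq_C_mul]] at this
    refine ⟨fun hu => by rw [natDegree_eq_zero_of_isUnit hu] at hpos; omega, ?_⟩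
    rintro u v huv
    by_contra hcon
    rw [not_or] at hcon
    obtain ⟨hu, hv⟩ := hcon
    obtain ⟨t, ht⟩ := hhg
    have hguw : g = u * (v * t) := by rw [ht, huv, mul_assoc]
    obtain ⟨s, r, hsr⟩ : IsCoprime u (v * t) :=
      (IsRelPrime.of_squarefree_mul (hguw ▸ hsq)).isCoprime
    -- the idempotent that separates `u` from the complementary factor
    set y := s * u %ₘ g with hy
    have hylt : y.natDegree < g.natDegree :=
      natDegree_modByMonic_lt _ hg fun h1 => by simp [h1] at hm
    have hyg : g ∣ y - s * u := by
      rw [hy, modByMonic_eq_sub_mul_div]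
      exact ⟨-(s * u /ₘ g), by ring⟩
    have hyu : u ∣ y := by
      have h1 : u ∣ y - s * u := (hguw ▸ dvd_mul_right _ _ : u ∣ g).trans hyg
      have := dvd_add h1 (dvd_mul_left u s)
      rwa [sub_add_cancel] at this
    have hyw : v * t ∣ y - 1 := by
      have h1 : v * t ∣ y - s * u := (hguw ▸ dvd_mul_left _ _ : v * t ∣ g).trans hyg
      have h2 : y - 1 = (y - s * u) - r * (v * t) := by rw [← hsr]; ring
      rw [h2]
      exact dvd_sub h1 (dvd_mul_left _ _)
    have hq : Nat.card K ≠ 0 := Nat.card_pos.ne'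
    have hyB : g ∣ y ^ Nat.card K - y := by
      rw [hguw]
      refine IsCoprime.mul_dvd ⟨s, r, hsr⟩ (dvd_sub (dvd_pow hyu hq) hyu) ?_
      have h1 : y ^ Nat.card K - y = (y ^ Nat.card K - 1) - (y - 1) := by ring
      rw [h1]
      exact dvd_sub (hyw.trans (sub_one_dvd_pow_sub_one y _)) hyw
    obtain ⟨c, hc⟩ := hall y (b2 y hylt hyB)
    have hC : ∀ (x : L[X]) (a : L), ¬ IsUnit x → x ∣ C a → a = 0 := by
      intro x a hx hxa
      by_contra ha
      exact hx (isUnit_of_dvd_unit hxa (isUnit_C.2 (isUnit_iff_ne_zero.2 ha)))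
    have hc0 : algebraMap K L c = 0 := by
      refine hC u _ hu ?_
      have := dvd_sub hyu ((huv ▸ dvd_mul_right u v : u ∣ h).trans hc)
      rwa [sub_sub_cancel] at this
    rw [hc0, C_0, sub_zero] at hc
    have h1 : v ∣ C (1 : L) := by
      have := dvd_sub ((huv ▸ dvd_mul_left v u : v ∣ h).trans hc) ((dvd_mul_right v t).trans hyw)
      rwa [sub_sub_cancel] at this
    exact one_ne_zero (hC v _ hv h1)
  · have e : (berlekamp kA D g).ops ≤ (berlekampBasis kA D g).ops +
        bs.length * (50 * Nat.card K * M * g.natDegree ^ 2) := by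
      rw [berlekamp, Cost.ops_bind]
      exact Nat.add_le_add le_rfl k3
    set m := g.natDegree
    have hq := size_le (Nat.card K)
    have hq1 : 1 ≤ Nat.card K := Nat.card_pos
    have e2 : bs.length * (50 * Nat.card K * M * m ^ 2) ≤
        m * D.dim * (50 * Nat.card K * M * m ^ 2) := by gcongr
    have e3 : m * D.dim * ((34 * (Nat.card K).size + 3) * M * m ^ 2) ≤
        m * D.dim * ((37 * Nat.card K) * M * m ^ 2) := by gcongr; omega
    have e4 : 18 * (m * D.dim) ^ 3 ≤ 110 * Nat.card K * (D.dim ^ 3) * m ^ 3 := by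
      calc 18 * (m * D.dim) ^ 3 = 18 * (D.dim ^ 3 * m ^ 3) := by ring
        _ ≤ 110 * Nat.card K * (D.dim ^ 3 * m ^ 3) := by gcongr; omega
        _ = _ := by ring
    calc _ ≤ m * D.dim * ((37 * Nat.card K) * M * m ^ 2) +
          110 * Nat.card K * (D.dim ^ 3) * m ^ 3 +
          m * D.dim * (50 * Nat.card K * M * m ^ 2) := by omega
      _ = 87 * (Nat.card K * (D.dim * M) * m ^ 3) + 110 * Nat.card K * (D.dim ^ 3) * m ^ 3 := by
          ring
      _ ≤ 110 * (Nat.card K * (D.dim * M) * m ^ 3) + 110 * Nat.card K * (D.dim ^ 3) * m ^ 3 := by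
          gcongr; norm_num
      _ = _ := by rw [FieldData.weight]; ring

/-! ### Separation of multiple factors -/

include hD in
/-- In characteristic `p` a polynomial with zero derivative is the `p`-th power of the polynomial whose
coefficients are the `p`-th roots, which are powers with exponent `#L / p`. -/
theorem rootP_spec {g : L[X]} (hg : g.Monic) (hm : 0 < g.natDegree) (h0 : derivative g = 0) :
    (rootP (K := K) D g).val ^ ringChar K = g ∧ (rootP (K := K) D g).val.Monic ∧
    (rootP (K := K) D g).val.natDegree < g.natDegree ∧
    (rootP (K := K) D g).ops ≤ 4 * Nat.card K * (D.dim * M) * g.natDegree := by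
  set p := ringChar K with hp
  haveI hpK : CharP K p := ringChar.charP K
  haveI : CharP L p := charP_of_injective_algebraMap (algebraMap K L).injective p
  haveI hpp : Fact p.Prime := ⟨CharP.char_is_prime K p⟩
  haveI : ExpChar L p := ExpChar.prime hpp.out
  haveI : Finite L := Nat.finite_of_card_ne_zero (by
    rw [natCard_eq_pow hD]; exact pow_ne_zero _ Nat.card_pos.ne')
  have hcard := natCard_eq_pow hD
  set Q := Nat.card K ^ D.dim with hQ
  have hpQ : Q / p * p = Q := Nat.div_mul_cancel (by
    letI := Fintype.ofFinite K
    obtain ⟨n, -, hn⟩ := FiniteField.card K p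
    rw [hQ, Nat.card_eq_fintype_card, hn, ← pow_mul]
    exact dvd_pow_self _ (mul_ne_zero n.ne_zero hD.dim_pos.ne'))
  have hroot : ∀ a : L, (a ^ (Q / p)) ^ p = a := fun a => by
    letI := Fintype.ofFinite L
    rw [← pow_mul, hpQ, ← hcard, Nat.card_eq_fintype_card, FiniteField.pow_card]
  have hpow : ∀ (a : L) (n : ℕ), (powC D.mul 1 a n).val = a ^ n ∧
      (powC D.mul 1 a n).ops ≤ 2 * n.size * M := fun a n =>
    powC_spec D.mul 1 a (fun n x => x = a ^ n) M (pow_zero a).symm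
      (fun n x hx => by rw [hD.exact.mul, hx, pow_add])
      (fun n x hx => by rw [hD.exact.mul, hx, pow_succ])
      (fun n x _ => ⟨hD.exact.mul_ops _ _, hD.exact.mul_ops _ _⟩) n
  set h := (rootP (K := K) D g).val with hh
  have hcoeff : ∀ j, h.coeff j = (g.coeff (p * j)) ^ (Q / p) := by
    intro j
    have hQp : 0 < Q / p := Nat.pos_of_ne_zero fun h => by
      rw [h, zero_mul] at hpQ
      exact (pow_pos Nat.card_pos _).ne hpQ
    rw [hh, rootP, foldlM_val, foldl_range_coeff (fun p : L[X] => p.coeff) _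
      (fun i t => (g.coeff (p * i)) ^ (Q / p)) 0
      (fun r i => by simp [(hpow _ _).1, coeff_update, ← hp, ← hQ])]
    split_ifs with hj
    · rfl
    · rw [coeff_eq_zero_of_natDegree_lt (p := g), zero_pow hQp.ne', coeff_zero]
      by_contra hcon
      apply hj
      refine ⟨Nat.zero_le _, ?_⟩
      rw [← hp]
      have : j ≤ g.natDegree / p := (Nat.le_div_iff_mul_le hpp.out.pos).2 (by
        rw [mul_comm]; omega)
      omega
  have hpw : h ^ p = g := by
    rw [← map_frobenius_expand p, map_expand, ← expand_contract p h0 hpp.out.ne_zero]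
    congr 1
    ext j
    rw [coeff_map, hcoeff, frobenius_def, hroot, coeff_contract hpp.out.ne_zero, mul_comm]
  have hdeg : p * h.natDegree = g.natDegree := by rw [← hpw, natDegree_pow]
  have h2p := hpp.out.two_le
  refine ⟨hpw, ?_, ?_, ?_⟩
  · have h1 : h.leadingCoeff ^ p = 1 := by rw [← leadingCoeff_pow, hpw]; exact hg
    have h2 : frobenius L p h.leadingCoeff = frobenius L p 1 := by
      rw [frobenius_def, h1, map_one]
    exact frobenius_inj L p h2
  · nlinarith
  · refine (foldlM_ops_le _ (2 * (Q / p).size * M) _ _ fun r i _ => ?_).trans ?_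
    · simpa using (hpow _ _).2
    · rw [List.length_range]
      have e1 : (Q / p).size ≤ D.dim * (Nat.card K).size := by
        refine (Nat.size_le_size (Nat.div_le_self _ _)).trans (Nat.size_le.2 ?_)
        rw [hQ, mul_comm, pow_mul]
        exact Nat.pow_lt_pow_left (Nat.lt_size_self _) hD.dim_pos.ne'
      have e2 := size_le (Nat.card K)
      have e3 : g.natDegree / p + 1 ≤ 2 * g.natDegree := by
        have := Nat.div_le_self g.natDegree p; omega
      calc _ ≤ 2 * g.natDegree * (2 * (D.dim * Nat.card K) * M) := by
            gcongr
            exact e1.trans (by gcongr)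
        _ = _ := by ring

/-- The quotient of a polynomial by its greatest common divisor with its derivative is squarefree. -/
theorem squarefree_div_gcd {g c Q : L[X]} (hg : g ≠ 0) (hQ : g = Q * c)
    (hc : ∀ x, x ∣ g → x ∣ derivative g → x ∣ c) : Squarefree Q := by
  have hQ0 : Q ≠ 0 := fun h => hg (by rw [hQ, h, zero_mul])
  rw [squarefree_iff_irreducible_sq_not_dvd_of_ne_zero hQ0]
  intro π hπ hdvd
  have hfin : FiniteMultiplicity π g := FiniteMultiplicity.of_not_isUnit hπ.not_isUnit hg
  obtain ⟨t, ht, hnot⟩ := hfin.exists_eq_pow_mul_and_not_dvd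
  set e := multiplicity π g
  have hdvdg : π ^ e ∣ g := ⟨t, ht⟩
  have h1 : π ^ (e - 1) ∣ c := hc _ ((pow_dvd_pow π (Nat.sub_le _ _)).trans hdvdg)
    (pow_sub_one_dvd_derivative_of_pow_dvd hdvdg)
  have h2 : π * π * π ^ (e - 1) ∣ π ^ e * t := by
    rw [← ht, hQ]; exact mul_dvd_mul hdvd h1
  have h3 : π ^ e * π ∣ π ^ e * t := by
    refine dvd_trans ?_ h2
    rw [mul_assoc, ← pow_succ', mul_comm]
    exact mul_dvd_mul_left π (pow_dvd_pow π (by omega))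
  exact hnot ((mul_dvd_mul_iff_left (pow_ne_zero _ hπ.ne_zero)).1 h3)

include hkA hD in
theorem factorAux_spec : ∀ (n : ℕ) (g : L[X]), g.Monic → g.natDegree < n →
    (∀ p ∈ (factorAux kA D n g).val, p.Monic ∧ Irreducible p) ∧
    (factorAux kA D n g).val.prod = g ∧
    (factorAux kA D n g).ops ≤ 200 * Nat.card K * D.weight M * g.natDegree ^ 3 := by
  intro n
  induction n with
  | zero => intro g _ h; omega
  | succ n ih =>
    intro g hg hn
    by_cases hm : g.natDegree = 0
    · simp only [factorAux, hm, if_true, Cost.val_pure, Cost.ops_pure]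
      exact ⟨by simp, by rw [hg.natDegree_eq_zero.1 hm]; rfl, Nat.zero_le _⟩
    have hm' : 0 < g.natDegree := Nat.pos_of_ne_zero hm
    have hq1 : 1 ≤ Nat.card K := Nat.card_pos
    have hMW : M ≤ D.weight M := by
      have := hD.dim_pos
      unfold FieldData.weight
      nlinarith [Nat.zero_le (D.dim ^ 3)]
    have hdMW : D.dim * M ≤ D.weight M := Nat.le_add_right _ _
    set W := Nat.card K * D.weight M with hW
    have hMW' : M ≤ W := hMW.trans (Nat.le_mul_of_pos_left _ hq1)
    have hder := derivP_ops hD.exact g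
    by_cases h0 : derivative g = 0
    · obtain ⟨r1, r2, r3, r4⟩ := rootP_spec (K := K) hD hg hm' h0
      obtain ⟨i1, i2, i3⟩ := ih _ r2 (by omega)
      have hv : (factorAux kA D (n + 1) g).val =
          (List.replicate (ringChar K) (factorAux kA D n (rootP (K := K) D g).val).val).flatten := by
        simp only [factorAux, hm, if_false, Cost.val_bind, derivP_val hD.exact, h0, if_true,
          Cost.val_pure]
      have ho : (factorAux kA D (n + 1) g).ops = (derivP D.toArith g).ops +
          ((rootP (K := K) D g).ops + (factorAux kA D n (rootP (K := K) D g).val).ops) := by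
        simp only [factorAux, hm, if_false, Cost.ops_bind, derivP_val hD.exact, h0, if_true,
          Cost.ops_pure, add_zero]
      rw [hv, ho]
      refine ⟨fun p hp => ?_, ?_, ?_⟩
      · obtain ⟨l, hl, hpl⟩ := List.mem_flatten.1 hp
        rw [List.eq_of_mem_replicate hl] at hpl
        exact i1 p hpl
      · rw [List.prod_flatten, List.map_replicate, i2, List.prod_replicate, r1]
      · set m := g.natDegree
        set d := (rootP (K := K) D g).val.natDegree
        have e1 : d ^ 3 + m ≤ m ^ 3 := by
          have := cube_add_sq_le (r3 : d < m)
          nlinarith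
        have e2 : 4 * Nat.card K * (D.dim * M) * m ≤ 4 * W * m := by
          rw [hW, mul_assoc 4 (Nat.card K)]; gcongr
        calc _ ≤ W * m + (4 * W * m + 200 * Nat.card K * D.weight M * d ^ 3) := by
              refine Nat.add_le_add (hder.trans (by gcongr)) (Nat.add_le_add (r4.trans e2) i3)
          _ = 5 * W * m + 200 * W * d ^ 3 := by rw [hW]; ring
          _ ≤ 200 * W * (d ^ 3 + m) := by nlinarith [Nat.zero_le (W * m)]
          _ ≤ 200 * W * m ^ 3 := by gcongr
          _ = _ := by rw [hW]; ring
    · obtain ⟨c1, c2, c3, ⟨u, v, huv⟩⟩ := gcdP_spec hD.exact g (derivative g) (Or.inl hg.ne_zero)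
      set c := (gcdP D.toArith g (derivative g)).val with hc
      obtain ⟨d1, d2, d3⟩ := divP_spec hD.exact g c c1.ne_zero
      rw [divP_val_snd hD.exact c1, (modByMonic_eq_zero_iff_dvd c1).2 c2, add_zero] at d1
      set Q := (divP D.toArith g c).val.1 with hQ
      have hQmon : Q.Monic := c1.of_mul_monic_right (by rw [← d1]; exact hg)
      have hdegadd : Q.natDegree + c.natDegree = g.natDegree := by
        rw [d1]; exact (hQmon.natDegree_mul c1).symm
      have hder_lt : (derivative g).natDegree < g.natDegree := natDegree_derivative_lt hm
      have hclt : c.natDegree < g.natDegree :=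
        (natDegree_le_of_dvd c3 h0).trans_lt hder_lt
      have hQsq : Squarefree Q := squarefree_div_gcd hg.ne_zero d1 fun x hx hx' => by
        rw [huv]
        exact dvd_add (hx.mul_left _) (hx'.mul_left _)
      obtain ⟨k1, k2, k3⟩ := berlekamp_spec hkA hD hQmon (by omega) hQsq
      obtain ⟨i1, i2, i3⟩ := ih c c1 (by omega)
      have hv : (factorAux kA D (n + 1) g).val =
          (berlekamp kA D Q).val ++ (factorAux kA D n c).val := by
        simp only [factorAux, hm, if_false, Cost.val_bind, derivP_val hD.exact, h0,
          Cost.val_pure]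
        rfl
      have ho : (factorAux kA D (n + 1) g).ops = (derivP D.toArith g).ops +
          ((gcdP D.toArith g (derivative g)).ops + ((divP D.toArith g c).ops +
          ((berlekamp kA D Q).ops + (factorAux kA D n c).ops))) := by
        simp only [factorAux, hm, if_false, Cost.ops_bind, derivP_val hD.exact, h0,
          Cost.ops_pure, add_zero]
        rfl
      rw [hv, ho]
      refine ⟨fun p hp => ?_, ?_, ?_⟩
      · rcases List.mem_append.1 hp with h | h
        · exact k1 p h
        · exact i1 p h
      · rw [List.prod_append, k2, i2, ← d1]
      · have hg2 := gcdP_ops hD.exact g (derivative g)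
        have hle := min_le_right g.natDegree (derivative g).natDegree
        set m := g.natDegree
        set dc := c.natDegree
        set dq := Q.natDegree
        have e1 : (gcdP D.toArith g (derivative g)).ops ≤ 24 * M * m ^ 2 := by
          refine hg2.trans ?_
          calc _ ≤ 12 * M * (m * (2 * m)) := by gcongr <;> omega
            _ = _ := by ring
        have e2 : (divP D.toArith g c).ops ≤ 15 * M * m ^ 2 := by
          refine d3.trans ?_
          have : (m + 1 - dc) * (dc + 1) + 1 ≤ 3 * m ^ 2 := by
            have h1 : (m + 1 - dc) * (dc + 1) ≤ (m + 1) * m := by gcongr <;> omega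
            have h2 : m ≤ m ^ 2 := Nat.le_self_pow two_ne_zero m
            have h3 : (m + 1) * m = m ^ 2 + m := by ring
            omega
          calc _ ≤ 5 * M * (3 * m ^ 2) := by gcongr
            _ = _ := by ring
        have e3 : (derivP D.toArith g).ops ≤ M * m ^ 2 := hder.trans (by
          gcongr; exact Nat.le_self_pow two_ne_zero m)
        have e4 : dq ^ 3 + dc ^ 3 ≤ m ^ 3 := by
          rw [← hdegadd]
          exact cube_add_cube_le dq dc
        have e5 : dc ^ 3 + m ^ 2 ≤ m ^ 3 := by
          exact cube_add_sq_le hclt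
        calc _ ≤ M * m ^ 2 + (24 * M * m ^ 2 + (15 * M * m ^ 2 +
              (110 * Nat.card K * D.weight M * dq ^ 3 +
                200 * Nat.card K * D.weight M * dc ^ 3))) := by
              refine Nat.add_le_add e3 (Nat.add_le_add e1 (Nat.add_le_add e2
                (Nat.add_le_add k3 i3)))
          _ = 40 * (M * m ^ 2) + (110 * W * dq ^ 3 + 200 * W * dc ^ 3) := by rw [hW]; ring
          _ ≤ 40 * (W * m ^ 2) + (110 * W * dq ^ 3 + 200 * W * dc ^ 3) := by gcongr
          _ ≤ 90 * W * (dc ^ 3 + m ^ 2) + 110 * W * (dq ^ 3 + dc ^ 3) := by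
              have : 40 * (W * m ^ 2) ≤ 90 * W * m ^ 2 := by rw [← mul_assoc]; gcongr; norm_num
              linarith
          _ ≤ 90 * W * m ^ 3 + 110 * W * m ^ 3 := by gcongr
          _ = _ := by rw [hW]; ring

include hkA hD in
/-- Factorization into monic irreducible polynomials, with its cost. -/
theorem factorPoly_spec {g : L[X]} (hg : g.Monic) :
    (∀ p ∈ (factorPoly kA D g).val, p.Monic ∧ Irreducible p) ∧
    (factorPoly kA D g).val.prod = g ∧
    (factorPoly kA D g).ops ≤ 200 * Nat.card K * D.weight M * g.natDegree ^ 3 :=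
  factorAux_spec hkA hD _ g hg (Nat.lt_succ_self _)

end Berlekamp

end SkewFact

namespace SkewFact

open Polynomial

/-! ### Arithmetic of the base field and of its extensions -/

section Extension

variable {K : Type u} [Field K]

theorem baseArith_exact : (baseArith K).Exact 1 where
  pos := le_rfl
  add _ _ := rfl
  neg _ := rfl
  mul _ _ := rfl
  inv _ := rfl
  add_ops _ _ := le_rfl
  neg_ops _ := le_rfl
  mul_ops _ _ := le_rfl
  inv_ops _ := le_rfl

theorem baseData_faithful : (baseData K).Faithful 1 where
  exact := baseArith_exact
  dim_pos := Nat.one_pos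
  coord_add _ _ _ := rfl
  coord_smul _ _ _ := rfl
  coord_ofCoord c i hi := by
    change c 0 = c i
    rw [Nat.lt_one_iff.1 hi]
  ext a b h := h 0 Nat.one_pos

variable {π : K[X]} (hπ : π.Monic)
include hπ

theorem mk_rep (a : AdjoinRoot π) : AdjoinRoot.mk π (rep π a) = a := by
  rw [rep]
  conv_rhs => rw [← Function.surjInv_eq (AdjoinRoot.mk_surjective (g := π)) a]
  rw [AdjoinRoot.mk_eq_mk, modByMonic_eq_sub_mul_div]
  exact ⟨-(_ /ₘ π), by ring⟩

theorem degree_rep_lt (a : AdjoinRoot π) : (rep π a).degree < π.degree :=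
  degree_modByMonic_lt _ hπ

theorem rep_mk {p : K[X]} (hp : p.degree < π.degree) : rep π (AdjoinRoot.mk π p) = p := by
  have h1 : π ∣ rep π (AdjoinRoot.mk π p) - p := by
    rw [← AdjoinRoot.mk_eq_mk, mk_rep hπ]
  have h2 := (degree_sub_le (rep π (AdjoinRoot.mk π p)) p).trans_lt
    (max_lt (degree_rep_lt hπ _) hp)
  exact sub_eq_zero.1 (eq_zero_of_dvd_of_degree_lt h1 h2)

theorem rep_add (a b : AdjoinRoot π) : rep π (a + b) = rep π a + rep π b := by
  rw [← rep_mk hπ ((degree_add_le (rep π a) (rep π b)).trans_lt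
    (max_lt (degree_rep_lt hπ a) (degree_rep_lt hπ b))), map_add, mk_rep hπ, mk_rep hπ]

theorem rep_smul (c : K) (a : AdjoinRoot π) : rep π (c • a) = c • rep π a := by
  rw [← rep_mk hπ ((degree_smul_le c (rep π a)).trans_lt (degree_rep_lt hπ a)),
    ← AdjoinRoot.smul_mk, mk_rep hπ]

theorem natDegree_rep_lt (h0 : 0 < π.natDegree) (a : AdjoinRoot π) :
    (rep π a).natDegree < π.natDegree := by
  by_cases h : rep π a = 0
  · rwa [h, natDegree_zero]
  · exact natDegree_lt_natDegree h (degree_rep_lt hπ a)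

theorem rep_zero : rep π (0 : AdjoinRoot π) = 0 := by
  have := rep_mk hπ (p := 0) (by
    rw [degree_zero]; exact bot_lt_iff_ne_bot.2 (degree_ne_bot.2 hπ.ne_zero))
  rwa [map_zero] at this

variable [Fact (Irreducible π)]

theorem invMod_spec (a : AdjoinRoot π) :
    (invMod π a).val = a⁻¹ ∧ (invMod π a).ops ≤ 200 * π.natDegree ^ 2 := by
  have hirr : Irreducible π := Fact.out
  have hδ : 0 < π.natDegree := hirr.natDegree_pos
  have ho := baseArith_exact (K := K)
  have hrep := natDegree_rep_lt hπ hδ a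
  have key := ext_loop_spec isDegree_natDegree (κ := 5 * 1)
    (divP_spec ho) (neg := negP (baseArith K)) (addMul := addMulP (baseArith K))
    (fun x => ⟨negP_val ho x, (negP_ops ho x).trans (by gcongr; norm_num)⟩)
    (fun x y r => ⟨addMulP_val ho x y r, (addMulP_ops ho x y r).trans (by gcongr; norm_num)⟩)
    π (rep π a) hπ.ne_zero (π.natDegree + 1) (by omega)
  rw [max_eq_left hrep.le] at key
  obtain ⟨-, ⟨u, hu⟩, k3, k4, k5, -, k6⟩ := key
  constructor
  · by_cases ha : a = 0
    · subst ha
      simp only [invMod, Cost.val_bind, Cost.val_pure, whileC, rep_zero hπ, ne_eq,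
        not_true_eq_false, if_false, scaleP_val ho, mul_zero, map_zero, inv_zero]
    · simp only [invMod, Cost.val_bind, Cost.val_pure, scaleP_val ho, ho.inv]
      generalize (whileC (fun s : (K[X] × K[X]) × (K[X] × K[X]) => s.1.2 ≠ 0) _ _ _).val = x at *
      have hdvd1 : x.1.1 ∣ π := by
        obtain ⟨t, ht⟩ := (k3 π).1 ⟨1, 0, by simp⟩
        exact ⟨t, by rw [mul_comm]; exact ht⟩
      have hdvd2 : x.1.1 ∣ rep π a := by
        obtain ⟨t, ht⟩ := (k3 (rep π a)).1 ⟨0, 1, by simp⟩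
        exact ⟨t, by rw [mul_comm]; exact ht⟩
      have hunit : IsUnit x.1.1 := by
        rcases hirr.isUnit_or_isUnit (hdvd1.choose_spec) with h | h
        · exact h
        · exfalso
          have h1 : π ∣ rep π a := by
            refine dvd_trans ?_ hdvd2
            obtain ⟨v, hv⟩ := h
            exact ⟨↑v⁻¹, by rw [hdvd1.choose_spec, ← hv, mul_assoc, Units.mul_inv, mul_one]⟩
          have h2 := eq_zero_of_dvd_of_degree_lt h1 (degree_rep_lt hπ a)
          apply ha
          rw [← mk_rep hπ a, h2, map_zero]
      obtain ⟨c, hc, hcx⟩ := isUnit_iff.1 hunit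
      rw [← hcx, leadingCoeff_C]
      refine eq_inv_of_mul_eq_one_left ?_
      have h3 : AdjoinRoot.mk π x.2.1 * a = AdjoinRoot.mk π (C c) := by
        have h4 := congrArg (AdjoinRoot.mk π) hu
        rw [map_add, map_mul, map_mul, AdjoinRoot.mk_self, mul_zero, zero_add, mk_rep hπ, ← hcx]
          at h4
        exact h4.symm
      rw [map_mul, mul_assoc, h3, ← map_mul, ← C_mul, inv_mul_cancel₀ hc.ne_zero, C_1, map_one]
  · simp only [invMod, Cost.ops_bind, Cost.ops_pure, add_zero]
    generalize (whileC (fun s : (K[X] × K[X]) × (K[X] × K[X]) => s.1.2 ≠ 0) _ _ _) = x at *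
    have e1 := ho.inv_ops x.val.1.1.leadingCoeff
    have e2 := scaleP_ops ho ((baseArith K).inv x.val.1.1.leadingCoeff).val x.val.2.1
    set δ := π.natDegree
    have e3 : 9 * (5 * 1) * (δ + 1) ^ 2 ≤ 45 * (2 * δ) ^ 2 := by gcongr <;> omega
    have e4 : 1 ≤ δ ^ 2 := Nat.one_le_pow _ _ hδ
    have e5 : δ ≤ δ ^ 2 := Nat.le_self_pow two_ne_zero δ
    have e6 : 45 * (2 * δ) ^ 2 = 180 * δ ^ 2 := by ring
    omega

/-- Arithmetic modulo `π` with reduced representatives is quadratic in the degree. -/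
theorem extData_faithful : (extData π).Faithful (200 * π.natDegree ^ 2) := by
  have hirr : Irreducible π := Fact.out
  have hδ : 0 < π.natDegree := hirr.natDegree_pos
  have ho := baseArith_exact (K := K)
  have hdeg : π.degree = (π.natDegree : WithBot ℕ) := degree_eq_natDegree hπ.ne_zero
  have e4 : 1 ≤ π.natDegree ^ 2 := Nat.one_le_pow _ _ hδ
  have e5 : π.natDegree ≤ π.natDegree ^ 2 := Nat.le_self_pow two_ne_zero _
  refine ⟨⟨by omega, ?_, ?_, ?_, ?_, ?_, ?_, ?_, ?_⟩, hδ, ?_, ?_, ?_, ?_⟩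
  · intro a b
    simp only [extData, Cost.val_bind, Cost.val_pure, addP_val ho, map_add, mk_rep hπ]
  · intro a
    simp only [extData, Cost.val_bind, Cost.val_pure, negP_val ho, map_neg, mk_rep hπ]
  · intro a b
    simp only [extData, Cost.val_bind, Cost.val_pure, mulModP_val ho hπ]
    rw [← mk_rep hπ a, ← mk_rep hπ b, ← map_mul, mk_rep hπ, mk_rep hπ, AdjoinRoot.mk_eq_mk,
      modByMonic_eq_sub_mul_div]
    exact ⟨-(_ /ₘ π), by ring⟩
  · exact fun a => (invMod_spec hπ a).1
  · intro a b
    simp only [extData, Cost.ops_bind, Cost.ops_pure, add_zero]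
    have := addP_ops ho (rep π a) (rep π b)
    have := natDegree_rep_lt hπ hδ b
    omega
  · intro a
    simp only [extData, Cost.ops_bind, Cost.ops_pure, add_zero]
    have := negP_ops ho (rep π a)
    have := natDegree_rep_lt hπ hδ a
    omega
  · intro a b
    simp only [extData, Cost.ops_bind, Cost.ops_pure, add_zero]
    have := mulModP_ops ho hπ (rep π a) (rep π b) (natDegree_rep_lt hπ hδ a)
      (natDegree_rep_lt hπ hδ b)
    omega
  · exact fun a => (invMod_spec hπ a).2
  · intro a b i
    simp only [extData, rep_add hπ, coeff_add]
  · intro c a i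
    simp only [extData, rep_smul hπ, coeff_smul, smul_eq_mul]
  · intro c i hi
    simp only [extData] at hi ⊢
    rw [rep_mk hπ]
    · simp only [finsetSum_coeff, coeff_monomial]
      rw [Finset.sum_eq_single_of_mem i (Finset.mem_range.2 hi), if_pos rfl]
      exact fun j _ hne => if_neg hne
    · rw [hdeg]
      refine (degree_sum_le _ _).trans_lt
        ((Finset.sup_lt_iff (WithBot.bot_lt_coe _)).2 fun j hj => ?_)
      exact (degree_monomial_le _ _).trans_lt (by exact_mod_cast Finset.mem_range.1 hj)
  · intro a b h
    simp only [extData] at h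
    rw [← mk_rep hπ a, ← mk_rep hπ b]
    congr 1
    ext i
    by_cases hi : i < π.natDegree
    · exact h i hi
    · rw [(degree_lt_iff_coeff_zero _ _).1 (hdeg ▸ degree_rep_lt hπ a) i (by omega),
        (degree_lt_iff_coeff_zero _ _).1 (hdeg ▸ degree_rep_lt hπ b) i (by omega)]

end Extension

end SkewFact

namespace SkewFact

open SkewPolynomial (φ)

/-! ### Degrees and coefficients of skew polynomials -/

section SkewBasic

variable {F : Type u} [Field F]

theorem coeff_sum_skew {ι : Type*} (s : Finset ι) (f : ι → SkewPolynomial F) (j : ℕ) :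
    (∑ i ∈ s, f i).coeff j = ∑ i ∈ s, (f i).coeff j := by
  classical
  induction s using Finset.induction_on with
  | empty => rfl
  | insert a s ha ih => rw [Finset.sum_insert ha, Finset.sum_insert ha, SkewPolynomial.coeff_add, ih]

theorem coeff_update_skew (p : SkewPolynomial F) (n : ℕ) (a : F) :
    (p.update n a).coeff = Function.update p.coeff n a := by
  ext i
  rw [SkewPolynomial.coeff_update]

theorem le_deg {p : SkewPolynomial F} {n : ℕ} (h : p.coeff n ≠ 0) : n ≤ deg p :=
  Finset.le_sup (f := id) (SkewPolynomial.mem_support_iff.2 h)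

theorem coeff_eq_zero_of_deg_lt {p : SkewPolynomial F} {n : ℕ} (h : deg p < n) :
    p.coeff n = 0 := by
  by_contra h'
  exact absurd (le_deg h') (by omega)

theorem deg_le {p : SkewPolynomial F} {n : ℕ} (h : ∀ i, n < i → p.coeff i = 0) : deg p ≤ n := by
  refine Finset.sup_le fun i hi => ?_
  by_contra h'
  exact SkewPolynomial.mem_support_iff.1 hi (h i (by simpa using h'))

theorem lc_ne_zero {p : SkewPolynomial F} (h : p ≠ 0) : lc p ≠ 0 := by
  obtain ⟨i, hi, hi'⟩ := Finset.exists_mem_eq_sup p.support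
    (Finset.nonempty_iff_ne_empty.2 (mt SkewPolynomial.support_eq_empty.1 h)) id
  rw [lc, deg, hi']
  exact SkewPolynomial.mem_support_iff.1 hi

@[simp]
theorem deg_zero : deg (0 : SkewPolynomial F) = 0 := by
  rw [deg, SkewPolynomial.support_zero]; rfl

theorem deg_monomial {a : F} (ha : a ≠ 0) (n : ℕ) : deg (SkewPolynomial.monomial n a) = n := by
  rw [deg, SkewPolynomial.support_monomial n ha, Finset.sup_singleton]; rfl

theorem deg_C (a : F) : deg (SkewPolynomial.C a) = 0 :=
  Nat.le_zero.1 (deg_le fun i hi => by rw [SkewPolynomial.coeff_C, if_neg (by omega)])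

theorem eq_C_of_deg_eq_zero {p : SkewPolynomial F} (h : deg p = 0) :
    p = SkewPolynomial.C (p.coeff 0) := by
  ext i
  rw [SkewPolynomial.coeff_C]
  split_ifs with hi
  · rw [hi]
  · exact coeff_eq_zero_of_deg_lt (by omega)

theorem eq_sum_monomial (p : SkewPolynomial F) {n : ℕ} (h : deg p < n) :
    p = ∑ i ∈ Finset.range n, SkewPolynomial.monomial i (p.coeff i) := by
  ext j
  simp only [coeff_sum_skew, SkewPolynomial.coeff_monomial, Finset.sum_ite_eq', Finset.mem_range]
  split_ifs with hj
  · rfl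
  · exact coeff_eq_zero_of_deg_lt (by omega)

theorem deg_neg (p : SkewPolynomial F) : deg (-p) = deg p := by
  rw [deg, SkewPolynomial.support_neg]; rfl

theorem deg_add_le (p q : SkewPolynomial F) : deg (p + q) ≤ max (deg p) (deg q) :=
  deg_le fun i hi => by
    rw [SkewPolynomial.coeff_add, coeff_eq_zero_of_deg_lt (p := p) (by omega),
      coeff_eq_zero_of_deg_lt (p := q) (by omega), add_zero]

theorem coeff_lowDeg_ne_zero {p : SkewPolynomial F} (h : p ≠ 0) : p.coeff (lowDeg p) ≠ 0 :=
  Nat.sInf_mem (s := {i | p.coeff i ≠ 0}) ⟨_, lc_ne_zero h⟩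

theorem coeff_eq_zero_of_lt_lowDeg {p : SkewPolynomial F} {n : ℕ} (h : n < lowDeg p) :
    p.coeff n = 0 := by
  by_contra h'
  exact Nat.notMem_of_lt_sInf h h'

theorem lowDeg_eq {p : SkewPolynomial F} {n : ℕ} (h : p.coeff n ≠ 0)
    (h' : ∀ i < n, p.coeff i = 0) : lowDeg p = n := by
  refine le_antisymm (Nat.sInf_le h) (le_of_not_gt fun hlt => ?_)
  exact coeff_lowDeg_ne_zero (p := p) (fun h0 => h (by rw [h0]; rfl)) (h' _ hlt)

variable [MulSemiringAction (Multiplicative ℕ) F]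

theorem phi_iter_eq_zero {k : ℕ} {a : F} : φ^[k] a = 0 ↔ a = 0 := by
  rw [← RingHom.coe_pow]
  exact map_eq_zero _

theorem coeff_monomial_mul (k : ℕ) (a : F) (g : SkewPolynomial F) (j : ℕ) :
    (SkewPolynomial.monomial k a * g).coeff j =
      if k ≤ j then a * φ^[k] (g.coeff (j - k)) else 0 := by
  conv_lhs => rw [eq_sum_monomial g (n := deg g + j + 1) (by omega)]
  simp only [Finset.mul_sum, coeff_sum_skew, SkewPolynomial.monomial_mul_monomial,
    SkewPolynomial.coeff_monomial]
  split_ifs with h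
  · rw [Finset.sum_eq_single (j - k)]
    · rw [if_pos (by omega)]
    · intro i _ hi
      rw [if_neg (by omega)]
    · intro hi
      exact absurd (Finset.mem_range.2 (by omega)) hi
  · exact Finset.sum_eq_zero fun i _ => if_neg (by omega)

theorem coeff_C_mul (a : F) (g : SkewPolynomial F) (j : ℕ) :
    (SkewPolynomial.C a * g).coeff j = a * g.coeff j := by
  rw [← SkewPolynomial.monomial_zero_left, coeff_monomial_mul, if_pos (Nat.zero_le _)]
  rfl

theorem coeff_mul_monomial (f : SkewPolynomial F) (k : ℕ) (a : F) (j : ℕ) :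
    (f * SkewPolynomial.monomial k a).coeff j =
      if k ≤ j then f.coeff (j - k) * φ^[j - k] a else 0 := by
  conv_lhs => rw [eq_sum_monomial f (n := deg f + j + 1) (by omega)]
  simp only [Finset.sum_mul, coeff_sum_skew, SkewPolynomial.monomial_mul_monomial,
    SkewPolynomial.coeff_monomial]
  split_ifs with h
  · rw [Finset.sum_eq_single (j - k)]
    · rw [if_pos (by omega)]
    · intro i _ hi
      rw [if_neg (by omega)]
    · intro hi
      exact absurd (Finset.mem_range.2 (by omega)) hi
  · exact Finset.sum_eq_zero fun i _ => if_neg (by omega)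

theorem coeff_mul_X_pow (f : SkewPolynomial F) (k j : ℕ) :
    (f * SkewPolynomial.X ^ k).coeff j = if k ≤ j then f.coeff (j - k) else 0 := by
  rw [SkewPolynomial.X_pow_eq_monomial, coeff_mul_monomial, iterate_map_one, mul_one]

theorem mul_eq_sum_monomial (f g : SkewPolynomial F) :
    f * g = ∑ i ∈ Finset.range (deg f + 1), SkewPolynomial.monomial i (f.coeff i) * g := by
  conv_lhs => rw [eq_sum_monomial f (Nat.lt_succ_self _), Finset.sum_mul]

theorem coeff_mul_skew (f g : SkewPolynomial F) (j : ℕ) :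
    (f * g).coeff j = ∑ i ∈ Finset.range (deg f + 1),
      if i ≤ j then f.coeff i * φ^[i] (g.coeff (j - i)) else 0 := by
  rw [mul_eq_sum_monomial]
  simp only [coeff_sum_skew, coeff_monomial_mul]

theorem coeff_mul_add (f g : SkewPolynomial F) :
    (f * g).coeff (deg f + deg g) = lc f * φ^[deg f] (lc g) := by
  rw [coeff_mul_skew, Finset.sum_eq_single (deg f)]
  · rw [if_pos (by omega), Nat.add_sub_cancel_left]; rfl
  · intro i hi hne
    rw [Finset.mem_range] at hi
    rw [if_pos (by omega), coeff_eq_zero_of_deg_lt (p := g) (by omega), iterate_map_zero, mul_zero]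
  · intro h
    exact absurd (Finset.mem_range.2 (by omega)) h

theorem deg_mul_le (f g : SkewPolynomial F) : deg (f * g) ≤ deg f + deg g :=
  deg_le fun j hj => by
    rw [coeff_mul_skew]
    refine Finset.sum_eq_zero fun i hi => ?_
    rw [Finset.mem_range] at hi
    rw [if_pos (by omega), coeff_eq_zero_of_deg_lt (p := g) (by omega), iterate_map_zero, mul_zero]

theorem lc_mul_ne_zero {f g : SkewPolynomial F} (hf : f ≠ 0) (hg : g ≠ 0) :
    (f * g).coeff (deg f + deg g) ≠ 0 := by
  rw [coeff_mul_add]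
  exact mul_ne_zero (lc_ne_zero hf) (mt phi_iter_eq_zero.1 (lc_ne_zero hg))

instance : NoZeroDivisors (SkewPolynomial F) where
  eq_zero_or_eq_zero_of_mul_eq_zero {f g} h := by
    by_contra! h'
    exact lc_mul_ne_zero h'.1 h'.2 (by rw [h]; rfl)

theorem deg_mul {f g : SkewPolynomial F} (hf : f ≠ 0) (hg : g ≠ 0) :
    deg (f * g) = deg f + deg g :=
  le_antisymm (deg_mul_le f g) (le_deg (lc_mul_ne_zero hf hg))

theorem lc_mul {f g : SkewPolynomial F} (hf : f ≠ 0) (hg : g ≠ 0) :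
    lc (f * g) = lc f * φ^[deg f] (lc g) := by
  rw [lc, deg_mul hf hg, coeff_mul_add]

theorem deg_one : deg (1 : SkewPolynomial F) = 0 := by
  rw [← SkewPolynomial.C_1, deg_C]

theorem isDegree_deg : IsDegree (deg : SkewPolynomial F → ℕ) where
  map_zero := deg_zero
  map_one := deg_one
  map_mul := deg_mul
  map_neg := deg_neg
  map_add_le := deg_add_le

theorem lc_C (a : F) : lc (SkewPolynomial.C a) = a := by
  rw [lc, deg_C, SkewPolynomial.coeff_C_zero]

theorem deg_X_pow (n : ℕ) : deg (SkewPolynomial.X ^ n : SkewPolynomial F) = n := by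
  rw [SkewPolynomial.X_pow_eq_monomial, deg_monomial one_ne_zero]

theorem isUnit_of_deg_eq_zero {p : SkewPolynomial F} (h0 : p ≠ 0) (h : deg p = 0) : IsUnit p := by
  rw [eq_C_of_deg_eq_zero h, ← SkewPolynomial.CRingHom_eq_C]
  refine IsUnit.map _ (IsUnit.mk0 _ fun h' => h0 ?_)
  rw [eq_C_of_deg_eq_zero h, h', SkewPolynomial.C_0]

theorem deg_eq_zero_of_isUnit {p : SkewPolynomial F} (h : IsUnit p) : deg p = 0 := by
  obtain ⟨u, rfl⟩ := h
  have h1 := deg_mul (f := (u : SkewPolynomial F)) (g := ↑u⁻¹) u.ne_zero u⁻¹.ne_zero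
  rw [Units.mul_inv, deg_one] at h1
  omega

/-- Left division with remainder, as a statement of existence. -/
theorem exists_div (f : SkewPolynomial F) {g : SkewPolynomial F} (hg : g ≠ 0) :
    ∃ q r, f = q * g + r ∧ (r = 0 ∨ deg r < deg g) := by
  induction h : deg f using Nat.strong_induction_on generalizing f with
  | _ n ih =>
    by_cases h0 : f = 0
    · exact ⟨0, 0, by simp [h0], Or.inl rfl⟩
    by_cases hlt : deg f < deg g
    · exact ⟨0, f, by simp, Or.inr hlt⟩
    push Not at hlt
    have hb : φ^[deg f - deg g] (lc g) ≠ 0 := mt phi_iter_eq_zero.1 (lc_ne_zero hg)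
    set m := SkewPolynomial.monomial (deg f - deg g) (lc f / φ^[deg f - deg g] (lc g)) with hm
    have ha : lc f / φ^[deg f - deg g] (lc g) ≠ 0 := div_ne_zero (lc_ne_zero h0) hb
    have hm0 : m ≠ 0 := by rwa [hm, Ne, SkewPolynomial.monomial_eq_zero_iff]
    have hd : deg m = deg f - deg g := deg_monomial ha _
    have htop : (f - m * g).coeff (deg f) = 0 := by
      have h1 := coeff_mul_add m g
      rw [hd, Nat.sub_add_cancel hlt, lc, hd, hm, SkewPolynomial.coeff_monomial, if_pos rfl,
        div_mul_cancel₀ _ hb] at h1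
      rw [SkewPolynomial.coeff_sub, h1, lc, sub_self]
    by_cases h1 : f - m * g = 0
    · exact ⟨m, 0, by rw [add_zero]; exact sub_eq_zero.1 h1, Or.inl rfl⟩
    have h2 : deg (f - m * g) < n := by
      have h3 := isDegree_deg.sub_le f (m * g)
      rw [deg_mul hm0 hg, hd] at h3
      refine lt_of_le_of_ne (by omega) fun h4 => lc_ne_zero h1 ?_
      rw [lc, h4, ← h, htop]
    obtain ⟨q, r, hqr, hr⟩ := ih _ h2 _ rfl
    exact ⟨m + q, r, by rw [add_mul, add_assoc, ← hqr]; abel, hr⟩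

/-- Right divisibility: `f` is a right factor of `g`, that is, `g ∈ R f`. -/
def RDvd (f g : SkewPolynomial F) : Prop := ∃ h, g = h * f

theorem RDvd.refl (f : SkewPolynomial F) : RDvd f f := ⟨1, (one_mul f).symm⟩

theorem RDvd.trans {f g h : SkewPolynomial F} (h1 : RDvd f g) (h2 : RDvd g h) : RDvd f h := by
  obtain ⟨a, rfl⟩ := h1
  obtain ⟨b, rfl⟩ := h2
  exact ⟨b * a, (mul_assoc ..).symm⟩

theorem RDvd.mul_left {f g : SkewPolynomial F} (h : RDvd f g) (a : SkewPolynomial F) :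
    RDvd f (a * g) := h.trans ⟨a, rfl⟩

theorem RDvd.add {f g h : SkewPolynomial F} (h1 : RDvd f g) (h2 : RDvd f h) : RDvd f (g + h) := by
  obtain ⟨a, rfl⟩ := h1
  obtain ⟨b, rfl⟩ := h2
  exact ⟨a + b, (add_mul ..).symm⟩

theorem RDvd.neg {f g : SkewPolynomial F} (h1 : RDvd f g) : RDvd f (-g) := by
  obtain ⟨a, rfl⟩ := h1
  exact ⟨-a, by rw [neg_mul]⟩

theorem RDvd.sub {f g h : SkewPolynomial F} (h1 : RDvd f g) (h2 : RDvd f h) : RDvd f (g - h) := by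
  rw [sub_eq_add_neg]; exact h1.add h2.neg

theorem RDvd.zero (f : SkewPolynomial F) : RDvd f 0 := ⟨0, by rw [zero_mul]⟩

theorem RDvd.ne_zero {f g : SkewPolynomial F} (h : RDvd f g) (hg : g ≠ 0) : f ≠ 0 := by
  rintro rfl
  obtain ⟨a, rfl⟩ := h
  exact hg (mul_zero a)

theorem RDvd.deg_le {f g : SkewPolynomial F} (h : RDvd f g) (hg : g ≠ 0) : deg f ≤ deg g := by
  have hf := h.ne_zero hg
  obtain ⟨a, rfl⟩ := h
  rw [deg_mul (left_ne_zero_of_mul hg) hf]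
  omega

theorem RDvd.sum {ι : Type*} (s : Finset ι) {f : SkewPolynomial F} {g : ι → SkewPolynomial F}
    (h : ∀ i ∈ s, RDvd f (g i)) : RDvd f (∑ i ∈ s, g i) := by
  classical
  induction s using Finset.induction_on with
  | empty => exact RDvd.zero f
  | insert a s ha ih =>
    rw [Finset.sum_insert ha]
    exact (h a (Finset.mem_insert_self ..)).add
      (ih fun i hi => h i (Finset.mem_insert_of_mem hi))

theorem rdvd_of_deg_eq_zero {f : SkewPolynomial F} (h0 : f ≠ 0) (h : deg f = 0)
    (g : SkewPolynomial F) : RDvd f g := by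
  obtain ⟨u, rfl⟩ := isUnit_of_deg_eq_zero h0 h
  exact ⟨g * ↑u⁻¹, by rw [mul_assoc, Units.inv_mul, mul_one]⟩

/-- A left multiple of the same degree generates the same left ideal. -/
theorem RDvd.symm_of_deg_le {f g : SkewPolynomial F} (h : RDvd f g) (hg : g ≠ 0)
    (hd : deg g ≤ deg f) : RDvd g f := by
  have hf := h.ne_zero hg
  obtain ⟨a, rfl⟩ := h
  have ha := left_ne_zero_of_mul hg
  rw [deg_mul ha hf] at hd
  obtain ⟨u, rfl⟩ := isUnit_of_deg_eq_zero ha (by omega)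
  exact ⟨↑u⁻¹, by rw [← mul_assoc, Units.inv_mul, one_mul]⟩

/-- Every left ideal of `F[X; σ]` is principal. -/
theorem exists_generator (I : Ideal (SkewPolynomial F)) : ∃ d, ∀ t, t ∈ I ↔ RDvd d t := by
  classical
  by_cases h : ∃ t ∈ I, t ≠ 0
  · have hex : ∃ n, ∃ t ∈ I, t ≠ 0 ∧ deg t = n := by
      obtain ⟨t, ht, h0⟩ := h
      exact ⟨_, t, ht, h0, rfl⟩
    obtain ⟨d, hd, hd0, hdn⟩ := Nat.find_spec hex
    refine ⟨d, fun t => ⟨fun ht => ?_, ?_⟩⟩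
    · obtain ⟨q, r, rfl, hr⟩ := exists_div t hd0
      have hrI : r ∈ I := by
        have := I.sub_mem ht (I.mul_mem_left q hd)
        rwa [add_sub_cancel_left] at this
      by_cases hr0 : r = 0
      · rw [hr0, add_zero]; exact ⟨q, rfl⟩
      · exact absurd ⟨r, hrI, hr0, rfl⟩ (Nat.find_min hex (hdn ▸ hr.resolve_left hr0))
    · rintro ⟨a, rfl⟩
      exact I.mul_mem_left a hd
  · push Not at h
    refine ⟨0, fun t => ⟨fun ht => ?_, ?_⟩⟩
    · rw [h t ht]; exact RDvd.refl 0
    · rintro ⟨a, rfl⟩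
      rw [mul_zero]; exact I.zero_mem

end SkewBasic

end SkewFact

namespace SkewFact

open SkewPolynomial (φ)

/-! ### The center of the skew polynomial ring -/

section Center

variable {F : Type u} [Field F] [MulSemiringAction (Multiplicative ℕ) F]

theorem phi_iter_coe (k : ℕ) (c : fixedField F) : φ^[k] (c : F) = c := by
  induction k with
  | zero => rfl
  | succ k ih => rw [Function.iterate_succ_apply', ih]; exact c.2

theorem phi_iter_eq_id_iff {j : ℕ} : (∀ a : F, φ^[j] a = a) ↔ autOrder F ∣ j := by
  rw [autOrder, orderOf_dvd_iff_pow_eq_one, RingHom.ext_iff]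
  simp only [RingHom.coe_pow, RingHom.coe_one, id]

theorem phi_iter_autOrder_mul (j : ℕ) (a : F) : φ^[autOrder F * j] a = a :=
  phi_iter_eq_id_iff.2 (dvd_mul_right ..) a

theorem phi_surjective [Finite F] : Function.Surjective (φ : F →+* F) :=
  Finite.surjective_of_injective (RingHom.injective _)

theorem autOrder_pos [Finite F] : 0 < autOrder F := by
  have : Finite (F →+* F) := DFunLike.finite _
  obtain ⟨i, j, hne, h⟩ := Finite.exists_ne_map_eq_of_infinite fun n : ℕ => (φ : F →+* F) ^ n
  wlog hij : i < j generalizing i j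
  · exact this j i hne.symm h.symm (by omega)
  refine orderOf_pos_iff.2 (isOfFinOrder_iff_pow_eq_one.2 ⟨j - i, by omega, ?_⟩)
  ext a
  obtain ⟨c, rfl⟩ := (phi_surjective (F := F)).iterate i a
  have h1 := RingHom.congr_fun h c
  simp only [RingHom.coe_pow] at h1
  rw [RingHom.coe_pow, ← Function.iterate_add_apply, Nat.sub_add_cancel hij.le, ← h1]
  rfl

/-- Powers of `σ` that agree have congruent exponents. -/
theorem autOrder_dvd_sub {i n : ℕ} (hin : i ≤ n) (h : ∀ a : F, φ^[i] a = φ^[n] a) :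
    autOrder F ∣ n - i := by
  refine phi_iter_eq_id_iff.1 fun a => ?_
  have h1 := h a
  rw [← Nat.add_sub_cancel' hin, Function.iterate_add_apply, ← RingHom.coe_pow] at h1
  exact ((RingHom.injective _) h1).symm

/-- The embedding of `K[z]` as a ring homomorphism. -/
noncomputable def embHom : Polynomial (fixedField F) →+* SkewPolynomial F :=
  Polynomial.eval₂RingHom' (SkewPolynomial.CRingHom.comp (fixedField F).subtype)
    (SkewPolynomial.X ^ autOrder F) fun c => by
      rw [Commute, SemiconjBy, RingHom.comp_apply, SkewPolynomial.CRingHom_eq_C,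
        SkewPolynomial.X_pow_eq_monomial, SkewPolynomial.C_mul_monomial,
        SkewPolynomial.monomial_mul_C, mul_one, one_mul]
      exact congrArg _ (phi_iter_coe _ c).symm

theorem embHom_apply (p : Polynomial (fixedField F)) : embHom p = emb p := by
  change Polynomial.eval₂ _ _ p = _
  rw [Polynomial.eval₂_eq_sum, emb]
  refine Finset.sum_congr rfl fun i _ => ?_
  beta_reduce
  rw [← pow_mul, RingHom.comp_apply, SkewPolynomial.CRingHom_eq_C,
    SkewPolynomial.C_mul_X_pow_eq_monomial]
  rfl

theorem emb_mul (p q : Polynomial (fixedField F)) : emb (p * q) = emb p * emb q := by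
  simp only [← embHom_apply, map_mul]

theorem emb_sub (p q : Polynomial (fixedField F)) : emb (p - q) = emb p - emb q := by
  simp only [← embHom_apply, map_sub]

theorem emb_zero : emb (0 : Polynomial (fixedField F)) = 0 := by
  rw [← embHom_apply, map_zero]

theorem emb_one : emb (1 : Polynomial (fixedField F)) = 1 := by
  rw [← embHom_apply, map_one]

theorem emb_C (c : fixedField F) : emb (Polynomial.C c) = SkewPolynomial.C (c : F) := by
  rw [emb, Polynomial.sum_C_index (by simp), mul_zero]
  rfl

/-- `K[z]` is central. -/
theorem emb_comm (p : Polynomial (fixedField F)) (g : SkewPolynomial F) :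
    emb p * g = g * emb p := by
  rw [eq_sum_monomial g (Nat.lt_succ_self _), Finset.mul_sum, Finset.sum_mul]
  refine Finset.sum_congr rfl fun i _ => ?_
  rw [emb, Polynomial.sum, Finset.mul_sum, Finset.sum_mul]
  refine Finset.sum_congr rfl fun j _ => ?_
  rw [SkewPolynomial.monomial_mul_monomial, SkewPolynomial.monomial_mul_monomial, phi_iter_coe,
    phi_iter_autOrder_mul, add_comm, mul_comm (p.coeff j : F)]

variable [Finite F]

theorem coeff_emb (p : Polynomial (fixedField F)) (n : ℕ) :
    (emb p).coeff n = if autOrder F ∣ n then (p.coeff (n / autOrder F) : F) else 0 := by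
  have hμ := autOrder_pos (F := F)
  rw [emb, Polynomial.sum, coeff_sum_skew]
  simp only [SkewPolynomial.coeff_monomial]
  split_ifs with h
  · obtain ⟨j, rfl⟩ := h
    rw [Nat.mul_div_cancel_left _ hμ]
    simp only [mul_right_inj' hμ.ne', Finset.sum_ite_eq', Polynomial.mem_support_iff, ne_eq]
    split_ifs with h0
    · rfl
    · rw [Polynomial.notMem_support_iff.1 h0]; rfl
  · refine Finset.sum_eq_zero fun i _ => if_neg ?_
    rintro rfl
    exact h (dvd_mul_right ..)

theorem coeff_emb_mul (p : Polynomial (fixedField F)) (n : ℕ) :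
    (emb p).coeff (autOrder F * n) = p.coeff n := by
  rw [coeff_emb, if_pos (dvd_mul_right ..), Nat.mul_div_cancel_left _ autOrder_pos]

theorem coeff_emb_zero (p : Polynomial (fixedField F)) : (emb p).coeff 0 = p.coeff 0 := by
  simpa using coeff_emb_mul p 0

theorem emb_injective : Function.Injective (emb : Polynomial (fixedField F) → _) := by
  intro p q h
  ext n
  rw [← coeff_emb_mul, ← coeff_emb_mul, h]

theorem emb_ne_zero {p : Polynomial (fixedField F)} (h : p ≠ 0) : emb p ≠ 0 := fun h' =>
  h (emb_injective (h'.trans emb_zero.symm))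

theorem deg_emb (p : Polynomial (fixedField F)) : deg (emb p) = autOrder F * p.natDegree := by
  by_cases h : p = 0
  · rw [h, emb_zero, deg_zero, Polynomial.natDegree_zero, mul_zero]
  apply le_antisymm
  · refine deg_le fun i hi => ?_
    rw [coeff_emb]
    split_ifs with hd
    · obtain ⟨j, rfl⟩ := hd
      rw [Nat.mul_div_cancel_left _ autOrder_pos, Polynomial.coeff_eq_zero_of_natDegree_lt]
      · rfl
      · exact lt_of_mul_lt_mul_left hi (Nat.zero_le _)
    · rfl
  · refine le_deg ?_
    rw [coeff_emb_mul]
    simpa using h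

theorem lc_emb (p : Polynomial (fixedField F)) : lc (emb p) = p.leadingCoeff := by
  rw [lc, deg_emb, coeff_emb_mul]; rfl

/-- Divisibility of central elements can be tested in `F[X; σ]`. -/
theorem dvd_of_rdvd_emb {p q : Polynomial (fixedField F)} (h : RDvd (emb p) (emb q)) : p ∣ q := by
  by_cases hp : p = 0
  · obtain ⟨a, ha⟩ := h
    rw [hp, emb_zero, mul_zero] at ha
    rw [emb_injective (ha.trans emb_zero.symm)]
    exact dvd_zero p
  rw [← EuclideanDomain.mod_eq_zero]
  by_contra h0
  have h1 : RDvd (emb p) (emb (q % p)) := by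
    have : q % p = q - (q / p) * p := by
      rw [eq_sub_iff_add_eq, mul_comm]; exact EuclideanDomain.mod_add_div q p
    rw [this, emb_sub]
    exact h.sub ⟨emb (q / p), emb_mul _ _⟩
  have h2 := h1.deg_le (emb_ne_zero h0)
  rw [deg_emb, deg_emb] at h2
  have h3 : q % p = 0 ∨ (q % p).natDegree < p.natDegree := by
    by_cases hu : p.natDegree = 0
    · left
      rw [EuclideanDomain.mod_eq_zero]
      exact (Polynomial.isUnit_iff_degree_eq_zero.2
        (by rw [Polynomial.degree_eq_natDegree hp, hu]; rfl)).dvd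
    · exact Or.inr (Polynomial.natDegree_mod_lt q hu)
  have := le_of_mul_le_mul_left h2 autOrder_pos
  exact absurd (h3.resolve_left h0) (by omega)

theorem rdvd_emb_of_dvd {p q : Polynomial (fixedField F)} (h : p ∣ q) :
    RDvd (emb p) (emb q) := by
  obtain ⟨a, rfl⟩ := h
  exact ⟨emb a, by rw [mul_comm, emb_mul]⟩

/-- In a factorization `h f` of a central element the factors commute. -/
theorem mul_eq_emb_comm {f h : SkewPolynomial F} {p : Polynomial (fixedField F)} (hf : f ≠ 0)
    (H : emb p = h * f) : emb p = f * h := by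
  refine mul_right_cancel₀ hf ?_
  rw [mul_assoc, ← H, emb_comm]

/-! ### Invariant elements and the bound -/

/-- An invariant element: `p R ⊆ R p`. -/
def IsInv (p : SkewPolynomial F) : Prop := ∀ g, RDvd p (p * g)

theorem isInv_emb_mul_X_pow (p : Polynomial (fixedField F)) (m : ℕ) :
    IsInv (emb p * SkewPolynomial.X ^ m) := fun g => by
  refine ⟨g.sum (fun (a : ℕ) b ↦ SkewPolynomial.monomial a (φ^[m] b)), ?_⟩
  rw [mul_assoc, SkewPolynomial.X_pow_mul, ← mul_assoc, emb_comm, mul_assoc]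

theorem isInv_emb (p : Polynomial (fixedField F)) : IsInv (emb p) := fun g =>
  ⟨g, emb_comm p g⟩

/-- Invariance has to be tested on algebra generators only. -/
theorem isInv_of_gens {gens : List F}
    (hgens : Algebra.adjoin (fixedField F) {a : F | a ∈ gens} = ⊤) {p : SkewPolynomial F}
    (hp : ∀ d ∈ gens.map SkewPolynomial.C ++ [SkewPolynomial.X], RDvd p (p * d)) : IsInv p := by
  have hmul : ∀ {a b}, RDvd p (p * a) → RDvd p (p * b) → RDvd p (p * (a * b)) := by
    rintro a b ⟨x, hx⟩ ⟨y, hy⟩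
    exact ⟨x * y, by rw [← mul_assoc, hx, mul_assoc, hy, mul_assoc]⟩
  have hC : ∀ a : F, RDvd p (p * SkewPolynomial.C a) := by
    intro a
    have ha : a ∈ Algebra.adjoin (fixedField F) {a : F | a ∈ gens} := by
      rw [hgens]; exact Algebra.mem_top
    induction ha using Algebra.adjoin_induction with
    | mem x hx =>
      exact hp _ (List.mem_append_left _ (List.mem_map.2 ⟨x, hx, rfl⟩))
    | algebraMap r =>
      refine ⟨SkewPolynomial.C (r : F), ?_⟩
      have := emb_comm (Polynomial.C r) p
      rw [emb_C] at this
      exact this.symm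
    | add x y _ _ hx hy =>
      rw [SkewPolynomial.C_add, mul_add]; exact hx.add hy
    | mul x y _ _ hx hy =>
      rw [SkewPolynomial.C_mul]; exact hmul hx hy
  have hX : ∀ n : ℕ, RDvd p (p * SkewPolynomial.X ^ n) := by
    intro n
    induction n with
    | zero => rw [pow_zero, mul_one]; exact RDvd.refl p
    | succ n ih => rw [pow_succ]; exact hmul ih (hp _ (by simp))
  intro g
  rw [eq_sum_monomial g (Nat.lt_succ_self _), Finset.mul_sum]
  refine RDvd.sum _ fun i _ => ?_
  rw [← SkewPolynomial.C_mul_X_pow_eq_monomial]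
  exact hmul (hC _) (hX i)

/-- The central polynomial `f̂` with `p = f̂ X ^ m` for a monic invariant `p`. -/
noncomputable def centralPart (p : SkewPolynomial F) : Polynomial (fixedField F) :=
  ∑ i ∈ Finset.range (deg p + 1), Polynomial.monomial i
    (toFixed (p.coeff (lowDeg p + autOrder F * i)))

theorem coeff_centralPart (p : SkewPolynomial F) (i : ℕ) :
    (centralPart p).coeff i = toFixed (p.coeff (lowDeg p + autOrder F * i)) := by
  rw [centralPart, Polynomial.finsetSum_coeff]
  simp only [Polynomial.coeff_monomial, Finset.sum_ite_eq', Finset.mem_range]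
  split_ifs with h
  · rfl
  · have : deg p < lowDeg p + autOrder F * i :=
      lt_of_lt_of_le (by omega) ((Nat.le_mul_of_pos_left i (autOrder_pos (F := F))).trans
        (Nat.le_add_left ..))
    rw [coeff_eq_zero_of_deg_lt this, toFixed, dif_pos (Subfield.zero_mem _)]
    rfl

theorem coe_toFixed {a : F} (h : (φ : F →+* F) a = a) : ((toFixed a : fixedField F) : F) = a := by
  have : a ∈ fixedField F := h
  rw [toFixed, dif_pos this]

/-- The coefficients of a monic invariant element: they are fixed by `σ`, and their exponents are
congruent modulo the order of `σ`. -/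
theorem IsInv.coeff_spec {p : SkewPolynomial F} (hp : IsInv p) (h1 : lc p = 1) :
    (∀ i, (φ : F →+* F) (p.coeff i) = p.coeff i) ∧
      ∀ i, p.coeff i ≠ 0 → autOrder F ∣ deg p - i := by
  have h0 : p ≠ 0 := by
    rintro rfl
    exact zero_ne_one h1
  have hcong : ∀ i, p.coeff i ≠ 0 → autOrder F ∣ deg p - i := by
    intro i hi
    refine autOrder_dvd_sub (le_deg hi) fun a => ?_
    by_cases ha : a = 0
    · rw [ha, iterate_map_zero, iterate_map_zero]
    have ha' : SkewPolynomial.C a ≠ 0 := mt SkewPolynomial.C_eq_zero.1 ha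
    obtain ⟨h, hh⟩ := hp (SkewPolynomial.C a)
    have hh0 : h ≠ 0 := by
      rintro rfl
      rw [zero_mul] at hh
      exact mul_ne_zero h0 ha' hh
    have hd := congrArg deg hh
    rw [deg_mul h0 ha', deg_mul hh0 h0, deg_C] at hd
    have hC := eq_C_of_deg_eq_zero (p := h) (by omega)
    have hco : ∀ j, p.coeff j * φ^[j] a = h.coeff 0 * p.coeff j := by
      intro j
      have := congrArg (SkewPolynomial.coeff · j) hh
      beta_reduce at this
      rw [hC, coeff_C_mul, ← SkewPolynomial.monomial_zero_left, coeff_mul_monomial,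
        if_pos (Nat.zero_le _), Nat.sub_zero] at this
      rw [this]
    have hn := hco (deg p)
    rw [show p.coeff (deg p) = 1 from h1, one_mul, mul_one] at hn
    have hi' := hco i
    rw [← hn, mul_comm] at hi'
    exact mul_right_cancel₀ hi hi'
  refine ⟨fun i => ?_, hcong⟩
  obtain ⟨h, hh⟩ := hp SkewPolynomial.X
  have hX : (SkewPolynomial.X : SkewPolynomial F) ≠ 0 := SkewPolynomial.X_ne_zero
  have hdX : deg (SkewPolynomial.X : SkewPolynomial F) = 1 := by
    rw [← pow_one SkewPolynomial.X, deg_X_pow]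
  have hh0 : h ≠ 0 := by
    rintro rfl
    rw [zero_mul] at hh
    exact mul_ne_zero h0 hX hh
  have hd := congrArg deg hh
  rw [deg_mul h0 hX, deg_mul hh0 h0, hdX] at hd
  have hdh : deg h = 1 := by omega
  have hlc := congrArg lc hh
  rw [lc_mul h0 hX, lc_mul hh0 h0, h1, iterate_map_one, mul_one, one_mul] at hlc
  rw [lc, hdX, SkewPolynomial.coeff_X_one, iterate_map_one, lc, hdh] at hlc
  have hco : ∀ j, p.coeff j = φ (p.coeff j) + h.coeff 0 * p.coeff (j + 1) := by
    intro j
    have := congrArg (SkewPolynomial.coeff · (j + 1)) hh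
    beta_reduce at this
    rw [← pow_one SkewPolynomial.X, coeff_mul_X_pow, if_pos (by omega), Nat.add_sub_cancel,
      coeff_mul_skew, hdh, Finset.sum_range_succ, Finset.sum_range_one, if_pos (by omega),
      if_pos (by omega), ← hlc, one_mul, Nat.add_sub_cancel] at this
    rw [add_comm] at this
    exact this
  have hc0 : h.coeff 0 = 0 := by
    rcases Nat.eq_zero_or_pos (deg p) with hz | hpos
    · have := congrArg (SkewPolynomial.coeff · 0) hh
      beta_reduce at this
      rw [← pow_one SkewPolynomial.X, coeff_mul_X_pow, if_neg (by omega), coeff_mul_skew, hdh,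
        Finset.sum_range_succ, Finset.sum_range_one, if_pos (by omega), if_neg (by omega),
        add_zero] at this
      have h2 : p.coeff 0 = 1 := by rw [← h1, lc, hz]
      rw [Nat.sub_zero, h2] at this
      simpa using this.symm
    · have h2 := hco (deg p - 1)
      rw [Nat.sub_add_cancel hpos, show p.coeff (deg p) = 1 from h1, mul_one] at h2
      by_cases hμ : autOrder F = 1
      · have := phi_iter_autOrder_mul 1 (p.coeff (deg p - 1))
        rw [hμ, Nat.mul_one, Function.iterate_one] at this
        rw [this] at h2
        simpa using h2
      · have hz : p.coeff (deg p - 1) = 0 := by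
          by_contra hne
          have h3 := hcong _ hne
          rw [show deg p - (deg p - 1) = 1 by omega] at h3
          exact hμ (Nat.dvd_one.1 h3)
        rw [hz, map_zero, zero_add] at h2
        exact h2.symm
  have := hco i
  rw [hc0, zero_mul, add_zero] at this
  exact this.symm

/-- Invariant elements are, up to a unit, products of a central element and a power of `X`. -/
theorem IsInv.eq_emb_mul {p : SkewPolynomial F} (hp : IsInv p) (h1 : lc p = 1) :
    p = emb (centralPart p) * SkewPolynomial.X ^ lowDeg p ∧ (centralPart p).Monic ∧
      (centralPart p).coeff 0 ≠ 0 := by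
  obtain ⟨hfix, hcong⟩ := hp.coeff_spec h1
  have h0 : p ≠ 0 := by
    rintro rfl
    exact zero_ne_one h1
  have hμ := autOrder_pos (F := F)
  have hlow := coeff_lowDeg_ne_zero h0
  have heq : p = emb (centralPart p) * SkewPolynomial.X ^ lowDeg p := by
    ext i
    rw [coeff_mul_X_pow, coeff_emb]
    by_cases hi : lowDeg p ≤ i
    · rw [if_pos hi]
      by_cases hd : autOrder F ∣ i - lowDeg p
      · rw [if_pos hd, coeff_centralPart, coe_toFixed (hfix _), Nat.mul_div_cancel' hd,
          Nat.add_sub_cancel' hi]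
      · rw [if_neg hd]
        by_contra hne
        refine hd ?_
        have e1 := hcong i hne
        have e2 := hcong _ hlow
        have e3 := le_deg hne
        have := Nat.dvd_sub e2 e1
        rwa [show deg p - lowDeg p - (deg p - i) = i - lowDeg p by omega] at this
    · rw [if_neg hi]
      exact coeff_eq_zero_of_lt_lowDeg (by omega)
  have hne : emb (centralPart p) ≠ 0 := by
    intro h
    rw [h, zero_mul] at heq
    exact h0 heq
  refine ⟨heq, ?_, ?_⟩
  · have h2 := congrArg lc heq
    rw [lc_mul hne (pow_ne_zero _ SkewPolynomial.X_ne_zero), h1, lc_emb, lc, deg_X_pow,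
      SkewPolynomial.X_pow_eq_monomial, SkewPolynomial.coeff_monomial, if_pos rfl,
      iterate_map_one, mul_one] at h2
    exact Subtype.ext h2.symm
  · rw [coeff_centralPart]
    intro h
    apply hlow
    rw [← coe_toFixed (hfix _), ← Nat.add_zero (lowDeg p), ← Nat.mul_zero (autOrder F), h]
    rfl

end Center

end SkewFact

namespace SkewFact

open SkewPolynomial (φ)

/-! ### The bound of a skew polynomial -/

section Bound

variable {F : Type u} [Field F] [MulSemiringAction (Multiplicative ℕ) F]

theorem smul_eq_C_mul (a : F) (p : SkewPolynomial F) : a • p = SkewPolynomial.C a * p := by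
  ext i
  rw [coeff_C_mul]
  exact congrArg (fun q : Multiplicative ℕ →₀ F => q (Multiplicative.ofAdd i))
    (SkewMonoidAlgebra.coeff_smul a p)

variable [Finite F]

/-- Multiplication by the central element `z` is an `F`-linear endomorphism of `R / R f`, a space
of dimension at most `deg f`; its characteristic polynomial gives an element that annihilates
`R / R f`. -/
theorem exists_annihilator {f : SkewPolynomial F} (hf : f ≠ 0) :
    ∃ s, s ≠ 0 ∧ deg s ≤ autOrder F * deg f ∧ ∀ g, RDvd f (s * g) := by
  let N : Submodule F (SkewPolynomial F) :=
    { carrier := {g | RDvd f g}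
      add_mem' := fun ha hb => RDvd.add ha hb
      zero_mem' := RDvd.zero f
      smul_mem' := fun a g hg => by
        rw [smul_eq_C_mul]; exact RDvd.mul_left hg _ }
  let Z : SkewPolynomial F →ₗ[F] SkewPolynomial F :=
    { toFun := fun p => SkewPolynomial.X ^ autOrder F * p
      map_add' := fun p q => mul_add _ _ _
      map_smul' := fun a p => by
        rw [RingHom.id_apply, smul_eq_C_mul, smul_eq_C_mul, ← mul_assoc, ← mul_assoc,
          SkewPolynomial.C_mul_X_pow_eq_monomial, SkewPolynomial.X_pow_eq_monomial,
          SkewPolynomial.monomial_mul_C, one_mul]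
        congr 2
        simpa using phi_iter_autOrder_mul 1 a }
  have hZ : N ≤ N.comap Z := fun g hg => RDvd.mul_left hg _
  have hZpow : ∀ i g, (Z ^ i) g = SkewPolynomial.X ^ (autOrder F * i) * g := by
    intro i
    induction i with
    | zero => intro g; rw [pow_zero, mul_zero, pow_zero, one_mul]; rfl
    | succ i ih =>
      intro g
      rw [pow_succ', Module.End.mul_apply, ih, Nat.mul_succ, add_comm, pow_add, mul_assoc]
      rfl
  let L : (Fin (deg f) → F) →ₗ[F] (SkewPolynomial F ⧸ N) :=
    Fintype.linearCombination F fun i => N.mkQ (SkewPolynomial.X ^ (i : ℕ))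
  have hL : Function.Surjective L := by
    intro q
    obtain ⟨p, rfl⟩ := N.mkQ_surjective q
    obtain ⟨c, r, rfl, hr⟩ := exists_div p hf
    have hc : N.mkQ (c * f) = 0 := (Submodule.Quotient.mk_eq_zero N).2 ⟨c, rfl⟩
    refine ⟨fun i => r.coeff i, ?_⟩
    rw [map_add, hc, zero_add, Fintype.linearCombination_apply]
    simp only [← map_smul, ← map_sum]
    congr 1
    simp only [SkewPolynomial.smul_X_eq_monomial]
    refine (Finset.sum_range fun i => SkewPolynomial.monomial i (r.coeff i)).symm.trans ?_
    rcases hr with rfl | hr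
    · refine Finset.sum_eq_zero fun i _ => ?_
      rw [SkewPolynomial.coeff_zero, SkewPolynomial.monomial_zero_right]
    · exact (eq_sum_monomial r hr).symm
  have : Module.Finite F (SkewPolynomial F ⧸ N) := Module.Finite.of_surjective L hL
  have hdim : Module.finrank F (SkewPolynomial F ⧸ N) ≤ deg f := by
    have := LinearMap.finrank_le_finrank_of_surjective hL
    rwa [Module.finrank_fin_fun] at this
  set χ := (N.mapQ N Z hZ).charpoly with hχ
  have hχd : χ.natDegree ≤ deg f := by rwa [hχ, LinearMap.charpoly_natDegree]
  have hμ := autOrder_pos (F := F)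
  set s : SkewPolynomial F := ∑ i ∈ Finset.range (χ.natDegree + 1),
    SkewPolynomial.monomial (autOrder F * i) (χ.coeff i) with hs
  refine ⟨s, ?_, ?_, ?_⟩
  · intro h0
    have h1 := congrArg (SkewPolynomial.coeff · (autOrder F * χ.natDegree)) h0
    beta_reduce at h1
    rw [hs, coeff_sum_skew] at h1
    simp only [SkewPolynomial.coeff_monomial, mul_right_inj' hμ.ne', Finset.sum_ite_eq',
      Finset.mem_range, Nat.lt_succ_self, if_true, SkewPolynomial.coeff_zero] at h1
    exact one_ne_zero ((LinearMap.charpoly_monic (N.mapQ N Z hZ)).symm.trans h1)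
  · refine deg_le fun j hj => ?_
    rw [hs, coeff_sum_skew]
    refine Finset.sum_eq_zero fun i hi => ?_
    rw [Finset.mem_range] at hi
    rw [SkewPolynomial.coeff_monomial, if_neg]
    have : autOrder F * i ≤ autOrder F * deg f := Nat.mul_le_mul_left _ (by omega)
    omega
  · intro g
    have h1 := LinearMap.congr_fun (LinearMap.aeval_self_charpoly (N.mapQ N Z hZ)) (N.mkQ g)
    rw [← hχ, Polynomial.aeval_eq_sum_range, LinearMap.zero_apply, LinearMap.sum_apply] at h1
    have h2 : ∀ i, (χ.coeff i • (N.mapQ N Z hZ) ^ i) (N.mkQ g) =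
        N.mkQ (SkewPolynomial.monomial (autOrder F * i) (χ.coeff i) * g) := by
      intro i
      rw [LinearMap.smul_apply, ← Submodule.mapQ_pow, Submodule.mkQ_apply, Submodule.mapQ_apply,
        hZpow, ← Submodule.Quotient.mk_smul, smul_eq_C_mul, ← mul_assoc,
        SkewPolynomial.C_mul_X_pow_eq_monomial]
      rfl
    simp only [h2, ← map_sum, ← Finset.sum_mul] at h1
    exact (Submodule.Quotient.mk_eq_zero N).1 h1

/-- `t` generates the largest two-sided ideal contained in `R f`, which is
`{s | s R ⊆ R f}`. -/
structure IsBound (f t : SkewPolynomial F) : Prop where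
  inv : IsInv t
  rdvd : RDvd f t
  min : ∀ s, (∀ g, RDvd f (s * g)) → RDvd t s

theorem IsInv.rdvd_mul {f t : SkewPolynomial F} (ht : IsInv t) (h : RDvd f t)
    (g : SkewPolynomial F) : RDvd f (t * g) := h.trans (ht g)

theorem exists_isBound {f : SkewPolynomial F} (hf : f ≠ 0) :
    ∃ t, t ≠ 0 ∧ IsBound f t ∧ deg t ≤ autOrder F * deg f := by
  obtain ⟨s, hs0, hsd, hs⟩ := exists_annihilator hf
  let I : Ideal (SkewPolynomial F) :=
    { carrier := {t | ∀ g, RDvd f (t * g)}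
      add_mem' := fun ha hb g => by rw [add_mul]; exact (ha g).add (hb g)
      zero_mem' := fun g => by rw [zero_mul]; exact RDvd.zero f
      smul_mem' := fun c x hx g => by
        rw [smul_eq_mul, mul_assoc]; exact (hx g).mul_left c }
  obtain ⟨t, ht⟩ := exists_generator I
  have hts : RDvd t s := (ht s).1 hs
  have htI : t ∈ I := (ht t).2 (RDvd.refl t)
  refine ⟨t, hts.ne_zero hs0, ⟨fun g => (ht _).1 fun g' => ?_, ?_, fun s' hs' => (ht s').1 hs'⟩,
    (hts.deg_le hs0).trans hsd⟩
  · rw [mul_assoc]; exact htI _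
  · simpa using htI 1

/-- Normalization of a bound. -/
theorem IsBound.monic {f t : SkewPolynomial F} (ht : IsBound f t) (h0 : t ≠ 0) :
    IsBound f (SkewPolynomial.C (lc t)⁻¹ * t) ∧ lc (SkewPolynomial.C (lc t)⁻¹ * t) = 1 := by
  have hu : (lc t)⁻¹ ≠ 0 := inv_ne_zero (lc_ne_zero h0)
  have hback : ∀ s, RDvd t s → RDvd (SkewPolynomial.C (lc t)⁻¹ * t) s := by
    rintro s ⟨a, rfl⟩
    refine ⟨a * SkewPolynomial.C (lc t), ?_⟩
    rw [mul_assoc, ← mul_assoc (SkewPolynomial.C (lc t)), ← SkewPolynomial.C_mul,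
      mul_inv_cancel₀ (lc_ne_zero h0), SkewPolynomial.C_1, one_mul]
  refine ⟨⟨fun g => ?_, ht.rdvd.mul_left _, fun s hs => hback s (ht.min s hs)⟩, ?_⟩
  · rw [mul_assoc]
    exact hback _ ((ht.inv g).mul_left _)
  · rw [lc_mul (mt SkewPolynomial.C_eq_zero.1 hu) h0, lc_C, deg_C]
    exact inv_mul_cancel₀ (lc_ne_zero h0)

/-- An invariant right factor of an irreducible central polynomial `π ≠ z` is trivial. -/
theorem IsInv.deg_eq_zero_or_rdvd {π : Polynomial (fixedField F)} (hπ : Irreducible π)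
    (hπ0 : π.coeff 0 ≠ 0) {t : SkewPolynomial F} (ht : IsInv t) (h : RDvd t (emb π)) :
    deg t = 0 ∨ RDvd (emb π) t := by
  have ht0 : t ≠ 0 := h.ne_zero (emb_ne_zero hπ.ne_zero)
  have htb : IsBound t t := ⟨ht, RDvd.refl t, fun s hs => by simpa using hs 1⟩
  obtain ⟨hb, hlc⟩ := htb.monic ht0
  have hu : (lc t)⁻¹ ≠ 0 := inv_ne_zero (lc_ne_zero ht0)
  have hdeg : deg (SkewPolynomial.C (lc t)⁻¹ * t) = deg t := by
    rw [deg_mul (mt SkewPolynomial.C_eq_zero.1 hu) ht0, deg_C, zero_add]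
  set t' := SkewPolynomial.C (lc t)⁻¹ * t
  obtain ⟨heq, hmon, -⟩ := hb.inv.eq_emb_mul hlc
  set Q := centralPart t'
  have hπt : RDvd t' (emb π) := hb.min _ fun g => (isInv_emb π).rdvd_mul h g
  have hm : lowDeg t' = 0 := by
    by_contra hm
    obtain ⟨a, ha⟩ := hπt
    rw [heq, ← mul_assoc] at ha
    have h1 := congrArg (SkewPolynomial.coeff · 0) ha
    beta_reduce at h1
    rw [coeff_mul_X_pow, if_neg (by omega), coeff_emb_zero] at h1
    exact hπ0 (Subtype.ext h1)
  rw [hm, pow_zero, mul_one] at heq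
  have hQ : Q ∣ π := dvd_of_rdvd_emb (heq ▸ hπt)
  have hQd : deg t = autOrder F * Q.natDegree := by rw [← hdeg, heq, deg_emb]
  rcases hπ.dvd_iff.1 hQ with hQu | hQa
  · left
    rw [hQd, Polynomial.natDegree_eq_zero_of_isUnit hQu, mul_zero]
  · right
    have h2 := rdvd_emb_of_dvd hQa.dvd
    rw [← heq] at h2
    -- the unit multiple `t'` of `t` generates the same left ideal
    refine h2.trans ⟨SkewPolynomial.C (lc t), ?_⟩
    rw [← mul_assoc, ← SkewPolynomial.C_mul, mul_inv_cancel₀ (lc_ne_zero ht0),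
      SkewPolynomial.C_1, one_mul]

/-- A nonconstant right factor of an irreducible central polynomial `π ≠ z` has degree at least
the degree of `π` in `z`. -/
theorem natDegree_le_deg {π : Polynomial (fixedField F)} (hπ : Irreducible π)
    (hπ0 : π.coeff 0 ≠ 0) {f : SkewPolynomial F} (hf : RDvd f (emb π)) (hd : 1 ≤ deg f) :
    π.natDegree ≤ deg f := by
  obtain ⟨t, ht0, htb, htd⟩ := exists_isBound (hf.ne_zero (emb_ne_zero hπ.ne_zero))
  have hft : 1 ≤ deg t := hd.trans (htb.rdvd.deg_le ht0)
  have hπt : RDvd t (emb π) := htb.min _ fun g => (isInv_emb π).rdvd_mul hf g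
  have h1 := (htb.inv.deg_eq_zero_or_rdvd hπ hπ0 hπt).resolve_left (by omega)
  have h2 := (h1.deg_le ht0).trans htd
  rw [deg_emb] at h2
  exact Nat.le_of_mul_le_mul_left h2 autOrder_pos

theorem irreducible_of_deg_eq {π : Polynomial (fixedField F)} (hπ : Irreducible π)
    (hπ0 : π.coeff 0 ≠ 0) {f : SkewPolynomial F} (hf : RDvd f (emb π))
    (hd : π.natDegree = deg f) : Irreducible f := by
  have hf0 : f ≠ 0 := hf.ne_zero (emb_ne_zero hπ.ne_zero)
  have hpos : 0 < π.natDegree := hπ.natDegree_pos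
  refine ⟨fun hu => ?_, fun a b hab => ?_⟩
  · rw [deg_eq_zero_of_isUnit hu] at hd
    omega
  · have hab0 : a * b ≠ 0 := hab ▸ hf0
    have ha0 := left_ne_zero_of_mul hab0
    have hb0 := right_ne_zero_of_mul hab0
    have hdm := deg_mul ha0 hb0
    rw [← hab] at hdm
    by_cases hb : deg b = 0
    · exact Or.inr (isUnit_of_deg_eq_zero hb0 hb)
    · have := natDegree_le_deg hπ hπ0 (RDvd.trans ⟨a, hab⟩ hf) (by omega)
      exact Or.inl (isUnit_of_deg_eq_zero ha0 (by omega))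

/-- A left factor of a right factor of a central element is also a right factor of this
element. -/
theorem RDvd.left_factor {π : Polynomial (fixedField F)} {h g : SkewPolynomial F}
    (hg : g ≠ 0) (H : RDvd (h * g) (emb π)) : RDvd h (emb π) := by
  obtain ⟨u, hu⟩ := H
  rw [← mul_assoc] at hu
  exact ⟨g * u, by rw [mul_eq_emb_comm hg hu, mul_assoc]⟩

/-- If `f(0) ≠ 0`, then `X` acts injectively on `R / R f`. -/
theorem rdvd_of_rdvd_X_mul {f g : SkewPolynomial F} (hf : f.coeff 0 ≠ 0)
    (h : RDvd f (SkewPolynomial.X * g)) : RDvd f g := by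
  obtain ⟨a, ha⟩ := h
  have ha0 : a.coeff 0 = 0 := by
    have h1 := congrArg (SkewPolynomial.coeff · 0) ha
    beta_reduce at h1
    rw [← SkewPolynomial.monomial_one_one_eq_X, coeff_monomial_mul, if_neg (by omega),
      coeff_mul_skew, Finset.sum_eq_single 0] at h1
    · rw [if_pos le_rfl] at h1
      exact (mul_eq_zero.1 h1.symm).resolve_right hf
    · intro i _ hi
      rw [if_neg (by omega)]
    · simp
  choose τ hτ using phi_surjective (F := F)
  have hτ' : a = SkewPolynomial.X *
      ∑ i ∈ Finset.range (deg a), SkewPolynomial.monomial i (τ (a.coeff (i + 1))) := by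
    simp only [Finset.mul_sum, SkewPolynomial.X_mul_monomial, hτ]
    conv_lhs => rw [eq_sum_monomial a (Nat.lt_succ_self _), Finset.sum_range_succ', ha0,
      SkewPolynomial.monomial_zero_right, add_zero]
  rw [hτ', mul_assoc] at ha
  exact ⟨_, mul_left_cancel₀ SkewPolynomial.X_ne_zero ha⟩

/-- The power of `X` in the bound of `f` is the power of `X` that divides `f`, and the central part
`f̂` of the bound generates the ideal of the central multiples of the cofactor. -/
theorem IsBound.split {f p : SkewPolynomial F} (hf : f ≠ 0) (hp : IsBound f p) (h1 : lc p = 1) :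
    ∃ f₁, f = f₁ * SkewPolynomial.X ^ lowDeg p ∧ RDvd f₁ (emb (centralPart p)) ∧
      ∀ Q, RDvd f₁ (emb Q) → centralPart p ∣ Q := by
  have hX : ∀ n : ℕ, (SkewPolynomial.X ^ n : SkewPolynomial F) ≠ 0 := fun n =>
    pow_ne_zero _ SkewPolynomial.X_ne_zero
  obtain ⟨heq, hmon, hQ0⟩ := hp.inv.eq_emb_mul h1
  set f₁ : SkewPolynomial F := ∑ i ∈ Finset.range (deg f + 1),
    SkewPolynomial.monomial i (f.coeff (lowDeg f + i)) with hf₁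
  have hco : ∀ j, f₁.coeff j = f.coeff (lowDeg f + j) := by
    intro j
    rw [hf₁, coeff_sum_skew]
    simp only [SkewPolynomial.coeff_monomial, Finset.sum_ite_eq', Finset.mem_range]
    split_ifs with h
    · rfl
    · exact (coeff_eq_zero_of_deg_lt (by omega)).symm
  have hff : f = f₁ * SkewPolynomial.X ^ lowDeg f := by
    ext j
    rw [coeff_mul_X_pow]
    split_ifs with h
    · rw [hco, Nat.add_sub_cancel' h]
    · exact coeff_eq_zero_of_lt_lowDeg (by omega)
  have hf10 : f₁.coeff 0 ≠ 0 := by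
    rw [hco]; exact coeff_lowDeg_ne_zero hf
  have hf1 : f₁ ≠ 0 := by
    intro h; rw [h] at hf10; exact hf10 rfl
  -- the bound of the cofactor is central
  obtain ⟨t, ht0, htb, -⟩ := exists_isBound hf1
  obtain ⟨hb, hlc⟩ := htb.monic ht0
  set t' := SkewPolynomial.C (lc t)⁻¹ * t
  obtain ⟨heq', hmon', hQ0'⟩ := hb.inv.eq_emb_mul hlc
  have ht' : t' ≠ 0 := by
    intro h
    rw [h, lc, SkewPolynomial.coeff_zero] at hlc
    exact zero_ne_one hlc
  have hm' : lowDeg t' = 0 := by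
    by_contra hm
    have h2 : RDvd t' (emb (centralPart t') * SkewPolynomial.X ^ (lowDeg t' - 1)) := by
      refine hb.min _ fun g => rdvd_of_rdvd_X_mul hf10 ?_
      have h3 : SkewPolynomial.X *
          (emb (centralPart t') * SkewPolynomial.X ^ (lowDeg t' - 1) * g) = t' * g := by
        conv_rhs => rw [heq']
        rw [← mul_assoc, ← mul_assoc, ← emb_comm, mul_assoc (emb _), ← pow_succ',
          Nat.sub_add_cancel (by omega)]
      rw [h3]
      exact hb.inv.rdvd_mul hb.rdvd g
    have h4 := h2.deg_le (mul_ne_zero (emb_ne_zero hmon'.ne_zero) (hX _))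
    conv_lhs at h4 => rw [heq']
    rw [deg_mul (emb_ne_zero hmon'.ne_zero) (hX _), deg_mul (emb_ne_zero hmon'.ne_zero) (hX _),
      deg_X_pow, deg_X_pow] at h4
    omega
  rw [hm', pow_zero, mul_one] at heq'
  have hmin : ∀ Q, RDvd f₁ (emb Q) →
      RDvd p (emb Q * SkewPolynomial.X ^ lowDeg f) := by
    rintro Q ⟨a, ha⟩
    refine hp.min _ fun g => (isInv_emb_mul_X_pow Q _).rdvd_mul ⟨a, ?_⟩ g
    rw [hff, ← mul_assoc, ← ha]
    congr 2
    rw [← hff]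
  have hlow : lowDeg p = lowDeg f := by
    apply le_antisymm
    · obtain ⟨a, ha⟩ := hmin _ (heq' ▸ hb.rdvd)
      by_contra hlt
      have h5 := congrArg (SkewPolynomial.coeff · (lowDeg f)) ha
      beta_reduce at h5
      rw [heq, ← mul_assoc, coeff_mul_X_pow, coeff_mul_X_pow, if_pos le_rfl, if_neg hlt,
        Nat.sub_self, coeff_emb_zero] at h5
      exact hQ0' (Subtype.ext h5)
    · obtain ⟨a, ha⟩ := hp.rdvd
      by_contra hlt
      have h5 := congrArg (SkewPolynomial.coeff · (lowDeg p)) ha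
      beta_reduce at h5
      rw [hff, ← mul_assoc, coeff_mul_X_pow, if_neg hlt] at h5
      exact coeff_lowDeg_ne_zero (fun h => by rw [h, lc] at h1; exact zero_ne_one h1) h5
  have hcancel : ∀ {a b : SkewPolynomial F} {m : ℕ},
      RDvd (a * SkewPolynomial.X ^ m) (b * SkewPolynomial.X ^ m) → RDvd a b := by
    rintro a b m ⟨c, hc⟩
    rw [← mul_assoc] at hc
    exact ⟨c, mul_right_cancel₀ (hX m) hc⟩
  rw [hlow] at heq ⊢
  refine ⟨f₁, hff, hcancel (m := lowDeg f) ?_, fun Q hQ => ?_⟩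
  · rw [← heq, ← hff]; exact hp.rdvd
  · refine dvd_of_rdvd_emb (hcancel (m := lowDeg f) ?_)
    rw [← heq]; exact hmin Q hQ

end Bound

end SkewFact

namespace SkewFact

open SkewPolynomial (φ)

/-! ### Costed arithmetic of skew polynomials -/

section SkewArith

variable {F : Type u} [Field F] [MulSemiringAction (Multiplicative ℕ) F] (w : OpCost)

/-- An upper bound for the cost of one operation of each kind in `F`. -/
def OpCost.total (w : OpCost) : ℕ := w.add + w.mul + w.inv + w.aut + 1

theorem addMonoR_val (a : F) (k : ℕ) (g r : SkewPolynomial F) :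
    (addMonoR w a k g r).val = r + SkewPolynomial.monomial k a * g := by
  ext j
  rw [addMonoR, foldlM_val, foldl_range_coeff SkewPolynomial.coeff _
    (fun i t => t + a * φ^[k] (g.coeff i)) k
    (fun r i => by simp [fAut, fMul, fAdd])]
  rw [SkewPolynomial.coeff_add, coeff_monomial_mul]
  by_cases h1 : k ≤ j
  · by_cases h2 : j < deg g + 1 + k
    · rw [if_pos ⟨h1, h2⟩, if_pos h1]
    · rw [if_neg (by omega), if_pos h1, coeff_eq_zero_of_deg_lt (p := g) (by omega),
        iterate_map_zero, mul_zero, add_zero]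
  · rw [if_neg (by omega), if_neg h1, add_zero]

theorem addMonoR_ops (a : F) (k : ℕ) (g r : SkewPolynomial F) :
    (addMonoR w a k g r).ops ≤ w.total * (deg g + 1) := by
  refine (foldlM_ops_le _ w.total _ _ fun r i _ => ?_).trans
    (by rw [List.length_range, mul_comm])
  simp only [Cost.ops_bind, Cost.ops_pure, fAut, fMul, fAdd, OpCost.total]
  omega

theorem negR_val (f : SkewPolynomial F) : (negR w f).val = -f := by
  ext j
  rw [negR, foldlM_val, foldl_range_coeff SkewPolynomial.coeff _
    (fun i t => -f.coeff i) 0 (fun r i => by simp [fNeg])]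
  rw [SkewPolynomial.coeff_neg]
  split_ifs with h
  · simp
  · rw [coeff_eq_zero_of_deg_lt (p := f) (by omega)]; simp

theorem negR_ops (f : SkewPolynomial F) : (negR w f).ops ≤ w.total * (deg f + 1) := by
  refine (foldlM_ops_le _ w.total _ _ fun r i _ => ?_).trans
    (by rw [List.length_range, mul_comm])
  simp only [Cost.ops_bind, Cost.ops_pure, fNeg, OpCost.total]
  omega

theorem scaleR_val (a : F) (f : SkewPolynomial F) :
    (scaleR w a f).val = SkewPolynomial.C a * f := by
  ext j
  rw [scaleR, foldlM_val, foldl_range_coeff SkewPolynomial.coeff _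
    (fun i t => a * f.coeff i) 0 (fun r i => by simp [fMul])]
  rw [coeff_C_mul]
  split_ifs with h
  · simp
  · rw [coeff_eq_zero_of_deg_lt (p := f) (by omega)]; simp

theorem scaleR_ops (a : F) (f : SkewPolynomial F) :
    (scaleR w a f).ops ≤ w.total * (deg f + 1) := by
  refine (foldlM_ops_le _ w.total _ _ fun r i _ => ?_).trans
    (by rw [List.length_range, mul_comm])
  simp only [Cost.ops_bind, Cost.ops_pure, fMul, OpCost.total]
  omega

theorem addMulR_val (f g r : SkewPolynomial F) : (addMulR w f g r).val = r + f * g := by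
  have key : ∀ n, ((List.range n).foldl (fun r i => (addMonoR w (f.coeff i) i g r).val) r) =
      r + ∑ i ∈ Finset.range n, SkewPolynomial.monomial i (f.coeff i) * g := by
    intro n
    induction n with
    | zero => simp
    | succ n ih =>
      rw [List.range_succ, List.foldl_append, ih, List.foldl_cons, List.foldl_nil,
        addMonoR_val, Finset.sum_range_succ, add_assoc]
  rw [addMulR, foldlM_val, key, ← mul_eq_sum_monomial]

theorem addMulR_ops (f g r : SkewPolynomial F) :
    (addMulR w f g r).ops ≤ w.total * ((deg f + 1) * (deg g + 1)) := by
  refine (foldlM_ops_le _ (w.total * (deg g + 1)) _ _ fun r i _ =>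
    addMonoR_ops w _ _ _ _).trans (by rw [List.length_range]; apply le_of_eq; ring)

theorem mulR_val (f g : SkewPolynomial F) : (mulR w f g).val = f * g := by
  rw [mulR, addMulR_val, zero_add]

theorem mulR_ops (f g : SkewPolynomial F) :
    (mulR w f g).ops ≤ w.total * ((deg f + 1) * (deg g + 1)) :=
  addMulR_ops w _ _ _

theorem divR_spec : DivSpec (deg : SkewPolynomial F → ℕ) (3 * w.total) (divR w) := by
  intro f g hg
  obtain ⟨h1, h2, h3⟩ := div_loop_spec isDegree_deg f g (c := 3 * w.total * (deg g + 1))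
    (fun s => do
      let k := deg s.2 - deg g
      let b' ← fAut w k (fInv w (lc g)).val
      let a ← fMul w (lc s.2) b'
      let t ← fAdd w (s.1.coeff k) a
      let a' ← fNeg w a
      let r ← addMonoR w a' k g s.2
      pure (s.1.update k t, r))
    (by
      rintro ⟨q, r⟩ hr hle -
      simp only at hr hle
      simp only [Cost.val_bind, Cost.ops_bind, Cost.val_pure, Cost.ops_pure, fInv, fAut, fMul,
        fAdd, fNeg, addMonoR_val]
      set k := deg r - deg g with hk
      have hg' : φ^[k] (lc g) ≠ 0 := mt phi_iter_eq_zero.1 (lc_ne_zero hg)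
      have hinv : φ^[k] (lc g)⁻¹ = (φ^[k] (lc g))⁻¹ := by
        rw [← RingHom.coe_pow]; exact map_inv₀ _ _
      set a := lc r * φ^[k] (lc g)⁻¹ with ha
      have hup : q.update k (q.coeff k + a) = q + SkewPolynomial.monomial k a := by
        ext j
        rw [coeff_update_skew, SkewPolynomial.coeff_add, SkewPolynomial.coeff_monomial,
          Function.update_apply]
        by_cases h : j = k
        · rw [if_pos h, if_pos h.symm, h]
        · rw [if_neg h, if_neg (Ne.symm h), add_zero]
      have ha0 : a ≠ 0 := mul_ne_zero (lc_ne_zero hr) (hinv ▸ inv_ne_zero hg')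
      have hm0 : SkewPolynomial.monomial k a ≠ 0 :=
        mt (SkewPolynomial.monomial_eq_zero_iff k a).1 ha0
      refine ⟨?_, ?_, ?_⟩
      · rw [hup, SkewPolynomial.monomial_neg, neg_mul, add_mul]; abel
      · by_cases h0 : r + SkewPolynomial.monomial k (-a) * g = 0
        · exact Or.inl h0
        right
        have he : r + SkewPolynomial.monomial k (-a) * g =
            r - SkewPolynomial.monomial k a * g := by
          rw [SkewPolynomial.monomial_neg, neg_mul, sub_eq_add_neg]
        rw [he] at h0 ⊢
        have hd : deg (SkewPolynomial.monomial k a * g) = deg r := by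
          rw [deg_mul hm0 hg, deg_monomial ha0]; omega
        have h3 := isDegree_deg.sub_le r (SkewPolynomial.monomial k a * g)
        rw [hd, max_self] at h3
        refine lt_of_le_of_ne h3 fun h4 => lc_ne_zero h0 ?_
        rw [lc, h4, SkewPolynomial.coeff_sub, coeff_monomial_mul, if_pos (by omega),
          show deg r - k = deg g by omega, ha, hinv]
        change lc r - lc r * (φ^[k] (lc g))⁻¹ * φ^[k] (lc g) = 0
        rw [mul_assoc, inv_mul_cancel₀ hg', mul_one, sub_self]
      · have := addMonoR_ops w (-a) k g r
        have e : w.aut + w.mul + w.add + w.add ≤ 2 * w.total := by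
          simp only [OpCost.total]; omega
        nlinarith [Nat.zero_le (w.total * deg g)])
  refine ⟨h1, h2, ?_⟩
  rw [divR, Cost.ops_bind]
  have : (fInv w (lc g)).ops ≤ w.total := by simp only [fInv, OpCost.total]; omega
  refine (Nat.add_le_add this h3).trans ?_
  nlinarith

theorem rgcdR_spec (f g : SkewPolynomial F) :
    (∀ t, (∃ a b, t = a * f + b * g) ↔ RDvd (rgcdR w f g).val t) ∧
    (g ≠ 0 ∨ f ≠ 0 → (rgcdR w f g).val ≠ 0) ∧
    (rgcdR w f g).ops ≤ 3 * w.total * ((deg f + 1) * (deg f + 2 * deg g + 2)) := by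
  obtain ⟨h1, h2, h3⟩ := gcd_loop_spec isDegree_deg (divR_spec w) f g
  simp only [rgcdR, Cost.val_bind, Cost.ops_bind, Cost.val_pure, Cost.ops_pure, add_zero]
  refine ⟨h1, h2, h3.trans ?_⟩
  rw [mul_assoc]
  gcongr
  exact min_le_left _ _

theorem rgcdR_rdvd (f g : SkewPolynomial F) :
    RDvd (rgcdR w f g).val f ∧ RDvd (rgcdR w f g).val g :=
  ⟨((rgcdR_spec w f g).1 f).1 ⟨1, 0, by simp⟩, ((rgcdR_spec w f g).1 g).1 ⟨0, 1, by simp⟩⟩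

/-- Exact division. -/
theorem divR_exact {f g : SkewPolynomial F} (hg : g ≠ 0) (h : RDvd g f) :
    f = (divR w f g).val.1 * g := by
  obtain ⟨a, ha⟩ := h
  obtain ⟨h1, h2, -⟩ := divR_spec w f g hg
  have h3 := isDegree_deg.unique hg (q := (divR w f g).val.1) (r := (divR w f g).val.2)
    (q' := a) (r' := 0) (by rw [← h1, add_zero, ha]) h2 (Or.inl rfl)
  rw [h3.1, ha]

theorem divR_snd_eq_zero {f g : SkewPolynomial F} (hg : g ≠ 0) :
    (divR w f g).val.2 = 0 ↔ RDvd g f := by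
  obtain ⟨h1, h2, -⟩ := divR_spec w f g hg
  constructor
  · intro h
    rw [h, add_zero] at h1
    exact ⟨_, h1⟩
  · rintro ⟨a, ha⟩
    exact (isDegree_deg.unique hg (q := (divR w f g).val.1) (r := (divR w f g).val.2)
      (q' := a) (r' := 0) (by rw [← h1, add_zero, ha]) h2 (Or.inl rfl)).2

theorem annR_spec {f : SkewPolynomial F} (h : SkewPolynomial F) (hf : f ≠ 0) :
    (∀ g, RDvd f (g * h) ↔ RDvd (annR w f h).val g) ∧
    deg (annR w f h).val ≤ max (deg f) (deg h) ∧
    (annR w f h).ops ≤ 27 * w.total * (max (deg f) (deg h) + 1) ^ 2 := by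
  obtain ⟨h1, -, -, -, -, h2, h3⟩ := ext_loop_spec isDegree_deg (divR_spec w)
    (neg := negR w) (addMul := addMulR w)
    (fun a => ⟨negR_val w a, (negR_ops w a).trans (by gcongr; omega)⟩)
    (fun a b r => ⟨addMulR_val w a b r, (addMulR_ops w a b r).trans (by gcongr; omega)⟩)
    f h hf (deg h + 1) le_rfl
  simp only [annR, Cost.val_bind, Cost.ops_bind, Cost.val_pure, Cost.ops_pure, add_zero]
  exact ⟨h1, h2, h3.trans (by gcongr ?_ * _; omega)⟩

theorem lcmR_spec {f h : SkewPolynomial F} (hf : f ≠ 0) :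
    (∀ s, RDvd (lcmR w f h).val s ↔ RDvd f s ∧ RDvd h s) ∧
    (lcmR w f h).ops ≤ 28 * w.total * (max (deg f) (deg h) + 1) ^ 2 := by
  obtain ⟨h1, h2, h3⟩ := annR_spec w h hf
  simp only [lcmR, Cost.val_bind, Cost.ops_bind, mulR_val]
  refine ⟨fun s => ⟨?_, ?_⟩, ?_⟩
  · rintro ⟨a, rfl⟩
    rw [← mul_assoc]
    exact ⟨(h1 _).2 ⟨a, rfl⟩, ⟨_, rfl⟩⟩
  · rintro ⟨h4, ⟨g, rfl⟩⟩
    obtain ⟨a, rfl⟩ := (h1 g).1 h4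
    exact ⟨a, mul_assoc _ _ _⟩
  · have h4 := mulR_ops w (annR w f h).val h
    set N := max (deg f) (deg h)
    have h5 : w.total * ((deg (annR w f h).val + 1) * (deg h + 1)) ≤
        w.total * ((N + 1) * (N + 1)) := by
      gcongr; exact le_max_right _ _
    nlinarith

variable [Finite F]

theorem annR_ne_zero {f : SkewPolynomial F} (h : SkewPolynomial F) (hf : f ≠ 0) :
    (annR w f h).val ≠ 0 := by
  obtain ⟨s, hs0, -, hs⟩ := exists_annihilator hf
  exact (((annR_spec w h hf).1 s).1 (hs h)).ne_zero hs0

theorem firstBad_spec {p : SkewPolynomial F} (hp : p ≠ 0) (ds : List (SkewPolynomial F))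
    (hds : ∀ d ∈ ds, deg d ≤ 1) :
    ((firstBad w p ds).val = none → ∀ d ∈ ds, RDvd p (p * d)) ∧
    (∀ d, (firstBad w p ds).val = some d → d ∈ ds ∧ ¬ RDvd p (p * d)) ∧
    (firstBad w p ds).ops ≤ ds.length * (11 * w.total * (deg p + 1)) := by
  classical
  induction ds with
  | nil => simp [firstBad]
  | cons d ds ih =>
    obtain ⟨i1, i2, i3⟩ := ih fun d' h => hds d' (by simp [h])
    have hd := hds d (by simp)
    have h1 := mulR_ops w p d
    have h2 := (divR_spec w (p * d) p hp).2.2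
    have h3 := deg_mul_le p d
    have h4 : w.total * ((deg p + 1) * (deg d + 1)) ≤ w.total * ((deg p + 1) * 2) := by
      gcongr; omega
    have h5 : 3 * w.total * ((deg (p * d) + 1 - deg p) * (deg p + 1) + 1) ≤
        3 * w.total * (2 * (deg p + 1) + (deg p + 1)) := by
      gcongr <;> omega
    have h6 : (mulR w p d).ops + (divR w (p * d) p).ops ≤ 11 * w.total * (deg p + 1) := by
      nlinarith
    simp only [firstBad, Cost.val_bind, Cost.ops_bind, mulR_val, List.length_cons]
    by_cases h : (divR w (p * d) p).val.2 = 0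
    · rw [if_pos h]
      have h' := (divR_snd_eq_zero w hp).1 h
      refine ⟨fun hn => ?_, fun d' hd' => ?_, ?_⟩
      · simpa [h'] using i1 hn
      · exact ⟨List.mem_cons_of_mem _ (i2 d' hd').1, (i2 d' hd').2⟩
      · rw [add_mul, one_mul]; omega
    · rw [if_neg h]
      have h' := mt (divR_snd_eq_zero w hp).2 h
      refine ⟨fun hn => ?_, fun d' hd' => ?_, ?_⟩
      · simp at hn
      · simp only [Cost.val_pure, Option.some.injEq] at hd'
        subst hd'
        exact ⟨by simp, h'⟩
      · rw [add_mul, one_mul, Cost.ops_pure]; omega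

/-- The loop for the bound replaces `p` by left multiples of `f` of larger and larger degree that
still divide the bound `t` of `f`. -/
theorem boundAux_spec {gens : List F}
    (hgens : Algebra.adjoin (fixedField F) {a : F | a ∈ gens} = ⊤) {f t : SkewPolynomial F}
    (ht0 : t ≠ 0) (ht : IsBound f t) (n : ℕ) :
    ∀ p, RDvd f p → RDvd p t → (∀ s, (∀ g, RDvd f (s * g)) → RDvd p s) → deg t < deg p + n →
      let x := boundAux w (gens.map SkewPolynomial.C ++ [SkewPolynomial.X]) n p
      x.val ≠ 0 ∧ IsBound f x.val ∧
      x.ops ≤ n * (w.total * (11 * gens.length + 66) * (deg t + 2) ^ 2) := by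
  induction n with
  | zero =>
    intro p _ hpt _ hlt
    have := hpt.deg_le ht0
    omega
  | succ n ih =>
    intro p hfp hpt hmin hlt x
    set ds := gens.map SkewPolynomial.C ++ [SkewPolynomial.X (R := F)] with hdsdef
    have hp0 : p ≠ 0 := hpt.ne_zero ht0
    have hdp : deg p ≤ deg t := hpt.deg_le ht0
    have hds : ∀ d ∈ ds, deg d ≤ 1 := by
      intro d hd
      rcases List.mem_append.1 hd with h | h
      · obtain ⟨a, -, rfl⟩ := List.mem_map.1 h
        rw [deg_C]; omega
      · rw [List.mem_singleton.1 h, ← pow_one SkewPolynomial.X, deg_X_pow]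
    have hlen : ds.length = gens.length + 1 := by simp [hdsdef]
    obtain ⟨b1, b2, b3⟩ := firstBad_spec w hp0 ds hds
    set N := deg t
    have hfb : (firstBad w p ds).ops ≤
        w.total * (11 * gens.length + 11) * (N + 2) ^ 2 := by
      refine b3.trans ?_
      rw [hlen]
      calc (gens.length + 1) * (11 * w.total * (deg p + 1))
          = w.total * (11 * gens.length + 11) * (deg p + 1) := by ring
        _ ≤ _ := by
          gcongr
          nlinarith
    have hx : x = (firstBad w p ds >>= fun bad => match bad with
      | none => pure p
      | some d => do
        let pd ← annR w p d
        let p' ← lcmR w pd p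
        boundAux w ds n p') := rfl
    rw [hx, Cost.val_bind, Cost.ops_bind]
    cases hbad : (firstBad w p ds).val with
    | none =>
      refine ⟨hp0, ⟨isInv_of_gens hgens (b1 hbad), hfp, hmin⟩, ?_⟩
      simp only [Cost.ops_pure, add_zero]
      refine hfb.trans (le_trans ?_ (Nat.le_mul_of_pos_left _ (Nat.succ_pos n)))
      gcongr
      omega
    | some d =>
      obtain ⟨hd, hnd⟩ := b2 d hbad
      obtain ⟨a1, a2, a3⟩ := annR_spec w d hp0
      have a0 := annR_ne_zero w d hp0
      have hdd := hds d hd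
      obtain ⟨l1, l2⟩ := lcmR_spec w (h := p) a0
      simp only [Cost.val_bind, Cost.ops_bind]
      set pd := (annR w p d).val
      set p' := (lcmR w pd p).val
      have hpp' : RDvd p p' := ((l1 p').1 (RDvd.refl _)).2
      have hmin' : ∀ s, (∀ g, RDvd f (s * g)) → RDvd p' s := by
        intro s hs
        refine (l1 s).2 ⟨(a1 s).1 (hmin _ fun g => ?_), hmin s hs⟩
        rw [mul_assoc]; exact hs _
      have hp't : RDvd p' t := hmin' t fun g => ht.inv.rdvd_mul ht.rdvd g
      have hp'0 : p' ≠ 0 := hp't.ne_zero ht0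
      have hlt' : deg p < deg p' := by
        by_contra hge
        have h1 : RDvd p' p := hpp'.symm_of_deg_le hp'0 (by omega)
        have h2 : RDvd pd p := ((l1 p).1 h1).1
        exact hnd ((a1 p).2 h2)
      obtain ⟨i1, i2, i3⟩ := ih p' (hfp.trans hpp') hp't hmin' (by omega)
      refine ⟨i1, i2, ?_⟩
      have c1 : (annR w p d).ops ≤ 27 * w.total * (N + 2) ^ 2 := by
        refine a3.trans ?_
        gcongr 27 * w.total * ?_ ^ 2
        omega
      have c2 : (lcmR w pd p).ops ≤ 28 * w.total * (N + 2) ^ 2 := by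
        refine l2.trans ?_
        gcongr 28 * w.total * ?_ ^ 2
        omega
      calc _ ≤ w.total * (11 * gens.length + 11) * (N + 2) ^ 2 + (27 * w.total * (N + 2) ^ 2 +
            (28 * w.total * (N + 2) ^ 2 +
              n * (w.total * (11 * gens.length + 66) * (N + 2) ^ 2))) := by gcongr
        _ = _ := by ring

theorem boundR_spec {gens : List F}
    (hgens : Algebra.adjoin (fixedField F) {a : F | a ∈ gens} = ⊤) {f : SkewPolynomial F}
    (hf : 1 ≤ deg f) :
    (boundR w gens f).val ≠ 0 ∧ IsBound f (boundR w gens f).val ∧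
    (boundR w gens f).ops ≤
      18 * w.total * (11 * gens.length + 66) * autOrder F ^ 3 * deg f ^ 3 := by
  have hf0 : f ≠ 0 := by
    rintro rfl
    rw [deg_zero] at hf
    omega
  obtain ⟨t, ht0, ht, htd⟩ := exists_isBound hf0
  obtain ⟨h1, h2, h3⟩ := boundAux_spec w hgens ht0 ht (autOrder F * deg f + 1) f (RDvd.refl f)
    ht.rdvd (fun s hs => by simpa using hs 1) (by omega)
  refine ⟨h1, h2, h3.trans ?_⟩
  have hpos : 1 ≤ autOrder F * deg f := Nat.mul_pos autOrder_pos hf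
  calc (autOrder F * deg f + 1) * (w.total * (11 * gens.length + 66) * (deg t + 2) ^ 2)
      ≤ (2 * (autOrder F * deg f)) *
        (w.total * (11 * gens.length + 66) * (3 * (autOrder F * deg f)) ^ 2) := by
        gcongr <;> omega
    _ = _ := by ring

end SkewArith

end SkewFact

namespace SkewFact

open SkewPolynomial (φ)

/-! ### The simple algebra `R / R π` -/

section QuotientAlgebra

variable {F : Type u} [Field F] [MulSemiringAction (Multiplicative ℕ) F]

/-- The ring `A = R / R π`. -/
def QuotA (π : Polynomial (fixedField F)) : Type u :=
  SkewPolynomial F ⧸ (Ideal.span {emb π} : Ideal (SkewPolynomial F))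

variable (π : Polynomial (fixedField F))

instance : (Ideal.span {emb π} : Ideal (SkewPolynomial F)).IsTwoSided where
  mul_mem_of_left := fun {a} b ha => by
    rw [Ideal.mem_span_singleton'] at ha ⊢
    obtain ⟨c, rfl⟩ := ha
    exact ⟨c * b, by rw [mul_assoc, mul_assoc, emb_comm]⟩

noncomputable instance : Ring (QuotA π) :=
  inferInstanceAs (Ring (SkewPolynomial F ⧸ (Ideal.span {emb π} : Ideal (SkewPolynomial F))))

/-- The class of a skew polynomial in `A`. -/
noncomputable def mkA : SkewPolynomial F →+* QuotA π :=
  Ideal.Quotient.mk (Ideal.span {emb π})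

theorem mkA_surjective : Function.Surjective (mkA π) := Ideal.Quotient.mk_surjective

variable {π}

theorem mkA_eq_zero {f : SkewPolynomial F} : mkA π f = 0 ↔ RDvd (emb π) f := by
  refine Ideal.Quotient.eq_zero_iff_mem.trans (Ideal.mem_span_singleton'.trans ?_)
  exact ⟨fun ⟨a, h⟩ => ⟨a, h.symm⟩, fun ⟨a, h⟩ => ⟨a, h.symm⟩⟩

variable (π)

/-- `K_π` as a subfield of the center of `A`. -/
noncomputable def centralHom : AdjoinRoot π →+* QuotA π :=
  Ideal.Quotient.lift (Ideal.span {π}) ((mkA π).comp embHom) fun a ha => by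
    rw [RingHom.comp_apply, embHom_apply, mkA_eq_zero]
    obtain ⟨c, rfl⟩ := Ideal.mem_span_singleton'.1 ha
    exact ⟨emb c, emb_mul _ _⟩

theorem centralHom_mk (Q : Polynomial (fixedField F)) :
    centralHom π (AdjoinRoot.mk π Q) = mkA π (emb Q) := by
  rw [← embHom_apply]
  rfl

noncomputable instance : Algebra (AdjoinRoot π) (QuotA π) :=
  (centralHom π).toAlgebra' fun c x => by
    obtain ⟨Q, rfl⟩ := AdjoinRoot.mk_surjective c
    obtain ⟨f, rfl⟩ := mkA_surjective π x
    rw [centralHom_mk, ← map_mul, ← map_mul, emb_comm]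

theorem algebraMap_mk (Q : Polynomial (fixedField F)) :
    algebraMap (AdjoinRoot π) (QuotA π) (AdjoinRoot.mk π Q) = mkA π (emb Q) :=
  centralHom_mk π Q

theorem mk_smul_mkA (Q : Polynomial (fixedField F)) (f : SkewPolynomial F) :
    AdjoinRoot.mk π Q • mkA π f = mkA π (emb Q * f) := by
  rw [Algebra.smul_def, algebraMap_mk, map_mul]

variable {π} [Finite F]

section Reduced

variable (hπ : π.Monic)
include hπ

theorem modA_spec (w : OpCost) (f : SkewPolynomial F) :
    mkA π (modA w π f).val = mkA π f ∧
      ((modA w π f).val = 0 ∨ deg (modA w π f).val < autOrder F * π.natDegree) := by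
  obtain ⟨h1, h2, -⟩ := divR_spec w f (emb π) (emb_ne_zero hπ.ne_zero)
  simp only [modA, Cost.val_bind, Cost.val_pure]
  rw [deg_emb] at h2
  refine ⟨?_, h2⟩
  conv_rhs => rw [h1]
  rw [map_add, mkA_eq_zero.2 ⟨_, rfl⟩, zero_add]

/-- Reduced representatives are unique. -/
theorem eq_zero_of_mkA_eq_zero {f : SkewPolynomial F} (hf : deg f < autOrder F * π.natDegree)
    (h : mkA π f = 0) : f = 0 := by
  by_contra h0
  have := (mkA_eq_zero.1 h).deg_le h0
  rw [deg_emb] at this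
  omega

theorem eq_of_mkA_eq {f g : SkewPolynomial F} (hf : deg f < autOrder F * π.natDegree)
    (hg : deg g < autOrder F * π.natDegree) (h : mkA π f = mkA π g) : f = g := by
  refine sub_eq_zero.1 (eq_zero_of_mkA_eq_zero hπ ?_ (by rw [map_sub, h, sub_self]))
  exact (isDegree_deg.sub_le f g).trans_lt (max_lt hf hg)

theorem exists_reduced (x : QuotA π) (h0 : 0 < π.natDegree) :
    ∃ f, mkA π f = x ∧ deg f < autOrder F * π.natDegree := by
  obtain ⟨f, rfl⟩ := mkA_surjective π x
  obtain ⟨h1, h2⟩ := modA_spec hπ ⟨0, 0, 0, 0⟩ f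
  refine ⟨_, h1, h2.elim (fun h => ?_) id⟩
  rw [h, deg_zero]
  exact Nat.mul_pos autOrder_pos h0

omit hπ in
theorem coeff_sum_monomial {n : ℕ} (c : Fin n → F) (i : Fin n) :
    (∑ i : Fin n, SkewPolynomial.monomial (i : ℕ) (c i)).coeff i = c i := by
  rw [coeff_sum_skew]
  simp only [SkewPolynomial.coeff_monomial, Fin.val_inj, Finset.sum_ite_eq', Finset.mem_univ,
    if_true]

omit hπ in
theorem deg_sum_monomial_lt {n : ℕ} (hn : 0 < n) (c : Fin n → F) :
    deg (∑ i : Fin n, SkewPolynomial.monomial (i : ℕ) (c i)) < n := by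
  refine Nat.lt_of_le_pred hn (deg_le fun j hj => ?_)
  rw [coeff_sum_skew]
  refine Finset.sum_eq_zero fun i _ => ?_
  rw [SkewPolynomial.coeff_monomial, if_neg]
  have := i.2
  simp only [Nat.pred_eq_sub_one] at hj
  omega

/-- The parametrization of `A` by coefficient vectors. -/
theorem sum_monomial_bijective (h0 : 0 < π.natDegree) : Function.Bijective
    fun c : Fin (autOrder F * π.natDegree) → F =>
      mkA π (∑ i : Fin (autOrder F * π.natDegree), SkewPolynomial.monomial (i : ℕ) (c i)) := by
  have hpos : 0 < autOrder F * π.natDegree := Nat.mul_pos autOrder_pos h0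
  constructor
  · intro c c' h
    have h1 := eq_of_mkA_eq hπ (deg_sum_monomial_lt hpos c) (deg_sum_monomial_lt hpos c') h
    funext i
    rw [← coeff_sum_monomial c i, h1, coeff_sum_monomial]
  · intro x
    obtain ⟨f, rfl, hf⟩ := exists_reduced hπ x h0
    refine ⟨fun i => f.coeff i, ?_⟩
    beta_reduce
    congr 1
    refine (Finset.sum_range fun i => SkewPolynomial.monomial i (f.coeff i)).symm.trans ?_
    exact (eq_sum_monomial f hf).symm

end Reduced

variable [Fact (Irreducible π)]

instance : Finite (AdjoinRoot π) := by
  have hirr : Irreducible π := Fact.out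
  have := (AdjoinRoot.powerBasis hirr.ne_zero).finite
  exact Module.finite_of_finite (fixedField F)

instance : Finite (QuotA π) := by
  have hirr : Irreducible π := Fact.out
  refine Finite.of_surjective
    (fun c : Fin (autOrder F * π.natDegree) → F =>
      mkA π (∑ i : Fin (autOrder F * π.natDegree), SkewPolynomial.monomial (i : ℕ) (c i)))
    fun x => ?_
  obtain ⟨f, rfl⟩ := mkA_surjective π x
  obtain ⟨q, r, rfl, hr⟩ := exists_div f (emb_ne_zero hirr.ne_zero)
  refine ⟨fun i => r.coeff i, ?_⟩
  beta_reduce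
  rw [map_add, mkA_eq_zero.2 ⟨q, rfl⟩, zero_add]
  congr 1
  refine (Finset.sum_range fun i => SkewPolynomial.monomial i (r.coeff i)).symm.trans ?_
  rcases hr with rfl | hr
  · exact Finset.sum_eq_zero fun i _ => by
      rw [SkewPolynomial.coeff_zero, SkewPolynomial.monomial_zero_right]
  · rw [deg_emb] at hr
    exact (eq_sum_monomial r hr).symm

theorem nontrivial_quotA : Nontrivial (QuotA π) := by
  have hirr : Irreducible π := Fact.out
  refine ⟨1, 0, fun h => ?_⟩
  rw [← map_one (mkA π), mkA_eq_zero] at h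
  have h1 := h.deg_le one_ne_zero
  rw [deg_emb, deg_one] at h1
  have := Nat.mul_pos (autOrder_pos (F := F)) hirr.natDegree_pos
  omega

/-- For `π ≠ z` the algebra `R / R π` is simple. -/
theorem isSimpleRing_quotA (hπ0 : π.coeff 0 ≠ 0) : IsSimpleRing (QuotA π) := by
  have hirr : Irreducible π := Fact.out
  refine isSimpleRing_iff_isTwoSided_imp.2 ⟨nontrivial_quotA, fun I hI => ?_⟩
  obtain ⟨d, hd⟩ := exists_generator (I.comap (mkA π))
  have hdI : mkA π d ∈ I := (hd d).2 (RDvd.refl d)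
  have hinv : IsInv d := fun g => (hd _).1 (by
    rw [Ideal.mem_comap, map_mul]; exact hI.mul_mem_of_left _ hdI)
  have hπd : RDvd d (emb π) := (hd _).1 (by
    rw [Ideal.mem_comap, mkA_eq_zero.2 (RDvd.refl _)]; exact I.zero_mem)
  rcases hinv.deg_eq_zero_or_rdvd hirr hπ0 hπd with h | h
  · right
    rw [Ideal.eq_top_iff_one, ← map_one (mkA π)]
    exact (hd 1).2 (rdvd_of_deg_eq_zero (hπd.ne_zero (emb_ne_zero hirr.ne_zero)) h 1)
  · left
    refine (Submodule.eq_bot_iff I).2 fun x hx => ?_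
    obtain ⟨f, rfl⟩ := mkA_surjective π x
    exact mkA_eq_zero.2 (h.trans ((hd f).1 hx))

/-- The center of `A` is `K_π`. -/
theorem exists_algebraMap_eq (hπ : π.Monic) {x : QuotA π} (hx : ∀ y, x * y = y * x) :
    ∃ c, algebraMap (AdjoinRoot π) (QuotA π) c = x := by
  have hirr : Irreducible π := Fact.out
  have hμ := autOrder_pos (F := F)
  have hδ := hirr.natDegree_pos
  obtain ⟨r, rfl, hr⟩ := exists_reduced hπ x hδ
  -- the exponents in the reduced representative are divisible by the order of `σ`
  have hexp : ∀ i, r.coeff i ≠ 0 → autOrder F ∣ i := by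
    intro i hi
    refine phi_iter_eq_id_iff.1 fun a => ?_
    have h1 := hx (mkA π (SkewPolynomial.C a))
    rw [← map_mul, ← map_mul] at h1
    have h2 := eq_of_mkA_eq hπ
      ((deg_mul_le _ _).trans_lt (by rwa [deg_C, add_zero]))
      ((deg_mul_le _ _).trans_lt (by rwa [deg_C, zero_add])) h1
    have h3 := congrArg (SkewPolynomial.coeff · i) h2
    beta_reduce at h3
    rw [coeff_C_mul, ← SkewPolynomial.monomial_zero_left, coeff_mul_monomial,
      if_pos (Nat.zero_le _), Nat.sub_zero, mul_comm] at h3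
    exact mul_right_cancel₀ hi h3
  have hfix : ∀ i, (φ : F →+* F) (r.coeff i) = r.coeff i := by
    by_cases h1 : autOrder F = 1
    · intro i
      have := phi_iter_autOrder_mul 1 (r.coeff i)
      rwa [h1, Nat.mul_one, Function.iterate_one] at this
    · have hlt : deg r + 1 < autOrder F * π.natDegree := by
        refine lt_of_le_of_ne hr fun heq => ?_
        by_cases hr0 : r = 0
        · rw [hr0, deg_zero] at heq
          have h2 : autOrder F ∣ 1 := ⟨_, heq⟩
          exact h1 (Nat.dvd_one.1 h2)
        · have h2 := hexp _ (lc_ne_zero hr0)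
          have h3 : autOrder F ∣ deg r + 1 := ⟨_, heq⟩
          exact h1 (Nat.dvd_one.1 ((Nat.dvd_add_right h2).1 h3))
      intro i
      have h2 := hx (mkA π SkewPolynomial.X)
      rw [← map_mul, ← map_mul] at h2
      have hX : deg (SkewPolynomial.X : SkewPolynomial F) = 1 := by
        rw [← pow_one SkewPolynomial.X, deg_X_pow]
      have h3 := eq_of_mkA_eq hπ
        ((deg_mul_le _ _).trans_lt (by rwa [hX]))
        ((deg_mul_le _ _).trans_lt (by rwa [hX, add_comm])) h2
      have h4 := congrArg (SkewPolynomial.coeff · (i + 1)) h3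
      beta_reduce at h4
      conv_lhs at h4 => rw [← pow_one SkewPolynomial.X, coeff_mul_X_pow, if_pos (by omega),
        Nat.add_sub_cancel]
      rw [← SkewPolynomial.monomial_one_one_eq_X, coeff_monomial_mul, if_pos (by omega),
        Nat.add_sub_cancel, one_mul] at h4
      exact h4.symm
  refine ⟨AdjoinRoot.mk π (∑ i ∈ Finset.range (deg r + 1), Polynomial.monomial i
    (toFixed (r.coeff (autOrder F * i)))), ?_⟩
  rw [algebraMap_mk]
  congr 1
  ext j
  rw [coeff_emb]
  split_ifs with hj
  · obtain ⟨i, rfl⟩ := hj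
    rw [Nat.mul_div_cancel_left _ hμ, Polynomial.finsetSum_coeff]
    simp only [Polynomial.coeff_monomial, Finset.sum_ite_eq', Finset.mem_range]
    split_ifs with hi
    · exact coe_toFixed (hfix _)
    · rw [coeff_eq_zero_of_deg_lt]
      · rfl
      · have := Nat.le_mul_of_pos_left i hμ
        omega
  · by_contra h0
    exact hj (hexp j (Ne.symm h0))

theorem natCard_field_eq (b : Module.Basis (Fin (autOrder F)) (fixedField F) F) :
    Nat.card F = Nat.card (fixedField F) ^ autOrder F := by
  have := Module.natCard_eq_pow_finrank (K := fixedField F) (V := F)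
  rwa [Module.finrank_eq_card_basis b, Fintype.card_fin] at this

theorem natCard_adjoinRoot :
    Nat.card (AdjoinRoot π) = Nat.card (fixedField F) ^ π.natDegree := by
  have hirr : Irreducible π := Fact.out
  have := Module.natCard_eq_pow_finrank (K := fixedField F) (V := AdjoinRoot π)
  rwa [(AdjoinRoot.powerBasis hirr.ne_zero).finrank, AdjoinRoot.powerBasis_dim] at this

theorem natCard_quotA (hπ : π.Monic) :
    Nat.card (QuotA π) = Nat.card F ^ (autOrder F * π.natDegree) := by
  have hirr : Irreducible π := Fact.out
  rw [← Nat.card_congr (Equiv.ofBijective _ (sum_monomial_bijective hπ hirr.natDegree_pos)),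
    Nat.card_fun, Nat.card_fin]

/-- The algebra `R / R π` is a full matrix algebra over its center. By the theorems of Wedderburn,
it is a matrix algebra over a finite field, which is the center. -/
theorem exists_algEquiv_end (b : Module.Basis (Fin (autOrder F)) (fixedField F) F)
    (hπ : π.Monic) (hπ0 : π.coeff 0 ≠ 0) :
    Nonempty (QuotA π ≃ₐ[AdjoinRoot π]
      Module.End (AdjoinRoot π) (Fin (autOrder F) → AdjoinRoot π)) := by
  have hirr : Irreducible π := Fact.out
  have := isSimpleRing_quotA hπ0
  have : IsArtinianRing (QuotA π) := isArtinian_of_finite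
  obtain ⟨n, hn, D, _, _, _, ⟨e⟩⟩ :=
    IsSimpleRing.exists_algEquiv_matrix_divisionRing_finite (AdjoinRoot π) (QuotA π)
  have hD : Finite D := Module.finite_of_finite (AdjoinRoot π)
  have hsurj : Function.Surjective (algebraMap (AdjoinRoot π) D) := by
    intro d
    obtain ⟨c, hc⟩ := exists_algebraMap_eq hπ (x := e.symm (Matrix.scalar (Fin n) d)) (by
      intro y
      apply e.injective
      rw [map_mul, map_mul, e.apply_symm_apply]
      exact Matrix.scalar_commute d (fun r => (littleWedderburn D).mul_comm d r) (e y))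
    refine ⟨c, ?_⟩
    have h1 := congrArg e hc
    rw [e.apply_symm_apply, AlgEquiv.commutes] at h1
    have h2 := congrFun (congrFun h1 0) 0
    rw [Matrix.algebraMap_matrix_apply, if_pos rfl] at h2
    simpa using h2
  have e1 : AdjoinRoot π ≃ₐ[AdjoinRoot π] D :=
    AlgEquiv.ofBijective (Algebra.ofId _ D) ⟨(algebraMap (AdjoinRoot π) D).injective, hsurj⟩
  have e2 : QuotA π ≃ₐ[AdjoinRoot π] Matrix (Fin n) (Fin n) (AdjoinRoot π) :=
    e.trans e1.symm.mapMatrix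
  have hcard := Nat.card_congr e2.toEquiv
  have hq : 1 < Nat.card (fixedField F) := Finite.one_lt_card
  have hnμ : n = autOrder F := by
    rw [natCard_quotA hπ, natCard_field_eq b] at hcard
    unfold Matrix at hcard
    rw [Nat.card_fun, Nat.card_fun, Nat.card_fin, natCard_adjoinRoot, ← pow_mul, ← pow_mul,
      ← pow_mul] at hcard
    have h1 := Nat.pow_right_injective hq hcard
    have h2 : π.natDegree * (autOrder F * autOrder F) = π.natDegree * (n * n) := by
      rw [← h1]; ring
    exact (Nat.mul_self_inj.1 (Nat.eq_of_mul_eq_mul_left hirr.natDegree_pos h2)).symm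
  subst hnμ
  exact ⟨e2.trans Matrix.toLinAlgEquiv'⟩

end QuotientAlgebra

end SkewFact

namespace SkewFact

open SkewPolynomial (φ)

/-! ### Coordinates and computations in `R / R π` -/

section Coordinates

variable {F : Type u} [Field F] [MulSemiringAction (Multiplicative ℕ) F] [Finite F]

theorem coeff_emb_mul_monomial (Q : Polynomial (fixedField F)) {j : ℕ} (hj : j < autOrder F)
    (a : F) (n : ℕ) : (emb Q * SkewPolynomial.monomial j a).coeff n =
      if n % autOrder F = j then (Q.coeff (n / autOrder F) : F) * a else 0 := by
  have hμ := autOrder_pos (F := F)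
  rw [coeff_mul_monomial]
  by_cases h : n % autOrder F = j
  · have h1 : n = autOrder F * (n / autOrder F) + j := by
      rw [← h]; exact (Nat.div_add_mod _ _).symm
    have h2 : n - j = autOrder F * (n / autOrder F) := by omega
    rw [if_pos h, if_pos (by omega), h2, coeff_emb_mul, phi_iter_autOrder_mul]
  · rw [if_neg h]
    split_ifs with h1
    · rw [coeff_emb, if_neg, zero_mul]
      rintro ⟨c, hc⟩
      apply h
      rw [show n = autOrder F * c + j by omega, Nat.mul_add_mod, Nat.mod_eq_of_lt hj]
    · rfl

variable (b : Module.Basis (Fin (autOrder F)) (fixedField F) F)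
  (π : Polynomial (fixedField F))

theorem coeff_ofVecA (c : Polynomial (AdjoinRoot π)) (n : ℕ) :
    (ofVecA b π c).coeff n = ∑ i : Fin (autOrder F),
      (rep π (c.coeff ((i : ℕ) * autOrder F + n % autOrder F))).coeff (n / autOrder F) • b i := by
  rw [ofVecA, coeff_sum_skew]
  refine Finset.sum_congr rfl fun i _ => ?_
  have hlt : n % autOrder F < autOrder F := Nat.mod_lt _ autOrder_pos
  rw [coeff_sum_skew, Finset.sum_eq_single ⟨n % autOrder F, hlt⟩]
  · rw [coeff_emb_mul_monomial _ hlt, if_pos rfl]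
    rfl
  · intro j _ hj
    rw [coeff_emb_mul_monomial _ j.2, if_neg fun h => hj (Fin.ext h.symm)]
  · simp

theorem vecA_coeff (r : SkewPolynomial F) (i j : Fin (autOrder F)) :
    (vecA b π r).coeff ((i : ℕ) * autOrder F + j) =
      AdjoinRoot.mk π (∑ k ∈ Finset.range π.natDegree,
        Polynomial.monomial k (b.repr (r.coeff (autOrder F * k + j)) i)) := by
  have hinj : ∀ i' j' : Fin (autOrder F), (i' : ℕ) * autOrder F + j' = i * autOrder F + j →
      i' = i ∧ j' = j := by
    intro i' j' h
    have h1 : (j' : ℕ) = j := by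
      have := congrArg (· % autOrder F) h
      simpa [Nat.mul_add_mod_of_lt, Nat.mod_eq_of_lt] using this
    rw [h1] at h
    exact ⟨Fin.ext (Nat.eq_of_mul_eq_mul_right autOrder_pos (Nat.add_right_cancel h)), Fin.ext h1⟩
  rw [vecA, Polynomial.finsetSum_coeff, Finset.sum_eq_single i, Polynomial.finsetSum_coeff,
    Finset.sum_eq_single j, Polynomial.coeff_monomial, if_pos rfl]
  · intro j' _ hj
    rw [Polynomial.coeff_monomial, if_neg fun h => hj (hinj _ _ h).2]
  · simp
  · intro i' _ hi
    rw [Polynomial.finsetSum_coeff]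
    exact Finset.sum_eq_zero fun j' _ => by
      rw [Polynomial.coeff_monomial, if_neg fun h => hi (hinj _ _ h).1]
  · simp

theorem index_lt (i j : Fin (autOrder F)) :
    (i : ℕ) * autOrder F + j < autOrder F * autOrder F := by
  have h1 : ((i : ℕ) + 1) * autOrder F ≤ autOrder F * autOrder F := Nat.mul_le_mul_right _ i.2
  have := j.2
  rw [add_mul, one_mul] at h1
  omega

theorem degree_vecA_lt (r : SkewPolynomial F) :
    (vecA b π r).degree < ((autOrder F * autOrder F : ℕ) : WithBot ℕ) := by
  rw [Polynomial.degree_lt_iff_coeff_zero]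
  intro m hm
  rw [vecA, Polynomial.finsetSum_coeff]
  refine Finset.sum_eq_zero fun i _ => ?_
  rw [Polynomial.finsetSum_coeff]
  refine Finset.sum_eq_zero fun j _ => ?_
  have := index_lt i j
  rw [Polynomial.coeff_monomial, if_neg (by omega)]

theorem natDegree_vecA_le (r : SkewPolynomial F) :
    (vecA b π r).natDegree ≤ autOrder F * autOrder F :=
  Polynomial.natDegree_le_of_degree_le (degree_vecA_lt b π r).le

variable {π} (hπ : π.Monic) [Fact (Irreducible π)]
include hπ

theorem deg_ofVecA_lt (c : Polynomial (AdjoinRoot π)) :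
    deg (ofVecA b π c) < autOrder F * π.natDegree := by
  have hirr : Irreducible π := Fact.out
  have hμ := autOrder_pos (F := F)
  have hpos : 0 < autOrder F * π.natDegree := Nat.mul_pos hμ hirr.natDegree_pos
  refine Nat.lt_of_le_pred hpos (deg_le fun n hn => ?_)
  rw [coeff_ofVecA]
  refine Finset.sum_eq_zero fun i _ => ?_
  rw [Polynomial.coeff_eq_zero_of_natDegree_lt, zero_smul]
  refine (natDegree_rep_lt hπ hirr.natDegree_pos _).trans_le ?_
  rw [Nat.le_div_iff_mul_le hμ, mul_comm]
  exact Nat.le_of_pred_lt hn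

theorem ofVecA_vecA {r : SkewPolynomial F} (hr : deg r < autOrder F * π.natDegree) :
    ofVecA b π (vecA b π r) = r := by
  have hμ := autOrder_pos (F := F)
  refine SkewPolynomial.ext fun n => ?_
  by_cases hn : n < autOrder F * π.natDegree
  · rw [coeff_ofVecA]
    have hlt : n % autOrder F < autOrder F := Nat.mod_lt _ hμ
    have hk : n / autOrder F < π.natDegree := Nat.div_lt_of_lt_mul hn
    conv_rhs => rw [← b.sum_repr (r.coeff n)]
    refine Finset.sum_congr rfl fun i _ => ?_
    rw [vecA_coeff b π r i ⟨n % autOrder F, hlt⟩, rep_mk hπ, Polynomial.finsetSum_coeff]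
    · simp only [Polynomial.coeff_monomial, Finset.sum_ite_eq', Finset.mem_range, if_pos hk,
        Nat.div_add_mod]
    · rw [Polynomial.degree_eq_natDegree hπ.ne_zero, Polynomial.degree_lt_iff_coeff_zero]
      intro m hm
      rw [Polynomial.finsetSum_coeff]
      refine Finset.sum_eq_zero fun k hk => ?_
      rw [Finset.mem_range] at hk
      rw [Polynomial.coeff_monomial, if_neg (by omega)]
  · have := deg_ofVecA_lt b hπ (vecA b π r)
    rw [coeff_eq_zero_of_deg_lt (by omega), coeff_eq_zero_of_deg_lt (by omega)]

theorem eq_zero_of_ofVecA_eq_zero {c : Polynomial (AdjoinRoot π)}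
    (hc : c.degree < ((autOrder F * autOrder F : ℕ) : WithBot ℕ)) (h : ofVecA b π c = 0) :
    c = 0 := by
  have hμ := autOrder_pos (F := F)
  ext m
  rw [Polynomial.coeff_zero]
  by_cases hm : m < autOrder F * autOrder F
  · have hj : m % autOrder F < autOrder F := Nat.mod_lt _ hμ
    have hi : m / autOrder F < autOrder F := Nat.div_lt_of_lt_mul hm
    have hrep : rep π (c.coeff m) = 0 := by
      ext k
      have h1 := congrArg (SkewPolynomial.coeff · (autOrder F * k + m % autOrder F)) h
      beta_reduce at h1
      rw [coeff_ofVecA, SkewPolynomial.coeff_zero, Nat.mul_add_mod, Nat.mod_eq_of_lt hj,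
        Nat.mul_add_div hμ, Nat.div_eq_of_lt hj, add_zero] at h1
      have h2 := Fintype.linearIndependent_iff.1 b.linearIndependent _ h1 ⟨m / autOrder F, hi⟩
      rw [mul_comm, Nat.div_add_mod] at h2
      rw [h2, Polynomial.coeff_zero]
    rw [← mk_rep hπ (c.coeff m), hrep, map_zero]
  · exact (Polynomial.degree_lt_iff_coeff_zero _ _).1 hc m (by omega)

omit hπ in
/-- The element of `A` with given coordinates, as a linear map. -/
noncomputable def ofVecAHom : Polynomial (AdjoinRoot π) →ₗ[AdjoinRoot π] QuotA π :=
  ∑ i : Fin (autOrder F), ∑ j : Fin (autOrder F),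
    (Polynomial.lcoeff (AdjoinRoot π) ((i : ℕ) * autOrder F + j)).smulRight
      (mkA π (SkewPolynomial.monomial (j : ℕ) (b i)))

theorem ofVecAHom_apply (c : Polynomial (AdjoinRoot π)) :
    ofVecAHom b c = mkA π (ofVecA b π c) := by
  simp only [ofVecAHom, LinearMap.sum_apply, LinearMap.smulRight_apply, Polynomial.lcoeff_apply,
    ofVecA, map_sum]
  refine Finset.sum_congr rfl fun i _ => Finset.sum_congr rfl fun j _ => ?_
  rw [← mk_smul_mkA, mk_rep hπ]

/-- Linear relations between reduced skew polynomials in `A` are the linear relations between their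
coordinate vectors. -/
theorem relMap_vecA_eq_zero_iff (ts : List (SkewPolynomial F))
    (hts : ∀ t ∈ ts, deg t < autOrder F * π.natDegree) (c : Polynomial (AdjoinRoot π)) :
    relMap (fun i => (ts.map (vecA b π)).getD i 0) c = 0 ↔
      relMap (fun i => mkA π (ts.getD i 0)) c = 0 := by
  have hv : ∀ i, (fun i => (ts.map (vecA b π)).getD i 0) i = vecA b π (ts.getD i 0) ∧
      deg (ts.getD i 0) < autOrder F * π.natDegree := by
    have hirr : Irreducible π := Fact.out
    intro i
    by_cases hi : i < ts.length
    · have h1 : ts.getD i 0 = ts[i] := by simp [hi]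
      rw [h1]
      exact ⟨by simp [hi], hts _ (List.getElem_mem hi)⟩
    · have h1 : ts.getD i 0 = 0 := by simp [not_lt.1 hi]
      rw [h1, deg_zero]
      refine ⟨?_, Nat.mul_pos autOrder_pos hirr.natDegree_pos⟩
      have h2 : vecA b π (0 : SkewPolynomial F) = 0 := by
        simp [vecA]
      rw [h2]
      simp [not_lt.1 hi]
  have hmap : ofVecAHom b (relMap (fun i => (ts.map (vecA b π)).getD i 0) c) =
      relMap (fun i => mkA π (ts.getD i 0)) c := by
    rw [map_relMap]
    congr 2
    funext i
    have := (hv i).1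
    beta_reduce at this
    rw [this, ofVecAHom_apply b hπ, ofVecA_vecA b hπ (hv i).2]
  constructor
  · intro h
    rw [← hmap, h, map_zero]
  · intro h
    have h1 : (relMap (fun i => (ts.map (vecA b π)).getD i 0) c).degree <
        ((autOrder F * autOrder F : ℕ) : WithBot ℕ) := by
      rw [relMap_eq_sum _ c (Nat.lt_succ_self _), ← Polynomial.mem_degreeLT]
      refine Submodule.sum_mem _ fun i _ => Submodule.smul_mem _ _ ?_
      have h2 := (hv i).1
      beta_reduce at h2
      rw [Polynomial.mem_degreeLT, h2]
      exact degree_vecA_lt b π _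
    refine eq_zero_of_ofVecA_eq_zero b hπ h1 (eq_zero_of_mkA_eq_zero hπ (deg_ofVecA_lt b hπ _) ?_)
    rw [← ofVecAHom_apply b hπ, hmap, h]

omit [Finite F] hπ [Fact (Irreducible π)] in
theorem basisA_eq : basisA b = List.ofFn fun m : Fin (autOrder F * autOrder F) =>
    SkewPolynomial.monomial ((finProdFinEquiv.symm m).2 : ℕ) (b (finProdFinEquiv.symm m).1) := by
  rw [List.ofFn_mul, basisA, List.flatMap_def, List.ofFn_eq_map]
  congr 1
  refine List.map_congr_left fun i _ => ?_
  have hc : (do let a ← List.finRange (autOrder F); pure (a : ℕ)) =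
      (List.finRange (autOrder F)).map Fin.val := List.flatMap_pure_eq_map _ _
  rw [List.ofFn_eq_map, hc, List.map_map]
  refine List.map_congr_left fun j _ => ?_
  have : ∀ h, (⟨(i : ℕ) * autOrder F + j, h⟩ : Fin (autOrder F * autOrder F)) =
      finProdFinEquiv (i, j) := by
    intro h
    ext
    simp [finProdFinEquiv, add_comm, mul_comm]
  rw [this, Equiv.symm_apply_apply]
  rfl

theorem relMap_basisA (T : QuotA π →ₗ[AdjoinRoot π] QuotA π) {c : Polynomial (AdjoinRoot π)} :
    ∑ m ∈ Finset.range (autOrder F * autOrder F),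
      c.coeff m • T (mkA π ((basisA b).getD m 0)) = T (ofVecAHom b c) := by
  rw [Finset.sum_range, ← finProdFinEquiv.sum_comp, Fintype.sum_prod_type, ofVecAHom]
  simp only [LinearMap.sum_apply, LinearMap.smulRight_apply, Polynomial.lcoeff_apply, map_sum,
    map_smul]
  refine Finset.sum_congr rfl fun i _ => Finset.sum_congr rfl fun j _ => ?_
  rw [basisA_eq]
  have h1 : ((finProdFinEquiv (i, j) : Fin (autOrder F * autOrder F)) : ℕ) =
      i * autOrder F + j := by
    simp [finProdFinEquiv, add_comm, mul_comm]
  rw [h1]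
  congr 3
  rw [← h1, List.getD_eq_getElem _ _ (by rw [List.length_ofFn]; exact Fin.is_lt _),
    List.getElem_ofFn, Fin.eta, Equiv.symm_apply_apply]

end Coordinates

end SkewFact

namespace SkewFact

open SkewPolynomial (φ)

/-! ### Linear systems, idempotents and minimal polynomials in `R / R π` -/

section AlgebraComputations

/-- Endomorphism rings of vector spaces are von Neumann regular. -/
theorem exists_mul_mul_eq {k V : Type*} [Field k] [AddCommGroup V] [Module k V]
    (T : Module.End k V) : ∃ S : Module.End k V, T * S * T = T := by
  obtain ⟨s, hs⟩ := T.rangeRestrict.exists_rightInverse_of_surjective T.range_rangeRestrict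
  obtain ⟨S, hS⟩ := s.exists_extend
  refine ⟨S, LinearMap.ext fun v => ?_⟩
  have h1 : S (T v) = s (T.rangeRestrict v) := LinearMap.congr_fun hS (T.rangeRestrict v)
  have h2 := LinearMap.congr_fun hs (T.rangeRestrict v)
  change T (S (T v)) = T v
  rw [h1]
  exact congrArg Subtype.val h2

theorem solveVN_cost {m d W A B C : ℕ} (hm : 1 ≤ m) (hd : 1 ≤ d) (hW : 1 ≤ W)
    (hA : A ≤ (m * m) * (8 * W * (m * d) ^ 2))
    (hB : B ≤ 200 * d ^ 2 * ((m * m + m * m) * ((m * m + m * m + m * m) *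
      (2 * (m * m) + 2 * (m * m + m * m) + 5 * (m * m)))))
    (hC : C ≤ W * (m * d)) : A + (B + C) ≤ 13300 * (W * m ^ 6) * d ^ 2 := by
  calc A + (B + C) ≤ (m * m) * (8 * W * (m * d) ^ 2) + (200 * d ^ 2 * ((m * m + m * m) *
          ((m * m + m * m + m * m) * (2 * (m * m) + 2 * (m * m + m * m) + 5 * (m * m)))) +
          W * (m * d)) := by gcongr
    _ = 8 * (W * m ^ 4) * d ^ 2 + 13200 * (1 * m ^ 6) * d ^ 2 +
          1 * (W * m ^ 1) * d ^ 1 := by ring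
    _ ≤ 8 * (W * m ^ 6) * d ^ 2 + 13200 * (W * m ^ 6) * d ^ 2 +
          1 * (W * m ^ 6) * d ^ 2 := by
        gcongr <;> first | exact hm | exact hd | norm_num
    _ = 13209 * (W * m ^ 6) * d ^ 2 := by ring
    _ ≤ _ := by gcongr; norm_num

theorem natDegree_le_getLast {k : Type*} [Field k] {l : List (Polynomial k)}
    (hl : l.Pairwise fun c c' => c.natDegree < c'.natDegree) (hne : l ≠ []) {c : Polynomial k}
    (hc : c ∈ l) : c.natDegree ≤ (l.getLast hne).natDegree := by
  rw [← List.dropLast_append_getLast hne] at hl hc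
  rcases List.mem_append.1 hc with h | h
  · exact ((List.pairwise_append.1 hl).2.2 _ h _ (by simp)).le
  · rw [List.mem_singleton.1 h]

variable {F : Type u} [Field F] [MulSemiringAction (Multiplicative ℕ) F] [Finite F] (w : OpCost)
  (b : Module.Basis (Fin (autOrder F)) (fixedField F) F)
  {π : Polynomial (fixedField F)} (hπ : π.Monic) [Fact (Irreducible π)]

theorem total_pos : 1 ≤ w.total := Nat.le_add_left _ _

include hπ

theorem deg_modA_lt (f : SkewPolynomial F) :
    deg (modA w π f).val < autOrder F * π.natDegree := by
  have hirr : Irreducible π := Fact.out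
  refine (modA_spec hπ w f).2.elim (fun h => ?_) id
  rw [h, deg_zero]
  exact Nat.mul_pos autOrder_pos hirr.natDegree_pos

theorem modA_ops {f : SkewPolynomial F} (hf : deg f ≤ autOrder F * π.natDegree) :
    (modA w π f).ops ≤ 9 * w.total * (autOrder F * π.natDegree) ^ 2 := by
  have hirr : Irreducible π := Fact.out
  have hN : 1 ≤ autOrder F * π.natDegree := Nat.mul_pos autOrder_pos hirr.natDegree_pos
  have h := (divR_spec w f (emb π) (emb_ne_zero hπ.ne_zero)).2.2
  simp only [modA, Cost.ops_bind, Cost.ops_pure, add_zero]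
  rw [deg_emb] at h
  set N := autOrder F * π.natDegree
  calc _ ≤ 3 * w.total * ((deg f + 1 - N) * (N + 1) + 1) := h
    _ ≤ 3 * w.total * (1 * (N + 1) + 1) := by gcongr; omega
    _ ≤ 3 * w.total * (3 * N ^ 2) := by gcongr; nlinarith
    _ = _ := by ring

theorem mulA_spec {f g : SkewPolynomial F} (hf : deg f < autOrder F * π.natDegree)
    (hg : deg g < autOrder F * π.natDegree) :
    mkA π (mulA w π f g).val = mkA π f * mkA π g ∧
    deg (mulA w π f g).val < autOrder F * π.natDegree ∧
    (mulA w π f g).ops ≤ 4 * w.total * (autOrder F * π.natDegree) ^ 2 := by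
  simp only [mulA, Cost.val_bind, Cost.ops_bind, mulR_val]
  refine ⟨?_, deg_modA_lt w hπ _, ?_⟩
  · rw [(modA_spec hπ w _).1, map_mul]
  · have h1 := mulR_ops w f g
    have h2 := (divR_spec w (f * g) (emb π) (emb_ne_zero hπ.ne_zero)).2.2
    have h3 := deg_mul_le f g
    simp only [modA, Cost.ops_bind, Cost.ops_pure, add_zero]
    rw [deg_emb] at h2
    set N := autOrder F * π.natDegree
    obtain ⟨M, hM⟩ : ∃ M, N = M + 1 := ⟨N - 1, by omega⟩
    calc _ ≤ w.total * ((deg f + 1) * (deg g + 1)) +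
          3 * w.total * ((deg (f * g) + 1 - N) * (N + 1) + 1) := by gcongr
      _ ≤ w.total * (N * N) + 3 * w.total * (M * (N + 1) + 1) := by gcongr <;> omega
      _ = 4 * w.total * N ^ 2 := by rw [hM]; ring

/-- Solution of `f = f y f`. -/
theorem solveVN_spec {f : SkewPolynomial F} (hf : deg f < autOrder F * π.natDegree)
    (hreg : ∃ y, mkA π f * y * mkA π f = mkA π f) :
    mkA π f * mkA π (solveVN w b π f).val * mkA π f = mkA π f ∧
    deg (solveVN w b π f).val < autOrder F * π.natDegree ∧
    (solveVN w b π f).ops ≤ 13300 * (w.total * autOrder F ^ 6) * π.natDegree ^ 2 := by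
  have hirr : Irreducible π := Fact.out
  have hδ := hirr.natDegree_pos
  have hμ := autOrder_pos (F := F)
  have hbas : ∀ v ∈ basisA b, deg v < autOrder F * π.natDegree := by
    intro v hv
    rw [basisA_eq, List.mem_ofFn] at hv
    obtain ⟨m, rfl⟩ := hv
    rw [deg_monomial (b.ne_zero _)]
    exact (Fin.is_lt _).trans_le (Nat.le_mul_of_pos_right _ hδ)
  have hlen : (basisA b).length = autOrder F * autOrder F := by rw [basisA_eq, List.length_ofFn]
  set step : SkewPolynomial F → SkewPolynomial F :=
    fun v => (mulA w π (mulA w π f v).val f).val with hstep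
  have hstep' : ∀ v, deg v < autOrder F * π.natDegree →
      mkA π (step v) = mkA π f * mkA π v * mkA π f ∧ deg (step v) < autOrder F * π.natDegree := by
    intro v hv
    obtain ⟨h1, h2, -⟩ := mulA_spec w hπ hf hv
    obtain ⟨h3, h4, -⟩ := mulA_spec w hπ h2 hf
    exact ⟨by rw [h3, h1], h4⟩
  set vsC := mapC (fun v => do
      let t ← mulA w π f v
      let t ← mulA w π t f
      pure (vecA b π t)) (basisA b) with hvsC
  set ts := (basisA b).map step ++ [f] with hts
  have hvs : vsC.val ++ [vecA b π f] = ts.map (vecA b π) := by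
    rw [hvsC, mapC_val, hts, List.map_append, List.map_map]
    rfl
  have htsd : ∀ t ∈ ts, deg t < autOrder F * π.natDegree := by
    intro t ht
    rcases List.mem_append.1 ht with h | h
    · obtain ⟨v, hv, rfl⟩ := List.mem_map.1 h
      exact (hstep' v (hbas v hv)).2
    · rwa [List.mem_singleton.1 h]
  have htslen : (ts.map (vecA b π)).length = autOrder F * autOrder F + 1 := by
    simp [hts, hlen]
  have hE := extData_faithful hπ
  obtain ⟨r1, r2, r3, r4⟩ := relations_spec hE.exact (ts.map (vecA b π))
    (autOrder F * autOrder F) (by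
      intro y hy
      obtain ⟨t, -, rfl⟩ := List.mem_map.1 hy
      exact natDegree_vecA_le b π t)
  rw [htslen] at r1 r3 r4
  -- the relation given by a coefficient vector `c` is `f y f + c_{μ²} f = 0` with `y = ∑ c_m b_m`
  have hrel : ∀ c : Polynomial (AdjoinRoot π), c.natDegree < autOrder F * autOrder F + 1 →
      relMap (fun i => mkA π (ts.getD i 0)) c = mkA π f * ofVecAHom b c * mkA π f +
        c.coeff (autOrder F * autOrder F) • mkA π f := by
    intro c hc
    rw [relMap_eq_sum _ c hc, Finset.sum_range_succ]
    have h1 := relMap_basisA b hπ (LinearMap.mulLeftRight (AdjoinRoot π) (mkA π f, mkA π f))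
      (c := c)
    simp only [LinearMap.mulLeftRight_apply] at h1
    rw [← h1]
    refine congrArg₂ (· + ·) (Finset.sum_congr rfl fun m hm => ?_) (congrArg₂ (· • ·) rfl ?_)
    · rw [Finset.mem_range] at hm
      have hm' : m < (basisA b).length := by rw [hlen]; exact hm
      have h2 : ts.getD m 0 = step ((basisA b).getD m 0) := by
        rw [hts, List.getD_append _ _ _ _ (by rwa [List.length_map]),
          List.getD_eq_getElem _ _ (by rwa [List.length_map]), List.getElem_map,
          List.getD_eq_getElem _ _ hm']
      rw [h2, (hstep' _ (by
        rw [List.getD_eq_getElem _ _ hm']; exact hbas _ (List.getElem_mem _))).1]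
    · have h2 : ts.getD (autOrder F * autOrder F) 0 = f := by
        rw [hts, List.getD_append_right _ _ _ _ (by rw [List.length_map, hlen]),
          List.length_map, hlen, Nat.sub_self]
        rfl
      rw [h2]
  have hXpow : ofVecAHom b (Polynomial.X ^ (autOrder F * autOrder F) :
      Polynomial (AdjoinRoot π)) = 0 := by
    simp only [ofVecAHom, LinearMap.sum_apply, LinearMap.smulRight_apply,
      Polynomial.lcoeff_apply]
    refine Finset.sum_eq_zero fun i _ => Finset.sum_eq_zero fun j _ => ?_
    rw [Polynomial.coeff_X_pow, if_neg (index_lt i j).ne, zero_smul]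
  set rels := relations (extData π).toArith (ts.map (vecA b π)) with hrels
  have hex : ∃ c' ∈ rels.val, c'.natDegree = autOrder F * autOrder F := by
    obtain ⟨y, hy⟩ := hreg
    obtain ⟨r, rfl, hr⟩ := exists_reduced hπ y hδ
    set c : Polynomial (AdjoinRoot π) :=
      Polynomial.X ^ (autOrder F * autOrder F) - vecA b π r with hc
    have hdeg : (vecA b π r).degree <
        (Polynomial.X ^ (autOrder F * autOrder F) : Polynomial (AdjoinRoot π)).degree := by
      rw [Polynomial.degree_X_pow]
      exact degree_vecA_lt b π r
    have hcd : c.natDegree = autOrder F * autOrder F := by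
      rw [← Polynomial.natDegree_X_pow (R := AdjoinRoot π) (autOrder F * autOrder F)]
      exact Polynomial.natDegree_eq_of_degree_eq (Polynomial.degree_sub_eq_left_of_degree_lt hdeg)
    have hcoeff : c.coeff (autOrder F * autOrder F) = 1 := by
      rw [hc, Polynomial.coeff_sub, Polynomial.coeff_X_pow, if_pos rfl,
        (Polynomial.degree_lt_iff_coeff_zero _ _).1 (degree_vecA_lt b π r) _ le_rfl, sub_zero]
    obtain ⟨c', h1, h2⟩ := r3 c
      (fun h0 => by rw [h0, Polynomial.coeff_zero] at hcoeff; exact zero_ne_one hcoeff)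
      (by omega)
      ((relMap_vecA_eq_zero_iff b hπ ts htsd c).2 (by
        rw [hrel c (by omega), hcoeff, one_smul, hc, map_sub, hXpow, zero_sub,
          ofVecAHom_apply b hπ, ofVecA_vecA b hπ hr, mul_neg, neg_mul, hy, neg_add_cancel]))
    exact ⟨c', h1, h2.trans hcd⟩
  obtain ⟨c', hc', hc'd⟩ := hex
  have hne : rels.val ≠ [] := List.ne_nil_of_mem hc'
  set c := rels.val.getLast hne with hcdef
  have hlast : rels.val.getLastD 0 = c := List.getLastD_eq_getLast?.trans (by
    rw [List.getLast?_eq_getLast_of_ne_nil hne]; rfl)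
  obtain ⟨c1, c2, c3⟩ := r1 c (List.getLast_mem hne)
  have hcd : c.natDegree = autOrder F * autOrder F := by
    have h : c'.natDegree ≤ c.natDegree := natDegree_le_getLast r2 hne hc'
    omega
  have hval : (solveVN w b π f).val = -ofVecA b π c := by
    simp only [solveVN, Cost.val_bind, negR_val]
    rw [← hvsC, hvs, ← hrels, hlast]
  rw [hval]
  refine ⟨?_, ?_, ?_⟩
  · have h1 := (relMap_vecA_eq_zero_iff b hπ ts htsd c).1 c1
    rw [hrel c c3, ← hcd, c2.coeff_natDegree, one_smul] at h1
    rw [map_neg, ← ofVecAHom_apply b hπ, mul_neg, neg_mul]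
    exact neg_eq_of_add_eq_zero_right h1
  · rw [deg_neg]
    exact deg_ofVecA_lt b hπ c
  · simp only [solveVN, Cost.ops_bind]
    rw [← hvsC, hvs, ← hrels, hlast]
    have o1 : vsC.ops ≤ (autOrder F * autOrder F) *
        (8 * w.total * (autOrder F * π.natDegree) ^ 2) := by
      rw [← hlen, hvsC]
      refine mapC_ops_le _ _ _ fun v hv => ?_
      obtain ⟨h1, h2, h3⟩ := mulA_spec w hπ hf (hbas v hv)
      obtain ⟨-, -, h4⟩ := mulA_spec w hπ h2 hf
      simp only [Cost.ops_bind, Cost.ops_pure]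
      linarith
    have r4' : rels.ops ≤ 200 * π.natDegree ^ 2 * ((autOrder F * autOrder F +
        autOrder F * autOrder F) * ((autOrder F * autOrder F + autOrder F * autOrder F +
        autOrder F * autOrder F) * (2 * (autOrder F * autOrder F) + 2 * (autOrder F * autOrder F +
        autOrder F * autOrder F) + 5 * (autOrder F * autOrder F)))) := by
      refine r4.trans ?_
      have h : 1 ≤ autOrder F * autOrder F := Nat.mul_pos hμ hμ
      gcongr <;> omega
    have o2 := negR_ops w (ofVecA b π c)
    have o3 := deg_ofVecA_lt b hπ c
    exact solveVN_cost hμ hδ (total_pos w) o1 r4' (o2.trans (Nat.mul_le_mul_left _ o3))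

theorem coIdempotent_spec {f : SkewPolynomial F} (hf : deg f ≤ autOrder F * π.natDegree)
    (hreg : ∃ y, mkA π f * y * mkA π f = mkA π f) :
    (∃ y, mkA π f * y * mkA π f = mkA π f ∧
      mkA π (coIdempotent w b π f).val = 1 - y * mkA π f) ∧
    deg (coIdempotent w b π f).val < autOrder F * π.natDegree ∧
    (coIdempotent w b π f).ops ≤ 13400 * (w.total * autOrder F ^ 6) * π.natDegree ^ 2 := by
  have hirr : Irreducible π := Fact.out
  have hδ := hirr.natDegree_pos
  have hμ := autOrder_pos (F := F)
  have hN : 1 ≤ autOrder F * π.natDegree := Nat.mul_pos hμ hδ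
  obtain ⟨h1, -⟩ := modA_spec hπ w f
  have h2 := deg_modA_lt w hπ f
  have h3 := modA_ops w hπ hf
  simp only [coIdempotent, Cost.val_bind, Cost.ops_bind, addMulR_val, negR_val]
  set f₀ := (modA w π f).val
  rw [← h1] at hreg ⊢
  obtain ⟨s1, s2, s3⟩ := solveVN_spec w b hπ h2 hreg
  set y := (solveVN w b π f₀).val
  obtain ⟨m1, m2, m3⟩ := mulA_spec w hπ s2 h2
  set e := (mulA w π y f₀).val
  have o1 := negR_ops w e
  have o2 := addMulR_ops w 1 1 (-e)
  rw [deg_one] at o2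
  refine ⟨⟨mkA π y, s1, ?_⟩, ?_, ?_⟩
  · rw [map_add, map_neg, m1, mul_one, map_one]
    abel
  · refine (deg_add_le _ _).trans_lt (max_lt (by rwa [deg_neg]) ?_)
    rw [mul_one, deg_one]
    exact hN
  · set m := autOrder F
    set d := π.natDegree
    calc _ ≤ 9 * w.total * (m * d) ^ 2 + (13300 * (w.total * m ^ 6) * d ^ 2 +
          (4 * w.total * (m * d) ^ 2 + (w.total * (m * d) +
            w.total * ((0 + 1) * (0 + 1))))) := by
          gcongr
          exact o1.trans (by gcongr; omega)
      _ = 13300 * (w.total * m ^ 6) * d ^ 2 + 13 * (w.total * m ^ 2) * d ^ 2 +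
          (w.total * m ^ 1) * d ^ 1 + (w.total * m ^ 0) * d ^ 0 := by ring
      _ ≤ 13300 * (w.total * m ^ 6) * d ^ 2 + 13 * (w.total * m ^ 6) * d ^ 2 +
          (w.total * m ^ 6) * d ^ 2 + (w.total * m ^ 6) * d ^ 2 := by
          gcongr <;> first | exact hμ | exact hδ | norm_num
      _ = 13315 * (w.total * m ^ 6) * d ^ 2 := by ring
      _ ≤ _ := by gcongr; norm_num

theorem powersA_spec {a : SkewPolynomial F} (ha : deg a < autOrder F * π.natDegree) (n : ℕ) :
    ∀ p : SkewPolynomial F, deg p < autOrder F * π.natDegree →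
      (powersA w π a n p).val.length = n + 1 ∧
      (∀ t ∈ (powersA w π a n p).val, deg t < autOrder F * π.natDegree) ∧
      (∀ i ≤ n, mkA π ((powersA w π a n p).val.getD i 0) = mkA π p * mkA π a ^ i) ∧
      (powersA w π a n p).ops ≤ n * (4 * w.total * (autOrder F * π.natDegree) ^ 2) := by
  induction n with
  | zero =>
    intro p hp
    simp only [powersA, Cost.val_pure, Cost.ops_pure]
    refine ⟨rfl, fun t ht => ?_, fun i hi => ?_, Nat.zero_le _⟩
    · rwa [List.mem_singleton.1 ht]
    · rw [Nat.le_zero.1 hi]; simp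
  | succ n ih =>
    intro p hp
    obtain ⟨m1, m2, m3⟩ := mulA_spec w hπ hp ha
    obtain ⟨i1, i2, i3, i4⟩ := ih _ m2
    simp only [powersA, Cost.val_bind, Cost.ops_bind, Cost.val_pure, Cost.ops_pure]
    refine ⟨by rw [List.length_cons, i1], fun t ht => ?_, fun i hi => ?_, ?_⟩
    · rcases List.mem_cons.1 ht with rfl | h
      · exact hp
      · exact i2 t h
    · cases i with
      | zero => simp
      | succ i =>
        rw [List.getD_cons_succ, i3 i (by omega), m1, mul_assoc, ← pow_succ']
    · rw [add_mul, one_mul]; omega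

theorem evalA_spec (g : Polynomial (AdjoinRoot π)) (pows : List (SkewPolynomial F))
    (hp : ∀ t ∈ pows, deg t < autOrder F * π.natDegree) (hg : g.natDegree < pows.length) :
    mkA π (evalA w π g pows).val = relMap (fun i => mkA π (pows.getD i 0)) g ∧
    deg (evalA w π g pows).val < autOrder F * π.natDegree ∧
    (evalA w π g pows).ops ≤ pows.length * (5 * w.total * (autOrder F * π.natDegree) ^ 2) := by
  have hirr : Irreducible π := Fact.out
  have hδ := hirr.natDegree_pos
  have hN : 1 ≤ autOrder F * π.natDegree := Nat.mul_pos autOrder_pos hδ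
  have hzip : pows.zipIdx = (List.range pows.length).map fun i => (pows.getD i 0, i) := by
    apply List.ext_getElem (by simp)
    intro i h1 h2
    simp only [List.length_zipIdx] at h1
    simp [h1]
  rw [evalA, hzip, List.foldlM_map, relMap_eq_sum _ g hg]
  have key := foldlM_range_spec (fun (s : SkewPolynomial F) i => do
      let t ← mulA w π (emb (rep π (g.coeff i))) (pows.getD i 0)
      addMulR w 1 t s)
    (fun n s => mkA π s = ∑ i ∈ Finset.range n, g.coeff i • mkA π (pows.getD i 0) ∧
      deg s < autOrder F * π.natDegree)
    (fun _ => 5 * w.total * (autOrder F * π.natDegree) ^ 2) 0 pows.length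
    ⟨by simp, by rw [deg_zero]; exact hN⟩ (by
      rintro i s hi ⟨h1, h2⟩
      have hd : deg (emb (rep π (g.coeff i))) < autOrder F * π.natDegree := by
        rw [deg_emb]
        exact Nat.mul_lt_mul_of_pos_left (natDegree_rep_lt hπ hδ _) autOrder_pos
      have hpi : deg (pows.getD i 0) < autOrder F * π.natDegree := by
        rw [List.getD_eq_getElem _ _ hi]; exact hp _ (List.getElem_mem _)
      obtain ⟨m1, m2, m3⟩ := mulA_spec w hπ hd hpi
      simp only [Cost.val_bind, Cost.ops_bind, addMulR_val, one_mul]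
      refine ⟨⟨?_, ?_⟩, ?_⟩
      · rw [map_add, h1, m1, Finset.sum_range_succ, ← map_mul, ← mk_smul_mkA, mk_rep hπ]
      · exact (deg_add_le _ _).trans_lt (max_lt h2 m2)
      · have o := addMulR_ops w 1 (mulA w π (emb (rep π (g.coeff i))) (pows.getD i 0)).val s
        rw [deg_one] at o
        set N := autOrder F * π.natDegree
        calc _ ≤ 4 * w.total * N ^ 2 + w.total * ((0 + 1) * N) := by
              refine Nat.add_le_add m3 (o.trans ?_)
              gcongr
              omega
          _ ≤ 4 * w.total * N ^ 2 + w.total * N ^ 2 := by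
              gcongr
              nlinarith
          _ = _ := by ring)
  rw [Finset.sum_const, Finset.card_range, smul_eq_mul] at key
  exact ⟨key.1.1, key.1.2, key.2⟩

theorem relMap_mul_pow (e a : QuotA π) (c : Polynomial (AdjoinRoot π)) :
    relMap (fun i => e * a ^ i) c = e * Polynomial.aeval a c := by
  rw [relMap_eq_sum _ c (Nat.lt_succ_self _), Polynomial.aeval_eq_sum_range, Finset.mul_sum]
  exact Finset.sum_congr rfl fun i _ => (mul_smul_comm _ _ _).symm

/-- The search for a zero divisor from an element `x`: `g` is the minimal polynomial of
`a = e' x e'` in the corner algebra `e' A e'`. -/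
theorem zeroDivisorFrom_spec {e' x : SkewPolynomial F}
    (he : deg e' < autOrder F * π.natDegree) (hx : deg x < autOrder F * π.natDegree)
    (hex : ∃ c : Polynomial (AdjoinRoot π), c ≠ 0 ∧ c.natDegree ≤ autOrder F ^ 2 ∧
      mkA π e' * Polynomial.aeval (mkA π e' * mkA π x * mkA π e') c = 0) :
    (∃ g : Polynomial (AdjoinRoot π), g.Monic ∧
      mkA π e' * Polynomial.aeval (mkA π e' * mkA π x * mkA π e') g = 0 ∧
      (∀ c : Polynomial (AdjoinRoot π), c ≠ 0 → c.natDegree < g.natDegree →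
        mkA π e' * Polynomial.aeval (mkA π e' * mkA π x * mkA π e') c ≠ 0) ∧
      ((zeroDivisorFrom w b π e' x).val = none → Irreducible g ∨ g = 1) ∧
      ∀ ζ, (zeroDivisorFrom w b π e' x).val = some ζ →
        deg ζ < autOrder F * π.natDegree ∧ ∃ g₁ g₂, g = g₁ * g₂ ∧ 0 < g₁.natDegree ∧
          0 < g₂.natDegree ∧
          mkA π ζ = mkA π e' * Polynomial.aeval (mkA π e' * mkA π x * mkA π e') g₁) ∧
    (zeroDivisorFrom w b π e' x).ops ≤
      60000 * Nat.card (fixedField F) * (w.total * autOrder F ^ 6) * π.natDegree ^ 3 := by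
  have hirr : Irreducible π := Fact.out
  have hδ := hirr.natDegree_pos
  have hμ := autOrder_pos (F := F)
  obtain ⟨t1, t2, t3⟩ := mulA_spec w hπ he hx
  obtain ⟨a1, a2, a3⟩ := mulA_spec w hπ t2 he
  rw [t1] at a1
  rw [← a1] at hex ⊢
  have hE := extData_faithful hπ
  set a := (mulA w π (mulA w π e' x).val e').val with ha
  obtain ⟨p1, p2, p3, p4⟩ := powersA_spec w hπ a2 (autOrder F ^ 2) e' he
  set pows := (powersA w π a (autOrder F ^ 2) e').val with hpows
  obtain ⟨r1, r2, r3, r4⟩ := relations_spec hE.exact (pows.map (vecA b π))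
    (autOrder F * autOrder F) (by
      intro y hy
      obtain ⟨t, -, rfl⟩ := List.mem_map.1 hy
      exact natDegree_vecA_le b π t)
  rw [List.length_map, p1] at r1 r3 r4
  set rels := relations (extData π).toArith (pows.map (vecA b π)) with hrels
  have hrel : ∀ c : Polynomial (AdjoinRoot π), c.natDegree < autOrder F ^ 2 + 1 →
      relMap (fun i => mkA π (pows.getD i 0)) c = mkA π e' * Polynomial.aeval (mkA π a) c := by
    intro c hc
    rw [← relMap_mul_pow hπ]
    exact relMap_congr hc fun i hi => p3 i (by omega)
  have hrel0 := fun c hc => (relMap_vecA_eq_zero_iff b hπ pows p2 c).trans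
    (by rw [hrel c hc] : _ ↔ mkA π e' * Polynomial.aeval (mkA π a) c = 0)
  have hne : rels.val ≠ [] := by
    obtain ⟨c, hc0, hcd, hc⟩ := hex
    obtain ⟨c', hc', -⟩ := r3 c hc0 (by omega) ((hrel0 c (by omega)).2 hc)
    exact List.ne_nil_of_mem hc'
  obtain ⟨g, rs, hgr⟩ := List.exists_cons_of_ne_nil hne
  have hhead : rels.val.headD 0 = g := by rw [hgr]; rfl
  obtain ⟨g1, g2, g3⟩ := r1 g (by rw [hgr]; simp)
  obtain ⟨f1, f2, f3⟩ := factorPoly_spec (baseArith_exact (K := fixedField F)) hE g2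
  have hval : zeroDivisorFrom w b π e' x = (do
      let t ← mulA w π e' x
      let a ← mulA w π t e'
      let pows ← powersA w π a (autOrder F ^ 2) e'
      let rels ← relations (extData π).toArith (pows.map (vecA b π))
      let fs ← factorPoly (baseArith (fixedField F)) (extData π) (rels.headD 0)
      match fs with
      | g₁ :: _ :: _ => do
        let ζ ← evalA w π g₁ pows
        pure (some ζ)
      | _ => pure none) := rfl
  set fs := factorPoly (baseArith (fixedField F)) (extData π) g with hfs
  have hops : (mulA w π e' x).ops + ((mulA w π (mulA w π e' x).val e').ops +
      ((powersA w π a (autOrder F ^ 2) e').ops + (rels.ops + fs.ops))) ≤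
      53700 * Nat.card (fixedField F) * (w.total * autOrder F ^ 6) * π.natDegree ^ 3 := by
    have hq : 1 ≤ Nat.card (fixedField F) := Nat.card_pos
    have hW := total_pos w
    have hwt : (extData π).weight (200 * π.natDegree ^ 2) = 201 * π.natDegree ^ 3 := by
      change π.natDegree * (200 * π.natDegree ^ 2) + π.natDegree ^ 3 = _
      ring
    rw [hwt] at f3
    have hgd : g.natDegree ≤ autOrder F ^ 2 := by omega
    set m := autOrder F
    set d := π.natDegree
    set q := Nat.card (fixedField F)
    have q1 : rels.ops ≤ 200 * d ^ 2 * ((m ^ 2 + m ^ 2) * ((m ^ 2 + m ^ 2 + m ^ 2) *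
        (2 * m ^ 2 + 2 * (m ^ 2 + m ^ 2) + 5 * m ^ 2))) := by
      refine r4.trans ?_
      rw [← pow_two m]
      have : 1 ≤ m ^ 2 := Nat.one_le_pow _ _ hμ
      gcongr <;> omega
    calc _ ≤ 4 * w.total * (m * d) ^ 2 + (4 * w.total * (m * d) ^ 2 +
          (m ^ 2 * (4 * w.total * (m * d) ^ 2) + (200 * d ^ 2 * ((m ^ 2 + m ^ 2) *
            ((m ^ 2 + m ^ 2 + m ^ 2) * (2 * m ^ 2 + 2 * (m ^ 2 + m ^ 2) + 5 * m ^ 2))) +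
            200 * q * (201 * d ^ 3) * (m ^ 2) ^ 3))) := by
          gcongr
          exact f3.trans (by gcongr)
      _ = 8 * 1 * (w.total * m ^ 2) * d ^ 2 + 4 * 1 * (w.total * m ^ 4) * d ^ 2 +
          13200 * 1 * (1 * m ^ 6) * d ^ 2 + 40200 * q * (1 * m ^ 6) * d ^ 3 := by ring
      _ ≤ 8 * q * (w.total * m ^ 6) * d ^ 3 + 4 * q * (w.total * m ^ 6) * d ^ 3 +
          13200 * q * (w.total * m ^ 6) * d ^ 3 + 40200 * q * (w.total * m ^ 6) * d ^ 3 := by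
          gcongr <;> first | exact hμ | exact hδ | norm_num
      _ = 53412 * q * (w.total * m ^ 6) * d ^ 3 := by ring
      _ ≤ _ := by gcongr; norm_num
  have hzv : (zeroDivisorFrom w b π e' x).val = (match fs.val with
      | g₁ :: _ :: _ => do
        let ζ ← evalA w π g₁ pows
        pure (some ζ)
      | _ => (pure none : Cost (Option (SkewPolynomial F)))).val := by
    rw [hval]
    simp only [Cost.val_bind]
    rw [← ha, ← hpows, ← hrels, hhead]
  have hzo : (zeroDivisorFrom w b π e' x).ops = (mulA w π e' x).ops +
      ((mulA w π (mulA w π e' x).val e').ops +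
      ((powersA w π a (autOrder F ^ 2) e').ops + (rels.ops + (fs.ops + (match fs.val with
      | g₁ :: _ :: _ => do
        let ζ ← evalA w π g₁ pows
        pure (some ζ)
      | _ => (pure none : Cost (Option (SkewPolynomial F)))).ops)))) := by
    rw [hval]
    simp only [Cost.ops_bind]
    rw [← ha, ← hpows, ← hrels, hhead]
  have hg0 := (hrel0 g g3).1 g1
  have hmin : ∀ c : Polynomial (AdjoinRoot π), c ≠ 0 → c.natDegree < g.natDegree →
      mkA π e' * Polynomial.aeval (mkA π a) c ≠ 0 := by
    intro c hc0 hcd hc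
    obtain ⟨c', hc', hc'd⟩ := r3 c hc0 (by omega) ((hrel0 c (by omega)).2 hc)
    rw [hgr] at hc' r2
    rcases List.mem_cons.1 hc' with rfl | h
    · omega
    · have := (List.pairwise_cons.1 r2).1 c' h
      omega
  have hmono : ∀ {A : ℕ}, A ≤ 53700 * Nat.card (fixedField F) * (w.total * autOrder F ^ 6) *
      π.natDegree ^ 3 → A ≤
      60000 * Nat.card (fixedField F) * (w.total * autOrder F ^ 6) * π.natDegree ^ 3 :=
    fun h => h.trans (by gcongr; norm_num)
  rw [hzv, hzo]
  rcases hl : fs.val with _ | ⟨q₁, _ | ⟨q₂, l⟩⟩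
  · refine ⟨⟨g, g2, hg0, hmin, fun _ => Or.inr ?_, fun ζ h => ?_⟩, hmono ?_⟩
    · rw [← f2, hl, List.prod_nil]
    · simp at h
    · simpa using hops
  · refine ⟨⟨g, g2, hg0, hmin, fun _ => Or.inl ?_, fun ζ h => ?_⟩, hmono ?_⟩
    · rw [← f2, hl, List.prod_singleton]
      exact (f1 q₁ (by rw [hl]; simp)).2
    · simp at h
    · simpa using hops
  · have e1 := f1 q₁ (by rw [hl]; simp)
    have e2 : ∀ p ∈ q₂ :: l, p.Monic := fun p hp => (f1 p (by rw [hl]; exact .tail _ hp)).1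
    have e3 := (f1 q₂ (by rw [hl]; simp)).2.natDegree_pos
    have e4 : g = q₁ * (q₂ :: l).prod := by rw [← f2, hl, List.prod_cons]
    have e5 : 0 < (q₂ :: l).prod.natDegree := by
      rw [List.prod_cons, (e2 q₂ (by simp)).natDegree_mul
        (monic_list_prod l fun p hp => e2 p (by simp [hp]))]
      omega
    have e6 : g.natDegree = q₁.natDegree + (q₂ :: l).prod.natDegree := by
      rw [e4, e1.1.natDegree_mul (monic_list_prod _ e2)]
    obtain ⟨v1, v2, v3⟩ := evalA_spec w hπ q₁ pows p2 (by omega)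
    rw [hrel q₁ (by omega)] at v1
    refine ⟨⟨g, g2, hg0, hmin, fun h => ?_, fun ζ h => ?_⟩, ?_⟩
    · simp at h
    · simp only [Cost.val_bind, Cost.val_pure, Option.some.injEq] at h
      rw [← h]
      exact ⟨v2, q₁, (q₂ :: l).prod, e4, e1.2.natDegree_pos, e5, v1⟩
    · simp only [Cost.ops_bind, Cost.ops_pure, add_zero]
      rw [p1] at v3
      have hq : 1 ≤ Nat.card (fixedField F) := Nat.card_pos
      have v4 : (evalA w π q₁ pows).ops ≤
          10 * Nat.card (fixedField F) * (w.total * autOrder F ^ 6) * π.natDegree ^ 3 := by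
        have : 1 ≤ autOrder F ^ 2 := Nat.one_le_pow _ _ hμ
        calc _ ≤ (autOrder F ^ 2 + autOrder F ^ 2) *
              (5 * w.total * (autOrder F * π.natDegree) ^ 2) := v3.trans (by gcongr)
          _ = 10 * 1 * (w.total * autOrder F ^ 4) * π.natDegree ^ 2 := by ring
          _ ≤ _ := by gcongr <;> first | exact hμ | exact hδ | norm_num
      calc _ = (mulA w π e' x).ops + ((mulA w π (mulA w π e' x).val e').ops +
            ((powersA w π a (autOrder F ^ 2) e').ops + (rels.ops + fs.ops))) +
            (evalA w π q₁ pows).ops := by ring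
        _ ≤ 53700 * Nat.card (fixedField F) * (w.total * autOrder F ^ 6) * π.natDegree ^ 3 +
            10 * Nat.card (fixedField F) * (w.total * autOrder F ^ 6) * π.natDegree ^ 3 :=
          Nat.add_le_add hops v4
        _ = 53710 * Nat.card (fixedField F) * (w.total * autOrder F ^ 6) * π.natDegree ^ 3 := by
          ring
        _ ≤ _ := by gcongr; norm_num

end AlgebraComputations

end SkewFact

namespace SkewFact

open SkewPolynomial (φ)

/-! ### Endomorphisms with an eigenvector are frequent -/

section Eigenvectors

open Module

open Classical in
theorem card_preimage_mul_card {G H : Type*} [AddGroup G] [AddGroup H] [Fintype G] [Fintype H]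
    (f : G →+ H) (hf : Function.Surjective f) (P : H → Prop) :
    (Finset.univ.filter fun g => P (f g)).card * Fintype.card H =
      Fintype.card G * (Finset.univ.filter P).card := by
  have hfib : ∀ x : H, (Finset.univ.filter fun g => f g = x).card =
      (Finset.univ.filter fun g => f g = 0).card := fun x =>
    AddMonoidHom.card_fiber_eq_of_mem_range f (hf x) (hf 0)
  have key : ∀ Q : H → Prop, (Finset.univ.filter fun g => Q (f g)).card =
      (Finset.univ.filter Q).card * (Finset.univ.filter fun g => f g = 0).card := by
    intro Q
    rw [Finset.card_eq_sum_card_fiberwise (f := f) (t := Finset.univ.filter Q)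
      (fun g hg => by simpa using hg), ← smul_eq_mul, ← Finset.sum_const]
    refine Finset.sum_congr rfl fun x hx => ?_
    rw [← hfib x, Finset.filter_filter]
    refine congrArg Finset.card (Finset.filter_congr fun g _ => ?_)
    exact and_iff_right_of_imp fun h => h ▸ (Finset.mem_filter.1 hx).2
  have h1 := key fun _ => True
  simp only [Finset.filter_true, Finset.card_univ] at h1
  rw [key P, h1]
  ring

theorem exists_linearMap_eq {k V W ι : Type*} [Field k] [AddCommGroup V] [Module k V]
    [AddCommGroup W] [Module k W] {v : ι → V} (hv : LinearIndependent k v) (w : ι → W) :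
    ∃ T : V →ₗ[k] W, ∀ i, T (v i) = w i := by
  obtain ⟨T, hT⟩ := ((Basis.span hv).constr k w).exists_extend
  refine ⟨T, fun i => ?_⟩
  have h1 := LinearMap.congr_fun hT (Basis.span hv i)
  rw [Basis.constr_basis] at h1
  rw [← h1]
  simp [Basis.span_apply]

variable {k U : Type*} [Field k] [AddCommGroup U] [Module k U] [Fintype k] [Fintype U]
  [Fintype (End k U)]

open Classical in
theorem card_span_singleton {u : U} (hu : u ≠ 0) :
    (Finset.univ.filter fun v : U => ∃ c : k, v = c • u).card = Fintype.card k := by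
  rw [← Finset.card_univ, ← Finset.card_image_of_injective (f := fun c : k => c • u) Finset.univ
    (smul_left_injective k hu)]
  refine congrArg Finset.card (Finset.ext fun v => ?_)
  simp [eq_comm]

open Classical in
theorem card_eigenvector {u : U} (hu : u ≠ 0) :
    (Finset.univ.filter fun T : End k U => ∃ c : k, T u = c • u).card * Fintype.card U =
      Fintype.card (End k U) * Fintype.card k := by
  rw [← card_span_singleton (k := k) hu]
  have hs : Function.Surjective (AddMonoidHom.mk' (fun T : End k U => T u) fun _ _ => rfl) := by
    intro v
    obtain ⟨T, hT⟩ := exists_linearMap_eq (k := k) (v := fun _ : Unit => u)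
      (linearIndependent_unique_iff.2 hu) (fun _ => v)
    exact ⟨T, hT ()⟩
  convert card_preimage_mul_card _ hs fun v => ∃ c : k, v = c • u
  rfl

open Classical in
theorem card_eigenvector_pair {u v : U} (hu : u ≠ 0) (hv : ¬ ∃ c : k, v = c • u) :
    (Finset.univ.filter fun T : End k U =>
      (∃ c : k, T u = c • u) ∧ ∃ c : k, T v = c • v).card * Fintype.card U ^ 2 =
      Fintype.card (End k U) * Fintype.card k ^ 2 := by
  have hv0 : v ≠ 0 := fun h => hv ⟨0, by rw [h, zero_smul]⟩
  have h1 : (Finset.univ.filter fun x : U × U =>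
      (∃ c : k, x.1 = c • u) ∧ ∃ c : k, x.2 = c • v).card = Fintype.card k ^ 2 := by
    rw [pow_two]
    nth_rw 1 [← card_span_singleton (k := k) hu]
    rw [← card_span_singleton (k := k) hv0, ← Finset.card_product]
    exact congrArg Finset.card (Finset.ext fun x => by simp)
  have hli : LinearIndependent k ![u, v] := by
    rw [LinearIndependent.pair_iff' hu]
    exact fun a ha => hv ⟨a, ha.symm⟩
  rw [← h1, pow_two, ← Fintype.card_prod]
  have hs : Function.Surjective
      (AddMonoidHom.mk' (fun T : End k U => (T u, T v)) fun _ _ => rfl) := by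
    intro x
    obtain ⟨T, hT⟩ := exists_linearMap_eq hli ![x.1, x.2]
    exact ⟨T, Prod.ext (hT 0) (hT 1)⟩
  convert card_preimage_mul_card _ hs fun x => (∃ c : k, x.1 = c • u) ∧ ∃ c : k, x.2 = c • v
  all_goals rfl

open Classical in
/-- At least half of the endomorphisms of a nonzero finite vector space have an eigenvector. This
is the second moment method: the number `X T` of eigenvectors of a random `T` satisfies
`(E X) ^ 2 ≤ P (X ≠ 0) * E (X ^ 2)`. -/
theorem card_le_two_mul_card_eigenvector [Nontrivial U] :
    Fintype.card (End k U) ≤ 2 * (Finset.univ.filter fun T : End k U =>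
      ∃ u : U, u ≠ 0 ∧ ∃ c : k, T u = c • u).card := by
  set G := Finset.univ.filter fun T : End k U => ∃ u : U, u ≠ 0 ∧ ∃ c : k, T u = c • u
  set q : ℝ := (Fintype.card k : ℝ) with hq
  set Q : ℝ := (Fintype.card U : ℝ) with hQ
  set E : ℝ := (Fintype.card (End k U) : ℝ) with hE
  have hq2 : 2 ≤ q := by
    have : 2 ≤ Fintype.card k := Fintype.one_lt_card
    rw [hq]
    exact_mod_cast this
  have hQ2 : 2 ≤ Q := by
    have : 2 ≤ Fintype.card U := Fintype.one_lt_card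
    rw [hQ]
    exact_mod_cast this
  have hE0 : 0 < E := by
    have : 0 < Fintype.card (End k U) := Fintype.card_pos
    rw [hE]
    exact_mod_cast this
  -- the indicator function of the pairs of an endomorphism and an eigenvector
  let δ : End k U → U → ℝ := fun T u => if ∃ c : k, T u = c • u then 1 else 0
  let S : Finset U := Finset.univ.erase 0
  have hScard : (S.card : ℝ) = Q - 1 := by
    rw [Finset.card_erase_of_mem (Finset.mem_univ _), Finset.card_univ, Nat.cast_sub Fintype.card_pos,
      Nat.cast_one]
  have m1 : ∀ u ∈ S, ∑ T, δ T u = E * q / Q := by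
    intro u hu
    have h1 := card_eigenvector (k := k) (Finset.ne_of_mem_erase hu)
    have h2 : ∑ T, δ T u =
        ((Finset.univ.filter fun T : End k U => ∃ c : k, T u = c • u).card : ℝ) := by
      rw [Finset.sum_boole]
    rw [h2, eq_div_iff (by linarith), hE, hq, hQ]
    exact_mod_cast h1
  have m2 : ∀ u ∈ S, ∀ v ∈ S, ∑ T, δ T u * δ T v ≤
      if ∃ c : k, v = c • u then E * q / Q else E * q ^ 2 / Q ^ 2 := by
    intro u hu v hv
    split_ifs with h
    · rw [← m1 u hu]
      refine Finset.sum_le_sum fun T _ => ?_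
      refine mul_le_of_le_one_right ?_ ?_ <;> · dsimp only [δ]; split_ifs <;> norm_num
    · have h1 := card_eigenvector_pair (k := k) (Finset.ne_of_mem_erase hu) h
      have h2 : ∑ T, δ T u * δ T v = ((Finset.univ.filter fun T : End k U =>
          (∃ c : k, T u = c • u) ∧ ∃ c : k, T v = c • v).card : ℝ) := by
        rw [← Finset.sum_boole]
        refine Finset.sum_congr rfl fun T _ => ?_
        dsimp only [δ]
        split_ifs <;> simp_all
      rw [h2]
      refine le_of_eq ?_
      rw [eq_div_iff (by positivity), hE, hq, hQ]
      exact_mod_cast h1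
  let X : End k U → ℝ := fun T => ∑ u ∈ S, δ T u
  have hX1 : ∑ T ∈ G, X T = (Q - 1) * (E * q / Q) := by
    have h1 : ∑ T ∈ G, X T = ∑ T, X T := by
      refine Finset.sum_subset (Finset.subset_univ _) fun T _ hT => ?_
      refine Finset.sum_eq_zero fun u hu => if_neg fun h => hT ?_
      exact Finset.mem_filter.2 ⟨Finset.mem_univ _, u, Finset.ne_of_mem_erase hu, h⟩
    rw [h1, Finset.sum_comm, Finset.sum_congr rfl m1, Finset.sum_const, nsmul_eq_mul, hScard]
  have hX2 : ∑ T ∈ G, X T ^ 2 ≤ (Q - 1) * ((q - 1) * (E * q / Q) + (Q - q) * (E * q ^ 2 / Q ^ 2)) := by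
    calc ∑ T ∈ G, X T ^ 2 ≤ ∑ T, X T ^ 2 :=
          Finset.sum_le_sum_of_subset_of_nonneg (Finset.subset_univ _) fun _ _ _ => sq_nonneg _
      _ = ∑ u ∈ S, ∑ v ∈ S, ∑ T, δ T u * δ T v := by
          simp_rw [X, pow_two, Finset.sum_mul_sum]
          rw [Finset.sum_comm]
          exact Finset.sum_congr rfl fun u _ => Finset.sum_comm
      _ ≤ ∑ u ∈ S, ∑ v ∈ S, if ∃ c : k, v = c • u then E * q / Q else E * q ^ 2 / Q ^ 2 :=
          Finset.sum_le_sum fun u hu => Finset.sum_le_sum fun v hv => m2 u hu v hv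
      _ = ∑ u ∈ S, ((q - 1) * (E * q / Q) + (Q - q) * (E * q ^ 2 / Q ^ 2)) := by
          refine Finset.sum_congr rfl fun u hu => ?_
          have h1 : ((S.filter fun v => ∃ c : k, v = c • u).card : ℝ) = q - 1 := by
            rw [Finset.filter_erase, Finset.card_erase_of_mem (by
              simpa using ⟨(0 : k), (zero_smul k u).symm⟩),
              card_span_singleton (Finset.ne_of_mem_erase hu), Nat.cast_sub Fintype.card_pos,
              Nat.cast_one]
          have h2 : ((S.filter fun v => ¬ ∃ c : k, v = c • u).card : ℝ) = Q - q := by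
            have h3 := Finset.card_filter_add_card_filter_not (s := S) (fun v => ∃ c : k, v = c • u)
            have h4 : ((S.filter fun v => ∃ c : k, v = c • u).card : ℝ) +
              ((S.filter fun v => ¬ ∃ c : k, v = c • u).card : ℝ) = S.card := by exact_mod_cast h3
            linarith
          rw [Finset.sum_ite, Finset.sum_const, Finset.sum_const, nsmul_eq_mul, nsmul_eq_mul, h1, h2]
      _ = _ := by rw [Finset.sum_const, nsmul_eq_mul, hScard]
  have hCS := sq_sum_le_card_mul_sum_sq (s := G) (f := X)
  rw [hX1] at hCS
  have h1 := hCS.trans (mul_le_mul_of_nonneg_left hX2 (Nat.cast_nonneg _))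
  have h2 : (E * q * (Q - 1) / Q ^ 2) * (E * (q * (Q - 1))) ≤
      (E * q * (Q - 1) / Q ^ 2) * (G.card * ((q - 1) * Q + (Q - q) * q)) := by
    have hQ0 : Q ≠ 0 := by linarith
    have e1 : (E * q * (Q - 1) / Q ^ 2) * (E * (q * (Q - 1))) =
        ((Q - 1) * (E * q / Q)) ^ 2 := by ring
    have e2 : (E * q * (Q - 1) / Q ^ 2) * (G.card * ((q - 1) * Q + (Q - q) * q)) =
        G.card * ((Q - 1) * ((q - 1) * (E * q / Q) + (Q - q) * (E * q ^ 2 / Q ^ 2))) := by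
      have e3 : E * q / Q = E * q * Q / Q ^ 2 := by
        rw [pow_two, mul_div_mul_right _ _ hQ0]
      rw [e3]
      ring
    rw [e1, e2]
    exact h1
  have h3 := le_of_mul_le_mul_left h2 (by
    have : 0 < Q - 1 := by linarith
    positivity)
  have hG : (0 : ℝ) ≤ G.card := Nat.cast_nonneg _
  have h4 : (q - 1) * Q + (Q - q) * q ≤ 2 * (q * (Q - 1)) := by nlinarith
  have h5 : E * (q * (Q - 1)) ≤ (2 * G.card) * (q * (Q - 1)) := by nlinarith
  have h6 : E ≤ 2 * G.card := le_of_mul_le_mul_right h5 (by nlinarith)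
  rw [hE] at h6
  exact_mod_cast h6

open Classical in
/-- In dimension at least two, at least three eighths of the endomorphisms are not scalar and have
an eigenvector. -/
theorem three_mul_card_le_card_eigenvector (hU : 2 ≤ finrank k U) :
    3 * Fintype.card (End k U) ≤ 8 * (Finset.univ.filter fun T : End k U =>
      (∃ u : U, u ≠ 0 ∧ ∃ c : k, T u = c • u) ∧ ∀ c : k, T ≠ c • 1).card := by
  have : Nontrivial U := nontrivial_of_finrank_pos (R := k) (by omega)
  have h1 := card_le_two_mul_card_eigenvector (k := k) (U := U)
  set G := Finset.univ.filter fun T : End k U => ∃ u : U, u ≠ 0 ∧ ∃ c : k, T u = c • u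
  have h2 : (G.filter fun T => ¬ ∀ c : k, T ≠ c • 1).card ≤ Fintype.card k := by
    rw [← Finset.card_univ]
    refine (Finset.card_le_card (t := Finset.univ.image fun c : k => c • (1 : End k U))
      fun T hT => ?_).trans Finset.card_image_le
    obtain ⟨c, hc⟩ := not_forall.1 (Finset.mem_filter.1 hT).2
    exact Finset.mem_image.2 ⟨c, Finset.mem_univ _, (not_not.1 hc).symm⟩
  have h3 := Finset.card_filter_add_card_filter_not (s := G) (fun T => ∀ c : k, T ≠ c • 1)
  rw [Finset.filter_filter] at h3
  have h4 : 8 * Fintype.card k ≤ Fintype.card (End k U) := by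
    rw [Module.card_eq_pow_finrank (K := k) (V := End k U), finrank_linearMap]
    have hk : 2 ≤ Fintype.card k := Fintype.one_lt_card
    calc 8 * Fintype.card k = 2 ^ 3 * Fintype.card k := by norm_num
      _ ≤ Fintype.card k ^ 3 * Fintype.card k := by gcongr
      _ = Fintype.card k ^ (2 * 2) := by ring
      _ ≤ _ := Nat.pow_le_pow_right (by omega) (Nat.mul_le_mul hU hU)
  omega

end Eigenvectors

end SkewFact

namespace SkewFact

open SkewPolynomial (φ)

/-! ### Zero divisors in the corner algebra -/

section ZeroDivisors

open Module

theorem isIdempotentElem_one_sub {A : Type*} [Ring A] {x y : A} (h : x * y * x = x) :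
    (1 - y * x) * (1 - y * x) = 1 - y * x := by
  have : y * x * (y * x) = y * x := by rw [mul_assoc, ← mul_assoc x, h]
  simp only [mul_sub, sub_mul, this, one_mul, mul_one, sub_self, sub_zero]

theorem mul_one_sub_eq_zero {A : Type*} [Ring A] {x y : A} (h : x * y * x = x) :
    x * (1 - y * x) = 0 := by
  rw [mul_sub, mul_one, ← mul_assoc, h, sub_self]

theorem corner_mul_aeval {k A : Type*} [Field k] [Ring A] [Algebra k A] {e a : A}
    (he : e * e = e) (hea : e * a = a) (hae : a * e = a) (g : Polynomial k) :
    e * Polynomial.aeval a g * e = e * Polynomial.aeval a g ∧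
      Polynomial.aeval a g * e = e * Polynomial.aeval a g := by
  have hc : Commute (Polynomial.aeval a g) e := by
    have : Commute a e := hae.trans hea.symm
    induction g using Polynomial.induction_on' with
    | add p q hp hq => rw [map_add]; exact hp.add_left hq
    | monomial n c =>
      rw [Polynomial.aeval_monomial]
      exact Commute.mul_left (Algebra.commutes c e) (this.pow_left n)
  refine ⟨?_, hc⟩
  rw [mul_assoc, hc.eq, ← mul_assoc, he]

variable {F : Type u} [Field F] [MulSemiringAction (Multiplicative ℕ) F] [Finite F] (w : OpCost)
  (b : Module.Basis (Fin (autOrder F)) (fixedField F) F)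
  {π : Polynomial (fixedField F)} (hπ : π.Monic) [Fact (Irreducible π)]

include b in
/-- The idempotent `1 - y f` has rank at least two if `f` is reducible: otherwise the polynomials
of degree less than `deg f` would inject into a space with too few elements. -/
theorem two_le_finrank_range (hπ0 : π.coeff 0 ≠ 0)
    (Φ : QuotA π ≃ₐ[AdjoinRoot π] End (AdjoinRoot π) (Fin (autOrder F) → AdjoinRoot π))
    {f : SkewPolynomial F} (hf : RDvd f (emb π)) (hd : 1 ≤ deg f) (hne : deg f ≠ π.natDegree)
    {y : QuotA π} :
    2 ≤ finrank (AdjoinRoot π) (LinearMap.range (Φ (1 - y * mkA π f))) := by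
  have hirr : Irreducible π := Fact.out
  have hlt : π.natDegree < deg f := lt_of_le_of_ne (natDegree_le_deg hirr hπ0 hf hd) hne.symm
  set U := LinearMap.range (Φ (1 - y * mkA π f))
  let r : (Fin (deg f) → F) → SkewPolynomial F := fun c =>
    ∑ i : Fin (deg f), SkewPolynomial.monomial (i : ℕ) (c i)
  let ψ : (Fin (deg f) → F) → (U →ₗ[AdjoinRoot π] (Fin (autOrder F) → AdjoinRoot π)) :=
    fun c => Φ (mkA π (r c)) ∘ₗ U.subtype
  have hψ : Function.Injective ψ := by
    intro c c' hcc
    have h1 : Φ (mkA π (r c - r c') * (1 - y * mkA π f)) = 0 := by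
      refine LinearMap.ext fun v => ?_
      have h2 := LinearMap.congr_fun hcc ⟨Φ (1 - y * mkA π f) v, LinearMap.mem_range_self _ v⟩
      rw [map_mul, map_sub, map_sub]
      exact sub_eq_zero.2 h2
    have h2 : mkA π (r c - r c') * (1 - y * mkA π f) = 0 :=
      (map_eq_zero_iff Φ Φ.injective).1 h1
    obtain ⟨y', rfl⟩ := mkA_surjective π y
    have h3 : mkA π (r c - r c' - (r c - r c') * y' * f) = 0 := by
      rw [map_sub, map_mul, map_mul, ← h2, mul_sub, mul_one, mul_assoc]
    have h4 : RDvd f (r c - r c') := by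
      have h5 := (RDvd.trans hf (mkA_eq_zero.1 h3)).add (⟨_, rfl⟩ : RDvd f ((r c - r c') * y' * f))
      rwa [sub_add_cancel] at h5
    have hrd : r c - r c' = 0 := by
      by_contra h0
      have h6 := h4.deg_le h0
      have h7 : deg (r c - r c') < deg f := by
        rw [sub_eq_add_neg]
        refine (deg_add_le _ _).trans_lt (max_lt (deg_sum_monomial_lt hd c) ?_)
        rw [deg_neg]
        exact deg_sum_monomial_lt hd c'
      omega
    funext i
    rw [← coeff_sum_monomial c i, ← coeff_sum_monomial c' i]
    exact congrArg (fun p => SkewPolynomial.coeff p i) (sub_eq_zero.1 hrd)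
  have : Finite (U →ₗ[AdjoinRoot π] (Fin (autOrder F) → AdjoinRoot π)) :=
    Module.finite_of_finite (AdjoinRoot π)
  have h1 := Nat.card_le_card_of_injective ψ hψ
  rw [Nat.card_fun, natCard_field_eq b, Module.natCard_eq_pow_finrank (K := AdjoinRoot π)
    (V := U →ₗ[AdjoinRoot π] _), natCard_adjoinRoot, finrank_linearMap, finrank_fin_fun, Nat.card_fin,
    ← pow_mul, ← pow_mul, Nat.pow_le_pow_iff_right Finite.one_lt_card] at h1
  have hμ := autOrder_pos (F := F)
  by_contra hlt2
  have h2 : π.natDegree * (finrank (AdjoinRoot π) U * autOrder F) ≤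
      π.natDegree * (1 * autOrder F) := by
    gcongr
    omega
  have h3 : autOrder F * deg f ≤ autOrder F * π.natDegree := by linarith
  exact absurd (Nat.le_of_mul_le_mul_left h3 hμ) (by omega)

include b hπ in
theorem exists_corner_relation (hπ0 : π.coeff 0 ≠ 0) (e x : QuotA π) :
    ∃ c : Polynomial (AdjoinRoot π), c ≠ 0 ∧ c.natDegree ≤ autOrder F ^ 2 ∧
      e * Polynomial.aeval (e * x * e) c = 0 := by
  obtain ⟨Φ⟩ := exists_algEquiv_end b hπ hπ0
  refine ⟨(Φ (e * x * e)).charpoly, (LinearMap.charpoly_monic _).ne_zero, ?_, ?_⟩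
  · rw [LinearMap.charpoly_natDegree, finrank_fin_fun, pow_two]
    exact Nat.le_mul_self _
  · have h1 : Φ (Polynomial.aeval (e * x * e) (Φ (e * x * e)).charpoly) = 0 := by
      rw [← Polynomial.aeval_algHom_apply Φ]
      exact LinearMap.aeval_self_charpoly _
    rw [(map_eq_zero_iff Φ Φ.injective).1 h1, mul_zero]

include hπ in
/-- If `e x e` has an eigenvector in the image of `e` and is not a scalar multiple of `e`, then its
minimal polynomial is reducible. -/
theorem zeroDivisorFrom_ne_none
    (Φ : QuotA π ≃ₐ[AdjoinRoot π] End (AdjoinRoot π) (Fin (autOrder F) → AdjoinRoot π))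
    (hπ0 : π.coeff 0 ≠ 0) {e' x : SkewPolynomial F}
    (he : deg e' < autOrder F * π.natDegree) (hx : deg x < autOrder F * π.natDegree)
    (hid : mkA π e' * mkA π e' = mkA π e')
    (hev : ∃ u, u ≠ 0 ∧ Φ (mkA π e') u = u ∧ ∃ c : AdjoinRoot π,
      Φ (mkA π e' * mkA π x * mkA π e') u = c • u)
    (hsc : ∀ c : AdjoinRoot π, mkA π e' * mkA π x * mkA π e' ≠ c • mkA π e') :
    (zeroDivisorFrom w b π e' x).val ≠ none := by
  intro hnone
  obtain ⟨⟨g, g1, g2, -, g4, -⟩, -⟩ := zeroDivisorFrom_spec w b hπ he hx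
    (exists_corner_relation b hπ hπ0 _ _)
  obtain ⟨u, u0, u1, c, u2⟩ := hev
  set e := mkA π e'
  set a := e * mkA π x * e with ha
  have hroot : g.eval c = 0 := by
    have h1 : Φ (e * Polynomial.aeval a g) u = 0 := by rw [g2, map_zero]; rfl
    have h2 : Φ (Polynomial.aeval a g) u = g.eval c • u := by
      rw [← Polynomial.aeval_algHom_apply Φ]
      exact Module.End.aeval_apply_of_hasEigenvector
        ⟨Module.End.mem_eigenspace_iff.2 u2, u0⟩
    rw [map_mul, Module.End.mul_apply, h2, map_smul, u1] at h1
    exact (smul_eq_zero.1 h1).resolve_right u0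
  rcases g4 hnone with h | h
  · have h1 := Polynomial.degree_eq_one_of_irreducible_of_root h hroot
    have h2 : g.natDegree = 1 := Polynomial.natDegree_eq_of_degree_eq_some h1
    rw [g1.eq_X_add_C h2, map_add, Polynomial.aeval_X, Polynomial.aeval_C, mul_add,
      ← Algebra.commutes, ← Algebra.smul_def] at g2
    have hea : e * a = a := by rw [ha, ← mul_assoc, ← mul_assoc, hid]
    rw [hea] at g2
    refine hsc (-g.coeff 0) ?_
    rw [neg_smul]
    exact eq_neg_of_add_eq_zero_left g2
  · rw [h, Polynomial.eval_one] at hroot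
    exact one_ne_zero hroot

/-- A zero divisor of the corner algebra at `1 - y f` splits `f`. -/
theorem deg_rgcdR_lt {f e' ζ : SkewPolynomial F} (hf0 : f ≠ 0) {y : QuotA π} {a : QuotA π}
    (hy : mkA π f * y * mkA π f = mkA π f) (he : mkA π e' = 1 - y * mkA π f)
    (ha : mkA π e' * a = a) (ha' : a * mkA π e' = a)
    {g₁ g₂ : Polynomial (AdjoinRoot π)}
    (hζ : mkA π ζ = mkA π e' * Polynomial.aeval a g₁)
    (h12 : mkA π e' * Polynomial.aeval a (g₁ * g₂) = 0)
    (h1 : mkA π e' * Polynomial.aeval a g₁ ≠ 0) (h2 : mkA π e' * Polynomial.aeval a g₂ ≠ 0) :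
    0 < deg (rgcdR w ζ f).val ∧ deg (rgcdR w ζ f).val < deg f := by
  obtain ⟨hd, hd0, -⟩ := rgcdR_spec w ζ f
  obtain ⟨hdζ, hdf⟩ := rgcdR_rdvd w ζ f
  have hg0 := hd0 (Or.inl hf0)
  have hid : mkA π e' * mkA π e' = mkA π e' := by rw [he, isIdempotentElem_one_sub hy]
  have hfe : mkA π f * mkA π e' = 0 := by rw [he, mul_one_sub_eq_zero hy]
  have hc1 := (corner_mul_aeval hid ha ha' g₁).1
  refine ⟨Nat.pos_of_ne_zero fun h0 => ?_, lt_of_not_ge fun hge => ?_⟩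
  · -- `1 = p ζ + q f` is impossible, because `ζ` and `f` annihilate `g₂(a)`
    obtain ⟨p, q, hpq⟩ := (hd 1).2 (rdvd_of_deg_eq_zero hg0 h0 1)
    refine h2 ?_
    have hpq' : mkA π p * mkA π ζ + mkA π q * mkA π f = 1 := by
      rw [← map_mul, ← map_mul, ← map_add, ← hpq, map_one]
    have hz : mkA π ζ * (mkA π e' * Polynomial.aeval a g₂) = 0 := by
      rw [hζ, ← mul_assoc, hc1, mul_assoc, ← map_mul, h12]
    have hz' : mkA π f * (mkA π e' * Polynomial.aeval a g₂) = 0 := by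
      rw [← mul_assoc, hfe, zero_mul]
    rw [← one_mul (mkA π e' * _), ← hpq', add_mul, mul_assoc, mul_assoc, hz, hz', mul_zero,
      mul_zero, add_zero]
  · obtain ⟨p, hp⟩ := (hdf.symm_of_deg_le hf0 hge).trans hdζ
    refine h1 ?_
    rw [← hc1, ← hζ, hp, map_mul, mul_assoc, hfe, mul_zero]

open Classical in
include hπ in
/-- For at least three eighths of the random choices, the search for a zero divisor succeeds. -/
theorem three_mul_card_le_card_zeroDivisorFrom [Fintype F] (hπ0 : π.coeff 0 ≠ 0)
    {f e' : SkewPolynomial F} (hf : RDvd f (emb π)) (hd : 1 ≤ deg f) (hne : deg f ≠ π.natDegree)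
    {y : QuotA π} (hy : mkA π f * y * mkA π f = mkA π f) (he : mkA π e' = 1 - y * mkA π f)
    (hed : deg e' < autOrder F * π.natDegree) :
    3 * Fintype.card (Fin (autOrder F * π.natDegree) → F) ≤
      8 * (Finset.univ.filter fun c : Fin (autOrder F * π.natDegree) → F =>
        (zeroDivisorFrom w b π e' (∑ i : Fin (autOrder F * π.natDegree),
          SkewPolynomial.monomial (i : ℕ) (c i))).val ≠ none).card := by
  have hirr : Irreducible π := Fact.out
  obtain ⟨Φ⟩ := exists_algEquiv_end b hπ hπ0
  have hid : mkA π e' * mkA π e' = mkA π e' := by rw [he, isIdempotentElem_one_sub hy]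
  have hU := two_le_finrank_range b hπ0 Φ hf hd hne (y := y)
  rw [← he] at hU
  have hfix : ∀ u ∈ LinearMap.range (Φ (mkA π e')), Φ (mkA π e') u = u := by
    rintro _ ⟨v, rfl⟩
    rw [← Module.End.mul_apply, ← map_mul, hid]
  set E := Φ (mkA π e') with hE
  set U := LinearMap.range E
  have : Fintype (AdjoinRoot π) := Fintype.ofFinite _
  have : Fintype U := Fintype.ofFinite _
  have : Finite (End (AdjoinRoot π) U) := Module.finite_of_finite (AdjoinRoot π)
  have : Fintype (End (AdjoinRoot π) U) := Fintype.ofFinite _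
  let x : (Fin (autOrder F * π.natDegree) → F) → SkewPolynomial F := fun c =>
    ∑ i : Fin (autOrder F * π.natDegree), SkewPolynomial.monomial (i : ℕ) (c i)
  have hxadd : ∀ c c', x (c + c') = x c + x c' := by
    intro c c'
    simp only [x, Pi.add_apply, map_add, Finset.sum_add_distrib]
  -- the compression to the image of `e'` of a random element
  let θ : (Fin (autOrder F * π.natDegree) → F) →+ End (AdjoinRoot π) U :=
    AddMonoidHom.mk' (fun c => E.rangeRestrict ∘ₗ Φ (mkA π (x c)) ∘ₗ U.subtype) fun c c' => by
      rw [hxadd, map_add, map_add, LinearMap.add_comp, LinearMap.comp_add]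
  have hθ : ∀ c (u : U), ((θ c u : U) : Fin (autOrder F) → AdjoinRoot π) =
      Φ (mkA π e' * mkA π (x c) * mkA π e') u := by
    intro c u
    rw [map_mul, map_mul, Module.End.mul_apply, Module.End.mul_apply, ← hE, hfix u u.2]
    rfl
  have hsurj : Function.Surjective θ := by
    intro T
    obtain ⟨t, ht⟩ := Φ.surjective (U.subtype ∘ₗ T ∘ₗ E.rangeRestrict)
    obtain ⟨c, hc⟩ := (sum_monomial_bijective hπ hirr.natDegree_pos).2 t
    refine ⟨c, LinearMap.ext fun u => Subtype.ext ?_⟩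
    have hc' : mkA π (x c) = t := hc
    have hu : E.rangeRestrict u = u := Subtype.ext (hfix u u.2)
    rw [hθ, hc', map_mul, map_mul, Module.End.mul_apply, Module.End.mul_apply, ← hE, hfix u u.2,
      ht]
    change E (T (E.rangeRestrict u) : U) = _
    rw [hu]
    exact hfix _ (T u).2
  set P : End (AdjoinRoot π) U → Prop := fun T =>
    (∃ u : U, u ≠ 0 ∧ ∃ c : AdjoinRoot π, T u = c • u) ∧ ∀ c : AdjoinRoot π, T ≠ c • 1
  have h1 : 3 * Fintype.card (End (AdjoinRoot π) U) ≤ 8 * (Finset.univ.filter P).card := by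
    convert three_mul_card_le_card_eigenvector (k := AdjoinRoot π) (U := U) hU
  have h2 : (Finset.univ.filter fun c => P (θ c)).card * Fintype.card (End (AdjoinRoot π) U) =
      Fintype.card (Fin (autOrder F * π.natDegree) → F) * (Finset.univ.filter P).card := by
    convert card_preimage_mul_card θ hsurj P
  have h3 : (Finset.univ.filter fun c => P (θ c)).card ≤ (Finset.univ.filter fun c =>
      (zeroDivisorFrom w b π e' (x c)).val ≠ none).card := by
    refine Finset.card_le_card fun c hc => ?_
    obtain ⟨⟨u, u0, a, ha⟩, hs⟩ := (Finset.mem_filter.1 hc).2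
    refine Finset.mem_filter.2 ⟨Finset.mem_univ _, zeroDivisorFrom_ne_none w b hπ Φ hπ0 hed
      (deg_sum_monomial_lt (Nat.mul_pos autOrder_pos hirr.natDegree_pos) c) hid
      ⟨u, fun h => u0 (Subtype.ext h), hfix u u.2, a, ?_⟩ fun a h => hs a ?_⟩
    · rw [← hθ, ha]
      rfl
    · refine LinearMap.ext fun v => Subtype.ext ?_
      rw [hθ, h, map_smul]
      change a • E v = a • (v : Fin (autOrder F) → AdjoinRoot π)
      rw [hfix v v.2]
  have h4 : 0 < Fintype.card (End (AdjoinRoot π) U) := Fintype.card_pos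
  refine Nat.le_of_mul_le_mul_right (c := Fintype.card (End (AdjoinRoot π) U)) ?_ h4
  set N := Fintype.card (Fin (autOrder F * π.natDegree) → F)
  calc 3 * N * Fintype.card (End (AdjoinRoot π) U)
      = N * (3 * Fintype.card (End (AdjoinRoot π) U)) := by ring
    _ ≤ N * (8 * (Finset.univ.filter P).card) := Nat.mul_le_mul_left N h1
    _ = 8 * ((Finset.univ.filter fun c => P (θ c)).card *
          Fintype.card (End (AdjoinRoot π) U)) := by rw [h2]; ring
    _ ≤ 8 * ((Finset.univ.filter fun c =>
          (zeroDivisorFrom w b π e' (x c)).val ≠ none).card *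
          Fintype.card (End (AdjoinRoot π) U)) := by gcongr
    _ = _ := by ring

end ZeroDivisors

end SkewFact

namespace SkewFact

open SkewPolynomial (φ)

/-! ### Randomized computations -/

section Randomized

open scoped ENNReal

namespace Rand

variable {α β : Type u}

/-- The mean of a nonnegative function of the outcome. -/
noncomputable def mean {γ : Type*} (μ : PMF γ) (h : γ → ℝ≥0∞) : ℝ≥0∞ := ∑' x, μ x * h x

section Mean

variable {γ γ' : Type*} (μ : PMF γ)

theorem mean_pure (a : γ) (h : γ → ℝ≥0∞) : mean (PMF.pure a) h = h a := by
  rw [mean, tsum_eq_single a fun x hx => by rw [PMF.pure_apply_of_ne _ _ hx, zero_mul],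
    PMF.pure_apply_self, one_mul]

theorem mean_bind (g : γ → PMF γ') (h : γ' → ℝ≥0∞) :
    mean (μ.bind g) h = mean μ fun x => mean (g x) h := by
  simp only [mean, PMF.bind_apply, ← ENNReal.tsum_mul_right, ← ENNReal.tsum_mul_left]
  rw [ENNReal.tsum_comm]
  simp only [mul_assoc]

theorem mean_map (f : γ → γ') (h : γ' → ℝ≥0∞) :
    mean (μ.map f) h = mean μ fun x => h (f x) := by
  rw [PMF.map, mean_bind]
  exact congrArg (mean μ) (funext fun x => mean_pure _ _)

variable {μ} in
theorem mean_mono {h h' : γ → ℝ≥0∞} (H : ∀ x ∈ μ.support, h x ≤ h' x) :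
    mean μ h ≤ mean μ h' := by
  refine ENNReal.tsum_le_tsum fun x => ?_
  by_cases hx : x ∈ μ.support
  · exact mul_le_mul_right (H x hx) _
  · rw [(PMF.apply_eq_zero_iff _ _).2 hx, zero_mul, zero_mul]

theorem mean_add (h h' : γ → ℝ≥0∞) :
    mean μ (fun x => h x + h' x) = mean μ h + mean μ h' := by
  simp only [mean, mul_add, ENNReal.tsum_add]

theorem mean_const (c : ℝ≥0∞) : mean μ (fun _ => c) = c := by
  rw [mean, ENNReal.tsum_mul_right, PMF.tsum_coe, one_mul]

theorem mean_mul_right (h : γ → ℝ≥0∞) (c : ℝ≥0∞) :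
    mean μ (fun x => h x * c) = mean μ h * c := by
  simp only [mean, ← mul_assoc, ENNReal.tsum_mul_right]

end Mean

theorem expectedOps_eq (p : Rand α) : p.expectedOps = mean p.dist fun x => (x.2 : ℝ≥0∞) := rfl

open Classical in
theorem failProb_eq (p : Rand α) :
    p.failProb = mean p.dist fun x => if x.1 = none then 1 else 0 := by
  rw [mean, ENNReal.tsum_prod', tsum_eq_single none]
  · simp [failProb]
  · rintro (_ | a) h
    · exact absurd rfl h
    · simp

/-- In every run of `p` at most `c` operations are used and the result, if there is one, satisfies
`Q`; the expected number of operations is at most `e`, and the probability of a failure is at most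
`t`. -/
structure Spec (p : Rand α) (Q : α → Prop) (c e : ℕ) (t : ℝ≥0∞) : Prop where
  ops_le : ∀ x ∈ p.dist.support, x.2 ≤ c
  result : ∀ x ∈ p.dist.support, ∀ a, x.1 = some a → Q a
  expected_le : p.expectedOps ≤ e
  fail_le : p.failProb ≤ t

theorem Spec.mono {p : Rand α} {Q Q' : α → Prop} {c c' e e' : ℕ} {t t' : ℝ≥0∞}
    (h : Spec p Q c e t) (hQ : ∀ a, Q a → Q' a) (hc : c ≤ c') (he : e ≤ e') (ht : t ≤ t') :
    Spec p Q' c' e' t' where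
  ops_le x hx := (h.ops_le x hx).trans hc
  result x hx a ha := hQ a (h.result x hx a ha)
  expected_le := h.expected_le.trans (by exact_mod_cast he)
  fail_le := h.fail_le.trans ht

/-- A bound for the number of operations in all runs is one for the expected number. -/
theorem expectedOps_le {p : Rand α} {c : ℕ} (h : ∀ x ∈ p.dist.support, x.2 ≤ c) :
    p.expectedOps ≤ c := by
  rw [expectedOps_eq, ← mean_const p.dist (c : ℝ≥0∞)]
  exact mean_mono fun x hx => by exact_mod_cast h x hx

theorem Spec.exists_result {p : Rand α} {Q : α → Prop} {c e : ℕ} {t : ℝ≥0∞} (h : Spec p Q c e t)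
    (ht : t < 1) : ∃ a, Q a := by
  classical
  by_contra hQ
  have h1 := h.fail_le
  rw [failProb_eq] at h1
  refine absurd (h1.trans_lt ht) (not_lt.2 ?_)
  refine (mean_const p.dist 1).ge.trans (mean_mono fun x hx => ?_)
  rcases hx' : x.1 with _ | a
  · rw [if_pos rfl]
  · exact absurd ⟨a, h.result x hx a hx'⟩ hQ

theorem spec_of_dist_eq_pure {p : Rand α} {x : Option α × ℕ} (hp : p.dist = PMF.pure x)
    {Q : α → Prop} (hx : ∃ a, x.1 = some a ∧ Q a) : Spec p Q x.2 x.2 0 := by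
  obtain ⟨a, h1, h2⟩ := hx
  have hs : ∀ y ∈ p.dist.support, y = x := by
    intro y hy
    rwa [hp, PMF.support_pure, Set.mem_singleton_iff] at hy
  have h0 : ∀ y ∈ p.dist.support, y.2 ≤ x.2 := fun y hy => (hs y hy) ▸ le_rfl
  refine ⟨h0, fun y hy c hc => ?_, expectedOps_le h0, ?_⟩
  · rw [hs y hy, h1] at hc
    exact Option.some.inj hc ▸ h2
  · rw [failProb_eq, hp, mean_pure]
    simp [h1]

theorem spec_lift {x : Cost α} {Q : α → Prop} (h : Q x.val) :
    Spec (Rand.lift x) Q x.ops x.ops 0 :=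
  spec_of_dist_eq_pure (p := Rand.lift x) rfl ⟨x.val, rfl, h⟩

theorem spec_pure {a : α} {Q : α → Prop} (h : Q a) : Spec (pure a : Rand α) Q 0 0 0 :=
  spec_of_dist_eq_pure (p := pure a) (x := (some a, 0)) rfl ⟨a, rfl, h⟩

theorem spec_fail (Q : α → Prop) : Spec (fail : Rand α) Q 0 0 1 := by
  have hs : ∀ y ∈ (fail : Rand α).dist.support, y = (none, 0) := by
    intro y hy
    rwa [dist, fail, PMF.support_pure, Set.mem_singleton_iff] at hy
  have h0 : ∀ x ∈ (fail : Rand α).dist.support, x.2 ≤ 0 := fun y hy => (hs y hy) ▸ le_rfl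
  refine ⟨h0, fun y hy c hc => ?_, expectedOps_le h0, ?_⟩
  · rw [hs y hy] at hc
    exact absurd hc (by simp)
  · rw [failProb_eq]
    refine (mean_pure _ _).le.trans ?_
    simp

theorem dist_bind (p : Rand α) (g : α → Rand β) :
    (p >>= g).dist = PMF.bind p.dist fun x =>
      match x.1 with
      | none => PMF.pure (none, x.2)
      | some a => (charge x.2 (g a)).dist := rfl

theorem expectedOps_charge (c : ℕ) (p : Rand α) : (charge c p).expectedOps = c + p.expectedOps := by
  rw [expectedOps_eq, expectedOps_eq]
  refine (mean_map p.dist _ _).trans ?_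
  have h := mean_add p.dist (fun _ => (c : ℝ≥0∞)) fun x => (x.2 : ℝ≥0∞)
  rw [mean_const] at h
  rw [← h]
  simp only [Nat.cast_add]

theorem failProb_charge (c : ℕ) (p : Rand α) : (charge c p).failProb = p.failProb := by
  rw [failProb_eq, failProb_eq]
  exact mean_map p.dist _ _

theorem mem_support_charge {c : ℕ} {p : Rand α} {x : Option α × ℕ}
    (hx : x ∈ (charge c p).dist.support) : ∃ y ∈ p.dist.support, y.1 = x.1 ∧ x.2 = c + y.2 := by
  have hd : (charge c p).dist = PMF.map (fun x => (x.1, c + x.2)) p.dist := rfl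
  rw [hd, PMF.mem_support_map_iff] at hx
  obtain ⟨y, hy, rfl⟩ := hx
  exact ⟨y, hy, rfl, rfl⟩

theorem Spec.bind {p : Rand α} {g : α → Rand β} {Q : α → Prop} {Q' : β → Prop} {c c' e e' : ℕ}
    {t t' : ℝ≥0∞} (hp : Spec p Q c e t) (hg : ∀ a, Q a → Spec (g a) Q' c' e' t') :
    Spec (p >>= g) Q' (c + c') (e + e') (t + t') := by
  have key : ∀ z ∈ (p >>= g).dist.support, ∃ x ∈ p.dist.support,
      (x.1 = none ∧ z = (none, x.2)) ∨
      ∃ a, x.1 = some a ∧ ∃ y ∈ (g a).dist.support, y.1 = z.1 ∧ z.2 = x.2 + y.2 := by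
    intro z hz
    rw [dist_bind, PMF.mem_support_bind_iff] at hz
    obtain ⟨⟨o, n⟩, hx, hz⟩ := hz
    refine ⟨_, hx, ?_⟩
    cases o with
    | none =>
      left
      rw [PMF.support_pure, Set.mem_singleton_iff] at hz
      exact ⟨rfl, hz⟩
    | some a =>
      right
      exact ⟨a, rfl, mem_support_charge hz⟩
  refine ⟨fun z hz => ?_, fun z hz b hb => ?_, ?_, ?_⟩
  · obtain ⟨x, hx, ⟨-, rfl⟩ | ⟨a, ha, y, hy, -, h2⟩⟩ := key z hz
    · exact (hp.ops_le x hx).trans (Nat.le_add_right _ _)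
    · rw [h2]
      exact Nat.add_le_add (hp.ops_le x hx) ((hg a (hp.result x hx a ha)).ops_le y hy)
  · obtain ⟨x, hx, ⟨-, rfl⟩ | ⟨a, ha, y, hy, h1, -⟩⟩ := key z hz
    · exact absurd hb (by simp)
    · exact (hg a (hp.result x hx a ha)).result y hy b (h1.trans hb)
  · rw [expectedOps_eq, dist_bind, mean_bind, Nat.cast_add]
    refine le_trans ?_ (add_le_add_left hp.expected_le _)
    rw [expectedOps_eq, ← mean_const p.dist (e' : ℝ≥0∞), ← mean_add]
    refine mean_mono fun x hx => ?_
    rcases x with ⟨_ | a, n⟩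
    · refine (mean_pure _ _).le.trans ?_
      exact le_self_add
    · refine (expectedOps_charge n (g a)).le.trans ?_
      exact add_le_add_right (hg a (hp.result _ hx a rfl)).expected_le _
  · classical
    rw [failProb_eq, dist_bind, mean_bind]
    refine le_trans ?_ (add_le_add_left hp.fail_le _)
    rw [failProb_eq, ← mean_const p.dist t', ← mean_add]
    refine mean_mono fun x hx => ?_
    rcases x with ⟨_ | a, n⟩
    · refine (mean_pure _ _).le.trans ?_
      simp
    · have h1 := failProb_charge n (g a)
      rw [failProb_eq] at h1
      refine h1.le.trans ((hg a (hp.result _ hx a rfl)).fail_le.trans ?_)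
      simp

/-- Repetition until the first success. If an attempt costs at most `c` and fails with probability
at most `5 / 8`, then the expected cost of `k` attempts is at most `c (1 - 5 / 8)⁻¹ ≤ 3 c`. -/
theorem Spec.retry {p : Rand α} {Q : α → Prop} {c e : ℕ} (hp : Spec p Q c e (5 / 8)) (k : ℕ) :
    Spec (Rand.retry p k) Q (k * c) (3 * c) ((5 / 8) ^ k) := by
  induction k with
  | zero =>
    rw [Nat.zero_mul, pow_zero]
    exact (spec_fail Q).mono (fun _ h => h) le_rfl (Nat.zero_le _) le_rfl
  | succ k ih =>
    have hdist : (Rand.retry p (k + 1)).dist = PMF.bind p.dist fun x =>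
        match x.1 with
        | none => (charge x.2 (Rand.retry p k)).dist
        | some a => PMF.pure (some a, x.2) := rfl
    have key : ∀ z ∈ (Rand.retry p (k + 1)).dist.support, ∃ x ∈ p.dist.support,
        z = x ∨ ∃ y ∈ (Rand.retry p k).dist.support, y.1 = z.1 ∧ z.2 = x.2 + y.2 := by
      intro z hz
      rw [hdist, PMF.mem_support_bind_iff] at hz
      obtain ⟨⟨o, n⟩, hx, hz⟩ := hz
      refine ⟨_, hx, ?_⟩
      cases o with
      | none => exact Or.inr (mem_support_charge hz)
      | some a =>
        left
        rwa [PMF.support_pure, Set.mem_singleton_iff] at hz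
    refine ⟨fun z hz => ?_, fun z hz b hb => ?_, ?_, ?_⟩
    · obtain ⟨x, hx, rfl | ⟨y, hy, -, h2⟩⟩ := key z hz
      · exact (hp.ops_le _ hx).trans (Nat.le_mul_of_pos_left _ k.succ_pos)
      · rw [h2, Nat.succ_mul, Nat.add_comm]
        exact Nat.add_le_add (ih.ops_le y hy) (hp.ops_le x hx)
    · obtain ⟨x, hx, rfl | ⟨y, hy, h1, -⟩⟩ := key z hz
      · exact hp.result _ hx b hb
      · exact ih.result y hy b (h1.trans hb)
    · classical
      have h1 : (Rand.retry p (k + 1)).expectedOps ≤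
          c + p.failProb * ((3 * c : ℕ) : ℝ≥0∞) := by
        rw [expectedOps_eq, hdist, mean_bind, failProb_eq, ← mean_mul_right,
          ← mean_const p.dist (c : ℝ≥0∞), ← mean_add]
        refine mean_mono fun x hx => ?_
        have h2 : (x.2 : ℝ≥0∞) ≤ c := by exact_mod_cast hp.ops_le x hx
        rcases x with ⟨_ | a, n⟩
        · refine (expectedOps_charge n (Rand.retry p k)).le.trans ?_
          refine add_le_add h2 ?_
          simpa using ih.expected_le
        · refine (mean_pure _ _).le.trans ?_
          simpa using h2
      refine h1.trans ?_
      calc (c : ℝ≥0∞) + p.failProb * ((3 * c : ℕ) : ℝ≥0∞)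
          ≤ c + 5 / 8 * ((3 * c : ℕ) : ℝ≥0∞) := by gcongr; exact hp.fail_le
        _ ≤ ((3 * c : ℕ) : ℝ≥0∞) := by
          have h3 : (5 / 8 : ℝ≥0∞) = ((5 / 8 : NNReal) : ℝ≥0∞) := by
            rw [ENNReal.coe_div (by norm_num)]; norm_num
          rw [h3]
          norm_cast
          rw [← NNReal.coe_le_coe]
          push_cast
          have : (0 : ℝ) ≤ c := Nat.cast_nonneg _
          linarith
    · classical
      have h1 : (Rand.retry p (k + 1)).failProb ≤ p.failProb * (5 / 8) ^ k := by
        rw [failProb_eq, hdist, mean_bind, failProb_eq, ← mean_mul_right]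
        refine mean_mono fun x hx => ?_
        rcases x with ⟨_ | a, n⟩
        · have h2 := failProb_charge n (Rand.retry p k)
          rw [failProb_eq] at h2
          refine h2.le.trans ?_
          simpa using ih.fail_le
        · refine (mean_pure _ _).le.trans ?_
          simp
      rw [pow_succ']
      refine h1.trans ?_
      gcongr
      exact hp.fail_le

open Classical in
/-- A deterministic computation that depends on a uniformly random vector of elements of `F`. -/
theorem spec_coins {F : Type u} [Fintype F] [Nonempty F] {n c : ℕ}
    {x : (Fin n → F) → Cost (Option α)} {Q : α → Prop} {d : ℕ}
    (hQ : ∀ v a, (x v).val = some a → Q a) (hd : ∀ v, (x v).ops ≤ d)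
    (hcard : 3 * Fintype.card (Fin n → F) ≤
      8 * (Finset.univ.filter fun v => (x v).val ≠ none).card) :
    Spec (Rand.coins F n c >>= fun v => Rand.liftOption (x v)) Q (n * c + d) (n * c + d)
      (5 / 8) := by
  have hdist : (Rand.coins F n c >>= fun v => Rand.liftOption (x v)).dist =
      (PMF.uniformOfFintype (Fin n → F)).map fun v => ((x v).val, n * c + (x v).ops) := by
    rw [dist_bind, dist, coins, PMF.bind_map, PMF.map]
    refine congrArg (PMF.bind _) (funext fun v => ?_)
    change PMF.map _ (PMF.pure ((x v).val, (x v).ops)) = _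
    rw [PMF.pure_map]
    rfl
  have hops : ∀ z ∈ (Rand.coins F n c >>= fun v => Rand.liftOption (x v)).dist.support,
      z.2 ≤ n * c + d := by
    intro z hz
    rw [hdist, PMF.mem_support_map_iff] at hz
    obtain ⟨v, -, rfl⟩ := hz
    exact Nat.add_le_add_left (hd v) _
  refine ⟨hops, fun z hz a ha => ?_, expectedOps_le hops, ?_⟩
  · rw [hdist, PMF.mem_support_map_iff] at hz
    obtain ⟨v, -, rfl⟩ := hz
    exact hQ v a ha
  · rw [failProb_eq, hdist, mean_map, mean, tsum_fintype]
    simp only [PMF.uniformOfFintype_apply]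
    rw [← Finset.mul_sum, Finset.sum_boole]
    have h1 := Finset.card_filter_add_card_filter_not (s := Finset.univ)
      (fun v => (x v).val = none)
    rw [Finset.card_univ] at h1
    have h0 : 0 < Fintype.card (Fin n → F) := Fintype.card_pos
    have h2 : 8 * (Finset.univ.filter fun v => (x v).val = none).card ≤
        5 * Fintype.card (Fin n → F) := by
      have h3 : (Finset.univ.filter fun v => ¬ (x v).val = none).card =
        (Finset.univ.filter fun v => (x v).val ≠ none).card := rfl
      omega
    rw [mul_comm, ← div_eq_mul_inv]
    refine ENNReal.div_le_of_le_mul ?_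
    rw [mul_comm, ← mul_div_assoc]
    refine (ENNReal.le_div_iff_mul_le (Or.inl (by norm_num)) (Or.inl (by norm_num))).2 ?_
    rw [mul_comm, mul_comm (_ : ℝ≥0∞) 5]
    exact_mod_cast h2

end Rand

end Randomized

end SkewFact

namespace SkewFact

open SkewPolynomial (φ)

/-! ### Factorization of polynomials with irreducible bound -/

section IrreducibleBound

open scoped ENNReal

variable {F : Type u} [Field F] [Fintype F] [MulSemiringAction (Multiplicative ℕ) F] (w : OpCost)
  (b : Module.Basis (Fin (autOrder F)) (fixedField F) F)
  {π : Polynomial (fixedField F)} (hπ : π.Monic) [Fact (Irreducible π)]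

include b hπ in
theorem exists_regular (hπ0 : π.coeff 0 ≠ 0) (x : QuotA π) : ∃ y, x * y * x = x := by
  obtain ⟨Φ⟩ := exists_algEquiv_end b hπ hπ0
  obtain ⟨S, hS⟩ := exists_mul_mul_eq (Φ x)
  refine ⟨Φ.symm S, Φ.injective ?_⟩
  rw [map_mul, map_mul, Φ.apply_symm_apply, hS]

variable (F) in
/-- A constant for the cost of one step of the factorization. -/
noncomputable def splitCost : ℕ :=
  100000 * Nat.card (fixedField F) * (w.total * autOrder F ^ 6)

include hπ in
theorem findZeroDivisor_spec (hπ0 : π.coeff 0 ≠ 0) {f e' : SkewPolynomial F}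
    (hf : RDvd f (emb π)) (hd : 1 ≤ deg f) (hne : deg f ≠ π.natDegree)
    {y : QuotA π} (hy : mkA π f * y * mkA π f = mkA π f) (he : mkA π e' = 1 - y * mkA π f)
    (hed : deg e' < autOrder F * π.natDegree) :
    Rand.Spec (findZeroDivisor w b π e')
      (fun ζ => deg ζ < autOrder F * π.natDegree ∧
        0 < deg (rgcdR w ζ f).val ∧ deg (rgcdR w ζ f).val < deg f)
      (splitCost F w * π.natDegree ^ 3) (splitCost F w * π.natDegree ^ 3) (5 / 8) := by
  classical
  have hirr : Irreducible π := Fact.out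
  have hδ := hirr.natDegree_pos
  have hμ := autOrder_pos (F := F)
  have hf0 : f ≠ 0 := hf.ne_zero (emb_ne_zero hirr.ne_zero)
  have hid : mkA π e' * mkA π e' = mkA π e' := by rw [he, isIdempotentElem_one_sub hy]
  have hN : 0 < autOrder F * π.natDegree := Nat.mul_pos hμ hδ
  have hspec := fun v : Fin (autOrder F * π.natDegree) → F => zeroDivisorFrom_spec w b hπ hed
    (deg_sum_monomial_lt hN v) (exists_corner_relation b hπ hπ0 _ _)
  have hcost : autOrder F * π.natDegree * autOrder F +
      60000 * Nat.card (fixedField F) * (w.total * autOrder F ^ 6) * π.natDegree ^ 3 ≤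
      splitCost F w * π.natDegree ^ 3 := by
    have hq : 1 ≤ Nat.card (fixedField F) := Nat.card_pos
    calc _ = 1 * 1 * (1 * autOrder F ^ 2) * π.natDegree ^ 1 +
          60000 * Nat.card (fixedField F) * (w.total * autOrder F ^ 6) * π.natDegree ^ 3 := by ring
      _ ≤ 1 * Nat.card (fixedField F) * (w.total * autOrder F ^ 6) * π.natDegree ^ 3 +
          60000 * Nat.card (fixedField F) * (w.total * autOrder F ^ 6) * π.natDegree ^ 3 := by
        gcongr <;> first | exact hμ | exact hδ | exact total_pos w | norm_num
      _ = 60001 * Nat.card (fixedField F) * (w.total * autOrder F ^ 6) * π.natDegree ^ 3 := by ring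
      _ ≤ _ := by
        rw [splitCost]
        gcongr
        norm_num
  refine (Rand.spec_coins (fun v ζ hζ => ?_) (fun v => (hspec v).2)
    (three_mul_card_le_card_zeroDivisorFrom w b hπ hπ0 hf hd hne hy he hed)).mono
    (fun _ h => h) hcost hcost le_rfl
  obtain ⟨⟨g, g1, g2, g3, -, g5⟩, -⟩ := hspec v
  obtain ⟨hζd, g₁, g₂, rfl, hd1, hd2, hζ'⟩ := g5 ζ hζ
  obtain ⟨h1, h2⟩ := ne_zero_and_ne_zero_of_mul g1.ne_zero
  have hdeg := Polynomial.natDegree_mul h1 h2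
  refine ⟨hζd, deg_rgcdR_lt w hf0 hy he ?_ ?_ hζ' g2 (g3 g₁ h1 (by omega)) (g3 g₂ h2 (by omega))⟩
  · rw [← mul_assoc, ← mul_assoc, hid]
  · rw [mul_assoc, hid]

theorem split_cost_le {N W z f g A B : ℕ} (hz : z < N) (hf : f ≤ N) (hg : g ≤ f) (hf1 : 1 ≤ f)
    (hA : A ≤ 3 * W * ((z + 1) * (z + 2 * f + 2)))
    (hB : B ≤ 3 * W * ((f + 1 - g) * (g + 1) + 1)) : A + B ≤ 30 * W * N ^ 2 := by
  have h1 : (z + 1) * (z + 2 * f + 2) ≤ N * (4 * N) := Nat.mul_le_mul hz (by omega)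
  have h2 : (f + 1 - g) * (g + 1) + 1 ≤ (2 * N) * (2 * N) + N * N :=
    Nat.add_le_add (Nat.mul_le_mul (by omega) (by omega)) (Nat.mul_pos (by omega) (by omega))
  calc A + B ≤ 3 * W * (N * (4 * N)) + 3 * W * ((2 * N) * (2 * N) + N * N) :=
        Nat.add_le_add (hA.trans (Nat.mul_le_mul_left _ h1)) (hB.trans (Nat.mul_le_mul_left _ h2))
    _ = 27 * W * N ^ 2 := by ring
    _ ≤ _ := by gcongr; norm_num

include hπ in
/-- Every splitting costs `O (δ ^ 3)` operations, where `δ = deg π`. There are at most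
`deg f / δ - 1` of them, because nonconstant factors have degree at least `δ`. -/
theorem factorizeIrred_spec (hπ0 : π.coeff 0 ≠ 0) (k n : ℕ) :
    ∀ f : SkewPolynomial F, RDvd f (emb π) → 1 ≤ deg f → deg f < n →
      Rand.Spec (factorizeIrred w b k π n f) (fun l => l.prod = f ∧ ∀ p ∈ l, Irreducible p)
        ((deg f / π.natDegree - 1) * ((k + 1) * (splitCost F w * π.natDegree ^ 3)))
        ((deg f / π.natDegree - 1) * (4 * (splitCost F w * π.natDegree ^ 3)))
        ((deg f / π.natDegree - 1 : ℕ) * (5 / 8) ^ k) := by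
  have hirr : Irreducible π := Fact.out
  have hδ := hirr.natDegree_pos
  have hμ := autOrder_pos (F := F)
  induction n with
  | zero => exact fun f _ _ h => absurd h (Nat.not_lt_zero _)
  | succ n ih =>
    intro f hf hd hn
    have hf1 : f ≠ 1 := by
      rintro rfl
      rw [deg_one] at hd
      omega
    have hf0 : f ≠ 0 := hf.ne_zero (emb_ne_zero hirr.ne_zero)
    have hfd : deg f ≤ autOrder F * π.natDegree := by
      rw [← deg_emb]
      exact hf.deg_le (emb_ne_zero hirr.ne_zero)
    rw [factorizeIrred, if_neg hf1]
    split_ifs with hdeg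
    · rw [deg_emb] at hdeg
      have hdf := Nat.eq_of_mul_eq_mul_left hμ hdeg
      refine (Rand.spec_pure ?_).mono (fun _ h => h) (Nat.zero_le _) (Nat.zero_le _) zero_le
      refine ⟨List.prod_singleton, fun p hp => ?_⟩
      rw [List.mem_singleton.1 hp]
      exact irreducible_of_deg_eq hirr hπ0 hf hdf
    · have hne : deg f ≠ π.natDegree := fun h => hdeg (by rw [deg_emb, h])
      obtain ⟨⟨y, hy, he⟩, hed, hops⟩ := coIdempotent_spec w b hπ hfd (exists_regular b hπ hπ0 _)
      have hchain : ∀ ζ, (deg ζ < autOrder F * π.natDegree ∧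
          0 < deg (rgcdR w ζ f).val ∧ deg (rgcdR w ζ f).val < deg f) →
          Rand.Spec (do
            let g ← Rand.lift (rgcdR w ζ f)
            let h ← Rand.lift (divR w f g)
            let l₁ ← factorizeIrred w b k π n h.1
            let l₂ ← factorizeIrred w b k π n g
            pure (l₁ ++ l₂)) (fun l => l.prod = f ∧ ∀ p ∈ l, Irreducible p)
          (30 * w.total * (autOrder F * π.natDegree) ^ 2 +
            (deg f / π.natDegree - 2) * ((k + 1) * (splitCost F w * π.natDegree ^ 3)))
          (30 * w.total * (autOrder F * π.natDegree) ^ 2 +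
            (deg f / π.natDegree - 2) * (4 * (splitCost F w * π.natDegree ^ 3)))
          ((deg f / π.natDegree - 2 : ℕ) * (5 / 8) ^ k) := by
        rintro ζ ⟨hζ, hg1, hg2⟩
        obtain ⟨-, hg0, hgo⟩ := rgcdR_spec w ζ f
        have hgf := (rgcdR_rdvd w ζ f).2
        set g := (rgcdR w ζ f).val with hg
        replace hg0 := hg0 (Or.inl hf0)
        have hh := divR_exact w hg0 hgf
        have hho := (divR_spec w f g hg0).2.2
        set h := (divR w f g).val.1 with hhdef
        have hh0 : h ≠ 0 := by
          intro h0
          rw [h0, zero_mul] at hh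
          exact hf0 hh
        have hdh : deg f = deg h + deg g := by
          conv_lhs => rw [hh]
          exact deg_mul hh0 hg0
        have hhπ : RDvd h (emb π) := RDvd.left_factor hg0 (hh ▸ hf)
        have hgπ : RDvd g (emb π) := hgf.trans hf
        have hhδ := natDegree_le_deg hirr hπ0 hhπ (by omega)
        have hgδ := natDegree_le_deg hirr hπ0 hgπ hg1
        have hsum : (deg h / π.natDegree - 1) + (deg g / π.natDegree - 1) ≤
            deg f / π.natDegree - 2 := by
          have h1 : deg h / π.natDegree + deg g / π.natDegree ≤ (deg h + deg g) / π.natDegree :=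
            Nat.div_add_div_le_add_div
          rw [← hdh] at h1
          have h2 := Nat.div_pos hhδ hδ
          have h3 := Nat.div_pos hgδ hδ
          omega
        have hops' : (rgcdR w ζ f).ops + (divR w f g).ops ≤
            30 * w.total * (autOrder F * π.natDegree) ^ 2 :=
          split_cost_le hζ hfd hg2.le (by omega) hgo hho
        have s4 : ∀ l₁ : List (SkewPolynomial F), (l₁.prod = h ∧ ∀ p ∈ l₁, Irreducible p) →
            Rand.Spec (do
              let l₂ ← factorizeIrred w b k π n g
              pure (l₁ ++ l₂)) (fun l => l.prod = f ∧ ∀ p ∈ l, Irreducible p)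
              ((deg g / π.natDegree - 1) * ((k + 1) * (splitCost F w * π.natDegree ^ 3)))
              ((deg g / π.natDegree - 1) * (4 * (splitCost F w * π.natDegree ^ 3)))
              ((deg g / π.natDegree - 1 : ℕ) * (5 / 8) ^ k + 0) := by
          rintro l₁ ⟨p1, q1⟩
          refine Rand.Spec.bind (ih g hgπ hg1 (by omega)) fun l₂ hl₂ => Rand.spec_pure ⟨?_, ?_⟩
          · rw [List.prod_append, p1, hl₂.1]
            exact hh.symm
          · intro p hp
            exact (List.mem_append.1 hp).elim (q1 p) (hl₂.2 p)
        have s3 := Rand.Spec.bind (ih h hhπ (by omega) (by omega)) s4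
        have s2 : ∀ q : SkewPolynomial F × SkewPolynomial F, q.1 = h → Rand.Spec (do
              let l₁ ← factorizeIrred w b k π n q.1
              let l₂ ← factorizeIrred w b k π n g
              pure (l₁ ++ l₂)) (fun l => l.prod = f ∧ ∀ p ∈ l, Irreducible p)
              ((deg h / π.natDegree - 1) * ((k + 1) * (splitCost F w * π.natDegree ^ 3)) +
                (deg g / π.natDegree - 1) * ((k + 1) * (splitCost F w * π.natDegree ^ 3)))
              ((deg h / π.natDegree - 1) * (4 * (splitCost F w * π.natDegree ^ 3)) +
                (deg g / π.natDegree - 1) * (4 * (splitCost F w * π.natDegree ^ 3)))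
              ((deg h / π.natDegree - 1 : ℕ) * (5 / 8) ^ k +
                ((deg g / π.natDegree - 1 : ℕ) * (5 / 8) ^ k + 0)) := by
          intro q hq
          rw [hq]
          exact s3
        have s1 := Rand.Spec.bind (Rand.spec_lift (x := divR w f g) (Q := fun q => q.1 = h) rfl) s2
        have hs := Rand.Spec.bind (Rand.spec_lift (x := rgcdR w ζ f) (Q := (· = g)) rfl)
          (g := fun g => do
            let h ← Rand.lift (divR w f g)
            let l₁ ← factorizeIrred w b k π n h.1
            let l₂ ← factorizeIrred w b k π n g
            pure (l₁ ++ l₂)) (by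
            intro g' hg'
            rw [hg']
            exact s1)
        refine hs.mono (fun _ h => h) ?_ ?_ ?_
        · have := Nat.mul_le_mul_right ((k + 1) * (splitCost F w * π.natDegree ^ 3)) hsum
          rw [add_mul] at this
          omega
        · have := Nat.mul_le_mul_right (4 * (splitCost F w * π.natDegree ^ 3)) hsum
          rw [add_mul] at this
          omega
        · simp only [zero_add, add_zero]
          rw [← add_mul, ← Nat.cast_add]
          gcongr
      have hfz := findZeroDivisor_spec w b hπ hπ0 hf hd hne hy he hed
      have hsf : 2 ≤ deg f / π.natDegree := by
        obtain ⟨ζ, -, h1, h2⟩ := hfz.exists_result (by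
          rw [ENNReal.div_lt_iff (by norm_num) (by norm_num)]
          norm_num)
        have hgf := (rgcdR_rdvd w ζ f).2
        obtain ⟨h, hh⟩ := id hgf
        have hmul := deg_mul (left_ne_zero_of_mul (hh ▸ hf0)) (right_ne_zero_of_mul (hh ▸ hf0))
        rw [← hh] at hmul
        have h3 := natDegree_le_deg hirr hπ0 (hgf.trans hf) h1
        have h4 := natDegree_le_deg hirr hπ0
          (RDvd.left_factor (right_ne_zero_of_mul (hh ▸ hf0)) (hh ▸ hf)) (by omega)
        rw [Nat.le_div_iff_mul_le hδ]
        omega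
      obtain ⟨s, hs⟩ : ∃ s, deg f / π.natDegree = s + 2 := ⟨_, (Nat.sub_add_cancel hsf).symm⟩
      have hconst : (coIdempotent w b π f).ops + 30 * w.total * (autOrder F * π.natDegree) ^ 2 ≤
          splitCost F w * π.natDegree ^ 3 := by
        have hq : 1 ≤ Nat.card (fixedField F) := Nat.card_pos
        calc _ ≤ 13400 * (w.total * autOrder F ^ 6) * π.natDegree ^ 2 +
              30 * w.total * (autOrder F * π.natDegree) ^ 2 := by gcongr
          _ = 13400 * 1 * (w.total * autOrder F ^ 6) * π.natDegree ^ 2 +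
              30 * 1 * (w.total * autOrder F ^ 2) * π.natDegree ^ 2 := by ring
          _ ≤ 13400 * Nat.card (fixedField F) * (w.total * autOrder F ^ 6) * π.natDegree ^ 3 +
              30 * Nat.card (fixedField F) * (w.total * autOrder F ^ 6) * π.natDegree ^ 3 := by
            gcongr <;> first | exact hμ | exact hδ | norm_num
          _ = 13430 * Nat.card (fixedField F) * (w.total * autOrder F ^ 6) * π.natDegree ^ 3 := by
            ring
          _ ≤ _ := by
            rw [splitCost]
            gcongr
            norm_num
      rw [hs] at hchain ⊢
      have s1 := (hfz.retry k).bind hchain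
      refine (Rand.Spec.bind (Rand.spec_lift (x := coIdempotent w b π f)
        (Q := (· = (coIdempotent w b π f).val)) rfl) (by
          intro e' he'
          rw [he']
          exact s1)).mono (fun _ h => h) ?_ ?_ ?_
      · simp only [Nat.add_sub_cancel, show s + 2 - 1 = s + 1 from rfl, add_mul, one_mul]
        omega
      · simp only [Nat.add_sub_cancel, show s + 2 - 1 = s + 1 from rfl, add_mul, one_mul]
        omega
      · simp only [Nat.add_sub_cancel, show s + 2 - 1 = s + 1 from rfl, Nat.cast_add, Nat.cast_one,
          add_mul, one_mul, zero_add]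
        rw [add_comm]

end IrreducibleBound

end SkewFact

namespace SkewFact

open SkewPolynomial (φ)

/-! ### The factorization algorithm -/

section Factorization

open scoped ENNReal

variable {F : Type u} [Field F] [MulSemiringAction (Multiplicative ℕ) F] (w : OpCost)

theorem irreducible_of_deg_eq_one {f : SkewPolynomial F} (h : deg f = 1) : Irreducible f := by
  have hf0 : f ≠ 0 := by
    rintro rfl
    rw [deg_zero] at h
    exact zero_ne_one h
  refine ⟨fun hu => ?_, fun a b hab => ?_⟩
  · rw [deg_eq_zero_of_isUnit hu] at h
    exact zero_ne_one h
  · have ha0 : a ≠ 0 := left_ne_zero_of_mul (hab ▸ hf0)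
    have hb0 : b ≠ 0 := right_ne_zero_of_mul (hab ▸ hf0)
    have hd := deg_mul ha0 hb0
    rw [← hab, h] at hd
    rcases Nat.eq_zero_or_pos (deg a) with h1 | h1
    · exact Or.inl (isUnit_of_deg_eq_zero ha0 h1)
    · exact Or.inr (isUnit_of_deg_eq_zero hb0 (by omega))

theorem IsBound.deg_le [Finite F] {f p : SkewPolynomial F} (hf : f ≠ 0) (hp : IsBound f p) :
    deg p ≤ autOrder F * deg f := by
  obtain ⟨t, ht0, ht, htd⟩ := exists_isBound hf
  exact ((hp.min t (ht.inv.rdvd_mul ht.rdvd)).deg_le ht0).trans htd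

/-- `Q` is a minimal central multiple of `f`: it generates the ideal of all elements of `K[z]` whose
image in the center is a left multiple of `f`. -/
def IsMinimalCentral (f : SkewPolynomial F) (Q : Polynomial (fixedField F)) : Prop :=
  RDvd f (emb Q) ∧ ∀ Q', RDvd f (emb Q') → Q ∣ Q'

theorem IsMinimalCentral.one_le_deg {f : SkewPolynomial F} {Q : Polynomial (fixedField F)}
    (h : IsMinimalCentral f Q) (hf : f ≠ 0) (hQ : ¬ IsUnit Q) : 1 ≤ deg f := by
  by_contra h0
  exact hQ (isUnit_of_dvd_one (h.2 1 (rdvd_of_deg_eq_zero hf (by omega) _)))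

/-- One step of the separation of the irreducible factors of a minimal central multiple. -/
theorem IsMinimalCentral.split_rgcdR [Finite F] {f : SkewPolynomial F} (hf : f ≠ 0)
    {π P : Polynomial (fixedField F)} (h : IsMinimalCentral f (π * P)) (hπ : ¬ IsUnit π)
    (hπ0 : π ≠ 0) (hP : P ≠ 0) :
    IsMinimalCentral (rgcdR w f (emb P)).val P ∧
    ∃ q, f = q * (rgcdR w f (emb P)).val ∧ RDvd q (emb π) ∧ 1 ≤ deg q := by
  obtain ⟨hd, hd0, -⟩ := rgcdR_spec w f (emb P)
  obtain ⟨hdf, hdP⟩ := rgcdR_rdvd w f (emb P)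
  set g := (rgcdR w f (emb P)).val
  have hg0 : g ≠ 0 := hdf.ne_zero hf
  obtain ⟨a, c, hac⟩ := (hd g).2 (RDvd.refl g)
  -- `π g` is a left multiple of `f`, because `π f` and `π P` are
  have hπg : ∀ t, RDvd f (t * (emb π * g)) := by
    intro t
    have h1 : emb π * g = emb π * a * f + c * emb (π * P) := by
      rw [hac, mul_add, ← mul_assoc, emb_mul, ← mul_assoc, ← mul_assoc, emb_comm π c]
    rw [h1]
    have h2 : RDvd f (emb π * a * f) := ⟨emb π * a, rfl⟩
    exact (h2.add (h.1.mul_left c)).mul_left t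
  refine ⟨⟨hdP, fun Q' hQ' => ?_⟩, ?_⟩
  · obtain ⟨t, ht⟩ := hQ'
    have h2 : RDvd f (emb (π * Q')) := by
      rw [emb_mul, ht, ← mul_assoc, emb_comm, mul_assoc]
      exact hπg t
    exact (mul_dvd_mul_iff_left hπ0).1 (h.2 _ h2)
  · obtain ⟨q, hq⟩ := hdf
    refine ⟨q, hq, ?_, ?_⟩
    · obtain ⟨t, ht⟩ := hπg 1
      rw [one_mul, hq, ← mul_assoc] at ht
      exact ⟨t, mul_right_cancel₀ hg0 ht⟩
    · by_contra h0
      have h1 : RDvd f g := RDvd.symm_of_deg_le ⟨q, hq⟩ hf (by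
        conv_lhs => rw [hq]
        refine (deg_mul_le _ _).trans ?_
        omega)
      have h2 : π * P ∣ 1 * P := by
        rw [one_mul]
        exact h.2 P (h1.trans hdP)
      exact hπ (isUnit_of_dvd_one ((mul_dvd_mul_iff_right hP).1 h2))

theorem splitByFactors_cost {n m W N len f g A B C D : ℕ} (hn : 1 ≤ n) (hm : 1 ≤ m) (hW : 1 ≤ W)
    (hN : N ≤ n) (hf : f ≤ n) (hg : g ≤ f) (hlen : len ≤ N)
    (hA : A ≤ 2 * 1 * ((N + len) * (N + 1)))
    (hB : B ≤ 3 * W * ((f + 1) * (f + 2 * (m * N) + 2)))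
    (hC : C ≤ 3 * W * ((f + 1 - g) * (g + 1) + 1)) (hD : D ≤ len * (60 * (W * m) * n ^ 2)) :
    A + (B + (C + (D + 0))) ≤ (len + 1) * (60 * (W * m) * n ^ 2) := by
  have h1 : (N + len) * (N + 1) ≤ (2 * n) * (2 * n) := Nat.mul_le_mul (by omega) (by omega)
  have hmN : m * N ≤ m * n := Nat.mul_le_mul_left _ hN
  have hmn : n ≤ m * n := Nat.le_mul_of_pos_left _ hm
  have h2 : (f + 1) * (f + 2 * (m * N) + 2) ≤ (2 * n) * (5 * (m * n)) :=
    Nat.mul_le_mul (by omega) (by omega)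
  have h3 : (f + 1 - g) * (g + 1) + 1 ≤ (2 * n) * (2 * n) + n * n :=
    Nat.add_le_add (Nat.mul_le_mul (by omega) (by omega)) (Nat.mul_pos hn hn)
  have hWm : 1 ≤ W * m := Nat.mul_pos hW hm
  calc A + (B + (C + (D + 0))) ≤ 2 * 1 * ((2 * n) * (2 * n)) +
        (3 * W * ((2 * n) * (5 * (m * n))) + (3 * W * ((2 * n) * (2 * n) + n * n) + (D + 0))) :=
        Nat.add_le_add (hA.trans (Nat.mul_le_mul_left _ h1)) (Nat.add_le_add
          (hB.trans (Nat.mul_le_mul_left _ h2)) (Nat.add_le_add_right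
          (hC.trans (Nat.mul_le_mul_left _ h3)) _))
    _ = 8 * 1 * n ^ 2 + 30 * (W * m) * n ^ 2 + 15 * (W * 1) * n ^ 2 + D := by ring
    _ ≤ 8 * (W * m) * n ^ 2 + 30 * (W * m) * n ^ 2 + 15 * (W * m) * n ^ 2 +
        len * (60 * (W * m) * n ^ 2) := by gcongr
    _ = len * (60 * (W * m) * n ^ 2) + 53 * (W * m) * n ^ 2 := by ring
    _ ≤ len * (60 * (W * m) * n ^ 2) + 60 * (W * m) * n ^ 2 := by gcongr; norm_num
    _ = _ := by ring

theorem splitByFactors_spec [Finite F] {n : ℕ} (hn : 1 ≤ n) :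
    ∀ (πs : List (Polynomial (fixedField F))) (f : SkewPolynomial F), πs ≠ [] →
      (∀ π ∈ πs, π.Monic ∧ Irreducible π) → f ≠ 0 → IsMinimalCentral f πs.prod →
      deg f ≤ n → πs.prod.natDegree ≤ n →
      ((splitByFactors w f πs).val.map Prod.fst).prod = f ∧
      (∀ x ∈ (splitByFactors w f πs).val,
        x.2 ∈ πs ∧ RDvd x.1 (emb x.2) ∧ 1 ≤ deg x.1) ∧
      (splitByFactors w f πs).ops ≤ πs.length * (60 * (w.total * autOrder F) * n ^ 2)
  | [], f, h, _, _, _, _, _ => absurd rfl h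
  | [π], f, _, hirr, hf, hmin, _, _ => by
    rw [List.prod_singleton] at hmin
    refine ⟨by simp [splitByFactors], fun x hx => ?_, Nat.zero_le _⟩
    rw [splitByFactors, Cost.val_pure, List.mem_singleton] at hx
    subst hx
    exact ⟨List.mem_singleton_self _, hmin.1,
      hmin.one_le_deg hf (hirr π (List.mem_singleton_self _)).2.not_isUnit⟩
  | π :: π' :: πs, f, _, hirr, hf, hmin, hfn, hPn => by
    have hμ := autOrder_pos (F := F)
    have hW := total_pos w
    set l := π' :: πs with hl
    have hirr' : ∀ π ∈ l, π.Monic ∧ Irreducible π := fun π h => hirr π (List.mem_cons_of_mem _ h)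
    obtain ⟨hm, hi⟩ := hirr π List.mem_cons_self
    have hPm : l.prod.Monic := monic_list_prod _ fun π h => (hirr' π h).1
    rw [List.prod_cons] at hmin hPn
    rw [Polynomial.Monic.natDegree_mul hm hPm] at hPn
    obtain ⟨hmin', q, hq, hqπ, hqd⟩ :=
      hmin.split_rgcdR w hf hi.not_isUnit hi.ne_zero hPm.ne_zero
    obtain ⟨-, -, hgo⟩ := rgcdR_spec w f (emb l.prod)
    have hgf := (rgcdR_rdvd w f (emb l.prod)).1
    have hPval := prodP_val (baseArith_exact (K := fixedField F)) l
    have hPops := prodP_ops (baseArith_exact (K := fixedField F)) l fun π h => (hirr' π h).2.ne_zero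
    rw [splitByFactors, ← hl]
    simp only [Cost.val_bind, Cost.ops_bind, Cost.val_pure, Cost.ops_pure]
    rw [hPval]
    set g := (rgcdR w f (emb l.prod)).val
    have hg0 : g ≠ 0 := hgf.ne_zero hf
    have hgd := hgf.deg_le hf
    have hdiv := divR_exact w hg0 hgf
    have hdo := (divR_spec w f g hg0).2.2
    have hqe : (divR w f g).val.1 = q := mul_right_cancel₀ hg0 (hdiv.symm.trans hq)
    obtain ⟨r1, r2, r3⟩ := splitByFactors_spec hn l g (by simp [hl]) hirr' hg0 hmin'
      (hgd.trans hfn) (by omega)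
    rw [hqe]
    refine ⟨?_, ?_, ?_⟩
    · rw [List.map_cons, List.prod_cons, r1, ← hq]
    · intro x hx
      rcases List.mem_cons.1 hx with rfl | hx
      · exact ⟨List.mem_cons_self, hqπ, hqd⟩
      · obtain ⟨x1, x2, x3⟩ := r2 x hx
        exact ⟨List.mem_cons_of_mem _ x1, x2, x3⟩
    · have hlen : l.length ≤ l.prod.natDegree := by
        rw [natDegree_list_prod _ fun π h => (hirr' π h).1]
        calc l.length = (l.map fun _ => 1).sum := by simp
          _ ≤ _ := List.sum_le_sum fun π h => (hirr' π h).2.natDegree_pos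
      rw [deg_emb] at hgo
      have hPn' : l.prod.natDegree ≤ n := by omega
      exact splitByFactors_cost hn hμ hW hPn' hfn hgd hlen hPops hgo hdo r3

theorem factorBound_spec [Fintype F] {f p : SkewPolynomial F} (hf : f ≠ 0) (hp0 : p ≠ 0)
    (hp : IsBound f p) :
    (∀ π ∈ (factorBound w p).val, π.Monic ∧ Irreducible π ∧ π.coeff 0 ≠ 0) ∧
    (factorBound w p).val.prod.natDegree ≤ deg f ∧
    (∃ f₁, f = f₁ * SkewPolynomial.X ^ lowDeg p ∧
      IsMinimalCentral f₁ (factorBound w p).val.prod) ∧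
    (factorBound w p).ops ≤ w.total * (autOrder F * deg f + 2) +
      400 * Nat.card (fixedField F) * deg f ^ 3 := by
  have hμ := autOrder_pos (F := F)
  obtain ⟨hb, hlc⟩ := hp.monic hp0
  have hu : (lc p)⁻¹ ≠ 0 := inv_ne_zero (lc_ne_zero hp0)
  have hdeg : deg (SkewPolynomial.C (lc p)⁻¹ * p) = deg p := by
    rw [deg_mul (fun h => hu ((map_eq_zero_iff _ SkewPolynomial.C_injective).1 h)) hp0, deg_C,
      zero_add]
  have hlow : lowDeg (SkewPolynomial.C (lc p)⁻¹ * p) = lowDeg p := by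
    refine lowDeg_eq ?_ fun i hi => ?_
    · rw [coeff_C_mul]
      exact mul_ne_zero hu (coeff_lowDeg_ne_zero hp0)
    · rw [coeff_C_mul, coeff_eq_zero_of_lt_lowDeg hi, mul_zero]
  obtain ⟨heq, hmon, hQ0⟩ := hb.inv.eq_emb_mul hlc
  obtain ⟨f₁, hf₁, h1, h2⟩ := hb.split hf hlc
  have hcent : centralPart (SkewPolynomial.C (lc p)⁻¹ * p) =
      ∑ i ∈ Finset.range (deg p + 1), Polynomial.monomial i
        (toFixed ((scaleR w (fInv w (lc p)).val p).val.coeff (lowDeg p + autOrder F * i))) := by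
    rw [centralPart, hdeg, hlow, scaleR_val]
    rfl
  obtain ⟨p1, p2, p3⟩ := factorPoly_spec (baseArith_exact (K := fixedField F))
    (baseData_faithful (K := fixedField F)) hmon
  rw [hlow] at hf₁ heq
  have hPd : (centralPart (SkewPolynomial.C (lc p)⁻¹ * p)).natDegree ≤ deg f := by
    have h3 := congrArg deg heq
    rw [hdeg, deg_mul (emb_ne_zero hmon.ne_zero) (pow_ne_zero _ SkewPolynomial.X_ne_zero),
      deg_emb] at h3
    have h4 := hp.deg_le hf
    exact Nat.le_of_mul_le_mul_left (by omega) hμ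
  simp only [factorBound, Cost.val_bind, Cost.ops_bind]
  rw [← hcent, p2]
  refine ⟨fun π hπ => ⟨(p1 π hπ).1, (p1 π hπ).2, fun h0 => hQ0 ?_⟩, hPd, ⟨f₁, hf₁, h1, h2⟩, ?_⟩
  · obtain ⟨Q, hQ⟩ := List.dvd_prod hπ
    rw [p2] at hQ
    rw [hQ, Polynomial.mul_coeff_zero, h0, zero_mul]
  · have o1 : (fInv w (lc p)).ops ≤ w.total := by
      simp only [fInv, OpCost.total]
      omega
    have o2 := scaleR_ops w (fInv w (lc p)).val p
    have o3 := hp.deg_le hf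
    have o4 : (baseData (fixedField F)).weight 1 = 2 := rfl
    rw [o4] at p3
    calc _ ≤ w.total + (w.total * (autOrder F * deg f + 1) +
          200 * Nat.card (fixedField F) * 2 * deg f ^ 3) := by
          refine Nat.add_le_add o1 (Nat.add_le_add (o2.trans ?_) (p3.trans ?_)) <;> gcongr
      _ = _ := by ring

end Factorization

section Randomized

open scoped ENNReal

variable {F : Type u} [Field F] [Fintype F] [MulSemiringAction (Multiplicative ℕ) F] (w : OpCost)
  (b : Module.Basis (Fin (autOrder F)) (fixedField F) F)

theorem factorizeAll_spec (k : ℕ) : ∀ gs : List (SkewPolynomial F × Polynomial (fixedField F)),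
    (∀ x ∈ gs, x.2.Monic ∧ Irreducible x.2 ∧ x.2.coeff 0 ≠ 0 ∧ RDvd x.1 (emb x.2) ∧
      1 ≤ deg x.1) →
    Rand.Spec (factorizeAll w b k gs)
      (fun l : List (SkewPolynomial F) => l.prod = (gs.map Prod.fst).prod ∧ ∀ p ∈ l, Irreducible p)
      ((k + 1) * splitCost F w * (gs.map fun x => deg x.1).sum ^ 3)
      (4 * splitCost F w * (gs.map fun x => deg x.1).sum ^ 3)
      ((gs.map fun x => deg x.1).sum * (5 / 8) ^ k)
  | [], _ => (Rand.spec_pure ⟨rfl, by simp⟩).mono (fun _ h => h) (Nat.zero_le _) (Nat.zero_le _)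
      zero_le
  | x :: gs, hgs => by
    obtain ⟨hm, hirr, h0, hdvd, hd⟩ := hgs x List.mem_cons_self
    have : Fact (Irreducible x.2) := ⟨hirr⟩
    have hδ := natDegree_le_deg hirr h0 hdvd hd
    have hdiv : (deg x.1 / x.2.natDegree - 1) * x.2.natDegree ≤ deg x.1 :=
      (Nat.mul_le_mul_right _ (Nat.sub_le _ _)).trans (Nat.div_mul_le_self _ _)
    have hdiv' : deg x.1 / x.2.natDegree - 1 ≤ deg x.1 :=
      (Nat.sub_le _ _).trans (Nat.div_le_self _ _)
    have hcube : (deg x.1 / x.2.natDegree - 1) * x.2.natDegree ^ 3 ≤ deg x.1 ^ 3 := by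
      calc _ = (deg x.1 / x.2.natDegree - 1) * x.2.natDegree * x.2.natDegree ^ 2 := by ring
        _ ≤ deg x.1 * deg x.1 ^ 2 := by gcongr
        _ = _ := by ring
    have h1 := (factorizeIrred_spec w b hm h0 k (deg x.1 + 1) x.1 hdvd hd (Nat.lt_succ_self _))
    have h2 := factorizeAll_spec k gs fun y hy => hgs y (List.mem_cons_of_mem _ hy)
    rw [factorizeAll]
    refine (h1.bind (g := fun l₁ => do
        let l₂ ← factorizeAll w b k gs
        pure (l₁ ++ l₂)) fun l₁ hl₁ => h2.bind fun l₂ hl₂ => Rand.spec_pure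
          (Q := fun l : List (SkewPolynomial F) => l.prod = ((x :: gs).map Prod.fst).prod ∧ ∀ p ∈ l, Irreducible p)
          ⟨?_, ?_⟩).mono
        (fun _ h => h) ?_ ?_ ?_
    · rw [List.prod_append, hl₁.1, hl₂.1, List.map_cons, List.prod_cons]
    · intro p hp
      exact (List.mem_append.1 hp).elim (hl₁.2 p) (hl₂.2 p)
    all_goals rw [List.map_cons, List.sum_cons]; set N := (gs.map fun x => deg x.1).sum
    · calc _ = (k + 1) * splitCost F w *
            ((deg x.1 / x.2.natDegree - 1) * x.2.natDegree ^ 3 + N ^ 3) := by ring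
        _ ≤ (k + 1) * splitCost F w * (deg x.1 ^ 3 + N ^ 3) := by gcongr
        _ ≤ _ := Nat.mul_le_mul_left _ (cube_add_cube_le _ _)
    · calc _ = 4 * splitCost F w *
            ((deg x.1 / x.2.natDegree - 1) * x.2.natDegree ^ 3 + N ^ 3) := by ring
        _ ≤ 4 * splitCost F w * (deg x.1 ^ 3 + N ^ 3) := by gcongr
        _ ≤ _ := Nat.mul_le_mul_left _ (cube_add_cube_le _ _)
    · rw [add_zero, ← add_mul, Nat.cast_add]
      gcongr

end Randomized

end SkewFact

namespace SkewFact

open SkewPolynomial (φ)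

/-! ### The total cost -/

section TotalCost

open scoped ENNReal

variable {F : Type u} [Field F] [Fintype F] [MulSemiringAction (Multiplicative ℕ) F] (w : OpCost)
  (b : Module.Basis (Fin (autOrder F)) (fixedField F) F)

variable (F) in
/-- A constant for the cost of the deterministic part of the algorithm, in which `r` is the number
of generators of `F`. -/
noncomputable def deterministicCost (r : ℕ) : ℕ :=
  18 * w.total * (11 * r + 66) * autOrder F ^ 3 + 100 * (w.total * autOrder F) +
    400 * Nat.card (fixedField F)

theorem deterministicCost_bound {r n A B C D : ℕ} (hn : 1 ≤ n)
    (hA : A ≤ 18 * w.total * (11 * r + 66) * autOrder F ^ 3 * n ^ 3)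
    (hB : B ≤ w.total * (autOrder F * n + 2) + 400 * Nat.card (fixedField F) * n ^ 3)
    (hC : C ≤ 15 * w.total * n ^ 2)
    (hD : D ≤ n * (60 * (w.total * autOrder F) * n ^ 2)) :
    A + (B + (C + D)) ≤ deterministicCost F w r * n ^ 3 := by
  have hμ : 1 ≤ autOrder F := autOrder_pos
  calc A + (B + (C + D)) ≤ 18 * w.total * (11 * r + 66) * autOrder F ^ 3 * n ^ 3 +
        (w.total * (autOrder F * n + 2) + 400 * Nat.card (fixedField F) * n ^ 3 +
          (15 * w.total * n ^ 2 + n * (60 * (w.total * autOrder F) * n ^ 2))) := by gcongr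
    _ = 18 * w.total * (11 * r + 66) * autOrder F ^ 3 * n ^ 3 +
        400 * Nat.card (fixedField F) * n ^ 3 + (w.total * autOrder F * n ^ 1 +
          2 * (w.total * 1) * n ^ 0 + 15 * (w.total * 1) * n ^ 2 +
          60 * (w.total * autOrder F) * n ^ 3) := by ring
    _ ≤ 18 * w.total * (11 * r + 66) * autOrder F ^ 3 * n ^ 3 +
        400 * Nat.card (fixedField F) * n ^ 3 + (w.total * autOrder F * n ^ 3 +
          2 * (w.total * autOrder F) * n ^ 3 + 15 * (w.total * autOrder F) * n ^ 3 +
          60 * (w.total * autOrder F) * n ^ 3) := by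
        gcongr <;> first | exact hn | norm_num
    _ = (18 * w.total * (11 * r + 66) * autOrder F ^ 3 + 78 * (w.total * autOrder F) +
        400 * Nat.card (fixedField F)) * n ^ 3 := by ring
    _ ≤ _ := by
        rw [deterministicCost]
        gcongr
        norm_num

theorem factorize_spec {gens : List F}
    (hgens : Algebra.adjoin (fixedField F) {a : F | a ∈ gens} = ⊤) {f : SkewPolynomial F}
    (hf : 1 ≤ deg f) (k : ℕ) :
    Rand.Spec (factorize w b k gens f) (fun l => l.prod = f ∧ ∀ p ∈ l, Irreducible p)
      ((deterministicCost F w gens.length + (k + 1) * splitCost F w) * deg f ^ 3)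
      ((deterministicCost F w gens.length + 4 * splitCost F w) * deg f ^ 3)
      (deg f * (5 / 8) ^ k) := by
  have hf0 : f ≠ 0 := by
    rintro rfl
    rw [deg_zero] at hf
    exact absurd hf (by norm_num)
  obtain ⟨hp0, hp, hpo⟩ := boundR_spec w hgens hf
  set p := (boundR w gens f).val with hpdef
  obtain ⟨hπs, hPd, ⟨f₁, hf₁, hmin⟩, hfo⟩ := factorBound_spec w hf0 hp0 hp
  set πs := (factorBound w p).val with hπsdef
  have hX0 : (SkewPolynomial.X ^ lowDeg p : SkewPolynomial F) ≠ 0 :=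
    pow_ne_zero _ SkewPolynomial.X_ne_zero
  have hf₁0 : f₁ ≠ 0 := by
    rintro rfl
    rw [zero_mul] at hf₁
    exact hf0 hf₁
  have hdeg : deg f = deg f₁ + lowDeg p := by
    conv_lhs => rw [hf₁]
    rw [deg_mul hf₁0 hX0, deg_X_pow]
  have hq : (divR w f (SkewPolynomial.X ^ lowDeg p)).val.1 = f₁ :=
    mul_right_cancel₀ hX0 ((divR_exact w hX0 ⟨f₁, hf₁⟩).symm.trans hf₁)
  have hqo : (divR w f (SkewPolynomial.X ^ lowDeg p)).ops ≤ 15 * w.total * deg f ^ 2 := by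
    refine (divR_spec w f _ hX0).2.2.trans ?_
    rw [deg_X_pow]
    have h1 : (deg f + 1 - lowDeg p) * (lowDeg p + 1) + 1 ≤
        (2 * deg f) * (2 * deg f) + deg f * deg f :=
      Nat.add_le_add (Nat.mul_le_mul (by omega) (by omega)) (Nat.mul_pos hf hf)
    calc _ ≤ 3 * w.total * ((2 * deg f) * (2 * deg f) + deg f * deg f) :=
          Nat.mul_le_mul_left _ h1
      _ = _ := by ring
  have hlen : πs.length ≤ deg f := by
    refine le_trans ?_ hPd
    rw [natDegree_list_prod _ fun π h => (hπs π h).1]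
    calc πs.length = (πs.map fun _ => 1).sum := by simp
      _ ≤ _ := List.sum_le_sum fun π h => (hπs π h).2.1.natDegree_pos
  have hgs : (πs ≠ [] → ((splitByFactors w f₁ πs).val.map Prod.fst).prod = f₁) ∧
      (∀ x ∈ (splitByFactors w f₁ πs).val, x.2.Monic ∧ Irreducible x.2 ∧ x.2.coeff 0 ≠ 0 ∧
        RDvd x.1 (emb x.2) ∧ 1 ≤ deg x.1) ∧
      (splitByFactors w f₁ πs).ops ≤ deg f * (60 * (w.total * autOrder F) * deg f ^ 2) ∧
      ((splitByFactors w f₁ πs).val.map fun x => deg x.1).sum ≤ deg f := by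
    by_cases hnil : πs = []
    · rw [hnil]
      simp [splitByFactors]
    · obtain ⟨s1, s2, s3⟩ := splitByFactors_spec w hf πs f₁ hnil
        (fun π h => ⟨(hπs π h).1, (hπs π h).2.1⟩) hf₁0 hmin (by omega) hPd
      refine ⟨fun _ => s1, fun x hx => ?_, s3.trans (by gcongr), ?_⟩
      · obtain ⟨x1, x2, x3⟩ := s2 x hx
        exact ⟨(hπs _ x1).1, (hπs _ x1).2.1, (hπs _ x1).2.2, x2, x3⟩
      · have h1 : ∀ l : List (SkewPolynomial F × Polynomial (fixedField F)),
            (l.map Prod.fst).prod ≠ 0 →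
            (l.map fun x => deg x.1).sum = deg (l.map Prod.fst).prod := by
          intro l
          induction l with
          | nil => intro _; simp [deg_one]
          | cons x l ih =>
            intro h
            rw [List.map_cons, List.prod_cons] at h
            rw [List.map_cons, List.sum_cons, List.map_cons, List.prod_cons, ih (right_ne_zero_of_mul h),
              deg_mul (left_ne_zero_of_mul h) (right_ne_zero_of_mul h)]
        rw [h1 _ (by rwa [s1]), s1]
        omega
  obtain ⟨hprod, hgs, hso, hsum⟩ := hgs
  set gs := (splitByFactors w f₁ πs).val with hgsdef
  have hall := (factorizeAll_spec w b k gs hgs).mono (fun _ h => h)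
    (c' := (k + 1) * splitCost F w * deg f ^ 3) (e' := 4 * splitCost F w * deg f ^ 3)
    (t' := deg f * (5 / 8) ^ k) (by gcongr) (by gcongr) (by gcongr)
  have hend : ∀ out : List (SkewPolynomial F),
      (out.prod = (gs.map Prod.fst).prod ∧ ∀ p ∈ out, Irreducible p) →
      Rand.Spec (if πs = [] then
          pure (SkewPolynomial.monomial 1 (f₁.coeff 0) ::
            List.replicate (lowDeg p - 1) SkewPolynomial.X)
        else pure (out ++ List.replicate (lowDeg p) SkewPolynomial.X) :
          Rand (List (SkewPolynomial F)))
        (fun l => l.prod = f ∧ ∀ p ∈ l, Irreducible p) 0 0 0 := by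
    rintro out ⟨o1, o2⟩
    have hXirr : Irreducible (SkewPolynomial.X : SkewPolynomial F) :=
      irreducible_of_deg_eq_one (by rw [← pow_one SkewPolynomial.X, deg_X_pow])
    split_ifs with hnil
    · have hd0 : deg f₁ = 0 := by
        have h1 := hmin.1
        rw [hnil, List.prod_nil, emb_one] at h1
        have h2 := h1.deg_le one_ne_zero
        rw [deg_one] at h2
        omega
      have hc := eq_C_of_deg_eq_zero hd0
      have hmono : (SkewPolynomial.monomial 1 (f₁.coeff 0) : SkewPolynomial F) =
          f₁ * SkewPolynomial.X := by
        conv_rhs => rw [hc, ← pow_one SkewPolynomial.X]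
        ext j
        rw [coeff_C_mul, SkewPolynomial.coeff_monomial, SkewPolynomial.X_pow_eq_monomial,
          SkewPolynomial.coeff_monomial]
        split_ifs <;> simp
      refine Rand.spec_pure ⟨?_, fun q hq => ?_⟩
      · rw [List.prod_cons, List.prod_replicate, hmono, mul_assoc, ← pow_succ',
          Nat.sub_add_cancel (by omega)]
        exact hf₁.symm
      · rcases List.mem_cons.1 hq with rfl | hq
        · refine irreducible_of_deg_eq_one ?_
          rw [hmono, ← pow_one SkewPolynomial.X,
            deg_mul hf₁0 (pow_ne_zero _ SkewPolynomial.X_ne_zero), hd0, deg_X_pow]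
        · rw [List.eq_of_mem_replicate hq]
          exact hXirr
    · refine Rand.spec_pure ⟨?_, fun q hq => ?_⟩
      · rw [List.prod_append, List.prod_replicate, o1, hprod hnil]
        exact hf₁.symm
      · rcases List.mem_append.1 hq with hq | hq
        · exact o2 q hq
        · rw [List.eq_of_mem_replicate hq]
          exact hXirr
  have s5 := hall.bind hend
  have s4 := Rand.Spec.bind (Rand.spec_lift (x := splitByFactors w f₁ πs) (Q := (· = gs)) rfl)
    (g := fun gs => do
      let out ← factorizeAll w b k gs
      if πs = [] then
        pure (SkewPolynomial.monomial 1 (f₁.coeff 0) ::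
          List.replicate (lowDeg p - 1) SkewPolynomial.X)
      else pure (out ++ List.replicate (lowDeg p) SkewPolynomial.X))
    (fun gs' h => by rw [h]; exact s5)
  have s3 := Rand.Spec.bind (Rand.spec_lift (x := divR w f (SkewPolynomial.X ^ lowDeg p))
    (Q := fun q => q.1 = f₁) hq)
    (g := fun q => do
      let gs ← Rand.lift (splitByFactors w q.1 πs)
      let out ← factorizeAll w b k gs
      if πs = [] then
        pure (SkewPolynomial.monomial 1 (q.1.coeff 0) ::
          List.replicate (lowDeg p - 1) SkewPolynomial.X)
      else pure (out ++ List.replicate (lowDeg p) SkewPolynomial.X))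
    (fun q h => by rw [h]; exact s4)
  have s2 := Rand.Spec.bind (Rand.spec_lift (x := factorBound w p) (Q := (· = πs)) rfl)
    (g := fun πs => do
      let q ← Rand.lift (divR w f (SkewPolynomial.X ^ lowDeg p))
      let gs ← Rand.lift (splitByFactors w q.1 πs)
      let out ← factorizeAll w b k gs
      if πs = [] then
        pure (SkewPolynomial.monomial 1 (q.1.coeff 0) ::
          List.replicate (lowDeg p - 1) SkewPolynomial.X)
      else pure (out ++ List.replicate (lowDeg p) SkewPolynomial.X))
    (fun πs' h => by rw [h]; exact s3)
  have s1 := Rand.Spec.bind (Rand.spec_lift (x := boundR w gens f) (Q := (· = p)) rfl)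
    (g := fun p => do
      let πs ← Rand.lift (factorBound w p)
      let q ← Rand.lift (divR w f (SkewPolynomial.X ^ lowDeg p))
      let gs ← Rand.lift (splitByFactors w q.1 πs)
      let out ← factorizeAll w b k gs
      if πs = [] then
        pure (SkewPolynomial.monomial 1 (q.1.coeff 0) ::
          List.replicate (lowDeg p - 1) SkewPolynomial.X)
      else pure (out ++ List.replicate (lowDeg p) SkewPolynomial.X))
    (fun p' h => by rw [h]; exact s2)
  have hdet := deterministicCost_bound w hf hpo hfo hqo hso
  refine Rand.Spec.mono s1 (fun _ h => h) ?_ ?_ ?_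
  · rw [add_mul (deterministicCost F w gens.length)]
    omega
  · rw [add_mul (deterministicCost F w gens.length)]
    omega
  · simp only [zero_add, add_zero]
    exact le_rfl

end TotalCost

end SkewFact


theorem corollary6p6 {F : Type*} [Field F] [Fintype F] (σ : F ≃+* F) :
    letI := SkewFact.sigmaAction σ
    ∀ (w : SkewFact.OpCost)
      (b : Module.Basis (Fin (SkewFact.autOrder F)) (SkewFact.fixedField F) F) (gens : List F),
      Algebra.adjoin (SkewFact.fixedField F) {a : F | a ∈ gens} = ⊤ →
      ∃ C : ℕ, ∀ f : SkewPolynomial F, 1 ≤ SkewFact.deg f →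
        -- whatever the random choices, the number of operations is cubic in the degree,
        -- and the output is a factorization into irreducible factors
        (∀ k : ℕ, 1 ≤ k → ∀ x ∈ (SkewFact.factorize w b k gens f).dist.support,
          x.2 ≤ C * k * SkewFact.deg f ^ 3 ∧
          ∀ l, x.1 = some l → l.prod = f ∧ ∀ p ∈ l, Irreducible p) ∧
        -- the expected number of operations is cubic, uniformly in the number of attempts
        (∀ k : ℕ, (SkewFact.factorize w b k gens f).expectedOps ≤
          (C : ENNReal) * (SkewFact.deg f : ENNReal) ^ 3) ∧
        -- with unlimited attempts the algorithm succeeds with probability one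
        Filter.Tendsto (fun k : ℕ => (SkewFact.factorize w b k gens f).failProb)
          Filter.atTop (nhds 0) := by
  let := SkewFact.sigmaAction σ
  intro w b gens hgens
  refine ⟨SkewFact.deterministicCost F w gens.length + 4 * SkewFact.splitCost F w, fun f hf => ?_⟩
  have hspec := fun k => SkewFact.factorize_spec w b hgens hf k
  refine ⟨fun k hk x hx => ⟨((hspec k).ops_le x hx).trans ?_, (hspec k).result x hx⟩,
    fun k => (hspec k).expected_le.trans (by push_cast; exact le_rfl), ?_⟩
  · refine Nat.mul_le_mul_right _ ?_
    rw [add_mul (SkewFact.deterministicCost F w gens.length)]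
    refine Nat.add_le_add (Nat.le_mul_of_pos_right _ hk) ?_
    calc (k + 1) * SkewFact.splitCost F w ≤ (4 * k) * SkewFact.splitCost F w :=
          Nat.mul_le_mul_right _ (by omega)
      _ = _ := by ring
  · have h1 : Filter.Tendsto (fun k : ℕ => (SkewFact.deg f : ENNReal) * (5 / 8) ^ k)
        Filter.atTop (nhds ((SkewFact.deg f : ENNReal) * 0)) :=
      ENNReal.Tendsto.const_mul (ENNReal.tendsto_pow_atTop_nhds_zero_of_lt_one (by
        rw [ENNReal.div_lt_iff (by norm_num) (by norm_num)]
        norm_num)) (Or.inr (ENNReal.natCast_ne_top _))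
    rw [mul_zero] at h1
    exact tendsto_of_tendsto_of_tendsto_of_le_of_le tendsto_const_nhds h1
      (fun _ => zero_le) fun k => (hspec k).fail_le
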